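/- **Theorem 13.1.** Write points of $\mathbb{C}^2$ as $(z,w)$ with $w=u+iv$. Let $M\subset\mathbb{C}^2$ be a real-analytic hypersurface given near $0\in M$ by $$v=F(z,\bar z,u)=z\bar z+O_{z,\bar z,u}(3),$$ where $F$ is a real-valued convergent power series at $0$ and $O_{z,\bar z,u}(3)$ denotes terms of total (unweighted) order at least $3$ in $(z,\bar z,u)$; such an $M$ is automatically Levi nondegenerate near $0$. Say that a real-analytic hypersurface through $0$ is in *normal form* if near $0$ its equation is $$v'=z'\bar z'+F'_{4,2}(u')\,z'^4\bar z'^2+F'_{2,4}(u')\,z'^2\bar z'^4+z'^2\bar z'^2\,O_{z',\bar z'}(3),$$ where $F'_{4,2},F'_{2,4}$ are convergent power series in $u'$ and $O_{z',\bar z'}(3)$ is a convergent power series in $(z',\bar z',u')$ all of whose monomials $z'^j\bar z'^k u'^l$ satisfy $j+k\ge 3$. Then there exists a local biholomorphism $(z,w)\mapsto(z',w')$ of $\mathbb{C}^2$ at $0$, fixing $0$, which maps the germ $(M,0)$ onto the germ $(M',0)$ of a hypersurface in normal form. Furthermore, among the local biholomorphisms fixing $0$ of the form $$z'=z+f(z,w),\qquad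 w'=w+g(z,w),$$ $$f_z(0)=f_w(0)=0,\qquad g_z(0)=g_w(0)=\operatorname{Re} g_{ww}(0)=0,$$ there exists exactly one germ at $0$ that maps $(M,0)$ onto the germ at $0$ of some hypersurface in normal form. -/

import Mathlib

open scoped Topology ComplexConjugate

/-- The real hypersurface `v = F(z, z̄, u)` in `ℂ²`, with coordinates `(z, w)`, `w = u + i v`.
A function of `(z, z̄, u)` is written as a function of `(z, u) ∈ ℂ × ℝ`. -/
def graphHypersurface (F : ℂ × ℝ → ℝ) : Set (ℂ × ℂ) :=
  {p | p.2.im = F (p.1, p.2.re)}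

/-- `F` is real-analytic near `0` and `F = z z̄ + O(3)`, with the (unweighted) order of vanishing
in `(z, z̄, u)`. -/
def IsLeviModelUpToOrderThree (F : ℂ × ℝ → ℝ) : Prop :=
  AnalyticAt ℝ F 0 ∧
    (fun p : ℂ × ℝ => F p - ‖p.1‖ ^ 2) =O[𝓝 0] (fun p : ℂ × ℝ => ‖p‖ ^ 3)

/-- Near `0`, `F = z z̄ + A(u) z⁴ z̄² + B(u) z² z̄⁴ + z² z̄² R(z, z̄, u)` where `A`, `B`, `R` are
real-analytic (convergent power series in `u`, resp. in `(z, z̄, u)`), and `R` is of order at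
least `3` in `(z, z̄)`, that is, `|R| ≤ C |z|³` near `0`. -/
def IsMoserNormalForm (F : ℂ × ℝ → ℝ) : Prop :=
  ∃ (A B : ℝ → ℂ) (R : ℂ × ℝ → ℂ),
    AnalyticAt ℝ A 0 ∧ AnalyticAt ℝ B 0 ∧ AnalyticAt ℝ R 0 ∧
    R =O[𝓝 0] (fun p : ℂ × ℝ => ‖p.1‖ ^ 3) ∧
    ∀ᶠ p : ℂ × ℝ in 𝓝 0,
      (F p : ℂ) = p.1 * conj p.1 + A p.2 * p.1 ^ 4 * conj p.1 ^ 2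
        + B p.2 * p.1 ^ 2 * conj p.1 ^ 4 + p.1 ^ 2 * conj p.1 ^ 2 * R p

/-- `h` fixes `0` and restricts to a biholomorphism from an open neighbourhood of `0` onto an open
neighbourhood of `0`. -/
def IsBiholomorphismFixingZero (h : ℂ × ℂ → ℂ × ℂ) : Prop :=
  h 0 = 0 ∧ ∃ e : OpenPartialHomeomorph (ℂ × ℂ) (ℂ × ℂ),
    0 ∈ e.source ∧ Set.EqOn h e e.source ∧
    AnalyticOnNhd ℂ e e.source ∧ AnalyticOnNhd ℂ e.symm e.target

/-- `h` is a local biholomorphism of `ℂ²` fixing `0`, and it maps the germ at `0` of the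
hypersurface `v = F` onto the germ at `0` of a hypersurface `v' = F'` in normal form. -/
def MapsToMoserNormalForm (h : ℂ × ℂ → ℂ × ℂ) (F : ℂ × ℝ → ℝ) : Prop :=
  IsBiholomorphismFixingZero h ∧ ∃ F' : ℂ × ℝ → ℝ, IsMoserNormalForm F' ∧
    ∀ᶠ p in 𝓝 (0 : ℂ × ℂ), p ∈ graphHypersurface F ↔ h p ∈ graphHypersurface F'

/-- The map `z' = z + f(z, w)`, `w' = w + g(z, w)`. -/
def identityPlus (f g : ℂ × ℂ → ℂ) : ℂ × ℂ → ℂ × ℂ :=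
  fun p => (p.1 + f p, p.2 + g p)

/-- `f_z(0) = f_w(0) = 0` and `g_z(0) = g_w(0) = Re g_ww(0) = 0`. -/
def HasNormalizedJet (f g : ℂ × ℂ → ℂ) : Prop :=
  deriv (fun z => f (z, 0)) 0 = 0 ∧ deriv (fun w => f (0, w)) 0 = 0 ∧
  deriv (fun z => g (z, 0)) 0 = 0 ∧ deriv (fun w => g (0, w)) 0 = 0 ∧
  (iteratedDeriv 2 (fun w => g (0, w)) 0).re = 0

/-! Polarization turns the hypersurface into a second-order differential equation. Replacing z̄ by a
free variable ζ and w̄ by ω, the equation v = F becomes ω = Θ(ζ, z, w). For fixed x = (z, w) this is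
a curve in the (ζ, ω)-plane, a Segre variety up to conjugation. The Levi form gives Θ_{ζz}(0) = -2i,
so a curve of this two-parameter family is determined by one point and the slope there
(`IsSegreFunction.exists_of_slope`), and the family solves some equation ω'' = Φ(ζ, ω, ω'). A
holomorphic map K from new to old coordinates acts by K on (z, w) and by its conjugate on (ζ, ω).
Since a holomorphic function vanishing on ζ = z̄, u real, vanishes identically, mapping
hypersurfaces to each other is the same as pulling back Segre functions (`IsPullback`).

For Segre functions the normal form reads Θ = w - 2i zζ (1 + zζ (z² D + ζ² E)): the ideal (z², ζ²)
omits exactly the monomials 1, z, ζ, zζ, so what must be removed is g(w) - 1 in the first bracket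
and the coefficients of 1, z, ζ, zζ in the second. This happens in three stages.

Along a curve γ transversal to the complex tangent space and lying in the hypersurface, in the
polarized sense, `adaptedMap` lets (z, t) be the point whose Segre curve passes through the
conjugate of γ(t) in the direction (1, ε) - 2iz γ̄'(t), where ε is the slope there of the Segre
curve of γ(t). In these coordinates Θ = w - 2i zζ (g(w) + zζ σ), by the reality of the hypersurface.

The coefficient σ_z(0, 0, w) measures how far γ is from solving a second-order equation read off
from the cubic part of Φ (`wedge_sub_thirdCoeff`, `IsPullback.chain_iff`). Its solutions are the
chains, and the chain through 0 in the direction (0, 1) is unique up to a real change of parameter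
(`exists_isSegreChain`). On a chain the z-term of σ vanishes, and by reality so does the ζ-term
(`IsSegreFunction.exists_isSemiNormal`).

There remain g and the coefficients a of 1 and e of zζ in σ. The substitution (z, w) ↦ (ν(w) z,
s(w)), with ν the conjugate of l, removes them exactly when three differential equations hold
(`IsSemiNormal.isNormalSegreFunction_iff`): one fixes l ν g(s) = s', one the logarithmic derivative
of l, and one prescribes the Schwarzian derivative of s (`normalEquations_iff`). The Schwarzian is
prescribed by real data (`star_normalDelta`), so real solutions with s(0) = 0, s'(0) = 1, l(0) = 1
exist and depend only on the real number s''(0).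

For uniqueness, the inverse of any normalized map to normal form sends the axis z = 0 to a chain
(`IsPullback.isSegreChain`), and hence is the same adapted map followed after such a substitution
(`IsPullback.exists_eq_adaptedMap`). Second-order jets along the axis add (`deriv_deriv_inverse`),
so Re g_ww(0) = 0 determines s''(0), and with it the substitution. -/

open Filter


attribute [fun_prop] analyticAt_fst analyticAt_snd

/-! ### Division of analytic functions by a coordinate -/

section Hadamard

variable {𝕜 : Type*} [NontriviallyNormedField 𝕜]
  {E : Type*} [NormedAddCommGroup E] [NormedSpace 𝕜 E]
  {F : Type*} [NormedAddCommGroup F] [NormedSpace 𝕜 F]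

/-- The projection `(z, y) ↦ (0, y)`. -/
def dropFst (𝕜 E : Type*) [NontriviallyNormedField 𝕜] [NormedAddCommGroup E] [NormedSpace 𝕜 E] :
    𝕜 × E →L[𝕜] 𝕜 × E :=
  (ContinuousLinearMap.inr 𝕜 𝕜 E).comp (ContinuousLinearMap.snd 𝕜 𝕜 E)

@[simp] lemma dropFst_apply (v : 𝕜 × E) : dropFst 𝕜 E v = (0, v.2) := rfl

lemma norm_dropFst_le : ‖dropFst 𝕜 E‖ ≤ 1 := by
  refine ContinuousLinearMap.opNorm_le_bound _ zero_le_one fun v => ?_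
  simp [Prod.norm_def]

/-- The power series of the quotient of `f (z, y) - f (0, y)` by `z`. -/
noncomputable def hadamardSeries (p : FormalMultilinearSeries 𝕜 (𝕜 × E) F) :
    FormalMultilinearSeries 𝕜 (𝕜 × E) F := fun n =>
  ∑ i : Fin (n + 1), ((p (n + 1)).curryMid i (1, 0)).compContinuousLinearMap
    (fun j => if j.castSucc < i then dropFst 𝕜 E else ContinuousLinearMap.id 𝕜 _)

lemma norm_hadamardSeries_le (p : FormalMultilinearSeries 𝕜 (𝕜 × E) F) (n : ℕ) :
    ‖hadamardSeries p n‖ ≤ (n + 1) * ‖p (n + 1)‖ := by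
  have h : ∀ i : Fin (n + 1), ‖((p (n + 1)).curryMid i (1, 0)).compContinuousLinearMap
      (fun j => if j.castSucc < i then dropFst 𝕜 E else ContinuousLinearMap.id 𝕜 _)‖
      ≤ ‖p (n + 1)‖ := by
    intro i
    refine (ContinuousMultilinearMap.norm_compContinuousLinearMap_le _ _).trans ?_
    have h1 : ‖(p (n + 1)).curryMid i (1, 0)‖ ≤ ‖p (n + 1)‖ := by
      refine (ContinuousLinearMap.le_opNorm _ _).trans ?_
      rw [ContinuousMultilinearMap.norm_curryMid]
      simp [Prod.norm_def]
    have h2 : ∏ j : Fin n, ‖(if j.castSucc < i then dropFst 𝕜 E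
        else ContinuousLinearMap.id 𝕜 (𝕜 × E))‖ ≤ 1 := by
      refine Finset.prod_le_one (fun _ _ => norm_nonneg _) fun j _ => ?_
      split_ifs
      · exact norm_dropFst_le
      · exact ContinuousLinearMap.norm_id_le
    calc _ ≤ ‖p (n + 1)‖ * 1 := mul_le_mul h1 h2 (Finset.prod_nonneg fun _ _ => norm_nonneg _)
            (norm_nonneg _)
      _ = _ := mul_one _
  calc _ ≤ ∑ i : Fin (n + 1), ‖p (n + 1)‖ := norm_sum_le_of_le _ fun i _ => h i
    _ = _ := by simp

/-- A telescoping sum: the arguments v are replaced by (0, v.2) one slot at a time. Consecutive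
terms differ by v.1 • (1, 0) in slot i, with the slots before i already replaced, which is the i-th
summand of the series. -/
lemma hadamardSeries_apply (p : FormalMultilinearSeries 𝕜 (𝕜 × E) F) (n : ℕ) (v : 𝕜 × E) :
    v.1 • hadamardSeries p n (fun _ => v)
      = p (n + 1) (fun _ => v) - p (n + 1) (fun _ => (0, v.2)) := by
  have key : ∀ i : Fin (n + 1), v.1 • (((p (n + 1)).curryMid i (1, 0)).compContinuousLinearMap
      (fun j => if j.castSucc < i then dropFst 𝕜 E else ContinuousLinearMap.id 𝕜 _)) (fun _ => v)
      = p (n + 1) (fun j => if (j : ℕ) < i then (0, v.2) else v)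
        - p (n + 1) (fun j => if (j : ℕ) < i + 1 then (0, v.2) else v) := by
    intro i
    set m : Fin (n + 1) → 𝕜 × E := fun j => if (j : ℕ) < i then (0, v.2) else v with hm
    have e1 : (fun j : Fin (n + 1) => if (j : ℕ) < i then ((0 : 𝕜), v.2) else v)
        = Function.update m i v := by
      ext1 j
      by_cases hj : j = i
      · subst hj; simp
      · simp [hj, hm]
    have e2 : (fun j : Fin (n + 1) => if (j : ℕ) < i + 1 then ((0 : 𝕜), v.2) else v)
        = Function.update m i (0, v.2) := by
      ext1 j
      by_cases hj : j = i
      · subst hj; simp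
      · have : (j : ℕ) ≠ i := fun h => hj (Fin.ext h)
        have h3 : ((j : ℕ) < i + 1) ↔ (j : ℕ) < i := by omega
        simp [hj, hm, h3]
    have e3 : v - (0, v.2) = v.1 • ((1 : 𝕜), (0 : E)) := by
      ext <;> simp
    refine Eq.trans ?_ (congrArg₂ (fun a b => p (n + 1) a - p (n + 1) b) e1 e2).symm
    rw [← ContinuousMultilinearMap.map_update_sub, e3, ContinuousMultilinearMap.map_update_smul]
    simp only [ContinuousMultilinearMap.compContinuousLinearMap_apply,
      ContinuousMultilinearMap.curryMid_apply]
    congr 2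
    ext1 j
    refine Fin.succAboveCases i ?_ (fun k => ?_) j
    · simp
    · simp only [Fin.insertNth_apply_succAbove]
      rw [Function.update_of_ne (Fin.succAbove_ne i k), hm]
      have h4 : ((i.succAbove k : Fin (n + 1)) : ℕ) < i ↔ k.castSucc < i := by
        rw [← Fin.lt_def]; exact Fin.succAbove_lt_iff_castSucc_lt i k
      simp only [h4]
      split_ifs <;> simp
  simp only [hadamardSeries, sum_apply, Finset.smul_sum]
  rw [Finset.sum_congr rfl fun i _ => key i]
  rw [Fin.sum_univ_eq_sum_range (fun i : ℕ => p (n + 1) (fun j => if (j : ℕ) < i then (0, v.2) else v)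
        - p (n + 1) (fun j => if (j : ℕ) < i + 1 then (0, v.2) else v)) (n + 1),
    Finset.sum_range_sub']
  simp [Nat.lt_succ_iff.1 (Fin.is_lt _)]

/-- Hadamard's lemma for analytic functions. -/
theorem AnalyticAt.exists_eq_add_smul [CompleteSpace F] {f : 𝕜 × E → F} {y₀ : E}
    (hf : AnalyticAt 𝕜 f (0, y₀)) :
    ∃ g : 𝕜 × E → F, AnalyticAt 𝕜 g (0, y₀) ∧
      ∀ᶠ p in 𝓝 ((0 : 𝕜), y₀), f p = f (0, p.2) + p.1 • g p := by
  obtain ⟨p, r, hp⟩ := hf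
  set q := hadamardSeries p
  have hq : 0 < q.radius := by
    obtain ⟨r', hr0, hr1⟩ := ENNReal.lt_iff_exists_nnreal_btwn.1 hp.radius_pos
    have hr0' : 0 < r' := by exact_mod_cast hr0
    obtain ⟨C, hC, h⟩ := p.norm_le_div_pow_of_pos_of_lt_radius hr0' hr1
    -- Halving the radius pays for the factor n + 1 ≤ 2 ^ n in the bound of the coefficients.
    have : ((r' / 2 : NNReal) : ENNReal) ≤ q.radius := by
      refine q.le_radius_of_bound (C / r') fun n => ?_
      have h1 : ‖q n‖ ≤ 2 ^ n * (C / r' ^ (n + 1)) := by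
        refine (norm_hadamardSeries_le p n).trans ?_
        refine mul_le_mul ?_ (h _) (norm_nonneg _) (by positivity)
        exact_mod_cast Nat.lt_two_pow_self
      calc ‖q n‖ * ((r' / 2 : NNReal) : ℝ) ^ n
          ≤ 2 ^ n * (C / r' ^ (n + 1)) * ((r' / 2 : NNReal) : ℝ) ^ n := by gcongr
        _ = C / r' := by
          push_cast
          have : (r' : ℝ) ≠ 0 := by exact_mod_cast hr0'.ne'
          rw [div_pow, pow_succ]
          field_simp
    refine lt_of_lt_of_le ?_ this
    simpa [pos_iff_ne_zero] using hr0'.ne'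
  have hqs := (q.hasFPowerSeriesOnBall hq).comp_sub ((0 : 𝕜), y₀)
  rw [zero_add] at hqs
  refine ⟨_, hqs.analyticAt, ?_⟩
  have hmem : ∀ᶠ x in 𝓝 ((0 : 𝕜), y₀), x ∈ Metric.eball ((0 : 𝕜), y₀) (min r q.radius) :=
    Metric.eball_mem_nhds _ (lt_min hp.r_pos hq)
  filter_upwards [hmem] with x hx
  set v := x - (0, y₀) with hv
  have hv1 : v.1 = x.1 := by simp [hv]
  have hx1 : x ∈ Metric.eball ((0 : 𝕜), y₀) r := Metric.eball_subset_eball (min_le_left _ _) hx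
  have hx2 : x ∈ Metric.eball ((0 : 𝕜), y₀) q.radius := Metric.eball_subset_eball (min_le_right _ _) hx
  have hx3 : ((0 : 𝕜), x.2) ∈ Metric.eball ((0 : 𝕜), y₀) r := by
    rw [Metric.mem_eball] at hx1 ⊢
    refine lt_of_le_of_lt ?_ hx1
    simp [Prod.edist_eq]
  have s1 := hp.hasSum_sub hx1
  have s2 := hp.hasSum_sub hx3
  have s3 := hqs.hasSum_sub hx2
  have e2 : ((0 : 𝕜), x.2) - (0, y₀) = (0, v.2) := by simp [hv]
  rw [e2] at s2
  have s4 := (hasSum_nat_add_iff' 1).2 (s1.sub s2)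
  simp only [Finset.range_one, Finset.sum_singleton] at s4
  have e0 : p 0 (fun _ => v) - p 0 (fun _ => ((0 : 𝕜), v.2)) = 0 := by
    rw [sub_eq_zero]; congr 1; ext1 i; exact i.elim0
  rw [← hv] at s4
  rw [e0, sub_zero] at s4
  have s5 := s3.const_smul v.1
  have : (fun n => v.1 • q n fun _ => x - (0, y₀)) =
      fun n => (p (n + 1) fun _ => v) - p (n + 1) fun _ => (0, v.2) := by
    ext1 n; exact hadamardSeries_apply p n v
  rw [this] at s5
  have := s4.unique s5
  rw [sub_eq_iff_eq_add] at this
  rw [this, hv1, add_comm]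

end Hadamard


/-! ### Conjugates of holomorphic maps -/

section ConjConj

variable {E : Type*} [NormedAddCommGroup E] [NormedSpace ℂ E] [StarAddMonoid E] [NormedStarGroup E]
  [StarModule ℂ E] {F : Type*} [NormedAddCommGroup F] [NormedSpace ℂ F] [StarAddMonoid F]
  [NormedStarGroup F] [StarModule ℂ F]

/-- The multilinear map `v ↦ star (q (star v))`. -/
noncomputable def ContinuousMultilinearMap.starStar {n : ℕ} (q : E [×n]→L[ℂ] F) : E [×n]→L[ℂ] F :=
  MultilinearMap.mkContinuous
    { toFun := fun v => star (q fun i => star (v i))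
      map_update_add' := by
        intro _ v i x y
        have h : ∀ z : E, (fun j => star (Function.update v i z j))
            = Function.update (fun j => star (v j)) i (star z) := by
          intro z; ext1 j
          by_cases hj : j = i
          · subst hj; simp
          · simp [hj]
        rw [h, h, h, star_add, q.map_update_add, star_add]
      map_update_smul' := by
        intro _ v i c x
        have h : ∀ z : E, (fun j => star (Function.update v i z j))
            = Function.update (fun j => star (v j)) i (star z) := by
          intro z; ext1 j
          by_cases hj : j = i
          · subst hj; simp
          · simp [hj]
        rw [h, h, star_smul, q.map_update_smul, star_smul, star_star] }
    ‖q‖ fun v => by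
      simpa using q.le_opNorm fun i => star (v i)

lemma ContinuousMultilinearMap.norm_starStar_le {n : ℕ} (q : E [×n]→L[ℂ] F) :
    ‖q.starStar‖ ≤ ‖q‖ := MultilinearMap.mkContinuous_norm_le _ (norm_nonneg _) _

/-- The coefficients of the power series are conjugated and their norms do not grow, so the radius
does not shrink. This is how changes of coordinates act on the polarized variables. -/
theorem AnalyticAt.star_star {f : E → F} {x : E} (hf : AnalyticAt ℂ f (star x)) :
    AnalyticAt ℂ (fun y => star (f (star y))) x := by
  obtain ⟨p, r, hp⟩ := hf
  refine ⟨fun n => (p n).starStar, r, ?_, hp.r_pos, ?_⟩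
  · refine hp.r_le.trans (FormalMultilinearSeries.radius_le_of_le fun {n} => ?_)
    exact (p n).norm_starStar_le
  · intro y hy
    have hy' : star y ∈ Metric.eball (0 : E) r := by
      simpa [Metric.mem_eball, edist_zero_right, enorm_eq_nnnorm] using hy
    have := hp.hasSum hy'
    rw [star_add]
    exact this.star

end ConjConj

/-! ### Complexification of real-analytic functions -/

section Complexification

variable {d : ℕ} {F : Type*} [NormedAddCommGroup F] [NormedSpace ℂ F]

/-- The complexification of a real multilinear map in `d` real variables. -/
noncomputable def complexifyMultilinear {n : ℕ} (q : (Fin d → ℝ) [×n]→L[ℝ] F) :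
    (Fin d → ℂ) [×n]→L[ℂ] F :=
  ∑ s : Fin n → Fin d, ContinuousMultilinearMap.smulRight
    ((ContinuousMultilinearMap.mkPiAlgebra ℂ (Fin n) ℂ).compContinuousLinearMap
      fun i => ContinuousLinearMap.proj (R := ℂ) (φ := fun _ : Fin d => ℂ) (s i))
    (q fun i => Pi.single (s i) 1)

lemma norm_complexifyMultilinear_le {n : ℕ} (q : (Fin d → ℝ) [×n]→L[ℝ] F) :
    ‖complexifyMultilinear q‖ ≤ d ^ n * ‖q‖ := by
  have h : ∀ s : Fin n → Fin d, ‖ContinuousMultilinearMap.smulRight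
    ((ContinuousMultilinearMap.mkPiAlgebra ℂ (Fin n) ℂ).compContinuousLinearMap
      fun i => ContinuousLinearMap.proj (R := ℂ) (φ := fun _ : Fin d => ℂ) (s i))
    (q fun i => Pi.single (s i) 1)‖ ≤ ‖q‖ := by
    intro s
    refine ContinuousMultilinearMap.opNorm_le_bound (norm_nonneg _) fun v => ?_
    simp only [ContinuousMultilinearMap.smulRight_apply,
      ContinuousMultilinearMap.compContinuousLinearMap_apply,
      ContinuousMultilinearMap.mkPiAlgebra_apply, ContinuousLinearMap.proj_apply, norm_smul,
      norm_prod]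
    rw [mul_comm]
    refine mul_le_mul ?_ (Finset.prod_le_prod (fun _ _ => norm_nonneg _)
      fun i _ => norm_le_pi_norm (v i) (s i)) (Finset.prod_nonneg fun _ _ => norm_nonneg _)
      (norm_nonneg _)
    refine (q.le_opNorm _).trans ?_
    simp [Pi.norm_single]
  calc _ ≤ ∑ s : Fin n → Fin d, ‖q‖ := norm_sum_le_of_le _ fun i _ => h i
    _ = _ := by simp

lemma complexifyMultilinear_ofReal {n : ℕ} (q : (Fin d → ℝ) [×n]→L[ℝ] F) (x : Fin d → ℝ) :
    complexifyMultilinear q (fun _ i => (x i : ℂ)) = q fun _ => x := by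
  have hx : x = ∑ j, x j • (Pi.single j 1 : Fin d → ℝ) := by
    ext k; simp [Finset.sum_apply, Pi.single_apply]
  conv_rhs => rw [hx]
  have := q.map_sum (fun (_ : Fin n) (j : Fin d) => x j • (Pi.single j 1 : Fin d → ℝ))
  rw [this]
  simp only [complexifyMultilinear, sum_apply]
  refine Finset.sum_congr rfl fun s _ => ?_
  rw [q.map_smul_univ (fun i => x (s i)) (fun i => Pi.single (s i) (1 : ℝ))]
  simp only [ContinuousMultilinearMap.smulRight_apply,
      ContinuousMultilinearMap.compContinuousLinearMap_apply,
      ContinuousMultilinearMap.mkPiAlgebra_apply, ContinuousLinearMap.proj_apply]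
  rw [← Complex.ofReal_prod, Complex.coe_smul]

/-- A real-analytic function of `d` variables extends holomorphically. -/
theorem AnalyticAt.exists_complexification [CompleteSpace F] {f : (Fin d → ℝ) → F}
    (hf : AnalyticAt ℝ f 0) :
    ∃ g : (Fin d → ℂ) → F, AnalyticAt ℂ g 0 ∧ ∀ᶠ x in 𝓝 (0 : Fin d → ℝ), f x = g fun i => x i := by
  obtain ⟨p, r, hp⟩ := hf
  set q : FormalMultilinearSeries ℂ (Fin d → ℂ) F := fun n => complexifyMultilinear (p n)
  have hq : 0 < q.radius := by
    obtain ⟨r', hr0, hr1⟩ := ENNReal.lt_iff_exists_nnreal_btwn.1 hp.radius_pos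
    have hr0' : 0 < r' := by exact_mod_cast hr0
    obtain ⟨C, hC, h⟩ := p.norm_mul_pow_le_of_lt_radius hr1
    -- Dividing the radius absorbs the factor d ^ n; using d + 1 in place of d also covers d = 0.
    have : ((r' / (d + 1) : NNReal) : ENNReal) ≤ q.radius := by
      refine q.le_radius_of_bound C fun n => ?_
      calc ‖q n‖ * ((r' / (d + 1) : NNReal) : ℝ) ^ n
          ≤ d ^ n * ‖p n‖ * ((r' / (d + 1) : NNReal) : ℝ) ^ n := by
            gcongr; exact norm_complexifyMultilinear_le _
        _ = (d / (d + 1)) ^ n * (‖p n‖ * r' ^ n) := by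
          push_cast
          rw [div_pow, div_pow]; ring
        _ ≤ 1 * C := by
          refine mul_le_mul (pow_le_one₀ (by positivity) ?_) (h n) (by positivity) zero_le_one
          rw [div_le_one (by positivity)]; linarith
        _ = C := one_mul _
    refine lt_of_lt_of_le ?_ this
    have : 0 < r' / (d + 1) := by positivity
    exact_mod_cast this
  have hqs := q.hasFPowerSeriesOnBall hq
  refine ⟨q.sum, hqs.analyticAt, ?_⟩
  have hmem : ∀ᶠ x in 𝓝 (0 : Fin d → ℝ), x ∈ Metric.eball (0 : Fin d → ℝ) (min r q.radius) :=
    Metric.eball_mem_nhds _ (lt_min hp.r_pos hq)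
  filter_upwards [hmem] with x hx
  have hx1 : x ∈ Metric.eball (0 : Fin d → ℝ) r := Metric.eball_subset_eball (min_le_left _ _) hx
  have hx2 : (fun i => (x i : ℂ)) ∈ Metric.eball (0 : Fin d → ℂ) q.radius := by
    have := Metric.eball_subset_eball (min_le_right _ _) hx
    rw [Metric.mem_eball, edist_zero_right, enorm_eq_nnnorm] at this ⊢
    refine lt_of_le_of_lt ?_ this
    rw [ENNReal.coe_le_coe, pi_nnnorm_le_iff]
    intro i
    rw [Complex.nnnorm_real]
    exact nnnorm_le_pi_nnnorm x i
  have s1 := hp.hasSum hx1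
  have s2 := hqs.hasSum hx2
  simp only [zero_add] at s1 s2
  refine s1.unique ?_
  convert s2 using 2 with n
  exact (complexifyMultilinear_ofReal (p n) x).symm

/-- A holomorphic function of `d` variables which vanishes at real points vanishes. -/
theorem AnalyticAt.eventually_eq_zero_of_real {f : (Fin d → ℂ) → F} [CompleteSpace F]
    (hf : AnalyticAt ℂ f 0) (h : ∀ᶠ x in 𝓝 (0 : Fin d → ℝ), f (fun i => x i) = 0) :
    ∀ᶠ x in 𝓝 (0 : Fin d → ℂ), f x = 0 := by
  obtain ⟨ε, hε, h1⟩ := Metric.eventually_nhds_iff_ball.1 (hf.eventually_analyticAt)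
  obtain ⟨δ, hδ, h2⟩ := Metric.eventually_nhds_iff_ball.1 h
  rw [Metric.eventually_nhds_iff_ball]
  refine ⟨ε / 4, by positivity, fun v hv => ?_⟩
  -- With v = a + i b, the identity theorem in one variable is used twice: for real s along t ↦ t (a
  -- + s b), evaluated at t = 1, and then along s ↦ a + s b, evaluated at s = i. The factor 4 keeps
  -- both families inside the ball of analyticity for parameters in a disk of radius 2.
  set a : Fin d → ℂ := fun i => ((v i).re : ℂ)
  set b : Fin d → ℂ := fun i => ((v i).im : ℂ)
  have hv' : ‖v‖ < ε / 4 := by simpa using hv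
  have ha : ‖a‖ < ε / 4 := by
    refine lt_of_le_of_lt ((pi_norm_le_iff_of_nonneg (norm_nonneg _)).2 fun i => ?_) hv'
    refine le_trans ?_ (norm_le_pi_norm v i)
    simpa [a] using Complex.abs_re_le_norm (v i)
  have hb : ‖b‖ < ε / 4 := by
    refine lt_of_le_of_lt ((pi_norm_le_iff_of_nonneg (norm_nonneg _)).2 fun i => ?_) hv'
    refine le_trans ?_ (norm_le_pi_norm v i)
    simpa [b] using Complex.abs_im_le_norm (v i)
  have hmem : ∀ t s : ℂ, ‖t‖ < 2 → ‖s‖ ≤ 1 → t • (a + s • b) ∈ Metric.ball (0 : Fin d → ℂ) ε := by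
    intro t s ht hs
    rw [mem_ball_zero_iff, norm_smul]
    have : ‖a + s • b‖ ≤ ‖a‖ + 1 * ‖b‖ := by
      refine (norm_add_le _ _).trans ?_
      rw [norm_smul]; gcongr
    nlinarith [norm_nonneg t, norm_nonneg (a + s • b)]
  have hreal : ∀ s : ℝ, ‖s‖ ≤ 1 → f (a + (s : ℂ) • b) = 0 := by
    intro s hs
    have hA : AnalyticOnNhd ℂ (fun t : ℂ => f (t • (a + (s : ℂ) • b))) (Metric.ball 0 2) := by
      intro t ht
      refine AnalyticAt.fun_comp (h1 _ (hmem t s (by simpa using ht) (by simpa using hs))) ?_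
      fun_prop
    have hz := hA.eqOn_zero_of_preconnected_of_frequently_eq_zero
      (convex_ball _ _).isPreconnected (Metric.mem_ball_self (by norm_num)) (z₀ := 0) ?_
    · have := hz (x := 1) (by simp)
      simpa using this
    · have hev : ∀ᶠ t : ℝ in 𝓝 0, f ((t : ℂ) • (a + (s : ℂ) • b)) = 0 := by
        have hc : Tendsto (fun t : ℝ => (fun i => t * ((v i).re + s * (v i).im) : Fin d → ℝ))
            (𝓝 0) (𝓝 0) := by
          refine Continuous.tendsto' (by fun_prop) _ _ (by ext; simp)
        filter_upwards [hc.eventually h] with t ht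
        convert ht using 2
        ext i
        simp [a, b]
      have hne : ∃ᶠ t : ℝ in 𝓝[≠] 0, f ((t : ℂ) • (a + (s : ℂ) • b)) = 0 :=
        (hev.filter_mono nhdsWithin_le_nhds).frequently
      have hmap : Tendsto (fun t : ℝ => (t : ℂ)) (𝓝[≠] 0) (𝓝[≠] 0) := by
        refine tendsto_nhdsWithin_iff.2 ⟨?_, ?_⟩
        · exact (Complex.continuous_ofReal.tendsto' 0 0 (by simp)).mono_left nhdsWithin_le_nhds
        · filter_upwards [self_mem_nhdsWithin] with t ht
          simpa using ht
      exact hmap.frequently hne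
  have hB : AnalyticOnNhd ℂ (fun s : ℂ => f (a + s • b)) (Metric.ball 0 2) := by
    intro s hs
    refine AnalyticAt.fun_comp (h1 _ ?_) ?_
    · rw [mem_ball_zero_iff]
      have hs' : ‖s‖ < 2 := by simpa using hs
      refine (norm_add_le _ _).trans_lt ?_
      rw [norm_smul]
      nlinarith [norm_nonneg s, norm_nonneg b]
    · fun_prop
  have hz := hB.eqOn_zero_of_preconnected_of_frequently_eq_zero
      (convex_ball _ _).isPreconnected (Metric.mem_ball_self (by norm_num)) (z₀ := 0) ?_
  · have := hz (x := Complex.I) (by simp)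
    refine Eq.trans (congrArg f ?_) this
    ext i
    simp only [a, b, Pi.add_apply, Pi.smul_apply, smul_eq_mul]
    conv_lhs => rw [← Complex.re_add_im (v i)]
    ring
  · have hev : ∀ᶠ s : ℝ in 𝓝 0, f (a + (s : ℂ) • b) = 0 := by
      filter_upwards [Metric.ball_mem_nhds (0 : ℝ) one_pos] with s hs
      exact hreal s (by simpa using (le_of_lt (by simpa using hs)))
    have hne : ∃ᶠ s : ℝ in 𝓝[≠] 0, f (a + (s : ℂ) • b) = 0 :=
        (hev.filter_mono nhdsWithin_le_nhds).frequently
    have hmap : Tendsto (fun t : ℝ => (t : ℂ)) (𝓝[≠] 0) (𝓝[≠] 0) := by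
      refine tendsto_nhdsWithin_iff.2 ⟨?_, ?_⟩
      · exact (Complex.continuous_ofReal.tendsto' 0 0 (by simp)).mono_left nhdsWithin_le_nhds
      · filter_upwards [self_mem_nhdsWithin] with t ht
        simpa using ht
    exact hmap.frequently hne

end Complexification


/-! ### Implicit and inverse functions -/

section Implicit

variable {𝕜 : Type*} [RCLike 𝕜]
  {E₁ : Type*} [NormedAddCommGroup E₁] [NormedSpace 𝕜 E₁] [CompleteSpace E₁]
  {E₂ : Type*} [NormedAddCommGroup E₂] [NormedSpace 𝕜 E₂] [FiniteDimensional 𝕜 E₂]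

/-- The analytic implicit function theorem, for as many equations as unknowns. -/
theorem AnalyticAt.exists_implicitFunction {f : E₁ × E₂ → E₂} {a : E₁} {b : E₂}
    (hf : AnalyticAt 𝕜 f (a, b)) (h0 : f (a, b) = 0)
    {A : E₂ →L[𝕜] E₂} (hA : HasFDerivAt (fun y => f (a, y)) A b) (hinj : ∀ y, A y = 0 → y = 0) :
    ∃ φ : E₁ → E₂, AnalyticAt 𝕜 φ a ∧ φ a = b ∧ ∀ᶠ p in 𝓝 (a, b), (f p = 0 ↔ φ p.1 = p.2) := by
  have : CompleteSpace E₂ := FiniteDimensional.complete 𝕜 E₂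
  have hc : ContDiffAt 𝕜 ⊤ f (a, b) := hf.contDiffAt
  have hA' : fderiv 𝕜 f (a, b) ∘L .inr 𝕜 E₁ E₂ = A := by
    refine HasFDerivAt.unique ?_ hA
    have h1 : HasFDerivAt (fun y : E₂ => (a, y)) (ContinuousLinearMap.inr 𝕜 E₁ E₂) b :=
      hasFDerivAt_prodMk_right a b
    exact (hf.differentiableAt.hasFDerivAt).comp b h1
  have hker : LinearMap.ker (A : E₂ →ₗ[𝕜] E₂) = ⊥ :=
    LinearMap.ker_eq_bot'.2 hinj
  have hi : (fderiv 𝕜 f (a, b) ∘L .inr 𝕜 E₁ E₂).IsInvertible := by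
    rw [hA']
    refine ⟨(LinearEquiv.ofInjectiveEndo (A : E₂ →ₗ[𝕜] E₂)
      (LinearMap.ker_eq_bot.1 hker)).toContinuousLinearEquiv, ?_⟩
    ext y; rfl
  have hn : (⊤ : WithTop ℕ∞) ≠ 0 := by simp
  refine ⟨hc.implicitFunction hn hi,
    (hc.contDiffAt_implicitFunction hn hi).analyticAt,
    hc.implicitFunction_apply_self hn hi, ?_⟩
  simpa [h0] using hc.eventually_apply_eq_iff_implicitFunction hn hi

/-- The analytic inverse function theorem at a fixed point, for maps tangent to the identity. -/
theorem AnalyticAt.exists_localInverse {h : E₁ → E₁} (hh : AnalyticAt 𝕜 h 0) (h0 : h 0 = 0)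
    (hd : HasFDerivAt h (ContinuousLinearMap.id 𝕜 E₁) 0) :
    ∃ e : OpenPartialHomeomorph E₁ E₁, 0 ∈ e.source ∧ ⇑e = h ∧
      AnalyticOnNhd 𝕜 e e.source ∧ AnalyticOnNhd 𝕜 e.symm e.target := by
  have hc : ContDiffAt 𝕜 ⊤ h 0 := hh.contDiffAt
  have hn : (⊤ : WithTop ℕ∞) ≠ 0 := by simp
  have hd' : HasFDerivAt h ((ContinuousLinearEquiv.refl 𝕜 E₁ : E₁ ≃L[𝕜] E₁) : E₁ →L[𝕜] E₁) 0 := hd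
  set e₀ := hc.toOpenPartialHomeomorph h hd' hn with he₀
  have hm : (0 : E₁) ∈ e₀.source := hc.mem_toOpenPartialHomeomorph_source hd' hn
  have hs : AnalyticAt 𝕜 e₀.symm 0 := by
    have := e₀.analyticAt_symm' (i := ContinuousLinearEquiv.refl 𝕜 E₁) hm hh hd'.fderiv
    simpa [he₀, h0] using this
  -- The inverse function theorem gives analyticity at the base point only, so the local
  -- homeomorphism is restricted to the open set where both it and its inverse are analytic.
  set U : Set E₁ := {x | AnalyticAt 𝕜 h x}
  set V : Set E₁ := e₀.source ∩ e₀ ⁻¹' {x | AnalyticAt 𝕜 e₀.symm x}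
  have hU : IsOpen U := isOpen_analyticAt 𝕜 h
  have hV : IsOpen V := e₀.isOpen_inter_preimage (isOpen_analyticAt 𝕜 e₀.symm)
  refine ⟨e₀.restrOpen (U ∩ V) (hU.inter hV), ?_, rfl, ?_, ?_⟩
  · rw [OpenPartialHomeomorph.restrOpen_source]
    refine ⟨hm, hh, hm, ?_⟩
    change AnalyticAt 𝕜 e₀.symm (h 0)
    rwa [h0]
  · intro x hx
    rw [OpenPartialHomeomorph.restrOpen_source] at hx
    exact hx.2.1
  · intro y hy
    have h1 := (e₀.restrOpen (U ∩ V) (hU.inter hV)).map_target hy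
    rw [OpenPartialHomeomorph.restrOpen_source] at h1
    have h2 : AnalyticAt 𝕜 e₀.symm (e₀ (e₀.symm y)) := h1.2.2.2
    have h3 : e₀ (e₀.symm y) = y := (e₀.restrOpen (U ∩ V) (hU.inter hV)).right_inv hy
    rw [h3] at h2
    exact h2

/-- A local inverse as a germ. -/
theorem AnalyticAt.exists_germInverse {h : E₁ → E₁} (hh : AnalyticAt 𝕜 h 0) (h0 : h 0 = 0)
    (hd : HasFDerivAt h (ContinuousLinearMap.id 𝕜 E₁) 0) :
    ∃ k : E₁ → E₁, AnalyticAt 𝕜 k 0 ∧ k 0 = 0 ∧ HasFDerivAt k (ContinuousLinearMap.id 𝕜 E₁) 0 ∧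
      (∀ᶠ x in 𝓝 0, k (h x) = x) ∧ ∀ᶠ x in 𝓝 0, h (k x) = x := by
  obtain ⟨e, he, rfl, h1, h2⟩ := hh.exists_localInverse h0 hd
  have hk0 : e.symm 0 = 0 := by
    conv_lhs => rw [← h0]
    exact e.left_inv he
  have ht : (0 : E₁) ∈ e.target := by
    rw [← h0]; exact e.map_source he
  refine ⟨e.symm, h2 0 ht, hk0, ?_, e.eventually_left_inverse he, e.eventually_right_inverse ht⟩
  have hd' : HasFDerivAt e ((ContinuousLinearEquiv.refl 𝕜 E₁ : E₁ ≃L[𝕜] E₁) : E₁ →L[𝕜] E₁)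
    (e.symm 0) := by rw [hk0]; exact hd
  exact e.hasFDerivAt_symm ht hd'

end Implicit

/-! ### Derivatives depending on parameters -/

section Params

variable {𝕜 : Type*} [NontriviallyNormedField 𝕜]
  {E : Type*} [NormedAddCommGroup E] [NormedSpace 𝕜 E]
  {F : Type*} [NormedAddCommGroup F] [NormedSpace 𝕜 F] [CompleteSpace F]

lemma AnalyticAt.deriv_param {f : E × 𝕜 → F} {p : E} {s : 𝕜} (hf : AnalyticAt 𝕜 f (p, s)) :
    AnalyticAt 𝕜 (fun q : E × 𝕜 => deriv (fun t => f (q.1, t)) q.2) (p, s) := by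
  have h1 : AnalyticAt 𝕜 (fun q : E × 𝕜 => fderiv 𝕜 f q (0, 1)) (p, s) :=
    (ContinuousLinearMap.apply 𝕜 F ((0 : E), (1 : 𝕜))).analyticAt _ |>.comp hf.fderiv
  refine h1.congr ?_
  filter_upwards [hf.eventually_analyticAt] with q hq
  have : HasDerivAt (fun t : 𝕜 => (q.1, t)) ((0 : E), (1 : 𝕜)) q.2 :=
    (hasDerivAt_const _ _).prodMk (hasDerivAt_id _)
  exact (hq.differentiableAt.hasFDerivAt.comp_hasDerivAt q.2 this).deriv.symm

lemma AnalyticAt.iteratedDeriv_param {f : E × 𝕜 → F} {p : E} {s : 𝕜} (hf : AnalyticAt 𝕜 f (p, s))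
    (n : ℕ) :
    AnalyticAt 𝕜 (fun q : E × 𝕜 => iteratedDeriv n (fun t => f (q.1, t)) q.2) (p, s) := by
  induction n with
  | zero => simpa using hf
  | succ n ih => simpa only [iteratedDeriv_succ] using ih.deriv_param

end Params


/-! ### Holomorphic differential equations -/

section ODE

variable {E : Type*} [NormedAddCommGroup E] [NormedSpace ℂ E]

/-- Holomorphic solutions of a holomorphic differential equation are unique. -/
theorem AnalyticAt.ode_unique {V : E → E} {y₀ : E} (hV : AnalyticAt ℂ V y₀) {y₁ y₂ : ℂ → E}
    (h₁ : y₁ 0 = y₀) (h₂ : y₂ 0 = y₀) (hd₁ : ∀ᶠ t in 𝓝 0, HasDerivAt y₁ (V (y₁ t)) t)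
    (hd₂ : ∀ᶠ t in 𝓝 0, HasDerivAt y₂ (V (y₂ t)) t) : y₁ =ᶠ[𝓝 0] y₂ := by
  obtain ⟨L, s, hs, hL⟩ := hV.hasStrictFDerivAt.exists_lipschitzOnWith
  have hc₁ : ∀ᶠ t in 𝓝 0, y₁ t ∈ s := hd₁.self_of_nhds.continuousAt.eventually (by rwa [h₁])
  have hc₂ : ∀ᶠ t in 𝓝 0, y₂ t ∈ s := hd₂.self_of_nhds.continuousAt.eventually (by rwa [h₂])
  obtain ⟨ε, hε, h⟩ := Metric.eventually_nhds_iff_ball.1 (((hd₁.and hd₂).and hc₁).and hc₂)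
  -- Chosen so that L * r < 1. The maximum of the distance between the solutions over the closed
  -- disk of radius r is then at most L * r times itself, hence zero.
  set r : ℝ := min (ε / 2) (1 / (2 * (L + 1))) with hr
  have hr0 : 0 < r := by positivity
  have hrε : r < ε := (min_le_left _ _).trans_lt (by linarith)
  have hrL : L * r < 1 := by
    have h1 : r ≤ 1 / (2 * (L + 1)) := min_le_right _ _
    have hL0 : (0 : ℝ) ≤ L := L.2
    calc L * r ≤ L * (1 / (2 * (L + 1))) := by gcongr
      _ < 1 := by rw [mul_one_div, div_lt_one (by positivity)]; linarith
  have hsub : ∀ t ∈ Metric.closedBall (0 : ℂ) r, t ∈ Metric.ball (0 : ℂ) ε := fun t ht =>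
    Metric.closedBall_subset_ball hrε ht
  set D : ℂ → E := fun t => y₁ t - y₂ t
  have hD : ∀ t ∈ Metric.closedBall (0 : ℂ) r, HasDerivAt D (V (y₁ t) - V (y₂ t)) t := fun t ht =>
    (h t (hsub t ht)).1.1.1.sub (h t (hsub t ht)).1.1.2
  have hcont : ContinuousOn (fun t => ‖D t‖) (Metric.closedBall 0 r) := fun t ht =>
    (hD t ht).continuousAt.norm.continuousWithinAt
  obtain ⟨t₀, ht₀, hmax⟩ := (isCompact_closedBall (0 : ℂ) r).exists_isMaxOn
    ⟨0, Metric.mem_closedBall_self hr0.le⟩ hcont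
  have hb : ∀ t ∈ Metric.closedBall (0 : ℂ) r, ‖V (y₁ t) - V (y₂ t)‖ ≤ L * ‖D t₀‖ := by
    intro t ht
    have h1 := h t (hsub t ht)
    have h2 := hL.dist_le_mul _ h1.1.2 _ h1.2
    rw [dist_eq_norm, dist_eq_norm] at h2
    refine h2.trans ?_
    gcongr
    exact hmax ht
  have h3 := Convex.norm_image_sub_le_of_norm_hasDerivWithin_le
    (fun t ht => (hD t ht).hasDerivWithinAt) hb (convex_closedBall (0 : ℂ) r)
    (Metric.mem_closedBall_self hr0.le) ht₀
  have hD0 : D 0 = 0 := by simp [D, h₁, h₂]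
  rw [hD0, sub_zero, sub_zero] at h3
  have ht₀' : ‖t₀‖ ≤ r := by simpa using ht₀
  have h4 : ‖D t₀‖ ≤ (L * r) * ‖D t₀‖ := by
    calc _ ≤ L * ‖D t₀‖ * ‖t₀‖ := h3
      _ ≤ L * ‖D t₀‖ * r := by gcongr
      _ = _ := by ring
  have h5 : ‖D t₀‖ = 0 := by nlinarith [norm_nonneg (D t₀)]
  filter_upwards [Metric.closedBall_mem_nhds (0 : ℂ) hr0] with t ht
  have h6 : ‖D t‖ ≤ ‖D t₀‖ := hmax ht
  rw [h5] at h6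
  exact sub_eq_zero.1 (norm_le_zero_iff.1 h6)

/-- Holomorphic differential equations have holomorphic solutions. -/
theorem AnalyticAt.exists_ode [CompleteSpace E] {V : E → E} {y₀ : E} (hV : AnalyticAt ℂ V y₀) :
    ∃ y : ℂ → E, AnalyticAt ℂ y 0 ∧ y 0 = y₀ ∧ ∀ᶠ t in 𝓝 0, HasDerivAt y (V (y t)) t := by
  obtain ⟨L, s, hs, hL⟩ := hV.hasStrictFDerivAt.exists_lipschitzOnWith
  have hbd : ∀ᶠ x in 𝓝 y₀, ‖V x‖ < ‖V y₀‖ + 1 :=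
    hV.continuousAt.norm.eventually (gt_mem_nhds (lt_add_one _))
  obtain ⟨ε, hε, hball⟩ := Metric.eventually_nhds_iff_ball.1
    ((hbd.and hV.eventually_analyticAt).and (eventually_mem_set.2 hs))
  set M : ℝ := ‖V y₀‖ + 1
  have hM : 0 < M := by positivity
  set R : ℝ := ε / 2 with hR
  have hR0 : 0 < R := by positivity
  have hB : ∀ x ∈ Metric.closedBall y₀ R, ‖V x‖ ≤ M ∧ AnalyticAt ℂ V x ∧ x ∈ s := by
    intro x hx
    have := hball x (Metric.closedBall_subset_ball (by rw [hR]; linarith) hx)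
    exact ⟨this.1.1.le, this.1.2, this.2⟩
  -- M * r ≤ R keeps the Picard iterates in the closed ball of radius R, and L * r ≤ 1 / 2 makes the
  -- iteration contract.
  set r : ℝ := min (R / M) (1 / (2 * (L + 1))) with hr
  have hr0 : 0 < r := by positivity
  have hL0 : (0 : ℝ) ≤ L := L.2
  have hrM : M * r ≤ R := by
    calc M * r ≤ M * (R / M) := by gcongr; exact min_le_left _ _
      _ = R := by field_simp
  have hrL : L * r ≤ 1 / 2 := by
    calc L * r ≤ L * (1 / (2 * (L + 1))) := by gcongr; exact min_le_right _ _
      _ ≤ 1 / 2 := by rw [mul_one_div, div_le_div_iff₀ (by positivity) (by positivity)]; linarith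
  set D := Metric.ball (0 : ℂ) r
  have h0D : (0 : ℂ) ∈ D := Metric.mem_ball_self hr0
  have hDn : ∀ t ∈ D, ‖t‖ ≤ r := fun t ht => by
    have : ‖t‖ < r := by simpa [D] using ht
    exact this.le
  -- Picard iteration takes place in S. The next iterate is the holomorphic primitive on the disk
  -- with value y₀ at 0, so no path integral is needed, and the uniform limit is again holomorphic.
  let S := {u : ℂ → E // DifferentiableOn ℂ u D ∧ u 0 = y₀ ∧ ∀ t ∈ D, u t ∈ Metric.closedBall y₀ R}
  have hstep : ∀ u : S, ∃ v : S, ∀ t ∈ D, HasDerivAt v.1 (V (u.1 t)) t := by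
    rintro ⟨u, hu1, hu2, hu3⟩
    have hdiff : DifferentiableOn ℂ (fun t => V (u t)) D := fun t ht =>
      ((hB _ (hu3 t ht)).2.1.differentiableAt.comp t
        (hu1.differentiableAt (Metric.isOpen_ball.mem_nhds ht))).differentiableWithinAt
    obtain ⟨v, hv0, hv⟩ := hdiff.isExactOn_ball.with_val_at 0 y₀
    refine ⟨⟨v, fun t ht => (hv t ht).differentiableAt.differentiableWithinAt, hv0, ?_⟩, hv⟩
    intro t ht
    have := Convex.norm_image_sub_le_of_norm_hasDerivWithin_le
      (fun t ht => (hv t ht).hasDerivWithinAt) (fun t ht => (hB _ (hu3 t ht)).1)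
      (convex_ball (0 : ℂ) r) h0D ht
    rw [hv0, sub_zero] at this
    rw [mem_closedBall_iff_norm]
    refine this.trans (le_trans ?_ hrM)
    gcongr
    exact hDn t ht
  choose next hnext using hstep
  have hcontr : ∀ (u v : S) (C : ℝ), (∀ t ∈ D, ‖u.1 t - v.1 t‖ ≤ C) →
      ∀ t ∈ D, ‖(next u).1 t - (next v).1 t‖ ≤ C * (1 / 2) := by
    intro u v C h t ht
    have hC : 0 ≤ C := (norm_nonneg _).trans (h 0 h0D)
    have := Convex.norm_image_sub_le_of_norm_hasDerivWithin_le (C := L * C)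
      (fun t ht => ((hnext u t ht).sub (hnext v t ht)).hasDerivWithinAt) (fun t ht => ?_)
      (convex_ball (0 : ℂ) r) h0D ht
    · simp only [Pi.sub_apply, (next u).2.2.1, (next v).2.2.1, sub_self, sub_zero] at this
      refine this.trans ?_
      calc L * C * ‖t‖ ≤ L * C * r := by gcongr; exact hDn t ht
        _ = C * (L * r) := by ring
        _ ≤ C * (1 / 2) := by gcongr
    · have h2 := hL.dist_le_mul _ (hB _ (u.2.2.2 t ht)).2.2 _ (hB _ (v.2.2.2 t ht)).2.2
      rw [dist_eq_norm, dist_eq_norm] at h2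
      refine h2.trans ?_
      gcongr
      exact h t ht
  let u₀ : S := ⟨fun _ => y₀, differentiableOn_const _, rfl, fun _ _ =>
    Metric.mem_closedBall_self hR0.le⟩
  let u : ℕ → S := fun n => next^[n] u₀
  have hu : ∀ n, u (n + 1) = next (u n) := fun n => Function.iterate_succ_apply' next n u₀
  have hgeo : ∀ n, ∀ t ∈ D, ‖(u n).1 t - (u (n + 1)).1 t‖ ≤ (2 * R) * (1 / 2) ^ n := by
    intro n
    induction n with
    | zero =>
      intro t ht
      have h1 := (u 0).2.2.2 t ht
      have h2 := (u 1).2.2.2 t ht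
      rw [← dist_eq_norm]
      refine (dist_triangle_right _ _ y₀).trans ?_
      rw [Metric.mem_closedBall] at h1 h2
      linarith
    | succ n ih =>
      rw [hu (n + 1), hu n, ← hu n]
      have := hcontr (u n) (u (n + 1)) _ ih
      rw [← hu n] at this
      simpa [pow_succ, mul_assoc] using this
  have hlim : ∀ t ∈ D, ∃ l, Tendsto (fun n => (u n).1 t) atTop (𝓝 l) := fun t ht =>
    cauchySeq_tendsto_of_complete (cauchySeq_of_le_geometric (1 / 2) (2 * R) (by norm_num)
      fun n => by rw [dist_eq_norm]; exact hgeo n t ht)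
  choose! y hy using hlim
  have hunif : TendstoUniformlyOn (fun n t => (u n).1 t) y atTop D := by
    rw [Metric.tendstoUniformlyOn_iff]
    intro δ hδ
    have h1 : Tendsto (fun n : ℕ => 2 * R * (1 / 2 : ℝ) ^ n / (1 - 1 / 2)) atTop (𝓝 0) := by
      have := (tendsto_pow_atTop_nhds_zero_of_lt_one (r := (1 / 2 : ℝ)) (by norm_num)
        (by norm_num)).const_mul (2 * R) |>.div_const (1 - 1 / 2)
      simpa using this
    filter_upwards [h1.eventually (gt_mem_nhds hδ)] with n hn t ht
    rw [dist_comm]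
    refine lt_of_le_of_lt ?_ hn
    exact dist_le_of_le_geometric_of_tendsto (1 / 2) (2 * R) (by norm_num)
      (fun n => by rw [dist_eq_norm]; exact hgeo n t ht) (hy t ht) n
  have hDo : IsOpen D := Metric.isOpen_ball
  have hloc := hunif.tendstoLocallyUniformlyOn
  have hdn : ∀ᶠ n in atTop, DifferentiableOn ℂ (fun t => (u n).1 t) D :=
    Eventually.of_forall fun n => (u n).2.1
  have hyd : DifferentiableOn ℂ y D := hloc.differentiableOn hdn hDo
  have hy0 : y 0 = y₀ := by
    refine tendsto_nhds_unique (hy 0 h0D) ?_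
    simp only [(u _).2.2.1]
    exact tendsto_const_nhds
  refine ⟨y, hyd.analyticAt (hDo.mem_nhds h0D), hy0, ?_⟩
  filter_upwards [hDo.mem_nhds h0D] with t ht
  have hda := (hyd.differentiableAt (hDo.mem_nhds ht)).hasDerivAt
  have hmem : y t ∈ Metric.closedBall y₀ R :=
    Metric.isClosed_closedBall.mem_of_tendsto (hy t ht)
      (Eventually.of_forall fun n => (u n).2.2.2 t ht)
  have h1 : Tendsto (fun n => deriv (u (n + 1)).1 t) atTop (𝓝 (deriv y t)) :=
    ((hloc.deriv hdn hDo).tendsto_at ht).comp (tendsto_add_atTop_nat 1)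
  have h2 : Tendsto (fun n => deriv (u (n + 1)).1 t) atTop (𝓝 (V (y t))) := by
    have : (fun n => deriv (u (n + 1)).1 t) = fun n => V ((u n).1 t) := by
      ext1 n
      rw [hu n]
      exact (hnext (u n) t ht).deriv
    rw [this]
    exact ((hB _ hmem).2.1.continuousAt.tendsto).comp (hy t ht)
  rw [tendsto_nhds_unique h1 h2] at hda
  exact hda

end ODE


/-! ### Expansions with analytic coefficients and remainders -/

section Expansions

variable {𝕜 : Type*} [NontriviallyNormedField 𝕜]
  {E : Type*} [NormedAddCommGroup E] [NormedSpace 𝕜 E]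
  {F : Type*} [NormedAddCommGroup F] [NormedSpace 𝕜 F]

/-- Off the hyperplane p.1 = 0 the factor cancels; on it the value is a limit of values off it. -/
lemma eventually_eq_zero_of_smul [CompleteSpace F] {H : 𝕜 × E → F} {y₀ : E}
    (hH : AnalyticAt 𝕜 H (0, y₀))
    (h : ∀ᶠ p in 𝓝 ((0 : 𝕜), y₀), p.1 • H p = 0) : ∀ᶠ p in 𝓝 ((0 : 𝕜), y₀), H p = 0 := by
  filter_upwards [hH.eventually_analyticAt, h.eventually_nhds] with p hp1 hp2
  by_cases hp : p.1 = 0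
  · have hc : Tendsto (fun t : 𝕜 => (t, p.2)) (𝓝[≠] 0) (𝓝 p) := by
      have : Tendsto (fun t : 𝕜 => (t, p.2)) (𝓝 0) (𝓝 p) := by
        refine Continuous.tendsto' (by fun_prop) _ _ ?_
        rw [← hp]
      exact this.mono_left nhdsWithin_le_nhds
    have h1 : Tendsto (fun t : 𝕜 => H (t, p.2)) (𝓝[≠] 0) (𝓝 (H p)) :=
      hp1.continuousAt.tendsto.comp hc
    have h2 : ∀ᶠ t : 𝕜 in 𝓝[≠] 0, H (t, p.2) = 0 := by
      filter_upwards [hc.eventually hp2, self_mem_nhdsWithin] with t ht ht0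
      exact (smul_eq_zero.1 ht).resolve_left ht0
    exact tendsto_nhds_unique h1 (tendsto_const_nhds.congr' (h2.mono fun _ h => h.symm))
  · exact (smul_eq_zero.1 hp2.self_of_nhds).resolve_left hp

/-- Taylor expansion in the first variable, with analytic coefficients and remainder. -/
lemma AnalyticAt.exists_taylor [CompleteSpace F] {f : 𝕜 × E → F} {y₀ : E}
    (hf : AnalyticAt 𝕜 f (0, y₀)) (n : ℕ) :
    ∃ (a : ℕ → E → F) (g : 𝕜 × E → F), (∀ k, AnalyticAt 𝕜 (a k) y₀) ∧ AnalyticAt 𝕜 g (0, y₀) ∧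
      (a 0 = fun y => f (0, y)) ∧
      (a n = fun y => g (0, y)) ∧
      ∀ᶠ p in 𝓝 ((0 : 𝕜), y₀), f p = ∑ k ∈ Finset.range n, p.1 ^ k • a k p.2 + p.1 ^ n • g p := by
  have hin : AnalyticAt 𝕜 (fun y : E => ((0 : 𝕜), y)) y₀ := by fun_prop
  induction n with
  | zero =>
    refine ⟨fun _ y => f (0, y), f, fun _ => hf.fun_comp_of_eq hin rfl, hf, rfl, rfl, ?_⟩
    simp
  | succ n ih =>
    obtain ⟨a, g, ha, hg, ha0, han, h⟩ := ih
    obtain ⟨g', hg', h'⟩ := hg.exists_eq_add_smul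
    refine ⟨Function.update a (n + 1) (fun y => g' (0, y)), g', ?_, hg', ?_, by simp, ?_⟩
    · intro k
      by_cases hk : k = n + 1
      · subst hk; simpa using hg'.fun_comp_of_eq hin rfl
      · simpa [hk] using ha k
    · simpa using ha0
    · filter_upwards [h, h'] with p h h'
      rw [h, Finset.sum_range_succ, h']
      have : ∑ k ∈ Finset.range n, p.1 ^ k • Function.update a (n + 1) (fun y => g' (0, y)) k p.2
          = ∑ k ∈ Finset.range n, p.1 ^ k • a k p.2 := by
        refine Finset.sum_congr rfl fun k hk => ?_
        have : k ≠ n + 1 := by have := Finset.mem_range.1 hk; omega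
        simp [this]
      have han' : a n p.2 = g (0, p.2) := by rw [han]
      rw [this]
      simp only [ne_eq, Nat.ne_of_lt (Nat.lt_succ_self n), not_false_eq_true, Function.update_of_ne,
        han', smul_add, smul_smul, ← pow_succ]
      abel

/-- Uniqueness of finite Taylor expansions. -/
lemma taylor_unique {n : ℕ} {a : ℕ → F} {g : 𝕜 → F}
    (hg : ContinuousAt g 0)
    (h : ∀ᶠ t in 𝓝[≠] (0 : 𝕜), ∑ k ∈ Finset.range n, t ^ k • a k + t ^ n • g t = 0) :
    (∀ k < n, a k = 0) ∧ g 0 = 0 := by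
  induction n generalizing a with
  | zero =>
    refine ⟨by simp, ?_⟩
    simp only [Finset.range_zero, Finset.sum_empty, pow_zero, one_smul, zero_add] at h
    exact tendsto_nhds_unique (hg.tendsto.mono_left nhdsWithin_le_nhds)
      (tendsto_const_nhds.congr' (h.mono fun _ h => h.symm))
  | succ n ih =>
    have h0 : a 0 = 0 := by
      have hc : ContinuousAt (fun t : 𝕜 => ∑ k ∈ Finset.range (n + 1), t ^ k • a k
          + t ^ (n + 1) • g t) 0 := by fun_prop
      have := tendsto_nhds_unique (hc.tendsto.mono_left (nhdsWithin_le_nhds (s := {0}ᶜ)))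
        (tendsto_const_nhds.congr' (h.mono fun _ h => h.symm))
      rw [Finset.sum_range_succ'] at this
      simpa using this
    have h1 : ∀ᶠ t in 𝓝[≠] (0 : 𝕜), ∑ k ∈ Finset.range n, t ^ k • a (k + 1) + t ^ n • g t = 0 := by
      filter_upwards [h, self_mem_nhdsWithin] with t ht ht0
      rw [Finset.sum_range_succ', h0, smul_zero, add_zero] at ht
      have : t • (∑ k ∈ Finset.range n, t ^ k • a (k + 1) + t ^ n • g t) = 0 := by
        rw [← ht, smul_add, Finset.smul_sum, smul_smul, ← pow_succ']
        simp only [smul_smul, ← pow_succ']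
      exact (smul_eq_zero.1 this).resolve_left ht0
    obtain ⟨h2, h3⟩ := ih h1
    refine ⟨fun k hk => ?_, h3⟩
    cases k with
    | zero => exact h0
    | succ k => exact h2 k (by omega)

/-- Hadamard's lemma in two variables. -/
lemma AnalyticAt.exists_hadamard_two {f : 𝕜 × 𝕜 × E → 𝕜} [CompleteSpace 𝕜] (hf : AnalyticAt 𝕜 f 0) :
    ∃ p q : 𝕜 × 𝕜 × E → 𝕜, AnalyticAt 𝕜 p 0 ∧ AnalyticAt 𝕜 q 0 ∧
      ∀ᶠ x in 𝓝 0, f x = f (0, 0, x.2.2) + x.1 * p x + x.2.1 * q x := by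
  obtain ⟨p, hp, h1⟩ := AnalyticAt.exists_eq_add_smul (y₀ := (0 : 𝕜 × E)) hf
  have hin : AnalyticAt 𝕜 (fun y : 𝕜 × E => ((0 : 𝕜), y)) 0 := by fun_prop
  have h0 : AnalyticAt 𝕜 (fun y : 𝕜 × E => f (0, y)) 0 := hf.fun_comp_of_eq hin rfl
  obtain ⟨q, hq, h2⟩ := AnalyticAt.exists_eq_add_smul (y₀ := (0 : E)) h0
  refine ⟨p, fun x => q x.2, hp, hq.fun_comp_of_eq (by fun_prop) rfl, ?_⟩
  have hs : Tendsto (fun x : 𝕜 × 𝕜 × E => x.2) (𝓝 0) (𝓝 0) :=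
    Continuous.tendsto' (by fun_prop) _ _ rfl
  filter_upwards [h1, hs.eventually h2] with x h1 h2
  rw [h1, h2]
  simp only [smul_eq_mul]
  ring

/-- A function vanishing for `z = 0` and for `ζ = 0` is divisible by `z ζ`. -/
lemma AnalyticAt.exists_eq_mul_mul {f : 𝕜 × 𝕜 × E → 𝕜} [CompleteSpace 𝕜] (hf : AnalyticAt 𝕜 f 0)
    (h1 : ∀ᶠ x in 𝓝 (0 : 𝕜 × 𝕜 × E), f (0, x.2.1, x.2.2) = 0)
    (h2 : ∀ᶠ x in 𝓝 (0 : 𝕜 × 𝕜 × E), f (x.1, 0, x.2.2) = 0) :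
    ∃ g : 𝕜 × 𝕜 × E → 𝕜, AnalyticAt 𝕜 g 0 ∧ ∀ᶠ x in 𝓝 0, f x = x.1 * x.2.1 * g x := by
  obtain ⟨p, hp, hp1⟩ := AnalyticAt.exists_eq_add_smul (y₀ := (0 : 𝕜 × E)) hf
  have hd : AnalyticAt 𝕜 (fun x : 𝕜 × 𝕜 × E => p (x.1, 0, x.2.2)) 0 :=
    hp.fun_comp_of_eq (by fun_prop) rfl
  have ht : Tendsto (fun x : 𝕜 × 𝕜 × E => (x.1, (0 : 𝕜), x.2.2)) (𝓝 0) (𝓝 0) :=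
    Continuous.tendsto' (by fun_prop) _ _ rfl
  have hz : ∀ᶠ x in 𝓝 (0 : 𝕜 × 𝕜 × E), p (x.1, 0, x.2.2) = 0 := by
    refine eventually_eq_zero_of_smul (y₀ := (0 : 𝕜 × E)) hd ?_
    filter_upwards [h2, ht.eventually hp1, ht.eventually h1] with x h2 h3 h4
    rw [h2, h4, zero_add] at h3
    exact h3.symm
  have hs : AnalyticAt 𝕜 (fun x : 𝕜 × 𝕜 × E => p (x.2.1, x.1, x.2.2)) 0 :=
    hp.fun_comp_of_eq (by fun_prop) rfl
  obtain ⟨q, hq, hq1⟩ := AnalyticAt.exists_eq_add_smul (y₀ := (0 : 𝕜 × E)) hs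
  have hsw : Tendsto (fun x : 𝕜 × 𝕜 × E => (x.2.1, x.1, x.2.2)) (𝓝 0) (𝓝 0) :=
    Continuous.tendsto' (by fun_prop) _ _ rfl
  refine ⟨fun x => q (x.2.1, x.1, x.2.2), hq.fun_comp_of_eq (by fun_prop) rfl, ?_⟩
  filter_upwards [hp1, h1, hz, hsw.eventually hq1] with x a1 a2 a3 a4
  have a1' : f x = f (0, x.2.1, x.2.2) + x.1 • p x := a1
  rw [a1', a2]
  have : p x = x.2.1 • q (x.2.1, x.1, x.2.2) := by
    have : p x = p (x.1, x.2.1, x.2.2) := rfl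
    rw [this, a4, a3, zero_add]
  rw [this]
  simp only [smul_eq_mul]
  ring

/-- Second order expansion in two of the variables. -/
lemma AnalyticAt.exists_second_order {f : 𝕜 × 𝕜 × E → 𝕜} [CompleteSpace 𝕜]
    (hf : AnalyticAt 𝕜 f 0) :
    ∃ (a b c d e k : E → 𝕜) (r₁ r₂ r₃ r₄ : 𝕜 × 𝕜 × E → 𝕜),
      (AnalyticAt 𝕜 a 0 ∧ AnalyticAt 𝕜 b 0 ∧ AnalyticAt 𝕜 c 0 ∧ AnalyticAt 𝕜 d 0 ∧
        AnalyticAt 𝕜 e 0 ∧ AnalyticAt 𝕜 k 0) ∧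
      (AnalyticAt 𝕜 r₁ 0 ∧ AnalyticAt 𝕜 r₂ 0 ∧ AnalyticAt 𝕜 r₃ 0 ∧ AnalyticAt 𝕜 r₄ 0) ∧
      (a = fun u => f (0, 0, u)) ∧
      ∀ᶠ x in 𝓝 0, f x = a x.2.2 + x.1 * b x.2.2 + x.2.1 * c x.2.2 + x.1 ^ 2 * d x.2.2
        + x.1 * x.2.1 * e x.2.2 + x.2.1 ^ 2 * k x.2.2
        + (x.1 ^ 3 * r₁ x + x.1 ^ 2 * x.2.1 * r₂ x + x.1 * x.2.1 ^ 2 * r₃ x + x.2.1 ^ 3 * r₄ x) := by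
  have hin : ∀ {g : 𝕜 × 𝕜 × E → 𝕜}, AnalyticAt 𝕜 g 0 → AnalyticAt 𝕜 (fun u : E => g (0, 0, u)) 0 :=
    fun hg => hg.fun_comp_of_eq (by fun_prop) rfl
  obtain ⟨p, q, hp, hq, h⟩ := hf.exists_hadamard_two
  obtain ⟨p1, p2, hp1, hp2, h1⟩ := hp.exists_hadamard_two
  obtain ⟨q1, q2, hq1, hq2, h2⟩ := hq.exists_hadamard_two
  obtain ⟨s1, s2, hs1, hs2, h3⟩ := hp1.exists_hadamard_two
  -- The product of the two variables arises from p and from q; the two contributions are merged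
  -- before being expanded further.
  obtain ⟨t1, t2, ht1, ht2, h4⟩ := (hp2.add hq1).exists_hadamard_two
  obtain ⟨v1, v2, hv1, hv2, h5⟩ := hq2.exists_hadamard_two
  refine ⟨fun u => f (0, 0, u), fun u => p (0, 0, u), fun u => q (0, 0, u), fun u => p1 (0, 0, u),
    fun u => (p2 + q1) (0, 0, u), fun u => q2 (0, 0, u), s1, s2 + t1, t2 + v1, v2,
    ⟨hin hf, hin hp, hin hq, hin hp1, hin (hp2.add hq1), hin hq2⟩,
    ⟨hs1, hs2.add ht1, ht2.add hv1, hv2⟩, rfl, ?_⟩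
  filter_upwards [h, h1, h2, h3, h4, h5] with x h h1 h2 h3 h4 h5
  have h4' : p2 x = (p2 + q1) (0, 0, x.2.2) + x.1 * t1 x + x.2.1 * t2 x - q1 x := by
    rw [← h4]; simp
  rw [h, h1, h2, h3, h4', h5]
  simp only [Pi.add_apply]
  ring

end Expansions

/-! ### Polarization and the 2-jet of the defining function -/

/-- A real-analytic function of `(z, u)` extends to a holomorphic function of `(z, z̄, u)`. -/
lemma AnalyticAt.exists_polarization {f : ℂ × ℝ → ℂ} (hf : AnalyticAt ℝ f 0) :
    ∃ g : ℂ × ℂ × ℂ → ℂ, AnalyticAt ℂ g 0 ∧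
      ∀ᶠ p in 𝓝 (0 : ℂ × ℝ), f p = g (p.1, conj p.1, p.2) := by
  have hc : AnalyticAt ℝ (fun x : Fin 3 → ℝ => ((x 0 : ℂ) + x 1 * Complex.I, x 2)) 0 := by
    have h : ∀ i : Fin 3, AnalyticAt ℝ (fun x : Fin 3 → ℝ => (x i : ℂ)) 0 := fun i =>
      (Complex.ofRealCLM.comp (ContinuousLinearMap.proj (R := ℝ) (φ := fun _ : Fin 3 => ℝ) i)).analyticAt _
    have h2 : AnalyticAt ℝ (fun x : Fin 3 → ℝ => x 2) 0 :=
      (ContinuousLinearMap.proj (R := ℝ) (φ := fun _ : Fin 3 => ℝ) 2).analyticAt _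
    exact ((h 0).add ((h 1).mul analyticAt_const)).prod h2
  have hf' := hf.fun_comp_of_eq hc (by simp)
  obtain ⟨g, hg, h⟩ := hf'.exists_complexification
  -- The real and imaginary parts of z, written in z and z̄, with z̄ replaced by an independent
  -- variable.
  refine ⟨fun p => g ![(p.1 + p.2.1) / 2, (p.1 - p.2.1) / (2 * Complex.I), p.2.2], ?_, ?_⟩
  · refine hg.fun_comp_of_eq ?_ ?_
    · refine AnalyticAt.pi fun i => ?_
      fin_cases i <;> simp <;> fun_prop (disch := simp)
    · ext i; fin_cases i <;> simp
  · have ht : Tendsto (fun p : ℂ × ℝ => (![p.1.re, p.1.im, p.2] : Fin 3 → ℝ)) (𝓝 0) (𝓝 0) := by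
      refine Continuous.tendsto' ?_ _ _ ?_
      · refine continuous_pi fun i => ?_
        fin_cases i <;> simp <;> fun_prop
      · ext i; fin_cases i <;> simp
    filter_upwards [ht.eventually h] with p hp
    have e1 : ((p.1.re : ℂ) + p.1.im * Complex.I, p.2) = p := by
      ext1 <;> simp
    simp only [Matrix.cons_val_zero, Matrix.cons_val_one, Matrix.cons_val] at hp
    rw [e1] at hp
    rw [hp]
    congr 1
    ext i
    fin_cases i
    · simp [Complex.re_eq_add_conj]
    · simp [Complex.im_eq_sub_conj]
    · simp

/-- A holomorphic function of `(z, ζ, u)` vanishing for `ζ = z̄` and real `u` vanishes. -/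
lemma AnalyticAt.eventually_eq_zero_of_polarized {H : ℂ × ℂ × ℂ → ℂ} (hH : AnalyticAt ℂ H 0)
    (h : ∀ᶠ p in 𝓝 (0 : ℂ × ℝ), H (p.1, conj p.1, p.2) = 0) : ∀ᶠ x in 𝓝 0, H x = 0 := by
  have hc : AnalyticAt ℂ (fun x : Fin 3 → ℂ => H (x 0 + x 1 * Complex.I,
      x 0 - x 1 * Complex.I, x 2)) 0 := by
    have h : ∀ i : Fin 3, AnalyticAt ℂ (fun x : Fin 3 → ℂ => x i) 0 := fun i =>
      (ContinuousLinearMap.proj (R := ℂ) (φ := fun _ : Fin 3 => ℂ) i).analyticAt _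
    refine hH.fun_comp_of_eq (f := fun x : Fin 3 → ℂ => (x 0 + x 1 * Complex.I,
      x 0 - x 1 * Complex.I, x 2)) ?_ ?_
    · exact ((h 0).add ((h 1).mul analyticAt_const)).prod
        (((h 0).sub ((h 1).mul analyticAt_const)).prod (h 2))
    · simp
  have h0 := hc.eventually_eq_zero_of_real ?_
  · have ht : Tendsto (fun p : ℂ × ℂ × ℂ => (![(p.1 + p.2.1) / 2, (p.1 - p.2.1) / (2 * Complex.I),
        p.2.2] : Fin 3 → ℂ)) (𝓝 0) (𝓝 0) := by
      refine Continuous.tendsto' ?_ _ _ ?_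
      · refine continuous_pi fun i => ?_
        fin_cases i <;> simp <;> fun_prop
      · ext i; fin_cases i <;> simp
    filter_upwards [ht.eventually h0] with x hx
    simp only [Matrix.cons_val_zero, Matrix.cons_val_one, Matrix.cons_val] at hx
    rw [← hx]
    congr 1
    have hI := Complex.I_ne_zero
    ext1
    · field_simp; ring
    · ext1
      · field_simp; ring
      · rfl
  · have ht : Tendsto (fun x : Fin 3 → ℝ => ((x 0 : ℂ) + x 1 * Complex.I, x 2)) (𝓝 0) (𝓝 0) :=
      Continuous.tendsto' (by fun_prop) _ _ (by simp)
    filter_upwards [ht.eventually h] with x hx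
    rw [← hx]
    simp [sub_eq_add_neg]


/-- A polynomial of degree less than `n` which is `O(tⁿ)` vanishes. -/
lemma coeff_eq_zero_of_isBigO {𝕜 F : Type*} [NontriviallyNormedField 𝕜] [NormedAddCommGroup F]
    [NormedSpace 𝕜 F] {n : ℕ} {a : ℕ → F}
    (h : (fun t : 𝕜 => ∑ k ∈ Finset.range n, t ^ k • a k) =O[𝓝[≠] 0] fun t => ‖t‖ ^ n) :
    ∀ k < n, a k = 0 := by
  induction n generalizing a with
  | zero => simp
  | succ n ih =>
    have h0 : a 0 = 0 := by
      have hc : ContinuousAt (fun t : 𝕜 => ∑ k ∈ Finset.range (n + 1), t ^ k • a k) 0 := by fun_prop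
      have hz : Tendsto (fun t : 𝕜 => ‖t‖ ^ (n + 1)) (𝓝[≠] 0) (𝓝 0) := by
        have : Tendsto (fun t : 𝕜 => ‖t‖ ^ (n + 1)) (𝓝 0) (𝓝 0) :=
          Continuous.tendsto' (by fun_prop) _ _ (by simp)
        exact this.mono_left nhdsWithin_le_nhds
      have := tendsto_nhds_unique (hc.tendsto.mono_left (nhdsWithin_le_nhds (s := {0}ᶜ)))
        (h.trans_tendsto hz)
      rw [Finset.sum_range_succ'] at this
      simpa using this
    have h1 : (fun t : 𝕜 => ∑ k ∈ Finset.range n, t ^ k • a (k + 1)) =O[𝓝[≠] 0]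
        fun t => ‖t‖ ^ n := by
      obtain ⟨C, hC⟩ := h.bound
      refine Asymptotics.IsBigO.of_bound C ?_
      filter_upwards [hC, self_mem_nhdsWithin] with t ht ht0
      have e : ∑ k ∈ Finset.range (n + 1), t ^ k • a k
          = t • ∑ k ∈ Finset.range n, t ^ k • a (k + 1) := by
        rw [Finset.sum_range_succ', h0, smul_zero, add_zero, Finset.smul_sum]
        simp only [smul_smul, ← pow_succ']
      rw [e, norm_smul, Real.norm_of_nonneg (by positivity), pow_succ] at ht
      rw [Real.norm_of_nonneg (by positivity)]
      have hpos : 0 < ‖t‖ := norm_pos_iff.2 ht0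
      refine le_of_mul_le_mul_left ?_ hpos
      linarith
    intro k hk
    cases k with
    | zero => exact h0
    | succ k => exact ih h1 k (by omega)

/-- `𝓕` is a holomorphic extension of the defining function `F` to a function of `(z, ζ, u)`. -/
structure IsPolarization (F : ℂ × ℝ → ℝ) (𝓕 : ℂ × ℂ × ℂ → ℂ) : Prop where
  analyticAt : AnalyticAt ℂ 𝓕 0
  eq : ∀ᶠ p in 𝓝 (0 : ℂ × ℝ), (F p : ℂ) = 𝓕 (p.1, conj p.1, p.2)
  symm : ∀ᶠ x in 𝓝 (0 : ℂ × ℂ × ℂ), conj (𝓕 (conj x.2.1, conj x.1, conj x.2.2)) = 𝓕 x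

lemma AnalyticAt.conj_conj_pi {f : ℂ × ℂ × ℂ → ℂ} (hf : AnalyticAt ℂ f 0) :
    AnalyticAt ℂ (fun x : ℂ × ℂ × ℂ => conj (f (conj x.2.1, conj x.1, conj x.2.2))) 0 := by
  have h1 : AnalyticAt ℂ (fun x : ℂ × ℂ × ℂ => star (f (star x))) 0 :=
    AnalyticAt.star_star (by simpa using hf)
  exact h1.fun_comp_of_eq (f := fun x : ℂ × ℂ × ℂ => (x.2.1, x.1, x.2.2)) (by fun_prop) rfl

lemma tendsto_polarized : Tendsto (fun p : ℂ × ℝ => (p.1, conj p.1, (p.2 : ℂ))) (𝓝 0) (𝓝 0) :=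
  Continuous.tendsto' (by fun_prop) _ _ (by simp)

lemma exists_isPolarization {F : ℂ × ℝ → ℝ} (hF : AnalyticAt ℝ F 0) :
    ∃ 𝓕, IsPolarization F 𝓕 := by
  have hF' : AnalyticAt ℝ (fun p => (F p : ℂ)) 0 := (Complex.ofRealCLM.analyticAt _).comp hF
  obtain ⟨g, hg, h⟩ := hF'.exists_polarization
  refine ⟨g, hg, h, ?_⟩
  have h1 := (hg.conj_conj_pi.sub hg).eventually_eq_zero_of_polarized ?_
  · filter_upwards [h1] with x hx
    exact sub_eq_zero.1 hx
  · filter_upwards [h] with p hp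
    simp [← hp]

section Jets

variable {F : ℂ × ℝ → ℝ} {𝓕 : ℂ × ℂ × ℂ → ℂ}

/-- The estimate O(3) is available at the points (z, z̄, u) with real u only, but these span enough
directions to determine the complex jet. The last conclusion, 𝓕_{zζ}(0) = 1, is the form in which
the Levi form is used. -/
lemma IsPolarization.jet (h : IsPolarization F 𝓕) (hF : IsLeviModelUpToOrderThree F) :
    𝓕 0 = 0 ∧ HasFDerivAt 𝓕 (0 : ℂ × ℂ × ℂ →L[ℂ] ℂ) 0 ∧
      HasDerivAt (fun z : ℂ => fderiv ℂ 𝓕 (z, 0, 0) (0, 1, 0)) 1 0 := by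
  set 𝓔 : ℂ × ℂ × ℂ → ℂ := fun x => 𝓕 x - x.1 * x.2.1 with h𝓔
  have hE : AnalyticAt ℂ 𝓔 0 := h.analyticAt.sub (by fun_prop)
  have hb : (fun p : ℂ × ℝ => 𝓔 (p.1, conj p.1, p.2)) =O[𝓝 0] fun p => ‖p‖ ^ 3 := by
    refine Asymptotics.IsBigO.congr' ((Complex.ofRealCLM.isBigO_comp _ _).trans hF.2) ?_ .rfl
    filter_upwards [h.eq] with p hp
    simp [h𝓔, ← hp, Complex.mul_conj, Complex.normSq_eq_norm_sq]
  have hE0 : 𝓔 0 = 0 := by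
    have := hb.eq_zero_imp.self_of_nhds (by simp)
    have e : (((0 : ℂ × ℝ).1, conj (0 : ℂ × ℝ).1, ((0 : ℂ × ℝ).2 : ℂ)) : ℂ × ℂ × ℂ) = 0 := by simp
    rwa [e] at this
  -- first derivative
  have hE1 : fderiv ℂ 𝓔 0 = 0 := by
    set L := fderiv ℂ 𝓔 0 with hL
    have hd : HasFDerivAt 𝓔 L 0 := hE.differentiableAt.hasFDerivAt
    have hdir : ∀ (c : ℂ) (s : ℝ), L (c, conj c, s) = 0 := by
      intro c s
      have hl : HasDerivAt (fun t : ℝ => ((t : ℂ) * c, (t : ℂ) * conj c, (t : ℂ) * s))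
          (c, conj c, (s : ℂ)) 0 := by
        have h1 : ∀ c : ℂ, HasDerivAt (fun t : ℝ => (t : ℂ) * c) c 0 := fun c => by
          simpa using (Complex.ofRealCLM.hasDerivAt (x := (0 : ℝ))).mul_const c
        exact (h1 c).prodMk ((h1 _).prodMk (h1 _))
      have h2 : HasDerivAt (fun t : ℝ => 𝓔 ((t : ℂ) * c, (t : ℂ) * conj c, (t : ℂ) * s))
          (L (c, conj c, s)) 0 := by
        have : HasFDerivAt 𝓔 (L.restrictScalars ℝ)
          (((0 : ℝ) : ℂ) * c, ((0 : ℝ) : ℂ) * conj c, ((0 : ℝ) : ℂ) * s) := by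
          have e : ((((0 : ℝ) : ℂ) * c, ((0 : ℝ) : ℂ) * conj c, ((0 : ℝ) : ℂ) * s) : ℂ × ℂ × ℂ)
            = 0 := by simp
          rw [e]
          exact hd.restrictScalars ℝ
        exact this.comp_hasDerivAt (0 : ℝ) hl
      have h3 : HasDerivAt (fun t : ℝ => 𝓔 ((t : ℂ) * c, (t : ℂ) * conj c, (t : ℂ) * s)) 0 0 := by
        have ht : Tendsto (fun t : ℝ => ((t : ℂ) * c, t * s)) (𝓝 0) (𝓝 0) :=
          Continuous.tendsto' (by fun_prop) _ _ (by simp)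
        have h4 := hb.comp_tendsto ht
        have h5 : (fun t : ℝ => 𝓔 ((t : ℂ) * c, (t : ℂ) * conj c, (t : ℂ) * s)) =O[𝓝 0]
            fun t : ℝ => ‖t - 0‖ ^ 3 := by
          refine (h4.congr_left ?_).trans ?_
          · intro t; simp
          · refine Asymptotics.IsBigO.of_bound (‖(c, s)‖ ^ 3) (Eventually.of_forall fun t => ?_)
            have : ((t : ℂ) * c, t * s) = t • (c, s) := by simp
            simp only [Function.comp, this, norm_smul, mul_pow, sub_zero, norm_pow, norm_norm,
              norm_mul]
            linarith [mul_comm (‖t‖ ^ 3) (‖(c, s)‖ ^ 3)]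
        have h6 := Asymptotics.IsBigO.hasFDerivAt (𝕜 := ℝ) h5 (by norm_num)
        simpa using h6.hasDerivAt
      exact h2.unique h3
    -- The real directions (1, 1, 0), (i, -i, 0) and (0, 0, 1) form a complex basis.
    have e1 := hdir 1 0
    have e2 := hdir Complex.I 0
    have e3 := hdir 0 1
    simp only [map_one, Complex.ofReal_zero, Complex.conj_I, map_zero, Complex.ofReal_one] at e1 e2 e3
    have key : ∀ p : ℂ × ℂ × ℂ, p = ((p.1 + p.2.1) / 2) • ((1 : ℂ), (1 : ℂ), (0 : ℂ))
        + ((p.1 - p.2.1) / (2 * Complex.I)) • (Complex.I, -Complex.I, (0 : ℂ))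
        + p.2.2 • ((0 : ℂ), (0 : ℂ), (1 : ℂ)) := by
      intro p
      have hI := Complex.I_ne_zero
      ext1
      · simp; field_simp; ring
      · ext1
        · simp; field_simp; ring
        · simp
    refine ContinuousLinearMap.ext fun p => ?_
    rw [key p]
    simp only [map_add, map_smul, e1, e2, e3]
    simp
  obtain ⟨a, b, c, d, e, k, r₁, r₂, r₃, r₄, -, ⟨hr₁, hr₂, hr₃, hr₄⟩, -, hx⟩ :=
    hE.exists_second_order
  -- On the real line t ↦ (t w, t w̄, 0) the expansion is a quadratic polynomial in t up to O(t³),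
  -- and the whole is O(t³), so its coefficients vanish. Taking w = 1 and w = i afterwards isolates
  -- the coefficients of ζ and zζ.
  have hdir : ∀ w : ℂ, c 0 * conj w + b 0 * w = 0 ∧
      d 0 * w ^ 2 + e 0 * w * conj w + k 0 * conj w ^ 2 = 0 := by
    intro w
    set A : ℕ → ℂ := ![a 0, c 0 * conj w + b 0 * w,
      d 0 * w ^ 2 + e 0 * w * conj w + k 0 * conj w ^ 2, 0, 0, 0] ∘ Fin.ofNat 6 with hA
    have ht : Tendsto (fun t : ℝ => ((t : ℂ) * w, (0 : ℝ))) (𝓝 0) (𝓝 0) :=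
      Continuous.tendsto' (by fun_prop) _ _ (by simp)
    set G : ℂ × ℂ × ℂ → ℂ := fun x => w ^ 3 * r₁ x + w ^ 2 * conj w * r₂ x
      + w * conj w ^ 2 * r₃ x + conj w ^ 3 * r₄ x with hG
    have hGc : ContinuousAt G 0 := by
      have := hr₁.continuousAt; have := hr₂.continuousAt
      have := hr₃.continuousAt; have := hr₄.continuousAt
      fun_prop
    have hline : Tendsto (fun t : ℝ => ((t : ℂ) * w, conj ((t : ℂ) * w), ((0 : ℝ) : ℂ)))
        (𝓝 0) (𝓝 0) := tendsto_polarized.comp ht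
    have hG1 : (fun t : ℝ => (t : ℂ) ^ 3 * G ((t : ℂ) * w, conj ((t : ℂ) * w), ((0 : ℝ) : ℂ)))
        =O[𝓝 0] fun t : ℝ => ‖t‖ ^ 3 := by
      have h1 := (hGc.tendsto.comp hline).isBigO_one ℝ
      have h2 : (fun t : ℝ => (t : ℂ) ^ 3) =O[𝓝 0] fun t : ℝ => ‖t‖ ^ 3 :=
        Asymptotics.IsBigO.of_bound 1 (by simp)
      simpa using h2.mul h1
    have hb1 : (fun t : ℝ => 𝓔 ((t : ℂ) * w, conj ((t : ℂ) * w), ((0 : ℝ) : ℂ)))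
        =O[𝓝 0] fun t : ℝ => ‖t‖ ^ 3 := by
      refine (hb.comp_tendsto ht).trans (Asymptotics.IsBigO.of_bound (‖(w, (0 : ℝ))‖ ^ 3)
        (Eventually.of_forall fun t => ?_))
      have : ((t : ℂ) * w, (0 : ℝ)) = t • (w, 0) := by simp
      simp only [Function.comp, this, norm_smul, mul_pow, norm_pow, norm_norm, norm_mul]
      linarith [mul_comm (‖t‖ ^ 3) (‖(w, (0 : ℝ))‖ ^ 3)]
    have hpoly := coeff_eq_zero_of_isBigO (𝕜 := ℝ) (n := 3) (a := A) ?_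
    · have h1 := hpoly 1 (by norm_num)
      have h2 := hpoly 2 (by norm_num)
      simp only [hA, Function.comp] at h1 h2
      exact ⟨h1, h2⟩
    · refine Asymptotics.IsBigO.mono ?_ (nhdsWithin_le_nhds (s := {0}ᶜ))
      refine (hb1.sub hG1).congr' ?_ .rfl
      filter_upwards [hline.eventually hx] with t ht
      simp only [Complex.ofReal_zero] at ht ⊢
      rw [ht]
      simp only [Finset.sum_range_succ, Finset.range_zero, Finset.sum_empty, hA, Function.comp, hG,
        map_mul, Complex.conj_ofReal, Complex.real_smul]
      simp [Fin.ofNat]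
      ring
  have hc0 : c 0 = 0 := by
    have h1 := (hdir 1).1
    have h2 := (hdir Complex.I).1
    simp only [map_one, mul_one, Complex.conj_I] at h1 h2
    have hI := Complex.I_ne_zero
    have h3 : (c 0 - b 0) * Complex.I = 0 := by linear_combination -h2
    have h4 := (mul_eq_zero.1 h3).resolve_right hI
    linear_combination (h1 + h4) / 2
  have he0 : e 0 = 0 := by
    have h1 := (hdir 1).2
    have h2 := (hdir Complex.I).2
    simp only [map_one, mul_one, one_pow, Complex.conj_I] at h1 h2
    have hI := Complex.I_mul_I
    linear_combination (h1 + h2) / 2 - (d 0 - e 0 + k 0) / 2 * hI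
  have hF𝓔 : 𝓕 = fun x => 𝓔 x + x.1 * x.2.1 := by ext1 x; simp [h𝓔]
  refine ⟨?_, ?_, ?_⟩
  · rw [hF𝓔]; simp [hE0]
  · have h1 : HasFDerivAt 𝓔 (0 : ℂ × ℂ × ℂ →L[ℂ] ℂ) 0 := hE1 ▸ hE.differentiableAt.hasFDerivAt
    have h2 : HasFDerivAt (fun x : ℂ × ℂ × ℂ => x.1 * x.2.1) (0 : ℂ × ℂ × ℂ →L[ℂ] ℂ) 0 := by
      have h3 := (hasFDerivAt_fst (𝕜 := ℂ) (p := (0 : ℂ × ℂ × ℂ))).mul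
        ((hasFDerivAt_fst (𝕜 := ℂ) (p := (0 : ℂ × ℂ))).comp (0 : ℂ × ℂ × ℂ) hasFDerivAt_snd)
      exact h3.congr_fderiv (ContinuousLinearMap.ext fun p => by simp)
    rw [hF𝓔]
    exact (h1.add h2).congr_fderiv (by simp)
  · have hin : Tendsto (fun z : ℂ => (z, (0 : ℂ), (0 : ℂ))) (𝓝 0) (𝓝 0) :=
      Continuous.tendsto' (by fun_prop) _ _ rfl
    set P : ℂ → ℂ := fun z => r₂ (z, 0, 0) + z * fderiv ℂ r₁ (z, 0, 0) (0, 1, 0) with hP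
    have hPd : DifferentiableAt ℂ P 0 := by
      have i0 : AnalyticAt ℂ (fun z : ℂ => (z, (0 : ℂ), (0 : ℂ))) 0 := by fun_prop
      have i1 : AnalyticAt ℂ (fun z : ℂ => r₂ (z, 0, 0)) 0 := hr₂.fun_comp_of_eq i0 rfl
      have i2 : AnalyticAt ℂ (fun z : ℂ => fderiv ℂ r₁ (z, 0, 0)) 0 :=
        hr₁.fderiv.fun_comp_of_eq i0 rfl
      have i3 : AnalyticAt ℂ (fun z : ℂ => fderiv ℂ r₁ (z, 0, 0) (0, 1, 0)) 0 :=
        ((ContinuousLinearMap.apply ℂ ℂ ((0 : ℂ), (1 : ℂ), (0 : ℂ))).analyticAt _).comp i2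
      exact (i1.add (analyticAt_id.mul i3)).differentiableAt
    -- Only the terms linear in ζ contribute. Of these, the constant coefficient and that of zζ in 𝓔
    -- vanish by the previous steps, which leaves z plus a multiple of z².
    have hev : (fun z : ℂ => fderiv ℂ 𝓕 (z, 0, 0) (0, 1, 0)) =ᶠ[𝓝 0] fun z => z + z ^ 2 * P z := by
      filter_upwards [hin.eventually hx.eventually_nhds, hin.eventually h.analyticAt.eventually_analyticAt,
        hin.eventually hr₁.eventually_analyticAt, hin.eventually hr₂.eventually_analyticAt,
        hin.eventually hr₃.eventually_analyticAt, hin.eventually hr₄.eventually_analyticAt]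
        with z hz hz𝓕 hz₁ hz₂ hz₃ hz₄
      have hl : HasDerivAt (fun ζ : ℂ => (z, ζ, (0 : ℂ))) ((0 : ℂ), (1 : ℂ), (0 : ℂ)) 0 :=
        (hasDerivAt_const _ _).prodMk ((hasDerivAt_id _).prodMk (hasDerivAt_const _ _))
      have dl : ∀ {g : ℂ × ℂ × ℂ → ℂ}, AnalyticAt ℂ g (z, 0, 0) →
          HasDerivAt (fun ζ : ℂ => g (z, ζ, 0)) (fderiv ℂ g (z, 0, 0) (0, 1, 0)) 0 := fun hg =>
        hg.differentiableAt.hasFDerivAt.comp_hasDerivAt (0 : ℂ) hl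
      have d0 := dl hz𝓕
      have hlt : Tendsto (fun ζ : ℂ => (z, ζ, (0 : ℂ))) (𝓝 0) (𝓝 (z, 0, 0)) :=
        Continuous.tendsto' (by fun_prop) _ _ rfl
      have hζ := hasDerivAt_id (𝕜 := ℂ) (0 : ℂ)
      have hζ2 := hζ.pow 2
      have hζ3 := hζ.pow 3
      have d1 := ((((hζ.const_mul (z + c 0 + z * e 0)).add (hζ2.mul_const (k 0))).add
        ((dl hz₁).const_mul (z ^ 3))).add ((hζ.const_mul (z ^ 2)).mul (dl hz₂))).add
        ((hζ2.const_mul z).mul (dl hz₃)) |>.add (hζ3.mul (dl hz₄)) |>.const_add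
          (a 0 + z * b 0 + z ^ 2 * d 0)
      refine d0.unique (HasDerivAt.congr_of_eventuallyEq (d1.congr_deriv ?_) ?_)
      · simp [hc0, he0, hP]; ring
      · filter_upwards [hlt.eventually hz] with ζ hζ
        have : 𝓔 (z, ζ, 0) = 𝓕 (z, ζ, 0) - z * ζ := rfl
        rw [this] at hζ
        simp only [Pi.add_apply, Pi.mul_apply, Pi.pow_apply, id]
        linear_combination hζ
    refine HasDerivAt.congr_of_eventuallyEq ?_ hev
    have := (hasDerivAt_id (𝕜 := ℂ) (0 : ℂ)).add
      (((hasDerivAt_id (𝕜 := ℂ) (0 : ℂ)).pow 2).mul hPd.hasDerivAt)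
    exact this.congr_deriv (by simp)

end Jets


/-! ### Segre functions of a hypersurface -/

lemma AnalyticAt.fderiv_apply {𝕜 E F : Type*} [NontriviallyNormedField 𝕜] [NormedAddCommGroup E]
    [NormedSpace 𝕜 E] [NormedAddCommGroup F] [NormedSpace 𝕜 F] [CompleteSpace F] {f : E → F} {x : E}
    (hf : AnalyticAt 𝕜 f x) (v : E) : AnalyticAt 𝕜 (fun p => fderiv 𝕜 f p v) x :=
  ((ContinuousLinearMap.apply 𝕜 F v).analyticAt _).comp hf.fderiv

/-- `Θ` defines a family of Segre varieties `{x | ω = Θ (ζ, x)}` which is invariant under the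
conjugation that exchanges `x` and `(ζ, ω)`. -/
structure IsSegreFunction (Θ : ℂ × ℂ × ℂ → ℂ) : Prop where
  analyticAt : AnalyticAt ℂ Θ 0
  zero : Θ 0 = 0
  hasFDerivAt : HasFDerivAt Θ
    ((ContinuousLinearMap.snd ℂ ℂ ℂ).comp (ContinuousLinearMap.snd ℂ ℂ (ℂ × ℂ))) 0
  symm : ∀ᶠ q in 𝓝 (0 : (ℂ × ℂ) × ℂ × ℂ),
    q.2.2 = Θ (q.2.1, q.1) ↔ (star q.1).2 = Θ ((star q.1).1, star q.2)

/-- The real points of the Segre family of `Θ` are the hypersurface `v = F`. -/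
def IsSegreFunctionOf (F : ℂ × ℝ → ℝ) (Θ : ℂ × ℂ × ℂ → ℂ) : Prop :=
  ∀ᶠ p in 𝓝 (0 : ℂ × ℂ), p ∈ graphHypersurface F ↔ (star p).2 = Θ ((star p).1, p)

/-- The equation `ω = Θ (ζ, (z, w))` is equivalent to `(w - ω) / 2i = 𝓕 (z, ζ, (w + ω) / 2)`. -/
def SolvesFor (𝓕 Θ : ℂ × ℂ × ℂ → ℂ) : Prop :=
  ∀ᶠ q in 𝓝 (0 : (ℂ × ℂ) × ℂ × ℂ),
    (q.1.2 - q.2.2) / (2 * Complex.I) = 𝓕 (q.1.1, q.2.1, (q.1.2 + q.2.2) / 2) ↔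
      q.2.2 = Θ (q.2.1, q.1)

/-- Since 𝓕 has zero differential at 0, the equation (w - ω) / 2i = 𝓕(z, ζ, (w + ω) / 2) has
ω-derivative -1 / 2i at 0, and the implicit function theorem solves it for ω. -/
lemma exists_segreFunction {𝓕 : ℂ × ℂ × ℂ → ℂ} (h : AnalyticAt ℂ 𝓕 0) (h0 : 𝓕 0 = 0)
    (h1 : HasFDerivAt 𝓕 (0 : ℂ × ℂ × ℂ →L[ℂ] ℂ) 0) :
    ∃ Θ : ℂ × ℂ × ℂ → ℂ, AnalyticAt ℂ Θ 0 ∧ Θ 0 = 0 ∧ SolvesFor 𝓕 Θ := by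
  set G : (ℂ × ℂ × ℂ) × ℂ → ℂ := fun p =>
    (p.1.2.2 - p.2) / (2 * Complex.I) - 𝓕 (p.1.2.1, p.1.1, (p.1.2.2 + p.2) / 2) with hG
  have hGa : AnalyticAt ℂ G ((0 : ℂ × ℂ × ℂ), (0 : ℂ)) := by
    have : AnalyticAt ℂ (fun p : (ℂ × ℂ × ℂ) × ℂ => 𝓕 (p.1.2.1, p.1.1, (p.1.2.2 + p.2) / 2))
        ((0 : ℂ × ℂ × ℂ), (0 : ℂ)) :=
      h.fun_comp_of_eq (by fun_prop (disch := norm_num)) (by simp)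
    refine AnalyticAt.fun_sub ?_ this
    fun_prop (disch := simp)
  have hGd : HasFDerivAt (fun y : ℂ => G ((0 : ℂ × ℂ × ℂ), y))
      (ContinuousLinearMap.toSpanSingleton ℂ (-1 / (2 * Complex.I))) 0 := by
    have a1 : HasDerivAt (fun y : ℂ => ((0 : ℂ), (0 : ℂ), (0 + y) / 2)) (0, 0, 1 / 2) 0 :=
      (hasDerivAt_const _ _).prodMk ((hasDerivAt_const _ _).prodMk
        (((hasDerivAt_id (0 : ℂ)).const_add 0).div_const 2))
    have h1' : HasFDerivAt 𝓕 (0 : ℂ × ℂ × ℂ →L[ℂ] ℂ) ((0 : ℂ), (0 : ℂ), (0 + (0 : ℂ)) / 2) := by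
      have e : (((0 : ℂ), (0 : ℂ), (0 + (0 : ℂ)) / 2) : ℂ × ℂ × ℂ) = 0 := by simp
      rw [e]; exact h1
    have a2 := h1'.comp_hasDerivAt (0 : ℂ) a1
    have a3 := (((hasDerivAt_id (0 : ℂ)).const_sub 0).div_const (2 * Complex.I)).sub a2
    have a4 : HasDerivAt (fun y : ℂ => G ((0 : ℂ × ℂ × ℂ), y)) (-1 / (2 * Complex.I)) 0 :=
      a3.congr_deriv (by simp)
    exact a4.hasFDerivAt
  obtain ⟨Θ, ha, hz, hΘ⟩ := hGa.exists_implicitFunction (by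
    have : 𝓕 (0, 0, 0) = 0 := h0
    simp [hG, this]) hGd (by
    intro y hy
    simpa using hy)
  refine ⟨Θ, ha, hz, ?_⟩
  have ht : Tendsto (fun q : (ℂ × ℂ) × ℂ × ℂ => ((q.2.1, q.1), q.2.2)) (𝓝 0)
      (𝓝 ((0 : ℂ × ℂ × ℂ), (0 : ℂ))) := Continuous.tendsto' (by fun_prop) _ _ rfl
  filter_upwards [ht.eventually hΘ] with q hq
  rw [eq_comm (a := q.2.2), ← hq, hG, sub_eq_zero]

/-- Setting ζ = z̄ and ω = w̄ makes (w + ω) / 2 = u and (w - ω) / 2i = v, which recovers the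
hypersurface. The symmetry of Θ is the reality of F: the polarized equation is carried to its
conjugate when (z, w) and (ζ, ω) are exchanged. -/
lemma IsPolarization.isSegreFunctionOf_and_symm {F : ℂ × ℝ → ℝ} {𝓕 Θ : ℂ × ℂ × ℂ → ℂ}
    (hF : IsPolarization F 𝓕) (h : SolvesFor 𝓕 Θ) :
    IsSegreFunctionOf F Θ ∧ ∀ᶠ q in 𝓝 (0 : (ℂ × ℂ) × ℂ × ℂ),
      q.2.2 = Θ (q.2.1, q.1) ↔ (star q.1).2 = Θ ((star q.1).1, star q.2) := by
  constructor
  · have ht : Tendsto (fun p : ℂ × ℂ => (p, star p)) (𝓝 0) (𝓝 0) :=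
      Continuous.tendsto' (by fun_prop) _ _ (by simp)
    have ht2 : Tendsto (fun p : ℂ × ℂ => (p.1, p.2.re)) (𝓝 0) (𝓝 0) :=
      Continuous.tendsto' (by fun_prop) _ _ rfl
    filter_upwards [ht.eventually h, ht2.eventually hF.eq] with p hp hp2
    rw [← hp]
    have e1 : (p.2 + (star p).2) / 2 = p.2.re := by
      rw [Complex.re_eq_add_conj]; rfl
    have e2 : (p.2 - (star p).2) / (2 * Complex.I) = p.2.im := by
      rw [Complex.im_eq_sub_conj]; rfl
    have e3 : (star p).1 = conj p.1 := rfl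
    simp only [e1, e2, e3]
    rw [← hp2, graphHypersurface, Set.mem_ofPred_eq]
    norm_cast
  · have ht : Tendsto (fun q : (ℂ × ℂ) × ℂ × ℂ => (star q.2, star q.1)) (𝓝 0) (𝓝 0) :=
      Continuous.tendsto' (by fun_prop) _ _ (by simp)
    have ht2 : Tendsto (fun q : (ℂ × ℂ) × ℂ × ℂ => (q.1.1, q.2.1, (q.1.2 + q.2.2) / 2))
      (𝓝 0) (𝓝 0) := Continuous.tendsto' (by fun_prop) _ _ (by simp)
    filter_upwards [h, ht.eventually h, ht2.eventually hF.symm] with q h1 h2 h3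
    rw [← h1, ← h2, ← h3]
    rw [← (starRingEnd ℂ).injective.eq_iff]
    have e1 : ((star q.2).2 + (star q.1).2) / 2 = conj ((q.1.2 + q.2.2) / 2) := by
      simp only [Prod.snd_star, Complex.star_def, map_div₀, map_add]
      rw [Complex.conj_ofNat, add_comm]
    have e2 : ((star q.2).2 - (star q.1).2) / (2 * Complex.I)
        = conj ((q.1.2 - q.2.2) / (2 * Complex.I)) := by
      simp only [Prod.snd_star, Complex.star_def, map_div₀, map_sub, map_mul, Complex.conj_I]
      rw [Complex.conj_ofNat]
      have hI := Complex.I_ne_zero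
      field_simp
      ring
    have e3 : (star q.1).1 = conj q.1.1 := rfl
    have e4 : (star q.2).1 = conj q.2.1 := rfl
    simp only [e1, e2, e3, e4, Complex.conj_conj]

/-- The `2`-jet of the Segre function of a hypersurface `v = z z̄ + O(3)`. -/
lemma segreFunction_jet {𝓕 Θ : ℂ × ℂ × ℂ → ℂ} (h𝓕 : AnalyticAt ℂ 𝓕 0)
    (h1 : HasFDerivAt 𝓕 (0 : ℂ × ℂ × ℂ →L[ℂ] ℂ) 0)
    (h2 : HasDerivAt (fun z : ℂ => fderiv ℂ 𝓕 (z, 0, 0) (0, 1, 0)) 1 0)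
    (hΘ : AnalyticAt ℂ Θ 0) (hΘ0 : Θ 0 = 0)
    (h : SolvesFor 𝓕 Θ) :
    HasFDerivAt Θ ((ContinuousLinearMap.snd ℂ ℂ ℂ).comp (ContinuousLinearMap.snd ℂ ℂ (ℂ × ℂ))) 0 ∧
      HasDerivAt (fun z : ℂ => fderiv ℂ Θ (0, z, 0) (1, 0, 0)) (-2 * Complex.I) 0 := by
  have hI := Complex.I_ne_zero
  set m : ℂ × ℂ × ℂ → ℂ × ℂ × ℂ := fun p => (p.2.1, p.1, (p.2.2 + Θ p) / 2) with hm
  have hma : AnalyticAt ℂ m 0 := by fun_prop (disch := norm_num)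
  have hm0 : m 0 = 0 := by simp [hm, hΘ0]
  -- Θ = w - 2i 𝓕(z, ζ, (w + Θ) / 2) is differentiated implicitly, once for the differential and
  -- once in ζ and then in z for the mixed derivative. The factor 𝓕_u vanishes at 0, as does Θ_ζ, so
  -- only 𝓕_{zζ}(0) = 1 survives, multiplied by -2i.
  have hfix : ∀ᶠ p in 𝓝 (0 : ℂ × ℂ × ℂ), Θ p = p.2.2 - 2 * Complex.I * 𝓕 (m p) := by
    have ht : Tendsto (fun p : ℂ × ℂ × ℂ => ((p.2, (p.1, Θ p)) : (ℂ × ℂ) × ℂ × ℂ)) (𝓝 0) (𝓝 0) := by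
      have : ContinuousAt (fun p : ℂ × ℂ × ℂ => ((p.2, (p.1, Θ p)) : (ℂ × ℂ) × ℂ × ℂ)) 0 := by
        have := hΘ.continuousAt
        fun_prop
      refine this.tendsto.trans (le_of_eq ?_)
      simp [hΘ0]
    filter_upwards [ht.eventually h] with p hp
    have h3 := hp.2 rfl
    rw [← h3]
    field_simp
    ring
  have hd0 : HasFDerivAt Θ ((ContinuousLinearMap.snd ℂ ℂ ℂ).comp
      (ContinuousLinearMap.snd ℂ ℂ (ℂ × ℂ))) 0 := by
    have h1' : HasFDerivAt 𝓕 (0 : ℂ × ℂ × ℂ →L[ℂ] ℂ) (m 0) := by rw [hm0]; exact h1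
    have a := h1'.comp (0 : ℂ × ℂ × ℂ) hma.differentiableAt.hasFDerivAt
    have b : HasFDerivAt (fun p : ℂ × ℂ × ℂ => p.2.2) ((ContinuousLinearMap.snd ℂ ℂ ℂ).comp
      (ContinuousLinearMap.snd ℂ ℂ (ℂ × ℂ))) 0 :=
      ((ContinuousLinearMap.snd ℂ ℂ ℂ).comp (ContinuousLinearMap.snd ℂ ℂ (ℂ × ℂ))).hasFDerivAt
    have c := b.sub (a.const_mul (2 * Complex.I))
    refine HasFDerivAt.congr_of_eventuallyEq (c.congr_fderiv ?_) hfix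
    exact ContinuousLinearMap.ext fun p => by simp
  refine ⟨hd0, ?_⟩
  set θ : ℂ → ℂ := fun z => fderiv ℂ Θ (0, z, 0) (1, 0, 0) with hθ
  have hin : AnalyticAt ℂ (fun z : ℂ => ((0 : ℂ), z, (0 : ℂ))) 0 := by fun_prop
  have hint : Tendsto (fun z : ℂ => ((0 : ℂ), z, (0 : ℂ))) (𝓝 0) (𝓝 0) :=
    Continuous.tendsto' (by fun_prop) _ _ rfl
  have hθa : AnalyticAt ℂ θ 0 := (hΘ.fderiv_apply (1, 0, 0)).fun_comp_of_eq hin rfl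
  have hθ0 : θ 0 = 0 := by
    have e : (((0 : ℂ), (0 : ℂ), (0 : ℂ)) : ℂ × ℂ × ℂ) = 0 := rfl
    simp only [hθ, e, hd0.fderiv]
    simp
  set G : ℂ × ℂ × ℂ → ℂ := fun p => fderiv ℂ 𝓕 p (0, 1, 0) with hG
  set H : ℂ × ℂ × ℂ → ℂ := fun p => fderiv ℂ 𝓕 p (0, 0, 1) with hH
  have hGa : AnalyticAt ℂ G 0 := h𝓕.fderiv_apply _
  have hHa : AnalyticAt ℂ H 0 := h𝓕.fderiv_apply _
  have hH0 : H 0 = 0 := by simp [hH, h1.fderiv]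
  have hG1 : fderiv ℂ G 0 (1, 0, 0) = 1 := by
    have a : HasDerivAt (fun z : ℂ => (z, (0 : ℂ), (0 : ℂ))) (1, 0, 0) 0 :=
      (hasDerivAt_id _).prodMk (hasDerivAt_const _ _)
    have b := (hGa.differentiableAt.hasFDerivAt (x := (0 : ℂ × ℂ × ℂ))).comp_hasDerivAt_of_eq
      (0 : ℂ) a rfl
    exact b.unique h2
  have hev : ∀ᶠ z in 𝓝 (0 : ℂ), θ z = -2 * Complex.I * (G (m (0, z, 0)) + H (m (0, z, 0)) * θ z / 2) := by
    have hmt : Tendsto m (𝓝 0) (𝓝 0) := by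
      have := hma.continuousAt.tendsto; rwa [hm0] at this
    filter_upwards [hint.eventually hfix.eventually_nhds, hint.eventually hΘ.eventually_analyticAt,
      hint.eventually (hmt.eventually h𝓕.eventually_analyticAt)] with z a1 a2 a3
    have l : HasDerivAt (fun ζ : ℂ => (ζ, z, (0 : ℂ))) (1, 0, 0) 0 :=
      (hasDerivAt_id _).prodMk (hasDerivAt_const _ _)
    have b1 : HasDerivAt (fun ζ : ℂ => Θ (ζ, z, 0)) (θ z) 0 :=
      a2.differentiableAt.hasFDerivAt.comp_hasDerivAt (0 : ℂ) l
    have b2 : HasDerivAt (fun ζ : ℂ => m (ζ, z, 0)) (0, 1, θ z / 2) 0 :=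
      (hasDerivAt_const _ _).prodMk ((hasDerivAt_id _).prodMk ((b1.const_add 0).div_const 2))
    have b3 := (a3.differentiableAt.hasFDerivAt.comp_hasDerivAt (0 : ℂ) b2).const_mul (2 * Complex.I)
      |>.const_sub 0
    have hlt : Tendsto (fun ζ : ℂ => (ζ, z, (0 : ℂ))) (𝓝 0) (𝓝 (0, z, 0)) :=
      Continuous.tendsto' (by fun_prop) _ _ rfl
    have b4 := b1.unique (b3.congr_of_eventuallyEq (hlt.eventually a1))
    have e : (((0 : ℂ), (1 : ℂ), θ z / 2) : ℂ × ℂ × ℂ) = (0, 1, 0) + (θ z / 2) • (0, 0, 1) := by simp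
    rw [e, map_add, map_smul] at b4
    simp only [hG, hH, smul_eq_mul] at b4 ⊢
    linear_combination b4
  have c1 : HasDerivAt (fun z : ℂ => m (0, z, 0)) (1, 0, 0) 0 := by
    have a : HasDerivAt (fun z : ℂ => ((0 : ℂ), z, (0 : ℂ))) (0, 1, 0) 0 :=
      (hasDerivAt_const _ _).prodMk ((hasDerivAt_id _).prodMk (hasDerivAt_const _ _))
    have b := (hd0 : HasFDerivAt Θ _ ((0 : ℂ), (0 : ℂ), (0 : ℂ))).comp_hasDerivAt (0 : ℂ) a
    exact ((hasDerivAt_id _).prodMk ((hasDerivAt_const _ _).prodMk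
      ((b.const_add 0).div_const 2))).congr_deriv (by simp)
  have c2 : HasDerivAt (fun z : ℂ => G (m (0, z, 0))) 1 0 :=
    (hGa.differentiableAt.hasFDerivAt.comp_hasDerivAt_of_eq (0 : ℂ) c1 hm0.symm).congr_deriv hG1
  have c3 := hHa.differentiableAt.hasFDerivAt.comp_hasDerivAt_of_eq (0 : ℂ) c1 hm0.symm
  have c4 := hθa.differentiableAt.hasDerivAt
  have c5 := (c2.add ((c3.mul c4).div_const 2)).const_mul (-2 * Complex.I)
  refine (c5.congr_deriv ?_).congr_of_eventuallyEq hev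
  have e : m (0, 0, 0) = 0 := hm0
  simp [hθ0, e, hH0]

theorem exists_isSegreFunction {F : ℂ × ℝ → ℝ} (hF : IsLeviModelUpToOrderThree F) :
    ∃ 𝓕 Θ : ℂ × ℂ × ℂ → ℂ, IsPolarization F 𝓕 ∧ IsSegreFunction Θ ∧ IsSegreFunctionOf F Θ ∧
      SolvesFor 𝓕 Θ ∧ HasFDerivAt 𝓕 (0 : ℂ × ℂ × ℂ →L[ℂ] ℂ) 0 ∧
      HasDerivAt (fun z : ℂ => fderiv ℂ Θ (0, z, 0) (1, 0, 0)) (-2 * Complex.I) 0 := by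
  obtain ⟨𝓕, h𝓕⟩ := exists_isPolarization hF.1
  obtain ⟨h0, h1, h2⟩ := h𝓕.jet hF
  obtain ⟨Θ, ha, hz, h⟩ := exists_segreFunction h𝓕.analyticAt h0 h1
  obtain ⟨a, b⟩ := segreFunction_jet h𝓕.analyticAt h1 h2 ha hz h
  obtain ⟨c, d⟩ := h𝓕.isSegreFunctionOf_and_symm h
  exact ⟨𝓕, Θ, h𝓕, ⟨ha, hz, a, d⟩, c, h, h1, b⟩


/-! ### Changes of coordinates -/

lemma HasFDerivAt.comp_of_eq {𝕜 E F G : Type*} [NontriviallyNormedField 𝕜] [NormedAddCommGroup E]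
    [NormedSpace 𝕜 E] [NormedAddCommGroup F] [NormedSpace 𝕜 F] [NormedAddCommGroup G]
    [NormedSpace 𝕜 G] {g : F → G} {g' : F →L[𝕜] G} {y : F} (hg : HasFDerivAt g g' y) {f : E → F}
    {f' : E →L[𝕜] F} (x : E) (hf : HasFDerivAt f f' x) (hy : f x = y) :
    HasFDerivAt (fun x => g (f x)) (g'.comp f') x := by
  subst hy
  exact hg.comp x hf

/-- The conjugate `y ↦ star (f (star y))` of a map. -/
def conjMap {E F : Type*} [Star E] [Star F] (f : E → F) : E → F := fun y => star (f (star y))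

lemma AnalyticAt.analyticAt_conjMap {E F : Type*} [NormedAddCommGroup E] [NormedSpace ℂ E] [StarAddMonoid E]
    [NormedStarGroup E] [StarModule ℂ E] [NormedAddCommGroup F] [NormedSpace ℂ F] [StarAddMonoid F]
    [NormedStarGroup F] [StarModule ℂ F] {f : E → F} (hf : AnalyticAt ℂ f 0) :
    AnalyticAt ℂ (conjMap f) 0 :=
  AnalyticAt.star_star (by simpa using hf)

/-- In the coordinates `K`, the Segre function `Θ` becomes `Θ'`. -/
def IsPullback (Θ : ℂ × ℂ × ℂ → ℂ) (K : ℂ × ℂ → ℂ × ℂ) (Θ' : ℂ × ℂ × ℂ → ℂ) : Prop :=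
  ∀ᶠ q in 𝓝 (0 : (ℂ × ℂ) × ℂ × ℂ),
    (conjMap K q.2).2 = Θ ((conjMap K q.2).1, K q.1) ↔ q.2.2 = Θ' (q.2.1, q.1)

lemma hasFDerivAt_conjMap_id {K : ℂ × ℂ → ℂ × ℂ}
    (hK : HasFDerivAt K (ContinuousLinearMap.id ℂ (ℂ × ℂ)) 0) :
    HasFDerivAt (conjMap K) (ContinuousLinearMap.id ℂ (ℂ × ℂ)) 0 := by
  have h0 : conjMap K 0 = star (K 0) := by simp [conjMap]
  rw [hasFDerivAt_iff_isLittleO_nhds_zero] at hK ⊢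
  have ht : Tendsto (fun h : ℂ × ℂ => star h) (𝓝 0) (𝓝 0) :=
    Continuous.tendsto' (by fun_prop) _ _ (by simp)
  have := hK.comp_tendsto ht
  refine (Asymptotics.isLittleO_norm_norm.1 ((Asymptotics.isLittleO_norm_norm.2 this).congr ?_ ?_))
  · intro h
    rw [← norm_star]
    simp [conjMap]
  · intro h
    simp

/-- Because K is tangent to the identity and Θ has differential dw, the pulled-back relation has
differential dω - dw at 0 and can be solved for ω. Tangency is inherited from this differential, and
the conjugation symmetry from that of Θ, as K and its conjugate are exchanged together with their
arguments. -/
lemma IsSegreFunction.exists_pullback {Θ : ℂ × ℂ × ℂ → ℂ} (hΘ : IsSegreFunction Θ)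
    {K : ℂ × ℂ → ℂ × ℂ} (hK : AnalyticAt ℂ K 0) (hK0 : K 0 = 0)
    (hKd : HasFDerivAt K (ContinuousLinearMap.id ℂ (ℂ × ℂ)) 0) :
    ∃ Θ', IsSegreFunction Θ' ∧ IsPullback Θ K Θ' := by
  have hKc := hK.analyticAt_conjMap
  have hKc0 : conjMap K 0 = 0 := by simp [conjMap, hK0]
  have hKcd := hasFDerivAt_conjMap_id hKd
  set m : (ℂ × ℂ × ℂ) × ℂ → ℂ × ℂ × ℂ := fun p => ((conjMap K (p.1.1, p.2)).1, K p.1.2) with hm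
  set G : (ℂ × ℂ × ℂ) × ℂ → ℂ := fun p => (conjMap K (p.1.1, p.2)).2 - Θ (m p) with hG
  have hm0 : m 0 = 0 := by
    have e : conjMap K (0, 0) = 0 := hKc0
    simp [hm, e, hK0]
  have hin : AnalyticAt ℂ (fun p : (ℂ × ℂ × ℂ) × ℂ => conjMap K (p.1.1, p.2)) 0 :=
    hKc.fun_comp_of_eq (by fun_prop) rfl
  have hma : AnalyticAt ℂ m 0 := by
    refine AnalyticAt.prod (analyticAt_fst.fun_comp hin) (hK.fun_comp_of_eq (by fun_prop) rfl)
  have hGa : AnalyticAt ℂ G 0 :=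
    AnalyticAt.fun_sub (analyticAt_snd.fun_comp hin) (hΘ.analyticAt.fun_comp_of_eq hma hm0)
  set D : (ℂ × ℂ × ℂ) × ℂ →L[ℂ] ℂ := ContinuousLinearMap.snd ℂ (ℂ × ℂ × ℂ) ℂ -
    ((ContinuousLinearMap.snd ℂ ℂ ℂ).comp (ContinuousLinearMap.snd ℂ ℂ (ℂ × ℂ))).comp
      (ContinuousLinearMap.fst ℂ (ℂ × ℂ × ℂ) ℂ) with hD
  have hGd : HasFDerivAt G D 0 := by
    have a1 : HasFDerivAt (fun p : (ℂ × ℂ × ℂ) × ℂ => (p.1.1, p.2))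
        (((ContinuousLinearMap.fst ℂ ℂ (ℂ × ℂ)).comp (ContinuousLinearMap.fst ℂ (ℂ × ℂ × ℂ) ℂ)).prod
          (ContinuousLinearMap.snd ℂ (ℂ × ℂ × ℂ) ℂ)) 0 :=
      (((ContinuousLinearMap.fst ℂ ℂ (ℂ × ℂ)).comp (ContinuousLinearMap.fst ℂ (ℂ × ℂ × ℂ) ℂ)).prod
          (ContinuousLinearMap.snd ℂ (ℂ × ℂ × ℂ) ℂ)).hasFDerivAt
    have a2 := HasFDerivAt.comp_of_eq hKcd (0 : (ℂ × ℂ × ℂ) × ℂ) a1 rfl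
    have a3 : HasFDerivAt (fun p : (ℂ × ℂ × ℂ) × ℂ => p.1.2)
        ((ContinuousLinearMap.snd ℂ ℂ (ℂ × ℂ)).comp (ContinuousLinearMap.fst ℂ (ℂ × ℂ × ℂ) ℂ)) 0 :=
      ((ContinuousLinearMap.snd ℂ ℂ (ℂ × ℂ)).comp
        (ContinuousLinearMap.fst ℂ (ℂ × ℂ × ℂ) ℂ)).hasFDerivAt
    have a4 := HasFDerivAt.comp_of_eq hKd (0 : (ℂ × ℂ × ℂ) × ℂ) a3 rfl
    have a5 : HasFDerivAt m _ 0 := a2.fst.prodMk a4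
    have a6 := HasFDerivAt.comp_of_eq hΘ.hasFDerivAt (0 : (ℂ × ℂ × ℂ) × ℂ) a5 hm0
    have a7 := a2.snd.sub a6
    exact a7.congr_fderiv (ContinuousLinearMap.ext fun p => by simp [hD])
  have hGd' : HasFDerivAt (fun y : ℂ => G ((0 : ℂ × ℂ × ℂ), y)) (ContinuousLinearMap.id ℂ ℂ) 0 := by
    have a : HasFDerivAt (fun y : ℂ => ((0 : ℂ × ℂ × ℂ), y)) (ContinuousLinearMap.inr ℂ (ℂ × ℂ × ℂ) ℂ) 0 :=
      (ContinuousLinearMap.inr ℂ (ℂ × ℂ × ℂ) ℂ).hasFDerivAt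
    exact (HasFDerivAt.comp_of_eq hGd (0 : ℂ) a rfl).congr_fderiv (ContinuousLinearMap.ext fun p => by simp [hD])
  have hG0 : G ((0 : ℂ × ℂ × ℂ), (0 : ℂ)) = 0 := by
    have e : m ((0 : ℂ × ℂ × ℂ), (0 : ℂ)) = 0 := hm0
    have e' : conjMap K (0, 0) = 0 := hKc0
    simp [hG, e, hΘ.zero, e']
  obtain ⟨Θ', ha, hz, hΘ'⟩ := AnalyticAt.exists_implicitFunction (a := (0 : ℂ × ℂ × ℂ)) (b := (0 : ℂ))
    hGa hG0 hGd' (fun y hy => hy)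
  have hpb : IsPullback Θ K Θ' := by
    have ht : Tendsto (fun q : (ℂ × ℂ) × ℂ × ℂ => ((q.2.1, q.1), q.2.2)) (𝓝 0)
        (𝓝 ((0 : ℂ × ℂ × ℂ), (0 : ℂ))) := Continuous.tendsto' (by fun_prop) _ _ rfl
    filter_upwards [ht.eventually hΘ'] with q hq
    rw [eq_comm (a := q.2.2), ← hq, hG, sub_eq_zero]
  refine ⟨Θ', ⟨ha, hz, ?_, ?_⟩, hpb⟩
  · have b1 : HasFDerivAt (fun p : ℂ × ℂ × ℂ => (p, Θ' p))
        ((ContinuousLinearMap.id ℂ (ℂ × ℂ × ℂ)).prod (fderiv ℂ Θ' 0)) 0 :=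
      (hasFDerivAt_id _).prodMk ha.differentiableAt.hasFDerivAt
    have b2 := HasFDerivAt.comp_of_eq hGd (0 : ℂ × ℂ × ℂ) b1 (by simp [hz])
    have b3 : ∀ᶠ p in 𝓝 (0 : ℂ × ℂ × ℂ), (0 : ℂ) = G (p, Θ' p) := by
      have ht : Tendsto (fun p : ℂ × ℂ × ℂ => (p, Θ' p)) (𝓝 0) (𝓝 ((0 : ℂ × ℂ × ℂ), (0 : ℂ))) := by
        have := (continuousAt_id (x := (0 : ℂ × ℂ × ℂ))).prodMk ha.continuousAt
        have := this.tendsto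
        simpa [hz] using this
      filter_upwards [ht.eventually hΘ'] with p hp
      exact (hp.2 rfl).symm
    have b4 := b2.unique ((hasFDerivAt_const (0 : ℂ) (0 : ℂ × ℂ × ℂ)).congr_of_eventuallyEq
      (b3.mono fun _ h => h.symm))
    have b5 : fderiv ℂ Θ' 0 = (ContinuousLinearMap.snd ℂ ℂ ℂ).comp
        (ContinuousLinearMap.snd ℂ ℂ (ℂ × ℂ)) := by
      refine ContinuousLinearMap.ext fun p => ?_
      have := congrArg (fun L : ℂ × ℂ × ℂ →L[ℂ] ℂ => L p) b4
      simpa [hD, sub_eq_zero] using this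
    rw [← b5]
    exact ha.differentiableAt.hasFDerivAt
  · have ht1 : Tendsto (fun q : (ℂ × ℂ) × ℂ × ℂ => (star q.2, star q.1)) (𝓝 0) (𝓝 0) :=
      Continuous.tendsto' (by fun_prop) _ _ (by simp)
    have ht2 : Tendsto (fun q : (ℂ × ℂ) × ℂ × ℂ => (K q.1, conjMap K q.2)) (𝓝 0) (𝓝 0) := by
      have h1 : ContinuousAt (fun q : (ℂ × ℂ) × ℂ × ℂ => K q.1) 0 :=
        hK.continuousAt.comp_of_eq (by fun_prop) rfl
      have h2 : ContinuousAt (fun q : (ℂ × ℂ) × ℂ × ℂ => conjMap K q.2) 0 :=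
        hKc.continuousAt.comp_of_eq (by fun_prop) rfl
      refine (h1.prodMk h2).tendsto.trans (le_of_eq ?_)
      simp [hK0, hKc0]
    filter_upwards [hpb, ht1.eventually hpb, ht2.eventually hΘ.symm] with q h1 h2 h3
    have h2' : (star (K q.1)).2 = Θ ((star (K q.1)).1, K (star q.2)) ↔
        (star q.1).2 = Θ' ((star q.1).1, star q.2) := by
      simpa only [conjMap, star_star] using h2
    rw [← h1, ← h2', h3]
    simp only [conjMap, star_star]

lemma IsPullback.comp {Θ Θ' Θ'' : ℂ × ℂ × ℂ → ℂ} {K L : ℂ × ℂ → ℂ × ℂ} (h : IsPullback Θ K Θ')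
    (hL : ContinuousAt L 0) (hL0 : L 0 = 0) (h' : IsPullback Θ' L Θ'') :
    IsPullback Θ (fun p => K (L p)) Θ'' := by
  have hLc : ContinuousAt (conjMap L) 0 := by
    refine ContinuousAt.star (hL.comp_of_eq (by fun_prop) (by simp))
  have ht : Tendsto (fun q : (ℂ × ℂ) × ℂ × ℂ => (L q.1, conjMap L q.2)) (𝓝 0) (𝓝 0) := by
    have h1 : ContinuousAt (fun q : (ℂ × ℂ) × ℂ × ℂ => L q.1) 0 :=
      hL.comp_of_eq (by fun_prop) rfl
    have h2 : ContinuousAt (fun q : (ℂ × ℂ) × ℂ × ℂ => conjMap L q.2) 0 :=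
      hLc.comp_of_eq (by fun_prop) rfl
    refine (h1.prodMk h2).tendsto.trans (le_of_eq ?_)
    simp [hL0, conjMap]
  filter_upwards [ht.eventually h, h'] with q h1 h2
  rw [← h2]
  simp only [conjMap, star_star] at h1 ⊢
  rw [h1]

lemma eventuallyEq_of_eq_iff {Θ₁ Θ₂ : ℂ × ℂ × ℂ → ℂ} (h : ContinuousAt Θ₁ 0) (h0 : Θ₁ 0 = 0)
    (h12 : ∀ᶠ q in 𝓝 (0 : (ℂ × ℂ) × ℂ × ℂ), q.2.2 = Θ₁ (q.2.1, q.1) → q.2.2 = Θ₂ (q.2.1, q.1)) :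
    ∀ᶠ x in 𝓝 0, Θ₁ x = Θ₂ x := by
  have ht : Tendsto (fun x : ℂ × ℂ × ℂ => ((x.2, (x.1, Θ₁ x)) : (ℂ × ℂ) × ℂ × ℂ)) (𝓝 0) (𝓝 0) := by
    have : ContinuousAt (fun x : ℂ × ℂ × ℂ => ((x.2, (x.1, Θ₁ x)) : (ℂ × ℂ) × ℂ × ℂ)) 0 := by
      fun_prop
    refine this.tendsto.trans (le_of_eq ?_)
    simp [h0]
  filter_upwards [ht.eventually h12] with x hx using hx rfl

lemma IsPullback.eventuallyEq {Θ Θ₁ Θ₂ : ℂ × ℂ × ℂ → ℂ} {K : ℂ × ℂ → ℂ × ℂ} (h₁ : IsPullback Θ K Θ₁)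
    (h₂ : IsPullback Θ K Θ₂) (hc : ContinuousAt Θ₁ 0) (h0 : Θ₁ 0 = 0) : Θ₁ =ᶠ[𝓝 0] Θ₂ := by
  refine eventuallyEq_of_eq_iff hc h0 ?_
  filter_upwards [h₁, h₂] with q h1 h2 h
  exact h2.1 (h1.2 h)

/-! ### The second-order equation of the Segre family -/

/-- The slope, at `ζ`, of the curve `ω = Θ (ζ, x)`. -/
noncomputable def segreSlope (Θ : ℂ × ℂ × ℂ → ℂ) : ℂ × ℂ × ℂ → ℂ := fun x => fderiv ℂ Θ x (1, 0, 0)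

lemma AnalyticAt.analyticAt_segreSlope {Θ : ℂ × ℂ × ℂ → ℂ} {x : ℂ × ℂ × ℂ} (h : AnalyticAt ℂ Θ x) :
    AnalyticAt ℂ (segreSlope Θ) x :=
  h.fderiv_apply _

lemma AnalyticAt.hasDerivAt_segreSlope {Θ : ℂ × ℂ × ℂ → ℂ} {x : ℂ × ℂ × ℂ} (h : AnalyticAt ℂ Θ x) :
    HasDerivAt (fun ζ => Θ (ζ, x.2)) (segreSlope Θ x) x.1 := by
  have l : HasDerivAt (fun ζ : ℂ => (ζ, x.2)) ((1 : ℂ), ((0 : ℂ), (0 : ℂ))) x.1 :=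
    (hasDerivAt_id _).prodMk (hasDerivAt_const _ _)
  exact HasFDerivAt.comp_hasDerivAt x.1 (h.differentiableAt.hasFDerivAt (x := (x.1, x.2))) l

lemma IsSegreFunction.segreSlope_zero {Θ : ℂ × ℂ × ℂ → ℂ} (h : IsSegreFunction Θ) : segreSlope Θ 0 = 0 := by
  simp [segreSlope, h.hasFDerivAt.fderiv]

/-- A curve of the family `ω = Θ (ζ, x)` is determined by a point and the slope at that point. -/
lemma IsSegreFunction.exists_of_slope {Θ : ℂ × ℂ × ℂ → ℂ} (h : IsSegreFunction Θ)
    (hL : HasDerivAt (fun z : ℂ => segreSlope Θ (0, z, 0)) (-2 * Complex.I) 0) :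
    ∃ ξ : ℂ × ℂ × ℂ → ℂ × ℂ, AnalyticAt ℂ ξ 0 ∧ ξ 0 = 0 ∧
      ∀ᶠ p in 𝓝 (0 : (ℂ × ℂ × ℂ) × ℂ × ℂ),
        (Θ (p.1.1, p.2) = p.1.2.1 ∧ segreSlope Θ (p.1.1, p.2) = p.1.2.2) ↔ ξ p.1 = p.2 := by
  set G : (ℂ × ℂ × ℂ) × ℂ × ℂ → ℂ × ℂ := fun p =>
    (Θ (p.1.1, p.2) - p.1.2.1, segreSlope Θ (p.1.1, p.2) - p.1.2.2) with hG
  have hsa := h.analyticAt.analyticAt_segreSlope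
  have hin : AnalyticAt ℂ (fun p : (ℂ × ℂ × ℂ) × ℂ × ℂ => (p.1.1, p.2)) 0 := by fun_prop
  have hGa : AnalyticAt ℂ G ((0 : ℂ × ℂ × ℂ), (0 : ℂ × ℂ)) := by
    refine AnalyticAt.prod (AnalyticAt.fun_sub (h.analyticAt.fun_comp_of_eq hin rfl) (by fun_prop))
      (AnalyticAt.fun_sub (hsa.fun_comp_of_eq hin rfl) (by fun_prop))
  have hr : HasFDerivAt (fun y : ℂ × ℂ => ((0 : ℂ), y)) (ContinuousLinearMap.inr ℂ ℂ (ℂ × ℂ)) 0 :=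
    (ContinuousLinearMap.inr ℂ ℂ (ℂ × ℂ)).hasFDerivAt
  have b1 := HasFDerivAt.comp_of_eq h.hasFDerivAt (0 : ℂ × ℂ) hr rfl
  have b2 := HasFDerivAt.comp_of_eq hsa.differentiableAt.hasFDerivAt (0 : ℂ × ℂ) hr rfl
  -- In x = (z, w) the differential at 0 of the pair (Θ, Θ_ζ) is triangular: that of Θ is dw, and
  -- Θ_ζ has z-derivative -2i. This is where Levi nondegeneracy enters.
  have hd : fderiv ℂ (segreSlope Θ) 0 (0, 1, 0) = -2 * Complex.I := by
    have a : HasDerivAt (fun z : ℂ => ((0 : ℂ), z, (0 : ℂ))) (0, 1, 0) 0 :=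
      (hasDerivAt_const _ _).prodMk ((hasDerivAt_id _).prodMk (hasDerivAt_const _ _))
    exact (HasFDerivAt.comp_hasDerivAt_of_eq (0 : ℂ) hsa.differentiableAt.hasFDerivAt a rfl).unique hL
  have b3 : HasFDerivAt (fun y : ℂ × ℂ => G ((0 : ℂ × ℂ × ℂ), y)) _ 0 :=
    (b1.sub_const 0).prodMk (b2.sub_const 0)
  obtain ⟨ξ, h1, h2, h3⟩ := AnalyticAt.exists_implicitFunction (a := (0 : ℂ × ℂ × ℂ))
    (b := (0 : ℂ × ℂ)) hGa (by
      have e : Θ (0, 0) = 0 := h.zero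
      have e' : segreSlope Θ (0, 0) = 0 := h.segreSlope_zero
      simp [hG, e, e']) b3 (by
      intro y hy
      obtain ⟨hy1, hy2⟩ := Prod.ext_iff.1 hy
      have hy1' : y.2 = 0 := by simpa using hy1
      have e : ((0 : ℂ), y) = y.1 • ((0 : ℂ), (1 : ℂ), (0 : ℂ)) := by
        ext <;> simp [hy1']
      have hy2' : fderiv ℂ (segreSlope Θ) 0 ((0 : ℂ), y) = 0 := by simpa using hy2
      rw [e, map_smul, hd] at hy2'
      have : y.1 = 0 := by simpa using hy2'
      exact Prod.ext this hy1')
  refine ⟨ξ, h1, h2, h3.mono fun p hp => ?_⟩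
  rw [← hp, hG, Prod.ext_iff]
  simp [sub_eq_zero]

/-- The coefficient of `s³` in `(1 + s X₁)³ Φ (ζ, ω, (k + s X₂) / (1 + s X₁))`. -/
noncomputable def thirdCoeff (Φ : ℂ × ℂ × ℂ → ℂ) (y : ℂ × ℂ × ℂ) (X : ℂ × ℂ) : ℂ :=
  iteratedDeriv 3 (fun s : ℂ =>
    (1 + s * X.1) ^ 3 * Φ (y.1, y.2.1, (y.2.2 + s * X.2) / (1 + s * X.1))) 0 / 6

lemma AnalyticAt.sub_taylor_isBigO {f : ℂ → ℂ} (hf : AnalyticAt ℂ f 0) (n : ℕ) :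
    (fun t => f t - ∑ k ∈ Finset.range n, t ^ k • (iteratedDeriv k f 0 / k.factorial))
      =O[𝓝 0] fun t => ‖t‖ ^ n := by
  have := hf.hasFPowerSeriesAt.isBigO_sub_partialSum_pow n
  simpa [FormalMultilinearSeries.partialSum, mul_comm] using this

lemma AnalyticAt.iteratedDeriv_eq_of_isBigO {f : ℂ → ℂ} (hf : AnalyticAt ℂ f 0) {n : ℕ}
    {a : ℕ → ℂ} (h : (fun t => f t - ∑ k ∈ Finset.range n, t ^ k • a k) =O[𝓝 0] fun t => ‖t‖ ^ n)
    {k : ℕ} (hk : k < n) : iteratedDeriv k f 0 / k.factorial = a k := by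
  have h1 := (h.sub (hf.sub_taylor_isBigO n)).mono (nhdsWithin_le_nhds (s := {0}ᶜ))
  refine sub_eq_zero.1 (coeff_eq_zero_of_isBigO (𝕜 := ℂ) (n := n)
    (a := fun k => iteratedDeriv k f 0 / k.factorial - a k) (h1.congr_left fun t => ?_) k hk)
  simp only [smul_sub, Finset.sum_sub_distrib]
  ring

lemma AnalyticAt.thirdCoeff_aux {Φ : ℂ × ℂ × ℂ → ℂ} {y : ℂ × ℂ × ℂ} (hΦ : AnalyticAt ℂ Φ y)
    (X : ℂ × ℂ) : AnalyticAt ℂ (fun q : ((ℂ × ℂ × ℂ) × ℂ × ℂ) × ℂ => (1 + q.2 * q.1.2.1) ^ 3 *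
      Φ (q.1.1.1, q.1.1.2.1, (q.1.1.2.2 + q.2 * q.1.2.2) / (1 + q.2 * q.1.2.1))) ((y, X), 0) := by
  refine AnalyticAt.fun_mul (by fun_prop) (hΦ.fun_comp_of_eq ?_ (by simp))
  fun_prop (disch := simp)

lemma AnalyticAt.analyticAt_thirdCoeff {Φ : ℂ × ℂ × ℂ → ℂ} {y : ℂ × ℂ × ℂ} (hΦ : AnalyticAt ℂ Φ y)
    (X : ℂ × ℂ) :
    AnalyticAt ℂ (fun p : (ℂ × ℂ × ℂ) × ℂ × ℂ => thirdCoeff Φ p.1 p.2) (y, X) := by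
  have h := (hΦ.thirdCoeff_aux X).iteratedDeriv_param 3
  have h2 : AnalyticAt ℂ (fun p : (ℂ × ℂ × ℂ) × ℂ × ℂ => (p, (0 : ℂ))) (y, X) := by fun_prop
  exact (h.fun_comp_of_eq h2 rfl).fun_div (analyticAt_const (v := (6 : ℂ))) (by norm_num)

/-- Taylor coefficients are unique, so the third one can be read off any expansion up to O(s⁴). -/
lemma AnalyticAt.thirdCoeff_eq {Φ : ℂ × ℂ × ℂ → ℂ} {y : ℂ × ℂ × ℂ} (hΦ : AnalyticAt ℂ Φ y)
    (X : ℂ × ℂ) {a : ℕ → ℂ}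
    (h : (fun s : ℂ => (1 + s * X.1) ^ 3 * Φ (y.1, y.2.1, (y.2.2 + s * X.2) / (1 + s * X.1))
      - ∑ k ∈ Finset.range 4, s ^ k • a k) =O[𝓝 0] fun s => ‖s‖ ^ 4) :
    thirdCoeff Φ y X = a 3 := by
  have h2 : AnalyticAt ℂ (fun s : ℂ => ((y, X), s)) 0 := by fun_prop
  have h3 := ((hΦ.thirdCoeff_aux X).fun_comp_of_eq h2 rfl).iteratedDeriv_eq_of_isBigO h
    (k := 3) (by norm_num)
  rw [← h3, thirdCoeff]
  norm_num [Nat.factorial]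

lemma AnalyticAt.thirdCoeff_isBigO {Φ : ℂ × ℂ × ℂ → ℂ} {y : ℂ × ℂ × ℂ} (hΦ : AnalyticAt ℂ Φ y)
    (X : ℂ × ℂ) : ∃ a : ℕ → ℂ, a 3 = thirdCoeff Φ y X ∧
    (fun s : ℂ => (1 + s * X.1) ^ 3 * Φ (y.1, y.2.1, (y.2.2 + s * X.2) / (1 + s * X.1))
      - ∑ k ∈ Finset.range 4, s ^ k • a k) =O[𝓝 0] fun s => ‖s‖ ^ 4 := by
  have h2 : AnalyticAt ℂ (fun s : ℂ => ((y, X), s)) 0 := by fun_prop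
  have h3 := ((hΦ.thirdCoeff_aux X).fun_comp_of_eq h2 rfl).sub_taylor_isBigO 4
  refine ⟨_, ?_, h3⟩
  rw [thirdCoeff]
  norm_num [Nat.factorial]

/-- Scaling X amounts to scaling s. The cubic homogeneity matches that of `wedge` of the first two
derivatives of a curve under reparametrization, so the chain equation does not depend on the
parameter. -/
lemma AnalyticAt.thirdCoeff_smul {Φ : ℂ × ℂ × ℂ → ℂ} {y : ℂ × ℂ × ℂ} (hΦ : AnalyticAt ℂ Φ y)
    (c : ℂ) (X : ℂ × ℂ) :
    thirdCoeff Φ y (c • X) = c ^ 3 * thirdCoeff Φ y X := by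
  obtain ⟨a, ha, h⟩ := hΦ.thirdCoeff_isBigO X
  have ht : Tendsto (fun s : ℂ => s * c) (𝓝 0) (𝓝 0) := Continuous.tendsto' (by fun_prop) _ _ (by simp)
  rw [hΦ.thirdCoeff_eq (c • X) (a := fun k => c ^ k * a k), ha]
  refine Asymptotics.IsBigO.trans ((h.comp_tendsto ht).congr_left fun s => ?_)
    (g := fun s => ‖s * c‖ ^ 4) ?_
  · simp only [Function.comp, Prod.smul_fst, Prod.smul_snd, smul_eq_mul, mul_pow, mul_assoc]
  · simp only [norm_mul, mul_pow, mul_comm _ (‖c‖ ^ 4)]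
    exact Asymptotics.isBigO_const_mul_self _ _ _


/-! ### Chains -/

lemma analyticAt_of_eventually_hasDerivAt {E : Type*} [NormedAddCommGroup E] [NormedSpace ℂ E]
    [CompleteSpace E] {y : ℂ → E} {y' : ℂ → E} {t₀ : ℂ}
    (h : ∀ᶠ t in 𝓝 t₀, HasDerivAt y (y' t) t) : AnalyticAt ℂ y t₀ :=
  Complex.analyticAt_iff_eventually_differentiableAt.2 (h.mono fun _ h => h.differentiableAt)

lemma HasDerivAt.star_star {E : Type*} [NormedAddCommGroup E] [NormedSpace ℂ E] [StarAddMonoid E]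
    [NormedStarGroup E] [StarModule ℂ E] {y : ℂ → E} {y' : E} {t : ℂ}
    (h : HasDerivAt y y' (star t)) : HasDerivAt (fun s => star (y (star s))) (star y') t := by
  have h' : HasFDerivAt y _ (star t) := h.hasFDerivAt
  have h2 := h'.star_star.hasDerivAt
  rw [_root_.star_star] at h2
  refine h2.congr_deriv ?_
  simp

lemma HasDerivAt.prod_fst {𝕜 E F : Type*} [NontriviallyNormedField 𝕜] [NormedAddCommGroup E]
    [NormedSpace 𝕜 E] [NormedAddCommGroup F] [NormedSpace 𝕜 F] {y : 𝕜 → E × F} {y' : E × F} {t : 𝕜}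
    (h : HasDerivAt y y' t) : HasDerivAt (fun s => (y s).1) y'.1 t :=
  (h.hasFDerivAt.fst.hasDerivAt).congr_deriv (by simp)

lemma HasDerivAt.prod_snd {𝕜 E F : Type*} [NontriviallyNormedField 𝕜] [NormedAddCommGroup E]
    [NormedSpace 𝕜 E] [NormedAddCommGroup F] [NormedSpace 𝕜 F] {y : 𝕜 → E × F} {y' : E × F} {t : 𝕜}
    (h : HasDerivAt y y' t) : HasDerivAt (fun s => (y s).2) y'.2 t :=
  (h.hasFDerivAt.snd.hasDerivAt).congr_deriv (by simp)

/-- A solution of `y' = ρ V(y)` is a reparametrization of a solution of `y' = V(y)`. -/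
lemma AnalyticAt.exists_reparametrization {E : Type*} [NormedAddCommGroup E] [NormedSpace ℂ E]
    [CompleteSpace E]
    {V : E → E} {y₀ : E} (hV : AnalyticAt ℂ V y₀) {y y₁ : ℂ → E} {ρ : ℂ → ℂ} (hρ : AnalyticAt ℂ ρ 0)
    (hy0 : y 0 = y₀) (hy₁0 : y₁ 0 = y₀) (hy : ∀ᶠ t in 𝓝 0, HasDerivAt y (V (y t)) t)
    (hy₁ : ∀ᶠ t in 𝓝 0, HasDerivAt y₁ (ρ t • V (y₁ t)) t) :
    ∃ s : ℂ → ℂ, AnalyticAt ℂ s 0 ∧ s 0 = 0 ∧ (∀ᶠ t in 𝓝 0, HasDerivAt s (ρ t) t) ∧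
      ∀ᶠ t in 𝓝 0, y₁ t = y (s t) := by
  -- Time is adjoined as a coordinate with derivative 1, so that the equation s' = ρ(t) becomes
  -- autonomous; the comparison of the two curves below uses the same device.
  have h1 : AnalyticAt ℂ (fun p : ℂ × ℂ => ((1 : ℂ), ρ p.1)) 0 :=
    analyticAt_const.prod (hρ.fun_comp_of_eq analyticAt_fst rfl)
  obtain ⟨S, hSa, hS0, hS⟩ := h1.exists_ode
  have hS1 : ∀ᶠ t in 𝓝 0, (S t).1 = t := by
    refine AnalyticAt.ode_unique (V := fun _ : ℂ => (1 : ℂ)) analyticAt_const (y₀ := (0 : ℂ))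
      (y₁ := fun t => (S t).1) (y₂ := fun t => t) (by simp [hS0]) rfl ?_ ?_
    · filter_upwards [hS] with t ht using ht.prod_fst
    · exact Eventually.of_forall fun t => hasDerivAt_id t
  set s : ℂ → ℂ := fun t => (S t).2 with hs
  have hsa : AnalyticAt ℂ s 0 := analyticAt_snd.fun_comp hSa
  have hs0 : s 0 = 0 := by simp [hs, hS0]
  have hsd : ∀ᶠ t in 𝓝 0, HasDerivAt s (ρ t) t := by
    filter_upwards [hS, hS1] with t ht ht1
    simpa only [ht1] using ht.prod_snd
  refine ⟨s, hsa, hs0, hsd, ?_⟩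
  have h2 : AnalyticAt ℂ (fun p : ℂ × E => ((1 : ℂ), ρ p.1 • V p.2)) (0, y₀) :=
    analyticAt_const.prod ((hρ.fun_comp_of_eq analyticAt_fst rfl).smul
      (hV.fun_comp_of_eq analyticAt_snd rfl))
  have hst : Tendsto s (𝓝 0) (𝓝 0) := by
    have := hsa.continuousAt.tendsto; rwa [hs0] at this
  have := AnalyticAt.ode_unique h2 (y₁ := fun t => (t, y₁ t)) (y₂ := fun t => (t, y (s t)))
    (by simp [hy₁0]) (by simp [hs0, hy0])
    (by filter_upwards [hy₁] with t ht using (hasDerivAt_id t).prodMk ht)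
    (by
      filter_upwards [hsd, hst.eventually hy] with t ht ht1
      exact (hasDerivAt_id t).prodMk (ht1.scomp t ht))
  filter_upwards [this] with t ht using (Prod.ext_iff.1 ht).2

/-- For a plane curve Y parametrizing a graph ω = θ(ζ), `wedge Y' Y''` equals Y₁'³ θ''. It thus
expresses a second-order equation without choosing a parameter. -/
def wedge (X Y : ℂ × ℂ) : ℂ := X.1 * Y.2 - X.2 * Y.1

/-- Chains: curves `γ` through `0`, transversal to the complex tangent space, whose polarizations
`(γ, γ*)` lie on `ω = Θ (ζ, x)` and which satisfy the Chern–Moser equation. -/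
structure IsSegreChain (Θ Φ : ℂ × ℂ × ℂ → ℂ) (γ : ℂ → ℂ × ℂ) : Prop where
  analyticAt : AnalyticAt ℂ γ 0
  zero : γ 0 = 0
  hasDerivAt : HasDerivAt γ (0, 1) 0
  mem : ∀ᶠ t in 𝓝 0, (conjMap γ t).2 = Θ ((conjMap γ t).1, γ t)
  chain : ∀ᶠ t in 𝓝 0, wedge (deriv (conjMap γ) t) (deriv (deriv (conjMap γ)) t) =
    thirdCoeff Φ ((conjMap γ t).1, (conjMap γ t).2, segreSlope Θ ((conjMap γ t).1, γ t))
      (deriv (conjMap γ) t)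

lemma fderiv_of_symm {𝓕 : ℂ × ℂ × ℂ → ℂ} (h : AnalyticAt ℂ 𝓕 0)
    (hs : ∀ᶠ x in 𝓝 (0 : ℂ × ℂ × ℂ), conj (𝓕 (conj x.2.1, conj x.1, conj x.2.2)) = 𝓕 x) :
    ∀ᶠ x in 𝓝 (0 : ℂ × ℂ × ℂ), ∀ v : ℂ × ℂ × ℂ,
      conj (fderiv ℂ 𝓕 (conj x.2.1, conj x.1, conj x.2.2) (conj v.2.1, conj v.1, conj v.2.2))
        = fderiv ℂ 𝓕 x v := by
  have ht : Tendsto (fun x : ℂ × ℂ × ℂ => (conj x.2.1, conj x.1, conj x.2.2)) (𝓝 0) (𝓝 0) :=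
    Continuous.tendsto' (by fun_prop) _ _ (by simp)
  filter_upwards [h.eventually_analyticAt, ht.eventually h.eventually_analyticAt,
    hs.eventually_nhds] with x h1 h2 h3 v
  have l : ∀ x v : ℂ × ℂ × ℂ, HasDerivAt (fun t : ℂ => x + t • v) v 0 := fun x v =>
    (((hasDerivAt_id (0 : ℂ)).smul_const v).const_add x).congr_deriv (by simp)
  have a1 := h1.differentiableAt.hasFDerivAt.comp_hasDerivAt_of_eq (0 : ℂ) (l x v) (by simp)
  have a2 := h2.differentiableAt.hasFDerivAt.comp_hasDerivAt_of_eq (0 : ℂ)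
    (l (conj x.2.1, conj x.1, conj x.2.2) (conj v.2.1, conj v.1, conj v.2.2)) (by simp)
  have a3 := HasDerivAt.star_star (t := 0) (by simpa using a2)
  have ht' : Tendsto (fun t : ℂ => x + t • v) (𝓝 0) (𝓝 x) :=
    Continuous.tendsto' (by fun_prop) _ _ (by simp)
  refine a3.unique (a1.congr_of_eventuallyEq ?_)
  filter_upwards [ht'.eventually h3] with t h4
  simp only [Function.comp] at h4 ⊢
  rw [← h4]
  simp

section ChainODE

variable (𝓕 Θ Φ : ℂ × ℂ × ℂ → ℂ)

/-- The point of polarized coordinates `(z, ζ, (w + ω) / 2)`. -/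
noncomputable def polarPoint (p : (ℂ × ℂ × ℂ) × ℂ × ℂ × ℂ) : ℂ × ℂ × ℂ :=
  (p.1.1, p.2.1, (p.1.2.1 + p.2.2.1) / 2)

/-- `dω/dt` along a chain, as a function of `((z, w, z'/w'), (ζ, ω, ζ'/ω'))`. -/
noncomputable def chainSpeed (p : (ℂ × ℂ × ℂ) × ℂ × ℂ × ℂ) : ℂ :=
  1 - Complex.I * fderiv ℂ 𝓕 (polarPoint p) (0, 0, 1)
    - 2 * Complex.I * fderiv ℂ 𝓕 (polarPoint p) (1, 0, 0) * p.1.2.2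

/-- `d(ζ, ω, ζ'/ω')/dt` along a chain. -/
noncomputable def chainHalf (p : (ℂ × ℂ × ℂ) × ℂ × ℂ × ℂ) : ℂ × ℂ × ℂ :=
  (chainSpeed 𝓕 p * p.2.2.2, chainSpeed 𝓕 p, -chainSpeed 𝓕 p *
    thirdCoeff Φ (p.2.1, p.2.2.1, segreSlope Θ (p.2.1, p.1.1, p.1.2.1)) (p.2.2.2, 1))

/-- The vector field of the differential equation of chains. -/
noncomputable def chainField (p : (ℂ × ℂ × ℂ) × ℂ × ℂ × ℂ) : (ℂ × ℂ × ℂ) × ℂ × ℂ × ℂ :=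
  (star (chainHalf 𝓕 Θ Φ (star p.swap)), chainHalf 𝓕 Θ Φ p)

variable {𝓕 Θ Φ}

lemma analyticAt_polarPoint (p : (ℂ × ℂ × ℂ) × ℂ × ℂ × ℂ) : AnalyticAt ℂ polarPoint p := by
  unfold polarPoint
  fun_prop (disch := norm_num)

lemma analyticAt_chainSpeed (h𝓕 : AnalyticAt ℂ 𝓕 0) : AnalyticAt ℂ (chainSpeed 𝓕) 0 := by
  have h : ∀ v, AnalyticAt ℂ (fun p => fderiv ℂ 𝓕 (polarPoint p) v) 0 := fun v =>
    (h𝓕.fderiv_apply v).fun_comp_of_eq (analyticAt_polarPoint _) (by simp [polarPoint])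
  unfold chainSpeed
  have := h (0, 0, 1)
  have := h (1, 0, 0)
  fun_prop

lemma analyticAt_chainHalf (h𝓕 : AnalyticAt ℂ 𝓕 0) (hΘ : IsSegreFunction Θ) (hΦ : AnalyticAt ℂ Φ 0) :
    AnalyticAt ℂ (chainHalf 𝓕 Θ Φ) 0 := by
  have h1 := analyticAt_chainSpeed h𝓕
  have h2 : AnalyticAt ℂ (fun p : (ℂ × ℂ × ℂ) × ℂ × ℂ × ℂ =>
      segreSlope Θ (p.2.1, p.1.1, p.1.2.1)) 0 :=
    hΘ.analyticAt.analyticAt_segreSlope.fun_comp_of_eq (by fun_prop) rfl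
  have h3 : AnalyticAt ℂ (fun p : (ℂ × ℂ × ℂ) × ℂ × ℂ × ℂ =>
      (((p.2.1, p.2.2.1, segreSlope Θ (p.2.1, p.1.1, p.1.2.1)), (p.2.2.2, (1 : ℂ))) :
        (ℂ × ℂ × ℂ) × ℂ × ℂ)) 0 := by fun_prop
  have h4 := (hΦ.analyticAt_thirdCoeff (0, 1)).fun_comp_of_eq h3 (by
    have e : segreSlope Θ (0, 0, 0) = 0 := hΘ.segreSlope_zero
    simp [e])
  unfold chainHalf
  refine AnalyticAt.prod (by fun_prop) (AnalyticAt.prod h1 ?_)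
  exact h1.fun_neg.fun_mul h4

lemma analyticAt_chainField (h𝓕 : AnalyticAt ℂ 𝓕 0) (hΘ : IsSegreFunction Θ)
    (hΦ : AnalyticAt ℂ Φ 0) : AnalyticAt ℂ (chainField 𝓕 Θ Φ) 0 := by
  have h := analyticAt_chainHalf h𝓕 hΘ hΦ
  have hsw : AnalyticAt ℂ (fun p : (ℂ × ℂ × ℂ) × ℂ × ℂ × ℂ => p.swap) 0 :=
    analyticAt_snd.prod analyticAt_fst
  have h1 : AnalyticAt ℂ (conjMap (chainHalf 𝓕 Θ Φ)) 0 := h.analyticAt_conjMap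
  exact (h1.fun_comp_of_eq hsw rfl).prod h

/-- The vector field commutes with the conjugation that exchanges its two halves; uniqueness of
solutions then makes the second half of a solution the conjugate of the first. -/
lemma chainField_star_swap (p : (ℂ × ℂ × ℂ) × ℂ × ℂ × ℂ) :
    chainField 𝓕 Θ Φ (star p.swap) = star (chainField 𝓕 Θ Φ p).swap := by
  have e : star (star p.swap).swap = p := by
    obtain ⟨a, b⟩ := p
    ext <;> simp
  unfold chainField
  rw [e]
  ext <;> simp

/-- Differentiating (w - ω) / 2i = 𝓕(z, ζ, (w + ω) / 2) with z' = α w' and ζ' = β ω' gives w' (1 - i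
𝓕_u - 2i 𝓕_z α) = ω' (1 + i 𝓕_u + 2i 𝓕_ζ β). Taking ω' to be the first bracket and w' the second
solves this, and the lemma says that the brackets are conjugate to each other. So the speeds respect
both the hypersurface and its real structure. -/
lemma chainSpeed_star_swap (h𝓕 : AnalyticAt ℂ 𝓕 0)
    (hs : ∀ᶠ x in 𝓝 (0 : ℂ × ℂ × ℂ), conj (𝓕 (conj x.2.1, conj x.1, conj x.2.2)) = 𝓕 x) :
    ∀ᶠ p in 𝓝 (0 : (ℂ × ℂ × ℂ) × ℂ × ℂ × ℂ), conj (chainSpeed 𝓕 (star p.swap)) =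
      1 + Complex.I * fderiv ℂ 𝓕 (polarPoint p) (0, 0, 1)
        + 2 * Complex.I * fderiv ℂ 𝓕 (polarPoint p) (0, 1, 0) * p.2.2.2 := by
  have ht : Tendsto polarPoint (𝓝 0) (𝓝 0) := by
    refine (analyticAt_polarPoint 0).continuousAt.tendsto.trans (le_of_eq ?_)
    simp [polarPoint]
  filter_upwards [ht.eventually (fderiv_of_symm h𝓕 hs)] with p hp
  have e : polarPoint (star p.swap) = (conj (polarPoint p).2.1, conj (polarPoint p).1,
      conj (polarPoint p).2.2) := by
    simp only [polarPoint, Prod.snd_star, Prod.fst_star, Prod.fst_swap, Prod.snd_swap,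
      Complex.star_def, map_div₀, map_add]
    rw [Complex.conj_ofNat, add_comm]
  rw [← hp (0, 0, 1), ← hp (0, 1, 0)]
  simp only [chainSpeed, e]
  simp
  exact Or.inl (Or.inl (Complex.conj_ofNat 2))

/-- Along an integral curve of the chain equation, the equation of the hypersurface is conserved. -/
lemma hasDerivAt_conserved {y : ℂ → (ℂ × ℂ × ℂ) × ℂ × ℂ × ℂ} {y' : (ℂ × ℂ × ℂ) × ℂ × ℂ × ℂ} {t : ℂ}
    (h𝓕 : AnalyticAt ℂ 𝓕 (polarPoint (y t))) (hy : HasDerivAt y y' t) :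
    HasDerivAt (fun t => ((y t).1.2.1 - (y t).2.2.1) / (2 * Complex.I) - 𝓕 (polarPoint (y t)))
      ((y'.1.2.1 - y'.2.2.1) / (2 * Complex.I) - (y'.1.1 * fderiv ℂ 𝓕 (polarPoint (y t)) (1, 0, 0)
        + y'.2.1 * fderiv ℂ 𝓕 (polarPoint (y t)) (0, 1, 0)
        + (y'.1.2.1 + y'.2.2.1) / 2 * fderiv ℂ 𝓕 (polarPoint (y t)) (0, 0, 1))) t := by
  have a : HasDerivAt (fun t => polarPoint (y t)) (y'.1.1, y'.2.1, (y'.1.2.1 + y'.2.2.1) / 2) t :=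
    hy.prod_fst.prod_fst.prodMk (hy.prod_snd.prod_fst.prodMk
      ((hy.prod_fst.prod_snd.prod_fst.add hy.prod_snd.prod_snd.prod_fst).div_const 2))
  have b := h𝓕.differentiableAt.hasFDerivAt.comp_hasDerivAt t a
  refine (((hy.prod_fst.prod_snd.prod_fst.sub hy.prod_snd.prod_snd.prod_fst).div_const (2 * Complex.I)).sub b).congr_deriv ?_
  have e : ((y'.1.1, y'.2.1, (y'.1.2.1 + y'.2.2.1) / 2) : ℂ × ℂ × ℂ) = y'.1.1 • (1, 0, 0)
    + y'.2.1 • (0, 1, 0) + ((y'.1.2.1 + y'.2.2.1) / 2) • (0, 0, 1) := by simp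
  rw [e, map_add, map_add, map_smul, map_smul, map_smul]
  simp only [smul_eq_mul]

end ChainODE

/-! ### Existence and uniqueness of the chain in the direction (0, 1) -/

lemma tendsto_slope {Θ : ℂ × ℂ × ℂ → ℂ} (hΘ : IsSegreFunction Θ) {γ : ℂ → ℂ × ℂ}
    (h : AnalyticAt ℂ γ 0) (h0 : γ 0 = 0) :
    Tendsto (fun t => ((conjMap γ t).1, (conjMap γ t).2, segreSlope Θ ((conjMap γ t).1, γ t)))
      (𝓝 0) (𝓝 0) := by
  have hc := h.analyticAt_conjMap.continuousAt
  have hc0 : conjMap γ 0 = 0 := by simp [conjMap, h0]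
  have hs : ContinuousAt (fun t => segreSlope Θ ((conjMap γ t).1, γ t)) 0 :=
    hΘ.analyticAt.analyticAt_segreSlope.continuousAt.comp_of_eq
      ((continuous_fst.continuousAt.comp hc).prodMk h.continuousAt) (by simp [hc0, h0])
  refine ((continuous_fst.continuousAt.comp hc).prodMk
    ((continuous_snd.continuousAt.comp hc).prodMk hs)).tendsto.trans (le_of_eq ?_)
  have e : segreSlope Θ (0, 0) = 0 := hΘ.segreSlope_zero
  simp [hc0, h0, e]

section ChainODE

variable {𝓕 Θ Φ : ℂ × ℂ × ℂ → ℂ}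

/-- Chains are lifted to the phase space of points and directions (z, w, z'/w') and their conjugates
(ζ, ω, ζ'/ω'), where they are integral curves of `chainField` up to the choice of parameter. The
solution starting at 0 is conjugation invariant and stays on the hypersurface. Any other chain lifts
to a solution of the same field multiplied by a function ρ of the parameter, hence is a
reparametrization; ρ is invariant under conjugation, which makes the reparametrization real. -/
theorem exists_isSegreChain (h𝓕 : AnalyticAt ℂ 𝓕 0) (h0 : 𝓕 0 = 0)
    (h1 : HasFDerivAt 𝓕 (0 : ℂ × ℂ × ℂ →L[ℂ] ℂ) 0)
    (hs : ∀ᶠ x in 𝓝 (0 : ℂ × ℂ × ℂ), conj (𝓕 (conj x.2.1, conj x.1, conj x.2.2)) = 𝓕 x)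
    (hΘ : IsSegreFunction Θ) (hsol : SolvesFor 𝓕 Θ) (hΦ : AnalyticAt ℂ Φ 0) :
    ∃ γ, IsSegreChain Θ Φ γ ∧ ∀ γ₁, IsSegreChain Θ Φ γ₁ → ∃ s : ℂ → ℂ, AnalyticAt ℂ s 0 ∧ s 0 = 0 ∧
      HasDerivAt s 1 0 ∧ (∀ᶠ t in 𝓝 0, star (s (star t)) = s t) ∧ ∀ᶠ t in 𝓝 0, γ₁ t = γ (s t) := by
  have hV := analyticAt_chainField h𝓕 hΘ hΦ
  obtain ⟨y, hya, hy0, hy⟩ := hV.exists_ode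
  have hyt : Tendsto y (𝓝 0) (𝓝 0) := by
    have := hya.continuousAt.tendsto; rwa [hy0] at this
  have hst : Tendsto (fun t : ℂ => star t) (𝓝 0) (𝓝 0) := Continuous.tendsto' (by fun_prop) _ _ (by simp)
  have hsp := chainSpeed_star_swap h𝓕 hs
  have hppt : Tendsto polarPoint (𝓝 0) (𝓝 0) := by
    refine (analyticAt_polarPoint 0).continuousAt.tendsto.trans (le_of_eq ?_)
    simp [polarPoint]
  have hspeed0 : chainSpeed 𝓕 0 = 1 := by
    have e : polarPoint 0 = 0 := by simp [polarPoint]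
    simp [chainSpeed, e, h1.fderiv]
  -- the solution is invariant under the conjugation
  have hysymm : y =ᶠ[𝓝 0] fun t => star (y (star t)).swap := by
    refine AnalyticAt.ode_unique hV hy0 (by simp [hy0]) hy ?_
    filter_upwards [hst.eventually hy] with t ht
    rw [chainField_star_swap]
    have h2 : HasDerivAt (fun t => (y t).swap) (chainField 𝓕 Θ Φ (y (star t))).swap (star t) :=
      ht.prod_snd.prodMk ht.prod_fst
    exact h2.star_star
  set γ : ℂ → ℂ × ℂ := fun t => ((y t).1.1, (y t).1.2.1) with hγ
  have hγc : conjMap γ =ᶠ[𝓝 0] fun t => ((y t).2.1, (y t).2.2.1) := by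
    filter_upwards [hysymm] with t ht
    rw [ht]
    rfl
  have hγa : AnalyticAt ℂ γ 0 := by
    refine AnalyticAt.prod ?_ ?_ <;> fun_prop
  have hγ0 : γ 0 = 0 := by simp [hγ, hy0]
  -- the conserved quantity
  have hmem0 : ∀ᶠ t in 𝓝 0, ((y t).1.2.1 - (y t).2.2.1) / (2 * Complex.I) - 𝓕 (polarPoint (y t)) = 0 := by
    refine AnalyticAt.ode_unique (V := fun _ : ℂ => (0 : ℂ)) analyticAt_const (y₀ := (0 : ℂ))
      (y₁ := fun t => ((y t).1.2.1 - (y t).2.2.1) / (2 * Complex.I) - 𝓕 (polarPoint (y t)))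
      (y₂ := fun _ => 0) ?_ rfl ?_ (Eventually.of_forall fun t => hasDerivAt_const _ _)
    · have e : polarPoint 0 = 0 := by simp [polarPoint]
      simp [hy0, e, h0]
    · filter_upwards [hy, (hppt.comp hyt).eventually h𝓕.eventually_analyticAt, hyt.eventually hsp]
        with t h1 h2 h3
      refine (hasDerivAt_conserved h2 h1).congr_deriv ?_
      have hI := Complex.I_ne_zero
      have hI2 := Complex.I_sq
      have e1 : (chainField 𝓕 Θ Φ (y t)).1.2.1 = conj (chainSpeed 𝓕 (star (y t).swap)) := rfl
      have e2 : (chainField 𝓕 Θ Φ (y t)).1.1 =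
          conj (chainSpeed 𝓕 (star (y t).swap)) * (y t).1.2.2 := by
        simp [chainField, chainHalf]
      have e3 : (chainField 𝓕 Θ Φ (y t)).2.1 = chainSpeed 𝓕 (y t) * (y t).2.2.2 := rfl
      have e4 : (chainField 𝓕 Θ Φ (y t)).2.2.1 = chainSpeed 𝓕 (y t) := rfl
      rw [e1, e2, e3, e4, h3]
      simp only [chainSpeed]
      field_simp
      ring_nf
  have hγmem : ∀ᶠ t in 𝓝 0, (conjMap γ t).2 = Θ ((conjMap γ t).1, γ t) := by
    have ht : Tendsto (fun t => ((γ t, ((y t).2.1, (y t).2.2.1)) : (ℂ × ℂ) × ℂ × ℂ)) (𝓝 0) (𝓝 0) := by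
      have : ContinuousAt (fun t => ((γ t, ((y t).2.1, (y t).2.2.1)) : (ℂ × ℂ) × ℂ × ℂ)) 0 := by
        have := hya.continuousAt
        have := hγa.continuousAt
        fun_prop
      refine this.tendsto.trans (le_of_eq ?_)
      simp [hγ0, hy0]
    filter_upwards [ht.eventually hsol, hmem0, hγc] with t h1 h2 h3
    rw [h3]
    exact h1.1 (sub_eq_zero.1 h2)
  have hspt : Tendsto (fun t => chainSpeed 𝓕 (y t)) (𝓝 0) (𝓝 1) := by
    have h2 := (analyticAt_chainSpeed h𝓕).continuousAt.tendsto
    rw [hspeed0] at h2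
    exact h2.comp hyt
  have hQa : AnalyticAt ℂ (fun t => chainSpeed 𝓕 (y t)) 0 :=
    (analyticAt_chainSpeed h𝓕).fun_comp_of_eq hya hy0
  have hcd : ∀ᶠ t in 𝓝 0, HasDerivAt (conjMap γ)
      (chainSpeed 𝓕 (y t) * (y t).2.2.2, chainSpeed 𝓕 (y t)) t := by
    filter_upwards [hy, hγc.eventually_nhds] with t h1 h2
    exact (h1.prod_snd.prod_fst.prodMk h1.prod_snd.prod_snd.prod_fst).congr_of_eventuallyEq h2
  have hchain : IsSegreChain Θ Φ γ := by
    refine ⟨hγa, hγ0, ?_, hγmem, ?_⟩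
    · have h2 := hy.self_of_nhds
      refine (h2.prod_fst.prod_fst.prodMk h2.prod_fst.prod_snd.prod_fst).congr_deriv ?_
      simp [hy0, chainField, chainHalf, hspeed0]
    · have hpt : Tendsto (fun t => ((conjMap γ t).1, (conjMap γ t).2,
          segreSlope Θ ((conjMap γ t).1, γ t))) (𝓝 0) (𝓝 0) := tendsto_slope hΘ hγa hγ0
      filter_upwards [hcd, hcd.eventually_nhds, hy, hQa.eventually_analyticAt, hγc,
        hpt.eventually hΦ.eventually_analyticAt] with t h2 h3 h4 h5 h6 h7
      have h8 := h5.differentiableAt.hasDerivAt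
      have h9 : HasDerivAt (deriv (conjMap γ)) _ t :=
        ((h8.mul h4.prod_snd.prod_snd.prod_snd).prodMk h8).congr_of_eventuallyEq
          (h3.mono fun _ h => h.deriv)
      have e1 : (chainField 𝓕 Θ Φ (y t)).2.2.2 = -chainSpeed 𝓕 (y t) *
        thirdCoeff Φ ((conjMap γ t).1, (conjMap γ t).2, segreSlope Θ ((conjMap γ t).1, γ t))
          ((y t).2.2.2, 1) := by
        rw [h6]
        rfl
      have e2 : ((chainSpeed 𝓕 (y t) * (y t).2.2.2, chainSpeed 𝓕 (y t)) : ℂ × ℂ) =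
          chainSpeed 𝓕 (y t) • ((y t).2.2.2, 1) := by simp
      rw [h9.deriv, h2.deriv, e1, e2, h7.thirdCoeff_smul]
      simp only [wedge, Prod.smul_fst, Prod.smul_snd, smul_eq_mul]
      ring
  refine ⟨γ, hchain, fun γ₁ h => ?_⟩
  set c : ℂ → ℂ × ℂ := conjMap γ₁ with hc
  have hca : AnalyticAt ℂ c 0 := h.analyticAt.analyticAt_conjMap
  have hc0 : c 0 = 0 := by simp [hc, conjMap, h.zero]
  have hda := h.analyticAt.deriv
  have hdc := hca.deriv
  have hcs : ∀ᶠ t in 𝓝 0, deriv c t = star (deriv γ₁ (star t)) := by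
    filter_upwards [hst.eventually h.analyticAt.eventually_analyticAt] with t ht
    exact ht.differentiableAt.hasDerivAt.star_star.deriv
  have ha1 : deriv γ₁ 0 = (0, 1) := h.hasDerivAt.deriv
  have hc1 : deriv c 0 = (0, 1) := by
    rw [hcs.self_of_nhds, star_zero, ha1]
    ext <;> simp
  -- The lift of an arbitrary chain. Both denominators are 1 at t = 0, and the lift starts at 0
  -- because the tangent there is (0, 1).
  set y₁ : ℂ → (ℂ × ℂ × ℂ) × ℂ × ℂ × ℂ := fun t =>
    (((γ₁ t).1, (γ₁ t).2, (deriv γ₁ t).1 / (deriv γ₁ t).2),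
      ((c t).1, (c t).2, (deriv c t).1 / (deriv c t).2)) with hy₁
  have hy₁a : AnalyticAt ℂ y₁ 0 := by
    have h2 := h.analyticAt
    refine AnalyticAt.prod (AnalyticAt.prod (by fun_prop) (AnalyticAt.prod (by fun_prop) ?_))
      (AnalyticAt.prod (by fun_prop) (AnalyticAt.prod (by fun_prop) ?_))
    · exact AnalyticAt.fun_div (by fun_prop) (by fun_prop) (by simp [ha1])
    · exact AnalyticAt.fun_div (by fun_prop) (by fun_prop) (by simp [hc1])
  have hy₁0 : y₁ 0 = 0 := by simp [hy₁, h.zero, hc0, ha1, hc1]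
  have hy₁t : Tendsto y₁ (𝓝 0) (𝓝 0) := by
    have := hy₁a.continuousAt.tendsto; rwa [hy₁0] at this
  have hy₁s : ∀ᶠ t in 𝓝 0, star (y₁ (star t)).swap = y₁ t := by
    filter_upwards [hcs, hst.eventually hcs] with t h2 h3
    rw [star_star] at h3
    have e1 : c (star t) = star (γ₁ t) := by simp [hc, conjMap]
    have e2 : γ₁ (star t) = star (c t) := by simp [hc, conjMap]
    have e3 : deriv γ₁ (star t) = star (deriv c t) := by rw [h2, star_star]
    simp only [hy₁]
    rw [e1, e2, e3, h3]
    ext <;> simp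
  have ha2 : ∀ᶠ t in 𝓝 0, (deriv γ₁ t).2 ≠ 0 :=
    (continuous_snd.continuousAt.comp hda.continuousAt).eventually_ne (by simp [ha1])
  have hc2 : ∀ᶠ t in 𝓝 0, (deriv c t).2 ≠ 0 :=
    (continuous_snd.continuousAt.comp hdc.continuousAt).eventually_ne (by simp [hc1])
  have hQ1a : AnalyticAt ℂ (fun t => chainSpeed 𝓕 (y₁ t)) 0 :=
    (analyticAt_chainSpeed h𝓕).fun_comp_of_eq hy₁a hy₁0
  have hQ1 : ∀ᶠ t in 𝓝 0, chainSpeed 𝓕 (y₁ t) ≠ 0 :=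
    hQ1a.continuousAt.eventually_ne (by simp [hy₁0, hspeed0])
  have hQ2 : ∀ᶠ t in 𝓝 0, conj (chainSpeed 𝓕 (star (y₁ t).swap)) ≠ 0 := by
    filter_upwards [hst.eventually hQ1, hst.eventually hy₁s] with t h2 h3
    rw [star_star] at h3
    rw [h3]
    simpa using h2
  set ρ : ℂ → ℂ := fun t => (deriv c t).2 / chainSpeed 𝓕 (y₁ t) with hρ
  have hρa : AnalyticAt ℂ ρ 0 :=
    AnalyticAt.fun_div (by fun_prop) hQ1a (by simp [hy₁0, hspeed0])
  have hρ0 : ρ 0 = 1 := by simp [hρ, hc1, hy₁0, hspeed0]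
  -- The derivative of the incidence relation. It says that the actual speeds of w and ω have the
  -- same ratio ρ to the prescribed ones, so ρ is its own conjugate.
  have hrel : ∀ᶠ t in 𝓝 0, (deriv γ₁ t).2 * chainSpeed 𝓕 (y₁ t) =
      (deriv c t).2 * conj (chainSpeed 𝓕 (star (y₁ t).swap)) := by
    have ht : Tendsto (fun t => ((γ₁ t, c t) : (ℂ × ℂ) × ℂ × ℂ)) (𝓝 0) (𝓝 0) := by
      refine (h.analyticAt.continuousAt.prodMk hca.continuousAt).tendsto.trans (le_of_eq ?_)
      simp [h.zero, hc0]
    have hz : ∀ᶠ t in 𝓝 0,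
        ((y₁ t).1.2.1 - (y₁ t).2.2.1) / (2 * Complex.I) - 𝓕 (polarPoint (y₁ t)) = 0 := by
      filter_upwards [ht.eventually hsol, h.mem] with t h2 h3
      exact sub_eq_zero.2 (h2.2 h3)
    filter_upwards [hz.eventually_nhds, (hppt.comp hy₁t).eventually h𝓕.eventually_analyticAt,
      hy₁a.eventually_analyticAt, h.analyticAt.eventually_analyticAt, hca.eventually_analyticAt,
      hy₁t.eventually hsp, ha2, hc2] with t h2 h3 h4 h5 h6 h7 h8 h9
    have b1 := h4.differentiableAt.hasDerivAt
    have b2 := (hasDerivAt_conserved h3 b1).unique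
      ((hasDerivAt_const t (0 : ℂ)).congr_of_eventuallyEq h2)
    have b3 := h5.differentiableAt.hasDerivAt
    have b4 := h6.differentiableAt.hasDerivAt
    have e1 := b1.prod_fst.prod_fst.unique b3.prod_fst
    have e2 := b1.prod_fst.prod_snd.prod_fst.unique b3.prod_snd
    have e3 := b1.prod_snd.prod_fst.unique b4.prod_fst
    have e4 := b1.prod_snd.prod_snd.prod_fst.unique b4.prod_snd
    have e5 : (deriv γ₁ t).1 = (y₁ t).1.2.2 * (deriv γ₁ t).2 := by simp only [hy₁]; field_simp
    have e6 : (deriv c t).1 = (y₁ t).2.2.2 * (deriv c t).2 := by simp only [hy₁]; field_simp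
    rw [e1, e2, e3, e4, e5, e6] at b2
    rw [h7]
    simp only [chainSpeed]
    have hI := Complex.I_ne_zero
    have b5 : (deriv γ₁ t).2 - (deriv c t).2 = 2 * Complex.I * (((deriv γ₁ t).2 - (deriv c t).2) /
      (2 * Complex.I)) := by field_simp
    linear_combination b5 + 2 * Complex.I * b2
  have hρs : ∀ᶠ t in 𝓝 0, star (ρ (star t)) = ρ t := by
    filter_upwards [hrel, hQ1, hQ2, hcs, hst.eventually hcs, hst.eventually hy₁s]
      with t h2 h3 h4 h5 h6 h7
    rw [star_star] at h7
    have e : star (ρ (star t)) = (deriv γ₁ t).2 / conj (chainSpeed 𝓕 (star (y₁ t).swap)) := by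
      simp only [hρ]
      rw [h6, h7, star_div₀]
      simp
    rw [e, hρ]
    field_simp
    exact h2.trans (mul_comm _ _)
  -- With β = ζ'/ω', the left side of the chain equation is -ω'² β' and the right side is ω'³ times
  -- its value at (β, 1). Hence β' = -ω' `thirdCoeff` at (β, 1), which is the last component of
  -- `chainHalf` times ρ.
  have hhalf : ∀ᶠ t in 𝓝 0, HasDerivAt (fun t => (y₁ t).2) (ρ t • chainHalf 𝓕 Θ Φ (y₁ t)) t := by
    have hpt : Tendsto (fun t => ((conjMap γ₁ t).1, (conjMap γ₁ t).2,
        segreSlope Θ ((conjMap γ₁ t).1, γ₁ t))) (𝓝 0) (𝓝 0) := tendsto_slope hΘ h.analyticAt h.zero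
    filter_upwards [hca.eventually_analyticAt, hdc.eventually_analyticAt, hc2, hQ1, h.chain,
      hpt.eventually hΦ.eventually_analyticAt] with t h2 h3 h4 h5 h6 h7
    have b1 := h2.differentiableAt.hasDerivAt
    have b2 := h3.differentiableAt.hasDerivAt
    have b3 := b2.prod_fst.div b2.prod_snd h4
    refine (b1.prod_fst.prodMk (b1.prod_snd.prodMk b3)).congr_deriv ?_
    have e6 : (deriv c t).1 = (y₁ t).2.2.2 * (deriv c t).2 := by simp only [hy₁]; field_simp
    have e2 : deriv c t = (deriv c t).2 • ((y₁ t).2.2.2, (1 : ℂ)) := by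
      ext
      · simp [e6, mul_comm]
      · simp
    have e7 := h6
    rw [← hc] at e7
    conv_rhs at e7 => rw [e2]
    rw [h7.thirdCoeff_smul] at e7
    have e8 : ρ t * chainSpeed 𝓕 (y₁ t) = (deriv c t).2 := by simp only [hρ]; field_simp
    ext
    · simp only [chainHalf, Prod.smul_fst, smul_eq_mul]
      rw [← mul_assoc, e8, e6, mul_comm]
    · simp only [chainHalf, Prod.smul_snd, Prod.smul_fst, smul_eq_mul]
      rw [e8]
    · simp only [chainHalf, Prod.smul_snd, smul_eq_mul]
      rw [← mul_assoc, mul_neg, e8]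
      rw [div_eq_iff (pow_ne_zero 2 h4)]
      simp only [wedge] at e7
      linear_combination -e7
  have hy₁d : ∀ᶠ t in 𝓝 0, HasDerivAt y₁ (ρ t • chainField 𝓕 Θ Φ (y₁ t)) t := by
    filter_upwards [hhalf, hst.eventually hhalf, hρs, hy₁s.eventually_nhds, hy₁s,
      hst.eventually hy₁s] with t h2 h3 h4 h5 h6 h7
    rw [star_star] at h7
    have b1 := h3.star_star
    have b2 : HasDerivAt (fun t => (y₁ t).1) _ t :=
      b1.congr_of_eventuallyEq (h5.mono fun s hs => (congrArg Prod.fst hs).symm)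
    refine (b2.prodMk h2).congr_deriv ?_
    rw [star_smul, h4, ← h7]
    rfl
  obtain ⟨s, hsa, hs0, hsd, hsy⟩ := hV.exists_reparametrization hρa hy0 hy₁0 hy hy₁d
  refine ⟨s, hsa, hs0, by simpa [hρ0] using hsd.self_of_nhds, ?_, ?_⟩
  · have : (fun t => star (s (star t)) - s t) =ᶠ[𝓝 0] fun _ => 0 := by
      refine AnalyticAt.ode_unique (V := fun _ : ℂ => (0 : ℂ)) analyticAt_const (y₀ := (0 : ℂ))
        (by simp [hs0]) rfl ?_ (Eventually.of_forall fun t => hasDerivAt_const _ _)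
      filter_upwards [hsd, hst.eventually hsd, hρs] with t h2 h3 h4
      exact (h3.star_star.sub h2).congr_deriv (by rw [h4, sub_self])
    exact this.mono fun t ht => sub_eq_zero.1 ht
  · filter_upwards [hsy] with t ht
    simp only [hγ, ← ht, hy₁]

end ChainODE


/-! ### The coefficient that detects chains -/

lemma HasFDerivAt.hasDerivAt_pair {F : Type*} [NormedAddCommGroup F] [NormedSpace ℂ F]
    {f : ℂ × ℂ → F} {x : ℂ × ℂ} {a b : ℂ → ℂ} {a' b' s : ℂ} (hf : AnalyticAt ℂ f x)
    (ha : HasDerivAt a a' s) (hb : HasDerivAt b b' s) (hx : x = (a s, b s)) :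
    HasDerivAt (fun s => f (a s, b s)) (a' • fderiv ℂ f x (1, 0) + b' • fderiv ℂ f x (0, 1)) s := by
  have h1 := hf.differentiableAt.hasFDerivAt.comp_hasDerivAt_of_eq s (ha.prodMk hb) hx
  refine h1.congr_deriv ?_
  rw [← map_smul, ← map_smul, ← map_add]
  simp

/-- The first two derivatives of `ζ ↦ κ (ζ, T ζ)`. -/
lemma hasDerivAt_twice {κ : ℂ × ℂ → ℂ × ℂ} {T : ℂ → ℂ} {t : ℂ} (hκ : AnalyticAt ℂ κ (0, t))
    (hT : AnalyticAt ℂ T 0) (hT0 : T 0 = t) :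
    (∀ᶠ ζ in 𝓝 0, HasDerivAt (fun ζ => κ (ζ, T ζ)) (fderiv ℂ κ (ζ, T ζ) (1, 0)
      + deriv T ζ • fderiv ℂ κ (ζ, T ζ) (0, 1)) ζ) ∧
    HasDerivAt (fun ζ => fderiv ℂ κ (ζ, T ζ) (1, 0) + deriv T ζ • fderiv ℂ κ (ζ, T ζ) (0, 1))
      (fderiv ℂ (fun x => fderiv ℂ κ x (1, 0)) (0, t) (1, 0)
        + deriv T 0 • (fderiv ℂ (fun x => fderiv ℂ κ x (1, 0)) (0, t) (0, 1)
          + fderiv ℂ (fun x => fderiv ℂ κ x (0, 1)) (0, t) (1, 0))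
        + deriv T 0 ^ 2 • fderiv ℂ (fun x => fderiv ℂ κ x (0, 1)) (0, t) (0, 1)
        + deriv (deriv T) 0 • fderiv ℂ κ (0, t) (0, 1)) 0 := by
  have ht : Tendsto (fun ζ => (ζ, T ζ)) (𝓝 0) (𝓝 (0, t)) := by
    have := (continuousAt_id (x := (0 : ℂ))).prodMk hT.continuousAt
    rw [← hT0]
    exact this
  constructor
  · filter_upwards [ht.eventually hκ.eventually_analyticAt, hT.eventually_analyticAt] with ζ h1 h2
    exact (HasFDerivAt.hasDerivAt_pair h1 (hasDerivAt_id ζ) h2.differentiableAt.hasDerivAt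
      rfl).congr_deriv (by simp)
  · have d := hT.differentiableAt.hasDerivAt
    have h1 := HasFDerivAt.hasDerivAt_pair (hκ.fderiv_apply (1, 0)) (hasDerivAt_id (0 : ℂ)) d
      (by simp [hT0])
    have h2 := HasFDerivAt.hasDerivAt_pair (hκ.fderiv_apply (0, 1)) (hasDerivAt_id (0 : ℂ)) d
      (by simp [hT0])
    have h3 := hT.deriv.differentiableAt.hasDerivAt
    refine (h1.add (h3.smul h2)).congr_deriv ?_
    simp only [id, hT0, one_smul, smul_add, smul_smul, pow_two]
    abel

/-- Differentiating Y₂ = θ(Y₁) twice and eliminating Y₂' leaves only the term with θ''. This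
transfers ω'' = Φ to Segre curves parametrized in other coordinates. -/
lemma wedge_eq_of_graph {Y : ℂ → ℂ × ℂ} {Y' : ℂ → ℂ × ℂ} {Y'' : ℂ × ℂ} {θ : ℂ → ℂ}
    (h1 : ∀ᶠ ζ in 𝓝 0, HasDerivAt Y (Y' ζ) ζ) (h2 : HasDerivAt Y' Y'' 0)
    (hθ : AnalyticAt ℂ θ (Y 0).1) (h : ∀ᶠ ζ in 𝓝 0, (Y ζ).2 = θ (Y ζ).1) :
    (Y' 0).2 = deriv θ (Y 0).1 * (Y' 0).1 ∧
      wedge (Y' 0) Y'' = (Y' 0).1 ^ 3 * deriv (deriv θ) (Y 0).1 := by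
  have hc : Tendsto (fun ζ => (Y ζ).1) (𝓝 0) (𝓝 (Y 0).1) :=
    h1.self_of_nhds.continuousAt.fst
  have h3 : ∀ᶠ ζ in 𝓝 0, (Y' ζ).2 = deriv θ (Y ζ).1 * (Y' ζ).1 := by
    filter_upwards [h1, hc.eventually hθ.eventually_analyticAt, h.eventually_nhds] with ζ a b c
    have e := (b.differentiableAt.hasDerivAt.comp ζ a.prod_fst).congr_of_eventuallyEq c
    exact a.prod_snd.unique e
  refine ⟨h3.self_of_nhds, ?_⟩
  have a := hθ.deriv.differentiableAt.hasDerivAt.comp (0 : ℂ) h1.self_of_nhds.prod_fst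
  have e := h2.prod_snd.unique ((a.mul h2.prod_fst).congr_of_eventuallyEq h3)
  rw [wedge, h3.self_of_nhds, e]
  simp only [Function.comp]
  ring

lemma deriv_model {σ : ℂ × ℂ → ℂ} {t g z : ℂ} (hσ : AnalyticAt ℂ (fun ζ => σ (z, ζ)) 0) :
    AnalyticAt ℂ (fun ζ => t - 2 * Complex.I * z * ζ * (g + z * ζ * σ (z, ζ))) 0 ∧
    deriv (fun ζ => t - 2 * Complex.I * z * ζ * (g + z * ζ * σ (z, ζ))) 0
      = -2 * Complex.I * z * g ∧
    deriv (deriv (fun ζ => t - 2 * Complex.I * z * ζ * (g + z * ζ * σ (z, ζ)))) 0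
      = -4 * Complex.I * z ^ 2 * σ (z, 0) := by
  have h1 : ∀ᶠ ζ in 𝓝 0, HasDerivAt (fun ζ => t - 2 * Complex.I * z * ζ * (g + z * ζ * σ (z, ζ)))
      (-2 * Complex.I * z * g - 2 * Complex.I * z ^ 2 *
        (2 * ζ * σ (z, ζ) + ζ ^ 2 * deriv (fun ζ => σ (z, ζ)) ζ)) ζ := by
    filter_upwards [hσ.eventually_analyticAt] with ζ h
    have a := h.differentiableAt.hasDerivAt
    have b := ((hasDerivAt_id ζ).const_mul (2 * Complex.I * z)).mul
      (((hasDerivAt_id ζ).const_mul z).mul a |>.const_add g) |>.const_sub t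
    refine b.congr_deriv ?_
    simp
    ring
  have h2 : HasDerivAt (fun ζ => -2 * Complex.I * z * g - 2 * Complex.I * z ^ 2 *
        (2 * ζ * σ (z, ζ) + ζ ^ 2 * deriv (fun ζ => σ (z, ζ)) ζ))
        (-4 * Complex.I * z ^ 2 * σ (z, 0)) 0 := by
    have a := hσ.differentiableAt.hasDerivAt
    have b := hσ.deriv.differentiableAt.hasDerivAt
    have c := (((hasDerivAt_id (0 : ℂ)).const_mul 2).mul a).add (((hasDerivAt_id (0 : ℂ)).pow 2).mul b)
      |>.const_mul (2 * Complex.I * z ^ 2) |>.const_sub (-2 * Complex.I * z * g)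
    refine c.congr_deriv ?_
    simp
    ring
  refine ⟨AnalyticAt.fun_sub analyticAt_const (AnalyticAt.fun_mul (by fun_prop)
    (AnalyticAt.fun_add analyticAt_const (AnalyticAt.fun_mul (by fun_prop) hσ))), ?_, ?_⟩
  · rw [h1.self_of_nhds.deriv]
    ring
  · exact (h2.congr_of_eventuallyEq (h1.mono fun _ h => h.deriv)).deriv

/-- The third order term in `z` of the equation saying that the curves
`ζ ↦ κ (ζ, t - 2 i z ζ (g + z ζ σ (z, ζ)))` are integral curves of `ω'' = Φ (ζ, ω, ω')`. -/
lemma wedge_sub_thirdCoeff {κ : ℂ × ℂ → ℂ × ℂ} {t g : ℂ} (hg : g ≠ 0) {σ : ℂ × ℂ → ℂ}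
    (hκ : AnalyticAt ℂ κ (0, t)) (hσ : AnalyticAt ℂ σ 0) {θ : ℂ → ℂ → ℂ}
    (hθ : ∀ᶠ z in 𝓝 0, AnalyticAt ℂ (θ z) (κ (0, t)).1)
    (hrel : ∀ᶠ z in 𝓝 0, ∀ᶠ ζ in 𝓝 0,
      (κ (ζ, t - 2 * Complex.I * z * ζ * (g + z * ζ * σ (z, ζ)))).2
        = θ z (κ (ζ, t - 2 * Complex.I * z * ζ * (g + z * ζ * σ (z, ζ)))).1)
    {Φ : ℂ × ℂ × ℂ → ℂ} {ε : ℂ} (hε : deriv (θ 0) (κ (0, t)).1 = ε)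
    (hΦ : AnalyticAt ℂ Φ ((κ (0, t)).1, (κ (0, t)).2, ε))
    (hΦθ : ∀ᶠ z in 𝓝 0, deriv (deriv (θ z)) (κ (0, t)).1
      = Φ ((κ (0, t)).1, (κ (0, t)).2, deriv (θ z) (κ (0, t)).1))
    (hk : (fderiv ℂ κ (0, t) (1, 0)).1 ≠ 0) :
    wedge (deriv (fun s => κ (0, s)) t) (deriv (deriv (fun s => κ (0, s))) t)
      - thirdCoeff Φ ((κ (0, t)).1, (κ (0, t)).2, ε) (deriv (fun s => κ (0, s)) t)
      = deriv (fun z => σ (z, 0)) 0 / (2 * g ^ 3)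
        * wedge (fderiv ℂ κ (0, t) (1, 0)) (deriv (fun s => κ (0, s)) t) := by
  have hI := Complex.I_ne_zero
  have hI2 := Complex.I_sq
  -- derivatives of `s ↦ κ (0, s)`
  have hd1 : ∀ᶠ s in 𝓝 t, HasDerivAt (fun s => κ (0, s)) (fderiv ℂ κ (0, s) (0, 1)) s := by
    have ht : Tendsto (fun s : ℂ => ((0 : ℂ), s)) (𝓝 t) (𝓝 (0, t)) :=
      Continuous.tendsto' (by fun_prop) _ _ rfl
    filter_upwards [ht.eventually hκ.eventually_analyticAt] with s hs
    exact (HasFDerivAt.hasDerivAt_pair hs (hasDerivAt_const s (0 : ℂ)) (hasDerivAt_id s)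
      rfl).congr_deriv (by simp)
  have hd2 : HasDerivAt (fun s => fderiv ℂ κ (0, s) (0, 1))
      (fderiv ℂ (fun x => fderiv ℂ κ x (0, 1)) (0, t) (0, 1)) t :=
    (HasFDerivAt.hasDerivAt_pair (hκ.fderiv_apply (0, 1)) (hasDerivAt_const t (0 : ℂ))
      (hasDerivAt_id t) rfl).congr_deriv (by simp)
  have e1 := hd1.self_of_nhds.deriv
  have e2 := (hd2.congr_of_eventuallyEq (hd1.mono fun _ h => h.deriv)).deriv
  rw [e1, e2]
  set p := (κ (0, t)).1
  set q := (κ (0, t)).2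
  set γ₁ := fderiv ℂ κ (0, t) (0, 1)
  set γ₂ := fderiv ℂ (fun x => fderiv ℂ κ x (0, 1)) (0, t) (0, 1)
  set k := fderiv ℂ κ (0, t) (1, 0)
  set c₀ := fderiv ℂ (fun x => fderiv ℂ κ x (1, 0)) (0, t) (1, 0)
  set c₁ := fderiv ℂ (fun x => fderiv ℂ κ x (1, 0)) (0, t) (0, 1)
          + fderiv ℂ (fun x => fderiv ℂ κ x (0, 1)) (0, t) (1, 0)
  -- The Segre curve with parameter z, written in the coordinates κ, has at ζ = 0 the velocity k -
  -- 2izg γ₁. Here γ₁ is the velocity of the axis, and the unknown σ enters only through the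
  -- acceleration, along γ₁.
  have key : ∀ᶠ z in 𝓝 (0 : ℂ),
      (k + (-2 * Complex.I * z * g) • γ₁).2 = deriv (θ z) p * (k + (-2 * Complex.I * z * g) • γ₁).1 ∧
      wedge (k + (-2 * Complex.I * z * g) • γ₁) (c₀ + (-2 * Complex.I * z * g) • c₁
        + (-2 * Complex.I * z * g) ^ 2 • γ₂ + (-4 * Complex.I * z ^ 2 * σ (z, 0)) • γ₁)
        = (k + (-2 * Complex.I * z * g) • γ₁).1 ^ 3 * deriv (deriv (θ z)) p := by
    have ht : Tendsto (fun z : ℂ => (z, (0 : ℂ))) (𝓝 0) (𝓝 0) :=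
      Continuous.tendsto' (by fun_prop) _ _ rfl
    filter_upwards [hθ, hrel, ht.eventually hσ.eventually_analyticAt] with z h1 h2 h3
    obtain ⟨a1, a2, a3⟩ := deriv_model (σ := σ) (t := t) (g := g) (z := z)
      (h3.fun_comp_of_eq (by fun_prop) rfl)
    obtain ⟨b1, b2⟩ := hasDerivAt_twice hκ a1 (by simp)
    have b3 := wedge_eq_of_graph b1 b2 (by simpa using h1) h2
    simpa only [a2, a3, mul_zero, zero_mul, sub_zero] using b3
  have hkε : k.2 = ε * k.1 := by
    have := key.self_of_nhds.1
    simpa [hε] using this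
  -- substitute `z = i k.1 s / (2 g)`
  have ht : Tendsto (fun s : ℂ => Complex.I * k.1 * s / (2 * g)) (𝓝 0) (𝓝 0) :=
    Continuous.tendsto' (by fun_prop) _ _ (by simp)
  -- Now -2izg = k.1 s, and the velocity is k.1 times (1, ε) + s γ₁. After division by k.1³ the left
  -- side is the function of s whose third coefficient is `thirdCoeff`, and the right side is
  -- explicit up to the Taylor remainder of σ.
  have hh : ∀ᶠ s in 𝓝 (0 : ℂ), k.1 ^ 3 * ((1 + s * γ₁.1) ^ 3 *
      Φ (p, q, (ε + s * γ₁.2) / (1 + s * γ₁.1))) =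
      wedge (k + (k.1 * s) • γ₁) (c₀ + (k.1 * s) • c₁
        + (k.1 * s) ^ 2 • γ₂ + (Complex.I * k.1 ^ 2 * s ^ 2 / g ^ 2
          * σ (Complex.I * k.1 * s / (2 * g), 0)) • γ₁) := by
    have hne : ∀ᶠ s : ℂ in 𝓝 0, 1 + s * γ₁.1 ≠ 0 :=
      ContinuousAt.eventually_ne (by fun_prop) (by simp)
    filter_upwards [ht.eventually key, ht.eventually hΦθ, hne] with s h1 h2 h3
    have f1 : -2 * Complex.I * (Complex.I * k.1 * s / (2 * g)) * g = k.1 * s := by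
      field_simp
      linear_combination (-s) * hI2
    have f2 : -4 * Complex.I * (Complex.I * k.1 * s / (2 * g)) ^ 2 =
        Complex.I * k.1 ^ 2 * s ^ 2 / g ^ 2 := by
      field_simp
      linear_combination (-4 * s ^ 2) * hI2
    rw [f1, f2, h2] at h1
    obtain ⟨h4, h5⟩ := h1
    have f3 : (k + (k.1 * s) • γ₁).1 = k.1 * (1 + s * γ₁.1) := by
      simp; ring
    have f4 : (k + (k.1 * s) • γ₁).2 = k.1 * (ε + s * γ₁.2) := by
      simp [hkε]; ring
    have f5 : deriv (θ (Complex.I * k.1 * s / (2 * g))) p = (ε + s * γ₁.2) / (1 + s * γ₁.1) := by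
      rw [f3, f4] at h4
      rw [eq_div_iff h3]
      refine mul_left_cancel₀ hk ?_
      linear_combination -h4
    rw [h5, f5, f3]
    ring
  have hσ0 : AnalyticAt ℂ (fun z => σ (z, 0)) 0 := hσ.fun_comp_of_eq (by fun_prop) rfl
  set r : ℂ → ℂ := fun z => σ (z, 0) - (σ (0, 0) + z * deriv (fun z => σ (z, 0)) 0) with hr
  have hrO : r =O[𝓝 0] fun z => ‖z‖ ^ 2 := by
    refine (hσ0.sub_taylor_isBigO 2).congr_left fun z => ?_
    simp [hr, Finset.sum_range_succ]
  have hs : ∀ z, σ (z, 0) = σ (0, 0) + z * deriv (fun z => σ (z, 0)) 0 + r z := fun z => by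
    simp [hr]
  -- Coefficients of the right side. In degree three the σ-part is i/g² times the factor i/(2g) that
  -- comes from z, which gives -σ_z / (2 g³); the contribution of σ along γ₁ to `wedge` with γ₁
  -- itself vanishes.
  have hO := hΦ.thirdCoeff_eq γ₁ (a := fun j => if j = 0 then wedge k c₀ / k.1 ^ 3
    else if j = 1 then (wedge γ₁ c₀ + wedge k c₁) / k.1 ^ 2
    else if j = 2 then (wedge γ₁ c₁ + wedge k γ₂ + Complex.I / g ^ 2 * σ (0, 0) * wedge k γ₁) / k.1
    else wedge γ₁ γ₂ - deriv (fun z => σ (z, 0)) 0 / (2 * g ^ 3) * wedge k γ₁) ?_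
  · simp at hO
    rw [hO]
    ring
  · have hb : (fun s : ℂ => s ^ 2 * (Complex.I / (g ^ 2 * k.1) * wedge k γ₁ *
        r (Complex.I * k.1 * s / (2 * g)))) =O[𝓝 0] fun s => ‖s‖ ^ 4 := by
      have h1 : (fun s : ℂ => r (Complex.I * k.1 * s / (2 * g))) =O[𝓝 0] fun s => ‖s‖ ^ 2 := by
        refine (hrO.comp_tendsto ht).trans ?_
        have : (fun s : ℂ => ‖Complex.I * k.1 * s / (2 * g)‖ ^ 2)
            = fun s => ‖Complex.I * k.1 / (2 * g)‖ ^ 2 * ‖s‖ ^ 2 := by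
          ext s
          rw [← mul_pow, ← norm_mul]
          ring_nf
        change (fun s : ℂ => ‖Complex.I * k.1 * s / (2 * g)‖ ^ 2) =O[𝓝 0] _
        rw [this]
        exact Asymptotics.isBigO_const_mul_self _ _ _
      have h2 : (fun s : ℂ => s ^ 2) =O[𝓝 0] fun s => ‖s‖ ^ 2 := by
        exact Asymptotics.isBigO_of_le _ fun s => by simp
      refine (h2.mul (h1.const_mul_left (Complex.I / (g ^ 2 * k.1) * wedge k γ₁))).congr_right ?_
      intro s
      ring
    refine hb.congr' ?_ EventuallyEq.rfl
    filter_upwards [hh] with s h1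
    have : (1 + s * γ₁.1) ^ 3 * Φ (p, q, (ε + s * γ₁.2) / (1 + s * γ₁.1)) =
      wedge (k + (k.1 * s) • γ₁) (c₀ + (k.1 * s) • c₁
        + (k.1 * s) ^ 2 • γ₂ + (Complex.I * k.1 ^ 2 * s ^ 2 / g ^ 2
          * σ (Complex.I * k.1 * s / (2 * g), 0)) • γ₁) / k.1 ^ 3 := by
      rw [← h1]
      field_simp
    rw [this, hs]
    simp only [wedge, Finset.sum_range_succ, Finset.sum_range_zero, smul_eq_mul, Prod.fst_add,
      Prod.snd_add, Prod.smul_fst, Prod.smul_snd]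
    norm_num
    field_simp
    ring_nf
    simp only [hI2]
    ring

/-- In coordinates `K` in which the Segre function has the form
`w - 2 i z ζ (g + z ζ σ)`, the curve `z = 0` is a chain if and only if `σ_z (0, 0, w) = 0`. -/
theorem IsPullback.chain_iff {Θ Θ' Φ : ℂ × ℂ × ℂ → ℂ} (hΘ : IsSegreFunction Θ)
    (hΦ : AnalyticAt ℂ Φ 0)
    (hΦΘ : ∀ᶠ x in 𝓝 0, segreSlope (segreSlope Θ) x = Φ (x.1, Θ x, segreSlope Θ x))
    {K : ℂ × ℂ → ℂ × ℂ} (hK : AnalyticAt ℂ K 0) (hK0 : K 0 = 0)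
    (hKd : HasFDerivAt K (ContinuousLinearMap.id ℂ (ℂ × ℂ)) 0)
    (hpb : IsPullback Θ K Θ') {g : ℂ → ℂ} {σ : ℂ × ℂ × ℂ → ℂ} (hg : AnalyticAt ℂ g 0) (hg0 : g 0 ≠ 0)
    (hσ : AnalyticAt ℂ σ 0)
    (hΘ' : ∀ᶠ x in 𝓝 (0 : ℂ × ℂ × ℂ), Θ' x =
      x.2.2 - 2 * Complex.I * x.2.1 * x.1 * (g x.2.2 + x.2.1 * x.1 * σ (x.2.1, x.1, x.2.2))) :
    ∀ᶠ t in 𝓝 (0 : ℂ), wedge (deriv (conjMap fun t => K (0, t)) t)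
        (deriv (deriv (conjMap fun t => K (0, t))) t) =
      thirdCoeff Φ ((conjMap K (0, t)).1, (conjMap K (0, t)).2,
        segreSlope Θ ((conjMap K (0, t)).1, K (0, t))) (deriv (conjMap fun t => K (0, t)) t) ↔
      deriv (fun z => σ (z, 0, t)) 0 = 0 := by
  have hc := hK.analyticAt_conjMap
  have hc0 : conjMap K 0 = 0 := by simp [conjMap, hK0]
  have hcd := hasFDerivAt_conjMap_id hKd
  have ht0 : Tendsto (fun t : ℂ => ((0 : ℂ), t)) (𝓝 0) (𝓝 0) :=
    Continuous.tendsto' (by fun_prop) _ _ rfl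
  have hcurve : (conjMap fun t => K (0, t)) = fun t => conjMap K (0, t) := by
    ext t <;> simp [conjMap, Prod.star_def]
  rw [hcurve]
  have hpt : ContinuousAt (fun x : ℂ × ℂ × ℂ => ((conjMap K (x.1, x.2.2)).1, K x.2)) 0 := by
    refine ContinuousAt.prodMk (continuous_fst.continuousAt.comp ?_) ?_
    · exact hc.continuousAt.comp_of_eq (by fun_prop) rfl
    · exact hK.continuousAt.comp_of_eq (by fun_prop) rfl
  have hpt' : Tendsto (fun x : ℂ × ℂ × ℂ => ((conjMap K (x.1, x.2.2)).1, K x.2)) (𝓝 0) (𝓝 0) := by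
    refine hpt.tendsto.trans (le_of_eq ?_)
    have e : conjMap K (0, 0) = 0 := hc0
    simp [e, hK0]
  have hΘ'c : ContinuousAt Θ' 0 := by
    have hg' : AnalyticAt ℂ (fun x : ℂ × ℂ × ℂ => g x.2.2) 0 := hg.fun_comp_of_eq (by fun_prop) rfl
    have hσ' : AnalyticAt ℂ (fun x : ℂ × ℂ × ℂ => σ (x.2.1, x.1, x.2.2)) 0 :=
      hσ.fun_comp_of_eq (by fun_prop) rfl
    have : AnalyticAt ℂ (fun x : ℂ × ℂ × ℂ => x.2.2 - 2 * Complex.I * x.2.1 * x.1 *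
      (g x.2.2 + x.2.1 * x.1 * σ (x.2.1, x.1, x.2.2))) 0 := by fun_prop
    exact this.continuousAt.congr (hΘ'.mono fun _ h => h.symm)
  -- the relation defining the pullback
  have hrel : ∀ᶠ x in 𝓝 (0 : ℂ × ℂ × ℂ),
      (conjMap K (x.1, Θ' x)).2 = Θ ((conjMap K (x.1, Θ' x)).1, K x.2) := by
    have ht : Tendsto (fun x : ℂ × ℂ × ℂ => ((x.2, (x.1, Θ' x)) : (ℂ × ℂ) × ℂ × ℂ)) (𝓝 0) (𝓝 0) := by
      have : ContinuousAt (fun x : ℂ × ℂ × ℂ => ((x.2, (x.1, Θ' x)) : (ℂ × ℂ) × ℂ × ℂ)) 0 := by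
        fun_prop
      refine this.tendsto.trans (le_of_eq ?_)
      simp [hΘ'.self_of_nhds]
    filter_upwards [ht.eventually hpb] with x hx using hx.2 rfl
  have hin : Tendsto (fun t : ℂ => ((0 : ℂ), (0 : ℂ), t)) (𝓝 0) (𝓝 0) :=
    Continuous.tendsto' (by fun_prop) _ _ rfl
  have hk1 : AnalyticAt ℂ (fun t : ℂ => fderiv ℂ (conjMap K) (0, t) (1, 0)) 0 :=
    (hc.fderiv_apply (1, 0)).fun_comp_of_eq (by fun_prop) rfl
  have hk2 : AnalyticAt ℂ (fun t : ℂ => fderiv ℂ (conjMap K) (0, t) (0, 1)) 0 :=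
    (hc.fderiv_apply (0, 1)).fun_comp_of_eq (by fun_prop) rfl
  have hf0 : fderiv ℂ (conjMap K) (0, 0) = ContinuousLinearMap.id ℂ (ℂ × ℂ) := hcd.fderiv
  have hk1ne : ∀ᶠ t in 𝓝 (0 : ℂ), (fderiv ℂ (conjMap K) (0, t) (1, 0)).1 ≠ 0 :=
    (continuous_fst.continuousAt.comp hk1.continuousAt).eventually_ne (by simp [hf0])
  have hwne : ∀ᶠ t in 𝓝 (0 : ℂ), wedge (fderiv ℂ (conjMap K) (0, t) (1, 0))
      (fderiv ℂ (conjMap K) (0, t) (0, 1)) ≠ 0 := by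
    have : AnalyticAt ℂ (fun t => wedge (fderiv ℂ (conjMap K) (0, t) (1, 0))
      (fderiv ℂ (conjMap K) (0, t) (0, 1))) 0 := by
      unfold wedge
      fun_prop
    exact this.continuousAt.eventually_ne (by simp [hf0, wedge])
  have hslope : Tendsto (fun x : ℂ × ℂ × ℂ => ((conjMap K (0, x.2.2)).1, (conjMap K (0, x.2.2)).2,
      segreSlope Θ ((conjMap K (0, x.2.2)).1, K x.2))) (𝓝 0) (𝓝 0) := by
    have h1 : ContinuousAt (fun x : ℂ × ℂ × ℂ => conjMap K (0, x.2.2)) 0 :=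
      hc.continuousAt.comp_of_eq (by fun_prop) rfl
    have h2 : ContinuousAt (fun x : ℂ × ℂ × ℂ => K x.2) 0 :=
      hK.continuousAt.comp_of_eq (by fun_prop) rfl
    have e : conjMap K (0, 0) = 0 := hc0
    have e' : segreSlope Θ (0, 0) = 0 := hΘ.segreSlope_zero
    have h3 : ContinuousAt (fun x : ℂ × ℂ × ℂ =>
        segreSlope Θ ((conjMap K (0, x.2.2)).1, K x.2)) 0 :=
      hΘ.analyticAt.analyticAt_segreSlope.continuousAt.comp_of_eq
        ((continuous_fst.continuousAt.comp h1).prodMk h2) (by simp [e, hK0])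
    refine ((continuous_fst.continuousAt.comp h1).prodMk
      ((continuous_snd.continuousAt.comp h1).prodMk h3)).tendsto.trans (le_of_eq ?_)
    simp [e, hK0, e']
  filter_upwards [hin.eventually hrel.eventually_nhds, hin.eventually hΘ'.eventually_nhds,
    hin.eventually (hpt'.eventually hΘ.analyticAt.eventually_analyticAt).eventually_nhds,
    hin.eventually (hpt'.eventually hΦΘ).eventually_nhds,
    hin.eventually hσ.eventually_analyticAt,
    ht0.eventually hc.eventually_analyticAt, hg.continuousAt.eventually_ne hg0, hk1ne, hwne,
    hin.eventually (hslope.eventually hΦ.eventually_analyticAt),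
    hin.eventually (hpt'.eventually hΘ.analyticAt.eventually_analyticAt)]
    with t h1 h2 h3 h4 h5 h6 h7 h8 h9 h10 h11
  have hz : Tendsto (fun z : ℂ => ((0 : ℂ), z, t)) (𝓝 0) (𝓝 (0, 0, t)) :=
    Continuous.tendsto' (by fun_prop) _ _ rfl
  have hd : ∀ z, AnalyticAt ℂ Θ ((conjMap K (0, t)).1, K (z, t)) →
      deriv (fun ζ => Θ (ζ, K (z, t))) (conjMap K (0, t)).1
        = segreSlope Θ ((conjMap K (0, t)).1, K (z, t)) := fun z h =>
    h.hasDerivAt_segreSlope.deriv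
  -- For fixed t the conjugate of K carries the curve ω = Θ'(ζ, z, t) into the Segre curve of Θ with
  -- parameter K(z, t). At ζ = 0 all of these curves pass through the same point, the conjugate of
  -- the axis at t.
  have hmain := wedge_sub_thirdCoeff (κ := conjMap K) (t := t) (g := g t) h7
    (σ := fun y => σ (y.1, y.2, t)) h6 (h5.fun_comp_of_eq (by fun_prop) rfl)
    (θ := fun z ζ => Θ (ζ, K (z, t)))
    (by
      filter_upwards [hz.eventually h3] with z hz3
      exact hz3.fun_comp_of_eq (by fun_prop) rfl)
    (by
      have hzζ : Tendsto (fun y : ℂ × ℂ => (y.2, y.1, t)) (𝓝 (0, 0)) (𝓝 (0, 0, t)) :=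
        Continuous.tendsto' (by fun_prop) _ _ rfl
      have := (hzζ.eventually (h1.and h2))
      rw [nhds_prod_eq] at this
      filter_upwards [this.curry] with z hz1
      filter_upwards [hz1] with ζ hz2
      have e := hz2.1
      rw [hz2.2] at e
      exact e)
    (Φ := Φ) (ε := segreSlope Θ ((conjMap K (0, t)).1, K (0, t)))
    (hd 0 h11) h10
    (by
      filter_upwards [hz.eventually h1, hz.eventually h2, hz.eventually h3, hz.eventually h4]
        with z h1 h2 h3 h4
      simp only [mul_zero, zero_mul, sub_zero] at h2
      simp only [h2] at h1
      have hl : Tendsto (fun ζ : ℂ => (ζ, K (z, t))) (𝓝 (conjMap K (0, t)).1)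
          (𝓝 ((conjMap K (0, t)).1, K (z, t))) := Continuous.tendsto' (by fun_prop) _ _ rfl
      have e : deriv (fun ζ => Θ (ζ, K (z, t))) =ᶠ[𝓝 (conjMap K (0, t)).1]
          fun ζ => segreSlope Θ (ζ, K (z, t)) :=
        (hl.eventually h3.eventually_analyticAt).mono fun ζ h => h.hasDerivAt_segreSlope.deriv
      rw [e.deriv_eq, hd z h3, h1, ← h4]
      exact h3.analyticAt_segreSlope.hasDerivAt_segreSlope.deriv)
    h8
  have e3 : deriv (fun s => conjMap K (0, s)) t = fderiv ℂ (conjMap K) (0, t) (0, 1) :=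
    ((HasFDerivAt.hasDerivAt_pair h6 (hasDerivAt_const t (0 : ℂ)) (hasDerivAt_id t)
      rfl).congr_deriv (by simp)).deriv
  rw [← sub_eq_zero, hmain, e3, mul_eq_zero, or_iff_left h9, div_eq_zero_iff,
    or_iff_left (by simpa using h7)]


/-! ### Reality conditions on the coefficients -/

lemma eventually_eq_zero_of_mul_mul {𝕜 E : Type*} [RCLike 𝕜] [NormedAddCommGroup E]
    [NormedSpace 𝕜 E] {H : 𝕜 × 𝕜 × E → 𝕜} (hH : AnalyticAt 𝕜 H 0)
    (h : ∀ᶠ x in 𝓝 (0 : 𝕜 × 𝕜 × E), x.1 * x.2.1 * H x = 0) : ∀ᶠ x in 𝓝 0, H x = 0 := by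
  have h1 : ∀ᶠ x in 𝓝 (0 : 𝕜 × 𝕜 × E), x.2.1 * H x = 0 := by
    refine eventually_eq_zero_of_smul (y₀ := (0 : 𝕜 × E)) (H := fun x => x.2.1 * H x) ?_ ?_
    · exact AnalyticAt.fun_mul (by fun_prop) hH
    · filter_upwards [h] with x hx
      rw [smul_eq_mul, ← mul_assoc, hx]
  have hs : Tendsto (fun x : 𝕜 × 𝕜 × E => (x.2.1, x.1, x.2.2)) (𝓝 0) (𝓝 0) :=
    Continuous.tendsto' (by fun_prop) _ _ rfl
  have h2 : ∀ᶠ x in 𝓝 (0 : 𝕜 × 𝕜 × E), H (x.2.1, x.1, x.2.2) = 0 := by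
    refine eventually_eq_zero_of_smul (y₀ := (0 : 𝕜 × E)) (H := fun x => H (x.2.1, x.1, x.2.2)) ?_ ?_
    · exact hH.fun_comp_of_eq (by fun_prop) rfl
    · filter_upwards [hs.eventually h1] with x hx using hx
  filter_upwards [hs.eventually h2] with x hx using hx

lemma tendsto_graph {Θ : ℂ × ℂ × ℂ → ℂ} (h : ContinuousAt Θ 0) (h0 : Θ 0 = 0) :
    Tendsto (fun x : ℂ × ℂ × ℂ => ((x.2, (x.1, Θ x)) : (ℂ × ℂ) × ℂ × ℂ)) (𝓝 0) (𝓝 0) := by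
  have : ContinuousAt (fun x : ℂ × ℂ × ℂ => ((x.2, (x.1, Θ x)) : (ℂ × ℂ) × ℂ × ℂ)) 0 := by
    fun_prop
  refine this.tendsto.trans (le_of_eq ?_)
  simp [h0]

/-- A Segre function with `Θ (0, z, w) = w` and `Θ_ζ (0, z, w) = -2 i z g (w)`. -/
lemma IsSegreFunction.exists_form {Θ : ℂ × ℂ × ℂ → ℂ} (h : IsSegreFunction Θ)
    (h0 : ∀ᶠ x in 𝓝 (0 : ℂ × ℂ × ℂ), Θ (0, x.2) = x.2.2) {g : ℂ → ℂ} (hg : AnalyticAt ℂ g 0)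
    (h1 : ∀ᶠ x in 𝓝 (0 : ℂ × ℂ × ℂ), segreSlope Θ (0, x.2) = -2 * Complex.I * x.2.1 * g x.2.2) :
    (∀ᶠ t in 𝓝 0, star (g (star t)) = g t) ∧ ∃ σ : ℂ × ℂ × ℂ → ℂ, AnalyticAt ℂ σ 0 ∧
      ∀ᶠ x in 𝓝 (0 : ℂ × ℂ × ℂ), Θ x = x.2.2 -
        2 * Complex.I * x.2.1 * x.1 * (g x.2.2 + x.2.1 * x.1 * σ (x.2.1, x.1, x.2.2)) := by
  have hI := Complex.I_ne_zero
  have hI2 := Complex.I_sq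
  have htg := tendsto_graph h.analyticAt.continuousAt h.zero
  have hstar : Tendsto (fun x : ℂ × ℂ × ℂ => star x) (𝓝 0) (𝓝 0) :=
    Continuous.tendsto' (by fun_prop) _ _ (by simp)
  -- Reality exchanges the conditions on ζ = 0 and z = 0. Hence Θ - w vanishes on both and is
  -- divisible by zζ.
  have hz0 : ∀ᶠ x in 𝓝 (0 : ℂ × ℂ × ℂ), Θ (x.1, 0, x.2.2) = x.2.2 := by
    have ht1 : Tendsto (fun x : ℂ × ℂ × ℂ => (((0, x.2.2), (x.1, x.2.2)) : (ℂ × ℂ) × ℂ × ℂ))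
      (𝓝 0) (𝓝 0) := Continuous.tendsto' (by fun_prop) _ _ rfl
    have ht2 : Tendsto (fun x : ℂ × ℂ × ℂ => ((0 : ℂ), star x.1, star x.2.2)) (𝓝 0) (𝓝 0) :=
      Continuous.tendsto' (by fun_prop) _ _ (by simp)
    filter_upwards [ht1.eventually h.symm, ht2.eventually h0] with x h2 h3
    refine (h2.2 ?_).symm
    have e : (star ((0 : ℂ), x.2.2)).1 = 0 := by simp
    rw [e]
    exact h3.symm
  have hfa : AnalyticAt ℂ (fun x : ℂ × ℂ × ℂ => Θ x - x.2.2) 0 :=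
    h.analyticAt.fun_sub (by fun_prop)
  obtain ⟨G, hG, hGe⟩ := hfa.exists_eq_mul_mul (by
    filter_upwards [h0] with x hx
    exact sub_eq_zero.2 hx) (by
    filter_upwards [hz0] with x hx
    exact sub_eq_zero.2 hx)
  -- `G (0, z, w) = - 2 i g (w)`
  have hG0 : ∀ᶠ x in 𝓝 (0 : ℂ × ℂ × ℂ), G (0, x.2) + 2 * Complex.I * g x.2.2 = 0 := by
    have hgx : AnalyticAt ℂ (fun x : ℂ × ℂ × ℂ => g x.2.2) 0 := hg.fun_comp_of_eq (by fun_prop) rfl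
    have hGx : AnalyticAt ℂ (fun x : ℂ × ℂ × ℂ => G (0, x.2)) 0 := hG.fun_comp_of_eq (by fun_prop) rfl
    have hHx : AnalyticAt ℂ (fun x : ℂ × ℂ × ℂ => G (0, x.2) + 2 * Complex.I * g x.2.2) 0 := by
      fun_prop
    have hp : Tendsto (fun x : ℂ × ℂ × ℂ => ((0 : ℂ), x.2)) (𝓝 0) (𝓝 0) :=
      Continuous.tendsto' (by fun_prop) _ _ rfl
    refine eventually_eq_zero_of_mul_mul hHx ?_
    filter_upwards [h1, hp.eventually h.analyticAt.eventually_analyticAt,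
      hp.eventually hGe.eventually_nhds, hp.eventually hG.eventually_analyticAt] with x h2 h3 h4 h5
    have a := h3.hasDerivAt_segreSlope
    have l : HasDerivAt (fun ζ : ℂ => (ζ, x.2)) ((1 : ℂ), ((0 : ℂ), (0 : ℂ))) 0 :=
      (hasDerivAt_id _).prodMk (hasDerivAt_const _ _)
    have b := HasFDerivAt.comp_hasDerivAt (0 : ℂ) h5.differentiableAt.hasFDerivAt l
    have c := ((hasDerivAt_id (0 : ℂ)).mul_const x.2.1).mul b |>.const_add x.2.2
    have ht : Tendsto (fun ζ : ℂ => (ζ, x.2)) (𝓝 0) (𝓝 (0, x.2)) :=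
      Continuous.tendsto' (by fun_prop) _ _ rfl
    have d := a.unique (c.congr_of_eventuallyEq (by
      filter_upwards [ht.eventually h4] with ζ hζ
      simp only [Pi.mul_apply, Function.comp, id]
      linear_combination hζ))
    rw [h2] at d
    simp at d
    linear_combination -x.1 * d
  -- the symmetry of `G`
  have hGc := hG.analyticAt_conjMap
  have hsymm : ∀ᶠ x in 𝓝 (0 : ℂ × ℂ × ℂ), G x + conjMap G (x.2.1, x.1, Θ x) = 0 := by
    have hΘa := h.analyticAt
    have hHx : AnalyticAt ℂ (fun x : ℂ × ℂ × ℂ => G x + conjMap G (x.2.1, x.1, Θ x)) 0 :=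
      hG.fun_add (hGc.fun_comp_of_eq (by fun_prop) (by simp [h.zero]))
    refine eventually_eq_zero_of_mul_mul hHx ?_
    have ht3 : Tendsto (fun x : ℂ × ℂ × ℂ => (star x.2.1, star x.1, star (Θ x))) (𝓝 0) (𝓝 0) := by
      have := hΘa.continuousAt
      have : ContinuousAt (fun x : ℂ × ℂ × ℂ => (star x.2.1, star x.1, star (Θ x))) 0 := by fun_prop
      refine this.tendsto.trans (le_of_eq ?_)
      simp [h.zero]
    filter_upwards [htg.eventually h.symm, hGe, ht3.eventually hGe] with x h2 h3 h4
    have h5 := h2.1 rfl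
    have h6 : x.2.2 = Θ x + x.2.1 * x.1 * conjMap G (x.2.1, x.1, Θ x) := by
      have e : (star x.2).2 - star (Θ x) = star x.2.1 * star x.1 * G (star x.2.1, star x.1, star (Θ x)) := by
        rw [h5]
        exact h4
      have e2 := congrArg star e
      simp only [star_sub, star_mul', star_star] at e2
      have e3 : star (star x.2).2 = x.2.2 := by simp
      rw [e3] at e2
      have e4 : conjMap G (x.2.1, x.1, Θ x) = star (G (star x.2.1, star x.1, star (Θ x))) := rfl
      rw [e4]
      linear_combination e2
    linear_combination -h3 - h6
  -- On z = 0, where Θ = w, the symmetry of G expresses G(ζ, 0, w) by the conjugate of g. Comparison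
  -- with G(0, z, w) at z = ζ = 0 shows that g is real, and then G + 2ig is again divisible by zζ.
  have hG1 : ∀ᶠ x in 𝓝 (0 : ℂ × ℂ × ℂ), G (x.1, 0, x.2.2) + 2 * Complex.I * star (g (star x.2.2)) = 0 := by
    have hp : Tendsto (fun x : ℂ × ℂ × ℂ => (x.1, (0 : ℂ), x.2.2)) (𝓝 0) (𝓝 0) :=
      Continuous.tendsto' (by fun_prop) _ _ rfl
    have hp2 : Tendsto (fun x : ℂ × ℂ × ℂ => ((0 : ℂ), star x.1, star x.2.2)) (𝓝 0) (𝓝 0) :=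
      Continuous.tendsto' (by fun_prop) _ _ (by simp)
    filter_upwards [hp.eventually hsymm, hz0, hp2.eventually hG0] with x h2 h3 h4
    rw [h3] at h2
    have e : conjMap G (0, x.1, x.2.2) = star (G (0, star x.1, star x.2.2)) := by
      simp [conjMap, Prod.star_def]
    rw [e] at h2
    have e2 := congrArg star h4
    simp only [star_add, star_mul', star_zero] at e2
    have e3 : star (2 : ℂ) = 2 := Complex.conj_ofNat 2
    have e4 : star Complex.I = -Complex.I := Complex.conj_I
    rw [e3, e4] at e2
    linear_combination h2 - e2
  have hgs : ∀ᶠ t in 𝓝 (0 : ℂ), star (g (star t)) = g t := by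
    have hp : Tendsto (fun t : ℂ => ((0 : ℂ), (0 : ℂ), t)) (𝓝 0) (𝓝 0) :=
      Continuous.tendsto' (by fun_prop) _ _ rfl
    filter_upwards [hp.eventually hG0, hp.eventually hG1] with t h2 h3
    have e : 2 * Complex.I * (star (g (star t)) - g t) = 0 := by linear_combination h3 - h2
    simpa [sub_eq_zero] using e
  refine ⟨hgs, ?_⟩
  have hgx : AnalyticAt ℂ (fun x : ℂ × ℂ × ℂ => g x.2.2) 0 := hg.fun_comp_of_eq (by fun_prop) rfl
  have hHx : AnalyticAt ℂ (fun x : ℂ × ℂ × ℂ => G x + 2 * Complex.I * g x.2.2) 0 := by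
      fun_prop
  have hw : Tendsto (fun x : ℂ × ℂ × ℂ => x.2.2) (𝓝 0) (𝓝 0) :=
    Continuous.tendsto' (by fun_prop) _ _ rfl
  obtain ⟨S, hS, hSe⟩ := hHx.exists_eq_mul_mul hG0 (by
    filter_upwards [hG1, hw.eventually hgs] with x h2 h3
    rw [← h3]
    exact h2)
  refine ⟨fun y => Complex.I / 2 * S (y.2.1, y.1, y.2.2), ?_, ?_⟩
  · exact analyticAt_const.fun_mul (hS.fun_comp_of_eq (by fun_prop) rfl)
  · filter_upwards [hGe, hSe] with x h2 h3
    linear_combination h2 + x.1 * x.2.1 * h3 + x.1 ^ 2 * x.2.1 ^ 2 * S x * hI2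

/-- The first order term in `ζ` of the equation of a pullback. -/
lemma IsPullback.slope_eq {Θ Θ' : ℂ × ℂ × ℂ → ℂ} (hΘ : IsSegreFunction Θ) (hΘ' : IsSegreFunction Θ')
    {K : ℂ × ℂ → ℂ × ℂ} (hK : AnalyticAt ℂ K 0) (hK0 : K 0 = 0) (hpb : IsPullback Θ K Θ')
    (h0 : ∀ᶠ x in 𝓝 (0 : ℂ × ℂ × ℂ), Θ' (0, x.2) = x.2.2) :
    ∀ᶠ x in 𝓝 (0 : ℂ × ℂ), (conjMap K (0, x.2)).2 = Θ ((conjMap K (0, x.2)).1, K x) ∧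
      (fderiv ℂ (conjMap K) (0, x.2) (1, 0)
        + segreSlope Θ' (0, x) • fderiv ℂ (conjMap K) (0, x.2) (0, 1)).2 =
      segreSlope Θ ((conjMap K (0, x.2)).1, K x) * (fderiv ℂ (conjMap K) (0, x.2) (1, 0)
        + segreSlope Θ' (0, x) • fderiv ℂ (conjMap K) (0, x.2) (0, 1)).1 := by
  have hc := hK.analyticAt_conjMap
  have hc0 : conjMap K 0 = 0 := by simp [conjMap, hK0]
  have hrel : ∀ᶠ x in 𝓝 (0 : ℂ × ℂ × ℂ),
      (conjMap K (x.1, Θ' x)).2 = Θ ((conjMap K (x.1, Θ' x)).1, K x.2) := by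
    filter_upwards [(tendsto_graph hΘ'.analyticAt.continuousAt hΘ'.zero).eventually hpb] with x hx
    exact hx.2 rfl
  have hin : Tendsto (fun x : ℂ × ℂ => ((0 : ℂ), x)) (𝓝 0) (𝓝 0) :=
    Continuous.tendsto' (by fun_prop) _ _ rfl
  have hin2 : Tendsto (fun x : ℂ × ℂ => ((0 : ℂ), x.2)) (𝓝 0) (𝓝 0) :=
    Continuous.tendsto' (by fun_prop) _ _ rfl
  have hpt : Tendsto (fun x : ℂ × ℂ => ((conjMap K (0, x.2)).1, K x)) (𝓝 0) (𝓝 0) := by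
    have h1 : ContinuousAt (fun x : ℂ × ℂ => conjMap K (0, x.2)) 0 :=
      hc.continuousAt.comp_of_eq (by fun_prop) rfl
    refine ((continuous_fst.continuousAt.comp h1).prodMk hK.continuousAt).tendsto.trans
      (le_of_eq ?_)
    have e : conjMap K (0, 0) = 0 := hc0
    simp [e, hK0]
  filter_upwards [hin.eventually h0, hin.eventually hrel.eventually_nhds,
    hin.eventually hΘ'.analyticAt.eventually_analyticAt, hin2.eventually hc.eventually_analyticAt,
    hpt.eventually hΘ.analyticAt.eventually_analyticAt] with x h1 h2 h3 h4 h5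
  have hT0 : Θ' (0, x) = x.2 := h1
  have hl : Tendsto (fun ζ : ℂ => (ζ, x)) (𝓝 0) (𝓝 (0, x)) :=
    Continuous.tendsto' (by fun_prop) _ _ rfl
  have h6 := h2.self_of_nhds
  simp only [hT0] at h6
  refine ⟨h6, ?_⟩
  have a := HasFDerivAt.hasDerivAt_pair (x := (0, x.2)) h4 (hasDerivAt_id (0 : ℂ))
    h3.hasDerivAt_segreSlope (by simp [hT0])
  rw [one_smul] at a
  have h5' : HasDerivAt (fun ζ => Θ (ζ, K x)) (segreSlope Θ ((conjMap K (0, x.2)).1, K x))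
      (conjMap K (id 0, Θ' (0, x))).1 := by
    have := h5.hasDerivAt_segreSlope
    simpa only [id, hT0] using this
  have b := h5'.comp (0 : ℂ) a.prod_fst
  exact a.prod_snd.unique (b.congr_of_eventuallyEq (hl.eventually h2))


/-- Taylor's formula of order four with a remainder analytic in both variables. -/
lemma AnalyticAt.exists_taylor_shift {f : ℂ → ℂ} (hf : AnalyticAt ℂ f 0) :
    ∃ r : ℂ × ℂ → ℂ, AnalyticAt ℂ r 0 ∧ ∀ᶠ x in 𝓝 (0 : ℂ × ℂ), f (x.2 + x.1) =
      f x.2 + x.1 * deriv f x.2 + x.1 ^ 2 * (deriv (deriv f) x.2 / 2)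
        + x.1 ^ 3 * (deriv (deriv (deriv f)) x.2 / 6) + x.1 ^ 4 * r x := by
  have h1 : AnalyticAt ℂ (fun x : ℂ × ℂ => f (x.2 + x.1)) (0, 0) :=
    hf.fun_comp_of_eq (by fun_prop) (by simp)
  obtain ⟨a, r, ha, hr, -, -, h⟩ := h1.exists_taylor 4
  have hw : ∀ᶠ w in 𝓝 (0 : ℂ), ∀ k < 4, iteratedDeriv k f w / k.factorial = a k w := by
    have hin : Tendsto (fun w : ℂ => ((0 : ℂ), w)) (𝓝 0) (𝓝 (0, 0)) :=
      Continuous.tendsto' (by fun_prop) _ _ rfl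
    filter_upwards [hin.eventually h.eventually_nhds, hin.eventually hr.eventually_analyticAt,
      hin.eventually h1.eventually_analyticAt] with w h2 h3 h4 k hk
    have hl : AnalyticAt ℂ (fun δ : ℂ => (δ, w)) 0 := by fun_prop
    have h5 : AnalyticAt ℂ (fun δ : ℂ => f (w + δ)) 0 := h4.fun_comp_of_eq hl rfl
    have h6 : (fun δ : ℂ => f (w + δ) - ∑ k ∈ Finset.range 4, δ ^ k • a k w) =O[𝓝 0]
        fun δ => ‖δ‖ ^ 4 := by
      have h7 : (fun δ : ℂ => δ ^ 4 • r (δ, w)) =O[𝓝 0] fun δ => ‖δ‖ ^ 4 := by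
        have h8 : (fun δ : ℂ => r (δ, w)) =O[𝓝 0] fun _ => (1 : ℝ) :=
          (h3.fun_comp_of_eq hl rfl).continuousAt.isBigO_one ℝ
        have h9 : (fun δ : ℂ => δ ^ 4) =O[𝓝 0] fun δ => ‖δ‖ ^ 4 :=
          Asymptotics.isBigO_of_le _ fun s => by simp
        simpa using h9.smul h8
      refine h7.congr' ?_ EventuallyEq.rfl
      filter_upwards [hl.continuousAt.eventually h2] with δ h8
      rw [h8]
      ring
    have h7 := h5.iteratedDeriv_eq_of_isBigO h6 hk
    rw [← h7, iteratedDeriv_comp_const_add]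
    simp
  refine ⟨r, hr, ?_⟩
  have ht : Tendsto (fun x : ℂ × ℂ => x.2) (𝓝 0) (𝓝 0) := Continuous.tendsto' (by fun_prop) _ _ rfl
  filter_upwards [h, ht.eventually hw] with x h2 h3
  rw [h2]
  have e0 := h3 0 (by norm_num)
  have e1 := h3 1 (by norm_num)
  have e2 := h3 2 (by norm_num)
  have e3 := h3 3 (by norm_num)
  simp only [iteratedDeriv_succ, iteratedDeriv_zero] at e0 e1 e2 e3
  simp only [Finset.sum_range_succ, Finset.sum_range_zero, ← e0, ← e1, ← e2, ← e3, smul_eq_mul]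
  norm_num [Nat.factorial]

/-- The monomials 1 and zζ are independent modulo the ideal (z², ζ²): the value at 0 gives α = 0,
and on the lines ζ = ±z the limits give ±β = D(0) + E(0), so β = 0. This separates the coefficients
to be normalized from those that may stay. -/
lemma eq_zero_of_quadratic {α β : ℂ} {D E : ℂ × ℂ → ℂ} (hD : ContinuousAt D 0)
    (hE : ContinuousAt E 0)
    (h : ∀ᶠ x in 𝓝 (0 : ℂ × ℂ), α + x.1 * x.2 * β = x.1 ^ 2 * D x + x.2 ^ 2 * E x) :
    α = 0 ∧ β = 0 := by
  have hα : α = 0 := by simpa using h.self_of_nhds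
  subst hα
  have key : ∀ l : ℂ, l ^ 2 = 1 → l * β = D 0 + E 0 := by
    intro l hl
    have ht : Tendsto (fun z : ℂ => (z, l * z)) (𝓝 0) (𝓝 0) :=
      Continuous.tendsto' (by fun_prop) _ _ (by simp)
    have h1 : ∀ᶠ z in 𝓝[≠] (0 : ℂ), l * β = D (z, l * z) + E (z, l * z) := by
      filter_upwards [(ht.mono_left nhdsWithin_le_nhds).eventually h, self_mem_nhdsWithin] with z h2 h3
      have h3' : z ^ 2 ≠ 0 := pow_ne_zero 2 h3
      refine mul_left_cancel₀ h3' ?_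
      linear_combination h2 + z ^ 2 * E (z, l * z) * hl
    have h2 : Tendsto (fun z : ℂ => D (z, l * z) + E (z, l * z)) (𝓝[≠] 0) (𝓝 (D 0 + E 0)) :=
      ((hD.tendsto.comp ht).add (hE.tendsto.comp ht)).mono_left nhdsWithin_le_nhds
    exact tendsto_nhds_unique (tendsto_const_nhds.congr' h1) h2
  have h1 := key 1 (by norm_num)
  have h2 := key (-1) (by norm_num)
  exact ⟨rfl, by linear_combination (h1 - h2) / 2⟩

lemma eventually_eq_zero_of_quadratic {α β : ℂ → ℂ} {D E : ℂ × ℂ × ℂ → ℂ} (hD : AnalyticAt ℂ D 0)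
    (hE : AnalyticAt ℂ E 0)
    (h : ∀ᶠ x in 𝓝 (0 : ℂ × ℂ × ℂ),
      α x.2.2 + x.1 * x.2.1 * β x.2.2 = x.1 ^ 2 * D x + x.2.1 ^ 2 * E x) :
    ∀ᶠ w in 𝓝 0, α w = 0 ∧ β w = 0 := by
  have hin : Tendsto (fun w : ℂ => ((0 : ℂ), (0 : ℂ), w)) (𝓝 0) (𝓝 0) :=
    Continuous.tendsto' (by fun_prop) _ _ rfl
  filter_upwards [hin.eventually h.eventually_nhds, hin.eventually hD.eventually_analyticAt,
    hin.eventually hE.eventually_analyticAt] with w h1 h2 h3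
  have ht : ContinuousAt (fun y : ℂ × ℂ => (y.1, y.2, w)) 0 := by fun_prop
  refine eq_zero_of_quadratic (D := fun y => D (y.1, y.2, w)) (E := fun y => E (y.1, y.2, w))
    ?_ ?_ (ht.eventually h1)
  · exact h2.continuousAt.comp_of_eq ht rfl
  · exact h3.continuousAt.comp_of_eq ht rfl

/-- The Segre function `Θ` is `w - 2 i ρ (g + ρ (a + e ρ + z² D + ζ² E))`, where `ρ = z ζ` and `g`,
`a`, `e` depend on `w` only. -/
structure IsSemiNormal (Θ : ℂ × ℂ × ℂ → ℂ) (g a e : ℂ → ℂ) (D E : ℂ × ℂ × ℂ → ℂ) : Prop where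
  g_analyticAt : AnalyticAt ℂ g 0
  a_analyticAt : AnalyticAt ℂ a 0
  e_analyticAt : AnalyticAt ℂ e 0
  D_analyticAt : AnalyticAt ℂ D 0
  E_analyticAt : AnalyticAt ℂ E 0
  eq : ∀ᶠ x in 𝓝 (0 : ℂ × ℂ × ℂ), Θ x = x.2.2 - 2 * Complex.I * x.2.1 * x.1 * (g x.2.2
    + x.2.1 * x.1 * (a x.2.2 + x.2.1 * x.1 * e x.2.2 + x.2.1 ^ 2 * D (x.2.1, x.1, x.2.2)
      + x.1 ^ 2 * E (x.2.1, x.1, x.2.2)))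

/-- The symmetry relations between the coefficients of a Segre function
`w - 2 i ρ (g + ρ σ)` without term of order `(3, 2)`. -/
lemma IsSegreFunction.exists_isSemiNormal {Θ : ℂ × ℂ × ℂ → ℂ} (h : IsSegreFunction Θ)
    {g : ℂ → ℂ} (hg : AnalyticAt ℂ g 0) (hgs : ∀ᶠ t in 𝓝 0, star (g (star t)) = g t)
    {σ : ℂ × ℂ × ℂ → ℂ} (hσ : AnalyticAt ℂ σ 0)
    (hΘ : ∀ᶠ x in 𝓝 (0 : ℂ × ℂ × ℂ), Θ x = x.2.2 -
        2 * Complex.I * x.2.1 * x.1 * (g x.2.2 + x.2.1 * x.1 * σ (x.2.1, x.1, x.2.2)))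
    (hσ1 : ∀ᶠ t in 𝓝 0, deriv (fun z => σ (z, 0, t)) 0 = 0) :
    ∃ a e D E, IsSemiNormal Θ g a e D E ∧
      (∀ᶠ t in 𝓝 0, a t = star (a (star t)) - 2 * Complex.I * g t * deriv g t) ∧
      ∀ᶠ t in 𝓝 0, e t = star (e (star t)) - 2 * Complex.I * g t * deriv (conjMap a) t
        - 2 * Complex.I * deriv g t * a t - 2 * deriv (deriv g) t * g t ^ 2 := by
  have hI2 := Complex.I_sq
  obtain ⟨a, b, c, d, e, k, r₁, r₂, r₃, r₄, ⟨ha, hb, hc, hd, he, hk⟩, ⟨hr₁, hr₂, hr₃, hr₄⟩, -, hexp⟩ :=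
    hσ.exists_second_order
  have hw : Tendsto (fun x : ℂ × ℂ × ℂ => x.2.2) (𝓝 0) (𝓝 0) :=
    Continuous.tendsto' (by fun_prop) _ _ rfl
  have hwa : ∀ {f : ℂ → ℂ}, AnalyticAt ℂ f 0 → AnalyticAt ℂ (fun x : ℂ × ℂ × ℂ => f x.2.2) 0 :=
    fun hf => hf.fun_comp_of_eq (by fun_prop) rfl
  have hin : Tendsto (fun w : ℂ => ((0 : ℂ), (0 : ℂ), w)) (𝓝 0) (𝓝 0) :=
    Continuous.tendsto' (by fun_prop) _ _ rfl
  -- The coefficient b of z is σ_z(0, 0, w), which vanishes because the axis is a chain.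
  have hb0 : ∀ᶠ t in 𝓝 0, b t = 0 := by
    filter_upwards [hσ1, hin.eventually hexp.eventually_nhds,
      hin.eventually hr₁.eventually_analyticAt] with t h1 h2 h3
    have hl : Tendsto (fun z : ℂ => (z, (0 : ℂ), t)) (𝓝 0) (𝓝 (0, 0, t)) :=
      Continuous.tendsto' (by fun_prop) _ _ rfl
    have hr : AnalyticAt ℂ (fun z : ℂ => r₁ (z, 0, t)) 0 := h3.fun_comp_of_eq (by fun_prop) rfl
    have h4 : HasDerivAt (fun z : ℂ => a t + z * b t + z ^ 2 * (d t + z * r₁ (z, 0, t))) (b t) 0 := by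
      have x1 := ((hasDerivAt_id (0 : ℂ)).mul_const (b t)).const_add (a t)
      have x2 : AnalyticAt ℂ (fun z : ℂ => d t + z * r₁ (z, 0, t)) 0 := by fun_prop
      have x3 := ((hasDerivAt_id (0 : ℂ)).pow 2).mul x2.differentiableAt.hasDerivAt
      exact (x1.add x3).congr_deriv (by simp)
    rw [← h1]
    refine (HasDerivAt.congr_of_eventuallyEq h4 ?_).deriv.symm
    filter_upwards [hl.eventually h2] with z h5
    rw [h5]
    ring
  -- The remaining quadratic terms and all cubic terms are distributed over the ideal (z², ζ²):
  -- those divisible by z² form D and the others E.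
  obtain ⟨D, hDdef⟩ : ∃ f : ℂ × ℂ × ℂ → ℂ, f = fun x => d x.2.2 + x.1 * r₁ x + x.2.1 * r₂ x := ⟨_, rfl⟩
  obtain ⟨E, hEdef⟩ : ∃ f : ℂ × ℂ × ℂ → ℂ, f = fun x => k x.2.2 + x.1 * r₃ x + x.2.1 * r₄ x := ⟨_, rfl⟩
  have hD : AnalyticAt ℂ D 0 := by
    have := hwa hd
    rw [hDdef]
    fun_prop
  have hE : AnalyticAt ℂ E 0 := by
    have := hwa hk
    rw [hEdef]
    fun_prop
  have hσe : ∀ᶠ x in 𝓝 (0 : ℂ × ℂ × ℂ), σ x = a x.2.2 + x.2.1 * c x.2.2 + x.1 * x.2.1 * e x.2.2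
      + x.1 ^ 2 * D x + x.2.1 ^ 2 * E x := by
    filter_upwards [hexp, hw.eventually hb0] with x h1 h2
    rw [h1, h2]
    simp only [hDdef, hEdef]
    ring
  -- the symmetry of `Θ`, in coordinates `(z, ζ, w)`
  obtain ⟨ω, hω⟩ : ∃ f : ℂ × ℂ × ℂ → ℂ, f = fun x => Θ (x.2.1, x.1, x.2.2) := ⟨_, rfl⟩
  have hωa : AnalyticAt ℂ ω 0 := by
    rw [hω]
    exact h.analyticAt.fun_comp_of_eq (by fun_prop) rfl
  have hω0 : ω 0 = 0 := by
    rw [hω]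
    exact h.zero
  have hswap : Tendsto (fun x : ℂ × ℂ × ℂ => (x.2.1, x.1, x.2.2)) (𝓝 0) (𝓝 0) :=
    Continuous.tendsto' (by fun_prop) _ _ rfl
  have hσc := hσ.analyticAt_conjMap
  have hc3 : AnalyticAt ℂ (fun x : ℂ × ℂ × ℂ => (x.2.1, x.1, ω x)) 0 := by fun_prop
  have hc30 : (fun x : ℂ × ℂ × ℂ => (x.2.1, x.1, ω x)) 0 = 0 := by simp [hω0]
  obtain ⟨η, hη⟩ : ∃ f : ℂ × ℂ × ℂ → ℂ, f = fun x => -2 * Complex.I * (g x.2.2 + x.1 * x.2.1 * σ x) := ⟨_, rfl⟩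
  have hga := hwa hg
  have hηa : AnalyticAt ℂ η 0 := by
    rw [hη]
    fun_prop
  have hωη : ∀ᶠ x in 𝓝 (0 : ℂ × ℂ × ℂ), ω x = x.2.2 + x.1 * x.2.1 * η x := by
    filter_upwards [hswap.eventually hΘ] with x hx
    simp only [hω, hη, hx]
    ring
  have hsy : ∀ᶠ x in 𝓝 (0 : ℂ × ℂ × ℂ), x.2.2 = ω x + 2 * Complex.I * x.1 * x.2.1 *
      (g (ω x) + x.1 * x.2.1 * conjMap σ (x.2.1, x.1, ω x)) := by
    have ht : Tendsto (fun x : ℂ × ℂ × ℂ => (star x.1, star x.2.1, star (ω x))) (𝓝 0) (𝓝 0) := by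
      have := hωa.continuousAt
      have : ContinuousAt (fun x : ℂ × ℂ × ℂ => (star x.1, star x.2.1, star (ω x))) 0 := by fun_prop
      refine this.tendsto.trans (le_of_eq ?_)
      simp [hω0]
    have hωt : Tendsto ω (𝓝 0) (𝓝 0) := by
      have := hωa.continuousAt.tendsto; rwa [hω0] at this
    have htg := (tendsto_graph h.analyticAt.continuousAt h.zero).comp hswap
    filter_upwards [htg.eventually h.symm, ht.eventually hΘ, hωt.eventually hgs] with x h1 h2 h3
    have h5 : star x.2.2 = Θ (star x.1, star x.2.1, star (ω x)) := by
      rw [hω]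
      exact h1.1 rfl
    rw [h2] at h5
    have h6 := congrArg star h5
    have e3 : star (2 : ℂ) = 2 := Complex.conj_ofNat 2
    have e4 : star Complex.I = -Complex.I := Complex.conj_I
    simp only [star_star, star_sub, star_add, star_mul', e3, e4, h3] at h6
    have e5 : conjMap σ (x.2.1, x.1, ω x) = star (σ (star x.2.1, star x.1, star (ω x))) := rfl
    rw [e5]
    linear_combination h6
  have hH1 : ∀ᶠ x in 𝓝 (0 : ℂ × ℂ × ℂ), g x.2.2 + x.1 * x.2.1 * σ x - g (ω x)
      - x.1 * x.2.1 * conjMap σ (x.2.1, x.1, ω x) = 0 := by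
    have x1 : AnalyticAt ℂ (fun x => g (ω x)) 0 := hg.fun_comp_of_eq hωa hω0
    have x2 : AnalyticAt ℂ (fun x : ℂ × ℂ × ℂ => conjMap σ (x.2.1, x.1, ω x)) 0 :=
      hσc.fun_comp_of_eq hc3 hc30
    refine eventually_eq_zero_of_mul_mul (((hga.fun_add (AnalyticAt.fun_mul (by fun_prop) hσ)).fun_sub
      x1).fun_sub (AnalyticAt.fun_mul (by fun_prop) x2)) ?_
    filter_upwards [hsy, hωη] with x h1 h2
    simp only [hη] at h2
    linear_combination (-Complex.I / 2) * (h1 + h2) + x.1 * x.2.1 * (g x.2.2 + x.1 * x.2.1 * σ x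
      - g (ω x) - x.1 * x.2.1 * conjMap σ (x.2.1, x.1, ω x)) * hI2
  obtain ⟨rg, hrg, hrge⟩ := hg.exists_taylor_shift
  have hg1 := hwa hg.deriv
  have hg2 := hwa hg.deriv.deriv
  have hg3 := hwa hg.deriv.deriv.deriv
  obtain ⟨g₁, hg₁⟩ : ∃ f, f = deriv g := ⟨_, rfl⟩
  obtain ⟨g₂, hg₂⟩ : ∃ f, f = deriv g₁ := ⟨_, rfl⟩
  obtain ⟨g₃, hg₃⟩ : ∃ f, f = deriv g₂ := ⟨_, rfl⟩
  rw [← hg₁, ← hg₂, ← hg₃] at hrge hg3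
  rw [← hg₁, ← hg₂] at hg2
  rw [← hg₁] at hg1
  have hg1a : AnalyticAt ℂ g₁ 0 := by
    rw [hg₁]
    exact hg.deriv
  have hg2a : AnalyticAt ℂ g₂ 0 := by
    rw [hg₂]
    exact hg1a.deriv
  have hg3a : AnalyticAt ℂ g₃ 0 := by
    rw [hg₃]
    exact hg2a.deriv
  have hδ : AnalyticAt ℂ (fun x : ℂ × ℂ × ℂ => (x.1 * x.2.1 * η x, x.2.2)) 0 := by fun_prop
  have hδ0 : (fun x : ℂ × ℂ × ℂ => (x.1 * x.2.1 * η x, x.2.2)) 0 = 0 := by simp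
  have hδt : Tendsto (fun x : ℂ × ℂ × ℂ => (x.1 * x.2.1 * η x, x.2.2)) (𝓝 0) (𝓝 0) := by
    refine hδ.continuousAt.tendsto.trans (le_of_eq ?_)
    simp
  obtain ⟨rg', hrg'⟩ : ∃ f : ℂ × ℂ × ℂ → ℂ, f = fun x => rg (x.1 * x.2.1 * η x, x.2.2) := ⟨_, rfl⟩
  -- γ is the quotient (g(ω) - g(w)) / zζ, from the Taylor expansion of g with increment ω - w = zζ
  -- η. It allows the symmetry relation to be divided by zζ once more.
  obtain ⟨γ, hγ⟩ : ∃ f : ℂ × ℂ × ℂ → ℂ, f = fun x => η x * g₁ x.2.2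
    + x.1 * x.2.1 * η x ^ 2 * (g₂ x.2.2 / 2)
    + x.1 ^ 2 * x.2.1 ^ 2 * η x ^ 3 * (g₃ x.2.2 / 6
      + x.1 * x.2.1 * η x * rg' x) := ⟨_, rfl⟩
  have hrga : AnalyticAt ℂ rg' 0 := by
    rw [hrg']
    exact hrg.fun_comp_of_eq hδ hδ0
  have hγa : AnalyticAt ℂ γ 0 := by
    rw [hγ]
    fun_prop (disch := norm_num)
  have hσ' : AnalyticAt ℂ (fun x : ℂ × ℂ × ℂ => conjMap σ (x.2.1, x.1, ω x)) 0 :=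
      hσc.fun_comp_of_eq hc3 hc30
  have hH2 : ∀ᶠ x in 𝓝 (0 : ℂ × ℂ × ℂ), σ x - conjMap σ (x.2.1, x.1, ω x) - γ x = 0 := by
    refine eventually_eq_zero_of_mul_mul ((hσ.fun_sub hσ').fun_sub hγa) ?_
    filter_upwards [hH1, hωη, hδt.eventually hrge] with x h1 h2 h3
    rw [← h2] at h3
    simp only [hγ, hrg']
    linear_combination h1 + h3
  -- the conjugate expansion
  obtain ⟨ac, hac⟩ : ∃ f, f = conjMap a := ⟨_, rfl⟩
  obtain ⟨cc, hcc⟩ : ∃ f, f = conjMap c := ⟨_, rfl⟩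
  obtain ⟨ec, hec⟩ : ∃ f, f = conjMap e := ⟨_, rfl⟩
  obtain ⟨D', hD'⟩ : ∃ f : ℂ × ℂ × ℂ → ℂ, f = fun x => conjMap D (x.2.1, x.1, ω x) := ⟨_, rfl⟩
  obtain ⟨E', hE'⟩ : ∃ f : ℂ × ℂ × ℂ → ℂ, f = fun x => conjMap E (x.2.1, x.1, ω x) := ⟨_, rfl⟩
  have hD'a : AnalyticAt ℂ D' 0 := by
    rw [hD']
    exact hD.analyticAt_conjMap.fun_comp_of_eq hc3 hc30
  have hE'a : AnalyticAt ℂ E' 0 := by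
    rw [hE']
    exact hE.analyticAt_conjMap.fun_comp_of_eq hc3 hc30
  have hσce : ∀ᶠ x in 𝓝 (0 : ℂ × ℂ × ℂ), conjMap σ (x.2.1, x.1, ω x) = ac (ω x) + x.1 * cc (ω x)
      + x.1 * x.2.1 * ec (ω x) + x.2.1 ^ 2 * D' x + x.1 ^ 2 * E' x := by
    have ht : Tendsto (fun x : ℂ × ℂ × ℂ => (star x.2.1, star x.1, star (ω x))) (𝓝 0) (𝓝 0) := by
      have := hωa.continuousAt
      have : ContinuousAt (fun x : ℂ × ℂ × ℂ => (star x.2.1, star x.1, star (ω x))) 0 := by fun_prop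
      refine this.tendsto.trans (le_of_eq ?_)
      simp [hω0]
    filter_upwards [ht.eventually hσe] with x hx
    have e1 : ∀ f : ℂ × ℂ × ℂ → ℂ, conjMap f (x.2.1, x.1, ω x) =
      star (f (star x.2.1, star x.1, star (ω x))) := fun f => rfl
    have e2 : ∀ f : ℂ → ℂ, conjMap f (ω x) = star (f (star (ω x))) := fun f => rfl
    simp only [hD', hE', hac, hcc, hec]
    rw [e1 σ, e1 D, e1 E, e2, e2, e2, hx]
    simp only [star_add, star_mul', star_pow, star_star]
    ring
  -- the coefficient of `ζ`
  have hc0 : ∀ᶠ t in 𝓝 0, c t = 0 := by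
    have hl0 : Tendsto (fun w : ℂ => ((0 : ℂ), (0 : ℂ), w)) (𝓝 0) (𝓝 0) := hin
    filter_upwards [hin.eventually hH2.eventually_nhds, hin.eventually hσe.eventually_nhds,
      hin.eventually hσce.eventually_nhds, hin.eventually hωη.eventually_nhds,
      hin.eventually hE.eventually_analyticAt, hin.eventually hD'a.eventually_analyticAt]
      with t h1 h2 h3 h4 h5 h6
    have hl : Tendsto (fun ζ : ℂ => ((0 : ℂ), ζ, t)) (𝓝 0) (𝓝 (0, 0, t)) :=
      Continuous.tendsto' (by fun_prop) _ _ rfl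
    have hla : AnalyticAt ℂ (fun ζ : ℂ => ((0 : ℂ), ζ, t)) 0 := by fun_prop
    have h7 : ContinuousAt (fun ζ : ℂ => E (0, ζ, t) - D' (0, ζ, t)) 0 :=
      ((h5.fun_comp_of_eq hla rfl).fun_sub (h6.fun_comp_of_eq hla rfl)).continuousAt
    have h8 := taylor_unique (𝕜 := ℂ) (n := 2)
      (a := fun j => if j = 0 then a t - ac t + 2 * Complex.I * g t * g₁ t else c t) h7 (by
      filter_upwards [nhdsWithin_le_nhds (hl.eventually (((h1.and h2).and h3).and h4))] with ζ h9
      obtain ⟨⟨⟨h9, h10⟩, h11⟩, h12⟩ := h9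
      rw [h10, h11] at h9
      simp only [zero_mul, add_zero, ne_eq, OfNat.ofNat_ne_zero, not_false_eq_true, zero_pow] at h9 h12
      simp only [h12, hγ, hη] at h9
      simp [Finset.sum_range_succ]
      simp at h9
      linear_combination h9)
    simpa using h8.1 1 (by norm_num)
  have hcc0 : ∀ᶠ t in 𝓝 0, cc t = 0 := by
    have hst : Tendsto (fun t : ℂ => star t) (𝓝 0) (𝓝 0) :=
      Continuous.tendsto' (by fun_prop) _ _ (by simp)
    filter_upwards [hst.eventually hc0] with t ht
    rw [hcc]
    change star (c (star t)) = 0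
    rw [ht, star_zero]
  have haca : AnalyticAt ℂ ac 0 := by
    rw [hac]
    exact ha.analyticAt_conjMap
  have heca : AnalyticAt ℂ ec 0 := by
    rw [hec]
    exact he.analyticAt_conjMap
  obtain ⟨ra, hra, hrae⟩ := haca.exists_taylor_shift
  obtain ⟨re, hre, hree⟩ := heca.exists_taylor_shift
  have hωt : Tendsto ω (𝓝 0) (𝓝 0) := by
      have := hωa.continuousAt.tendsto; rwa [hω0] at this
  have ha1 := hwa haca.deriv
  have ha2 := hwa haca.deriv.deriv
  have ha3 := hwa haca.deriv.deriv.deriv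
  have he1 := hwa heca.deriv
  have he2 := hwa heca.deriv.deriv
  have he3 := hwa heca.deriv.deriv.deriv
  obtain ⟨ac₁, hac₁⟩ : ∃ f, f = deriv ac := ⟨_, rfl⟩
  obtain ⟨ac₂, hac₂⟩ : ∃ f, f = deriv ac₁ := ⟨_, rfl⟩
  obtain ⟨ac₃, hac₃⟩ : ∃ f, f = deriv ac₂ := ⟨_, rfl⟩
  obtain ⟨ec₁, hec₁⟩ : ∃ f, f = deriv ec := ⟨_, rfl⟩
  obtain ⟨ec₂, hec₂⟩ : ∃ f, f = deriv ec₁ := ⟨_, rfl⟩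
  obtain ⟨ec₃, hec₃⟩ : ∃ f, f = deriv ec₂ := ⟨_, rfl⟩
  rw [← hac₁, ← hac₂, ← hac₃] at hrae ha3
  rw [← hec₁, ← hec₂, ← hec₃] at hree he3
  rw [← hac₁, ← hac₂] at ha2
  rw [← hec₁, ← hec₂] at he2
  rw [← hac₁] at ha1
  rw [← hec₁] at he1
  have hac1a : AnalyticAt ℂ ac₁ 0 := by
    rw [hac₁]
    exact haca.deriv
  have hac2a : AnalyticAt ℂ ac₂ 0 := by
    rw [hac₂]
    exact hac1a.deriv
  have hac3a : AnalyticAt ℂ ac₃ 0 := by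
    rw [hac₃]
    exact hac2a.deriv
  have hec1a : AnalyticAt ℂ ec₁ 0 := by
    rw [hec₁]
    exact heca.deriv
  have hec2a : AnalyticAt ℂ ec₂ 0 := by
    rw [hec₂]
    exact hec1a.deriv
  have hec3a : AnalyticAt ℂ ec₃ 0 := by
    rw [hec₃]
    exact hec2a.deriv
  obtain ⟨ra', hra'⟩ : ∃ f : ℂ × ℂ × ℂ → ℂ, f = fun x => ra (x.1 * x.2.1 * η x, x.2.2) := ⟨_, rfl⟩
  have hraa : AnalyticAt ℂ ra' 0 := by
    rw [hra']
    exact hra.fun_comp_of_eq hδ hδ0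
  obtain ⟨re', hre'⟩ : ∃ f : ℂ × ℂ × ℂ → ℂ, f = fun x => re (x.1 * x.2.1 * η x, x.2.2) := ⟨_, rfl⟩
  have hrea : AnalyticAt ℂ re' 0 := by
    rw [hre']
    exact hre.fun_comp_of_eq hδ hδ0
  obtain ⟨A₂, hA₂⟩ : ∃ f : ℂ × ℂ × ℂ → ℂ, f = fun x => ac₂ x.2.2 / 2
    + x.1 * x.2.1 * η x * (ac₃ x.2.2 / 6)
    + (x.1 * x.2.1 * η x) ^ 2 * ra' x := ⟨_, rfl⟩
  obtain ⟨E₁, hE₁⟩ : ∃ f : ℂ × ℂ × ℂ → ℂ, f = fun x => ec₁ x.2.2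
    + x.1 * x.2.1 * η x * (ec₂ x.2.2 / 2)
    + (x.1 * x.2.1 * η x) ^ 2 * (ec₃ x.2.2 / 6)
    + (x.1 * x.2.1 * η x) ^ 3 * re' x := ⟨_, rfl⟩
  have hA₂a : AnalyticAt ℂ A₂ 0 := by
    rw [hA₂]
    fun_prop (disch := norm_num)
  have hE₁a : AnalyticAt ℂ E₁ 0 := by
    rw [hE₁]
    fun_prop (disch := norm_num)
  have hwe := hwa he
  -- The coefficients of 1 and zζ in the divided symmetry relation, modulo (z², ζ²). They mix
  -- because the conjugate coefficients are evaluated at ω = w + zζ η and not at w.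
  have hfin := eventually_eq_zero_of_quadratic
    (α := fun t => a t - ac t + 2 * Complex.I * g t * g₁ t)
    (β := fun t => e t - ec t + 2 * Complex.I * g t * ac₁ t + 2 * Complex.I * g₁ t * a t
      + 2 * g₂ t * g t ^ 2)
    (D := fun x => E' x - D x + x.2.1 ^ 2 * η x ^ 2 * A₂ x + x.2.1 ^ 2 * η x * E₁ x
      - 2 * Complex.I * x.2.1 ^ 2 * σ x * ac₁ x.2.2
      - 2 * Complex.I * g₁ x.2.2 * (x.2.1 ^ 2 * e x.2.2 + x.1 * x.2.1 * D x)
      - Complex.I * g₂ x.2.2 * x.2.1 ^ 2 * σ x * (η x - 2 * Complex.I * g x.2.2)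
      + x.2.1 ^ 2 * η x ^ 3 * (g₃ x.2.2 / 6
        + x.1 * x.2.1 * η x * rg' x))
    (E := fun x => D' x - E x - 2 * Complex.I * g₁ x.2.2 * (x.1 * x.2.1 * E x))
    (by fun_prop (disch := norm_num)) (by fun_prop) (by
      filter_upwards [hH2, hσe, hσce, hωη, hδt.eventually hrae, hδt.eventually hree,
        hw.eventually hc0, hωt.eventually hcc0] with x h1 h2 h3 h4 h5 h6 h7 h8
      rw [← h4] at h5 h6
      have h5' : ac (ω x) = ac x.2.2 + x.1 * x.2.1 * η x * ac₁ x.2.2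
        + (x.1 * x.2.1 * η x) ^ 2 * A₂ x := by
        simp only [hA₂, hra']
        rw [h5]
        ring
      have h6' : ec (ω x) = ec x.2.2 + x.1 * x.2.1 * η x * E₁ x := by
        simp only [hE₁, hre']
        rw [h6]
        ring
      rw [h3, h5', h6', h8] at h1
      rw [h7] at h2
      have h9 : η x = -2 * Complex.I * (g x.2.2 + x.1 * x.2.1 * σ x) := by rw [hη]
      simp only [hγ] at h1
      linear_combination h1 - h2 + (x.1 * x.2.1 * ac₁ x.2.2 + g₁ x.2.2
        + x.1 * x.2.1 * g₂ x.2.2 * (η x - 2 * Complex.I * g x.2.2) / 2) * h9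
        - 2 * Complex.I * g₁ x.2.2 * x.1 * x.2.1 * h2
        + 2 * x.1 * x.2.1 * g₂ x.2.2 * g x.2.2 ^ 2 * hI2)
  refine ⟨a, e, D, E, ⟨hg, ha, he, hD, hE, ?_⟩, ?_, ?_⟩
  · filter_upwards [hΘ, hswap.eventually hσe, hw.eventually hc0] with x h1 h2 h3
    rw [h1, h2, h3]
    ring
  · filter_upwards [hfin] with t ht
    have h1 : ac t = star (a (star t)) := by rw [hac]; rfl
    rw [← hg₁]
    linear_combination ht.1 + h1
  · filter_upwards [hfin] with t ht
    have h1 : ec t = star (e (star t)) := by rw [hec]; rfl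
    rw [← hg₁, ← hg₂, ← hac, ← hac₁]
    linear_combination ht.2 + h1


/-! ### Coordinates adapted to a chain -/

lemma IsSegreFunction.eventually_eq_of_left {Θ : ℂ × ℂ × ℂ → ℂ} (h : IsSegreFunction Θ)
    (h0 : ∀ᶠ x in 𝓝 (0 : ℂ × ℂ × ℂ), Θ (0, x.2) = x.2.2) :
    ∀ᶠ x in 𝓝 (0 : ℂ × ℂ), Θ (x.1, 0, x.2) = x.2 := by
  have h1 : Tendsto (fun x : ℂ × ℂ => (((0 : ℂ), x.2), x)) (𝓝 0) (𝓝 0) :=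
    Continuous.tendsto' (by fun_prop) _ _ rfl
  have h2 : Tendsto (fun x : ℂ × ℂ => ((0 : ℂ), star x.1, star x.2)) (𝓝 0) (𝓝 0) :=
    Continuous.tendsto' (by fun_prop) _ _ (by simp)
  filter_upwards [h1.eventually h.symm, h2.eventually h0] with x h3 h4
  refine (h3.2 ?_).symm
  have e : (star ((0 : ℂ), x.2)).1 = 0 := by simp
  rw [e]
  exact h4.symm

/-- The second order data of the family of Segre varieties. -/
lemma IsSegreFunction.segreSlope_segreSlope {Θ : ℂ × ℂ × ℂ → ℂ} (h : IsSegreFunction Θ)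
    {ξ : ℂ × ℂ × ℂ → ℂ × ℂ} (hξ : ∀ᶠ p in 𝓝 (0 : (ℂ × ℂ × ℂ) × ℂ × ℂ),
      (Θ (p.1.1, p.2) = p.1.2.1 ∧ segreSlope Θ (p.1.1, p.2) = p.1.2.2) ↔ ξ p.1 = p.2) :
    ∀ᶠ x in 𝓝 (0 : ℂ × ℂ × ℂ), segreSlope (segreSlope Θ) x =
      (fun y => segreSlope (segreSlope Θ) (y.1, ξ y)) (x.1, Θ x, segreSlope Θ x) := by
  have hs := h.analyticAt.analyticAt_segreSlope.continuousAt
  have hc := h.analyticAt.continuousAt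
  have ht : Tendsto (fun x : ℂ × ℂ × ℂ => (((x.1, Θ x, segreSlope Θ x) : ℂ × ℂ × ℂ), x.2)) (𝓝 0) (𝓝 0) := by
    have : ContinuousAt (fun x : ℂ × ℂ × ℂ => (((x.1, Θ x, segreSlope Θ x) : ℂ × ℂ × ℂ), x.2)) 0 := by
      fun_prop
    refine this.tendsto.trans (le_of_eq ?_)
    simp [h.zero, h.segreSlope_zero]
  filter_upwards [ht.eventually hξ] with x hx
  have : ξ (x.1, Θ x, segreSlope Θ x) = x.2 := hx.1 ⟨rfl, rfl⟩
  simp only [this]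

/-- The map which sends `(z, t)` to the point with Segre variety through `star (γ t)` of slope
`(ε - 2 i z q') / (1 - 2 i z p')`, where `ε` is the slope at `γ t` and `(p, q) = conjMap γ`. -/
noncomputable def adaptedMap (Θ : ℂ × ℂ × ℂ → ℂ) (ξ : ℂ × ℂ × ℂ → ℂ × ℂ) (γ : ℂ → ℂ × ℂ) :
    ℂ × ℂ → ℂ × ℂ := fun x =>
  ξ ((conjMap γ x.2).1, (conjMap γ x.2).2,
    (segreSlope Θ ((conjMap γ x.2).1, γ x.2) - 2 * Complex.I * x.1 * (deriv (conjMap γ) x.2).2) /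
      (1 - 2 * Complex.I * x.1 * (deriv (conjMap γ) x.2).1))

section adapted

variable {Θ Φ : ℂ × ℂ × ℂ → ℂ} {ξ : ℂ × ℂ × ℂ → ℂ × ℂ} {γ : ℂ → ℂ × ℂ}

lemma conjMap_zero {E F : Type*} [AddMonoid E] [StarAddMonoid E] [AddMonoid F] [StarAddMonoid F]
    {f : E → F} (h : f 0 = 0) : conjMap f 0 = 0 := by
  simp [conjMap, h]

lemma IsSegreChain.deriv_conjMap_zero (hγ : IsSegreChain Θ Φ γ) : deriv (conjMap γ) 0 = (0, 1) := by
  have h : HasDerivAt γ (0, 1) (star (0 : ℂ)) := by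
    rw [star_zero]
    exact hγ.hasDerivAt
  exact h.star_star.deriv.trans (by simp [Prod.star_def])

lemma analyticAt_adaptedSlope (hΘ : IsSegreFunction Θ) (hγ : IsSegreChain Θ Φ γ) :
    AnalyticAt ℂ (fun x : ℂ × ℂ =>
      (((conjMap γ x.2).1, (conjMap γ x.2).2,
    (segreSlope Θ ((conjMap γ x.2).1, γ x.2) - 2 * Complex.I * x.1 * (deriv (conjMap γ) x.2).2) /
      (1 - 2 * Complex.I * x.1 * (deriv (conjMap γ) x.2).1)) : ℂ × ℂ × ℂ)) 0 := by
  have hc0 := conjMap_zero hγ.zero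
  obtain ⟨c, hc⟩ : ∃ c, c = conjMap γ := ⟨_, rfl⟩
  have hca : AnalyticAt ℂ c 0 := by
    rw [hc]
    exact hγ.analyticAt.analyticAt_conjMap
  rw [← hc] at hc0 ⊢
  have h1 : AnalyticAt ℂ (fun x : ℂ × ℂ => c x.2) 0 := hca.fun_comp_of_eq (by fun_prop) rfl
  have h2 : AnalyticAt ℂ (fun x : ℂ × ℂ => deriv c x.2) 0 := hca.deriv.fun_comp_of_eq (by fun_prop) rfl
  have h3 : AnalyticAt ℂ (fun x : ℂ × ℂ => γ x.2) 0 := hγ.analyticAt.fun_comp_of_eq (by fun_prop) rfl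
  have h1f : AnalyticAt ℂ (fun x : ℂ × ℂ => (c x.2).1) 0 := analyticAt_fst.fun_comp_of_eq h1 rfl
  have h1s : AnalyticAt ℂ (fun x : ℂ × ℂ => (c x.2).2) 0 := analyticAt_snd.fun_comp_of_eq h1 rfl
  have h2f : AnalyticAt ℂ (fun x : ℂ × ℂ => (deriv c x.2).1) 0 := analyticAt_fst.fun_comp_of_eq h2 rfl
  have h2s : AnalyticAt ℂ (fun x : ℂ × ℂ => (deriv c x.2).2) 0 := analyticAt_snd.fun_comp_of_eq h2 rfl
  have h4 : AnalyticAt ℂ (fun x : ℂ × ℂ => segreSlope Θ ((c x.2).1, γ x.2)) 0 :=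
    hΘ.analyticAt.analyticAt_segreSlope.fun_comp_of_eq (h1f.prod h3) (by simp [hc0, hγ.zero])
  refine h1f.prod (h1s.prod (AnalyticAt.fun_div (h4.fun_sub ?_) (analyticAt_const.fun_sub ?_) ?_))
  · exact AnalyticAt.fun_mul (by fun_prop) h2s
  · exact AnalyticAt.fun_mul (by fun_prop) h2f
  · simp

lemma adaptedSlope_zero (hΘ : IsSegreFunction Θ) (hγ : IsSegreChain Θ Φ γ) :
    (((conjMap γ 0).1, (conjMap γ 0).2,
    (segreSlope Θ ((conjMap γ 0).1, γ 0) - 2 * Complex.I * 0 * (deriv (conjMap γ) 0).2) /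
      (1 - 2 * Complex.I * 0 * (deriv (conjMap γ) 0).1)) : ℂ × ℂ × ℂ) = 0 := by
  have e : segreSlope Θ (0, 0) = 0 := hΘ.segreSlope_zero
  simp [conjMap_zero hγ.zero, hγ.zero, e]

lemma analyticAt_adaptedMap (hΘ : IsSegreFunction Θ) (hγ : IsSegreChain Θ Φ γ)
    (hξ : AnalyticAt ℂ ξ 0) : AnalyticAt ℂ (adaptedMap Θ ξ γ) 0 :=
  hξ.fun_comp_of_eq (analyticAt_adaptedSlope hΘ hγ) (adaptedSlope_zero hΘ hγ)

lemma adaptedMap_zero (hΘ : IsSegreFunction Θ) (hγ : IsSegreChain Θ Φ γ)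
    (hξ0 : ξ 0 = 0) : adaptedMap Θ ξ γ 0 = 0 := by
  refine Eq.trans ?_ hξ0
  exact congrArg ξ (adaptedSlope_zero hΘ hγ)

/-- At z = 0 the prescribed slope is that of the Segre curve of γ t itself, which passes through the
prescribed point because γ lies on the hypersurface in the polarized sense. -/
lemma adaptedMap_axis (hΘ : IsSegreFunction Θ) (hγ : IsSegreChain Θ Φ γ)
    (hξe : ∀ᶠ p in 𝓝 (0 : (ℂ × ℂ × ℂ) × ℂ × ℂ),
      (Θ (p.1.1, p.2) = p.1.2.1 ∧ segreSlope Θ (p.1.1, p.2) = p.1.2.2) ↔ ξ p.1 = p.2) :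
    ∀ᶠ t in 𝓝 (0 : ℂ), adaptedMap Θ ξ γ (0, t) = γ t := by
  have hs := tendsto_slope hΘ hγ.analyticAt hγ.zero
  have hg : Tendsto γ (𝓝 0) (𝓝 0) := by
    have := hγ.analyticAt.continuousAt.tendsto
    rwa [hγ.zero] at this
  filter_upwards [(hs.prodMk_nhds hg).eventually hξe, hγ.mem] with t h1 h2
  have := h1.1 ⟨h2.symm, rfl⟩
  simpa [adaptedMap] using this

lemma adaptedMap_spec (hΘ : IsSegreFunction Θ) (hγ : IsSegreChain Θ Φ γ)
    (hξ : AnalyticAt ℂ ξ 0) (hξ0 : ξ 0 = 0)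
    (hξe : ∀ᶠ p in 𝓝 (0 : (ℂ × ℂ × ℂ) × ℂ × ℂ),
      (Θ (p.1.1, p.2) = p.1.2.1 ∧ segreSlope Θ (p.1.1, p.2) = p.1.2.2) ↔ ξ p.1 = p.2) :
    ∀ᶠ x in 𝓝 (0 : ℂ × ℂ), Θ ((conjMap γ x.2).1, adaptedMap Θ ξ γ x) = (conjMap γ x.2).2 ∧
      segreSlope Θ ((conjMap γ x.2).1, adaptedMap Θ ξ γ x) =
        (segreSlope Θ ((conjMap γ x.2).1, γ x.2) - 2 * Complex.I * x.1 * (deriv (conjMap γ) x.2).2) /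
      (1 - 2 * Complex.I * x.1 * (deriv (conjMap γ) x.2).1) := by
  have h1 := (analyticAt_adaptedSlope hΘ hγ).continuousAt.tendsto
  have h2 := (analyticAt_adaptedMap hΘ hγ hξ).continuousAt.tendsto
  rw [adaptedMap_zero hΘ hγ hξ0] at h2
  replace h1 := h1.trans (le_of_eq (congrArg 𝓝 (adaptedSlope_zero hΘ hγ)))
  filter_upwards [(Tendsto.prodMk_nhds h1 h2).eventually hξe] with x hx
  exact hx.2 rfl

/-- In the direction of t the map is γ, with velocity (0, 1). For t = 0 the Segre curves pass
through the origin with slope -2iz; since Θ has differential dw and Θ_ζ has z-derivative -2i, the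
velocity in z is (1, 0). This fixes the factor -2i in the definition. -/
lemma hasFDerivAt_adaptedMap (hΘ : IsSegreFunction Θ)
    (hL : HasDerivAt (fun z : ℂ => segreSlope Θ (0, z, 0)) (-2 * Complex.I) 0)
    (hγ : IsSegreChain Θ Φ γ)
    (hξ : AnalyticAt ℂ ξ 0) (hξ0 : ξ 0 = 0)
    (hξe : ∀ᶠ p in 𝓝 (0 : (ℂ × ℂ × ℂ) × ℂ × ℂ),
      (Θ (p.1.1, p.2) = p.1.2.1 ∧ segreSlope Θ (p.1.1, p.2) = p.1.2.2) ↔ ξ p.1 = p.2) :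
    HasFDerivAt (adaptedMap Θ ξ γ) (ContinuousLinearMap.id ℂ (ℂ × ℂ)) 0 := by
  have hKa := analyticAt_adaptedMap hΘ hγ hξ
  have hK0 := adaptedMap_zero hΘ hγ hξ0
  have hax := adaptedMap_axis hΘ hγ hξe
  have hspec := adaptedMap_spec hΘ hγ hξ hξ0 hξe
  obtain ⟨K, hK⟩ : ∃ K, K = adaptedMap Θ ξ γ := ⟨_, rfl⟩
  rw [← hK] at hKa hK0 hax hspec ⊢
  have hf := hKa.differentiableAt.hasFDerivAt
  have hlz : HasDerivAt (fun z : ℂ => (z, (0 : ℂ))) (1, 0) 0 :=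
    (hasDerivAt_id (0 : ℂ)).prodMk (hasDerivAt_const _ _)
  have hlt : HasDerivAt (fun t : ℂ => ((0 : ℂ), t)) (0, 1) 0 :=
    (hasDerivAt_const _ _).prodMk (hasDerivAt_id (0 : ℂ))
  have ht : fderiv ℂ K 0 (0, 1) = (0, 1) := by
    have h1 : HasDerivAt (fun t : ℂ => K (0, t)) (fderiv ℂ K 0 (0, 1)) 0 :=
      HasFDerivAt.comp_hasDerivAt (0 : ℂ) hf hlt
    exact h1.unique (hγ.hasDerivAt.congr_of_eventuallyEq hax)
  have hz : HasDerivAt (fun z : ℂ => K (z, 0)) (fderiv ℂ K 0 (1, 0)) 0 :=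
    HasFDerivAt.comp_hasDerivAt (0 : ℂ) hf hlz
  have hzz : Tendsto (fun z : ℂ => (z, (0 : ℂ))) (𝓝 0) (𝓝 0) :=
    Continuous.tendsto' (by fun_prop) _ _ rfl
  have hs' : ∀ᶠ z in 𝓝 (0 : ℂ), Θ (0, K (z, 0)) = 0 ∧
      segreSlope Θ (0, K (z, 0)) = -2 * Complex.I * z := by
    filter_upwards [hzz.eventually hspec] with z hz
    have e : segreSlope Θ (0, 0) = 0 := hΘ.segreSlope_zero
    simpa [conjMap_zero hγ.zero, hγ.zero, e, hγ.deriv_conjMap_zero] using hz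
  have hK00 : K (0, 0) = 0 := hK0
  have hl : HasDerivAt (fun z : ℂ => ((0 : ℂ), K (z, 0))) (0, fderiv ℂ K 0 (1, 0)) 0 :=
    (hasDerivAt_const _ _).prodMk hz
  have e2 : (fderiv ℂ K 0 (1, 0)).2 = 0 := by
    have h1 : HasDerivAt (fun z : ℂ => Θ (0, K (z, 0))) (fderiv ℂ K 0 (1, 0)).2 0 := by
      have h2 : HasFDerivAt Θ ((ContinuousLinearMap.snd ℂ ℂ ℂ).comp
        (ContinuousLinearMap.snd ℂ ℂ (ℂ × ℂ))) ((0 : ℂ), K (0, 0)) := by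
        rw [hK00]
        exact hΘ.hasFDerivAt
      exact HasFDerivAt.comp_hasDerivAt (0 : ℂ) h2 hl
    exact h1.unique ((hasDerivAt_const _ (0 : ℂ)).congr_of_eventuallyEq (hs'.mono fun z h => h.1))
  have hsa := hΘ.analyticAt.analyticAt_segreSlope.differentiableAt.hasFDerivAt
  have e3 : fderiv ℂ (segreSlope Θ) 0 (0, 1, 0) = -2 * Complex.I := by
    have h1 : HasDerivAt (fun z : ℂ => ((0 : ℂ), z, (0 : ℂ))) (0, 1, 0) 0 :=
      (hasDerivAt_const _ _).prodMk ((hasDerivAt_id (0 : ℂ)).prodMk (hasDerivAt_const _ _))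
    have h2 : HasDerivAt (fun z => segreSlope Θ (0, z, 0)) (fderiv ℂ (segreSlope Θ) 0 (0, 1, 0)) 0 :=
      HasFDerivAt.comp_hasDerivAt_of_eq (0 : ℂ) hsa h1 rfl
    exact h2.unique hL
  have e1 : (fderiv ℂ K 0 (1, 0)).1 = 1 := by
    have h1 : HasDerivAt (fun z : ℂ => segreSlope Θ (0, K (z, 0)))
        (fderiv ℂ (segreSlope Θ) 0 (0, fderiv ℂ K 0 (1, 0))) 0 := by
      have h2 : HasFDerivAt (segreSlope Θ) (fderiv ℂ (segreSlope Θ) 0) ((0 : ℂ), K (0, 0)) := by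
        rw [hK00]
        exact hsa
      exact HasFDerivAt.comp_hasDerivAt (0 : ℂ) h2 hl
    have h3 := h1.unique (((hasDerivAt_id (0 : ℂ)).const_mul (-2 * Complex.I)).congr_of_eventuallyEq
      (hs'.mono fun z h => h.2))
    have h4 : ((0 : ℂ), fderiv ℂ K 0 (1, 0)) = (fderiv ℂ K 0 (1, 0)).1 • ((0 : ℂ), (1 : ℂ), (0 : ℂ)) := by
      ext <;> simp [e2]
    rw [h4, map_smul, e3] at h3
    simpa using h3
  refine hf.congr_fderiv ?_
  ext
  · simp [e1]
  · simp [e2]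
  · simp [ht]
  · simp [ht]

/-- Along a chain there are coordinates in which the equation is semi-normal. -/
theorem IsSegreChain.exists_isSemiNormal (hΘ : IsSegreFunction Θ)
    (hL : HasDerivAt (fun z : ℂ => segreSlope Θ (0, z, 0)) (-2 * Complex.I) 0)
    (hξ : AnalyticAt ℂ ξ 0) (hξ0 : ξ 0 = 0)
    (hξe : ∀ᶠ p in 𝓝 (0 : (ℂ × ℂ × ℂ) × ℂ × ℂ),
      (Θ (p.1.1, p.2) = p.1.2.1 ∧ segreSlope Θ (p.1.1, p.2) = p.1.2.2) ↔ ξ p.1 = p.2)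
    (hΦ : AnalyticAt ℂ Φ 0)
    (hΦΘ : ∀ᶠ x in 𝓝 0, segreSlope (segreSlope Θ) x = Φ (x.1, Θ x, segreSlope Θ x))
    (hγ : IsSegreChain Θ Φ γ) :
    ∃ Θ' g a e D E, IsSegreFunction Θ' ∧ IsPullback Θ (adaptedMap Θ ξ γ) Θ' ∧
      IsSemiNormal Θ' g a e D E ∧ g 0 = 1 ∧ (∀ᶠ t in 𝓝 0, star (g (star t)) = g t) ∧
      (∀ᶠ t in 𝓝 0, a t = star (a (star t)) - 2 * Complex.I * g t * deriv g t) ∧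
      ∀ᶠ t in 𝓝 0, e t = star (e (star t)) - 2 * Complex.I * g t * deriv (conjMap a) t
        - 2 * Complex.I * deriv g t * a t - 2 * deriv (deriv g) t * g t ^ 2 := by
  have hKa := analyticAt_adaptedMap hΘ hγ hξ
  have hK0 := adaptedMap_zero hΘ hγ hξ0
  have hax := adaptedMap_axis hΘ hγ hξe
  have hspec := adaptedMap_spec hΘ hγ hξ hξ0 hξe
  have hKd := hasFDerivAt_adaptedMap hΘ hL hγ hξ hξ0 hξe
  obtain ⟨K, hK⟩ : ∃ K, K = adaptedMap Θ ξ γ := ⟨_, rfl⟩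
  rw [← hK] at hKa hK0 hax hspec hKd ⊢
  obtain ⟨Θ', hΘ', hpb⟩ := hΘ.exists_pullback hKa hK0 hKd
  have hcK := hKa.analyticAt_conjMap
  have hst : Tendsto (fun t : ℂ => star t) (𝓝 0) (𝓝 0) :=
    Continuous.tendsto' (by fun_prop) _ _ (by simp)
  have hcax : (fun t : ℂ => conjMap K (0, t)) =ᶠ[𝓝 0] conjMap γ := by
    filter_upwards [hst.eventually hax] with t h1
    change star (K (star (0 : ℂ), star t)) = star (γ (star t))
    rw [star_zero, h1]
  -- The Segre curve of the point K x passes through the conjugate of γ at x.2, which in the new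
  -- coordinates is the point (0, x.2).
  have h0 : ∀ᶠ x in 𝓝 (0 : ℂ × ℂ × ℂ), Θ' (0, x.2) = x.2.2 := by
    have h1 : Tendsto (fun x : ℂ × ℂ × ℂ => (x.2, ((0 : ℂ), x.2.2))) (𝓝 0) (𝓝 0) :=
      Continuous.tendsto' (by fun_prop) _ _ rfl
    have h2 : Tendsto (fun x : ℂ × ℂ × ℂ => x.2) (𝓝 0) (𝓝 0) :=
      Continuous.tendsto' (by fun_prop) _ _ rfl
    have h3 : Tendsto (fun x : ℂ × ℂ × ℂ => x.2.2) (𝓝 0) (𝓝 0) :=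
      Continuous.tendsto' (by fun_prop) _ _ rfl
    filter_upwards [h1.eventually hpb, h2.eventually hspec, h3.eventually hcax] with x h4 h5 h6
    refine (h4.1 ?_).symm
    rw [h6]
    exact h5.1.symm
  obtain ⟨k₁, hk₁⟩ : ∃ k₁ : ℂ → ℂ × ℂ, k₁ = fun t => fderiv ℂ (conjMap K) (0, t) (1, 0) := ⟨_, rfl⟩
  have hk₁a : AnalyticAt ℂ k₁ 0 := by
    rw [hk₁]
    exact (hcK.fderiv_apply (1, 0)).fun_comp_of_eq (by fun_prop) rfl
  have hk₁0 : k₁ 0 = (1, 0) := by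
    have : fderiv ℂ (conjMap K) (0, 0) = ContinuousLinearMap.id ℂ (ℂ × ℂ) :=
      (hasFDerivAt_conjMap_id hKd).fderiv
    simp [hk₁, this]
  have hcd : ∀ᶠ t in 𝓝 (0 : ℂ), fderiv ℂ (conjMap K) (0, t) (0, 1) = deriv (conjMap γ) t := by
    have h1 : Tendsto (fun t : ℂ => ((0 : ℂ), t)) (𝓝 0) (𝓝 0) :=
      Continuous.tendsto' (by fun_prop) _ _ rfl
    filter_upwards [h1.eventually hcK.eventually_analyticAt, hcax.eventuallyEq_nhds] with t h2 h3
    rw [← h3.deriv_eq]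
    exact (HasFDerivAt.comp_hasDerivAt t h2.differentiableAt.hasFDerivAt
      ((hasDerivAt_const t (0 : ℂ)).prodMk (hasDerivAt_id t))).deriv.symm
  -- With k₁ the derivative of the conjugate map transversal to the axis and τ the new slope, the
  -- vector k₁ + τ γ̄' is parallel to (1, ε) - 2iz γ̄' by construction, while at z = 0 one has τ = 0
  -- and k₁ = k₁.1 (1, ε). Since (1, ε) and γ̄' are independent near 0, τ = -2iz k₁.1, so g is the
  -- first component of k₁.
  have hτ : ∀ᶠ x in 𝓝 (0 : ℂ × ℂ), segreSlope Θ' (0, x) = -2 * Complex.I * x.1 * (k₁ x.2).1 := by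
    have hsl := hpb.slope_eq hΘ hΘ' hKa hK0 h0
    have h1 : Tendsto (fun x : ℂ × ℂ => ((0 : ℂ), x.2)) (𝓝 0) (𝓝 0) :=
      Continuous.tendsto' (by fun_prop) _ _ rfl
    have h2 : Tendsto (fun x : ℂ × ℂ => x.2) (𝓝 0) (𝓝 0) :=
      Continuous.tendsto' (by fun_prop) _ _ rfl
    have hτ0 : ∀ᶠ t in 𝓝 (0 : ℂ), segreSlope Θ' (0, 0, t) = 0 := by
      have h3 : Tendsto (fun t : ℂ => ((0 : ℂ), (0 : ℂ), t)) (𝓝 0) (𝓝 0) :=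
        Continuous.tendsto' (by fun_prop) _ _ rfl
      have h4 : Tendsto (fun t : ℂ => ((0 : ℂ), t)) (𝓝 0) (𝓝 0) :=
        Continuous.tendsto' (by fun_prop) _ _ rfl
      filter_upwards [h3.eventually hΘ'.analyticAt.eventually_analyticAt,
        h4.eventually (hΘ'.eventually_eq_of_left h0).eventually_nhds] with t h5 h6
      have h7 : Tendsto (fun ζ : ℂ => (ζ, t)) (𝓝 0) (𝓝 (0, t)) :=
        Continuous.tendsto' (by fun_prop) _ _ rfl
      exact h5.hasDerivAt_segreSlope.unique
        ((hasDerivAt_const (0 : ℂ) t).congr_of_eventuallyEq (h7.eventually h6))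
    obtain ⟨c, hc⟩ : ∃ c, c = deriv (conjMap γ) := ⟨_, rfl⟩
    have hca : ContinuousAt c 0 := by
      rw [hc]
      exact hγ.analyticAt.analyticAt_conjMap.deriv.continuousAt
    have hc0 : c 0 = (0, 1) := by rw [hc, hγ.deriv_conjMap_zero]
    obtain ⟨ε, hε⟩ : ∃ ε : ℂ → ℂ, ε = fun t => segreSlope Θ ((conjMap γ t).1, γ t) := ⟨_, rfl⟩
    have hεa : Tendsto ε (𝓝 0) (𝓝 0) := by
      rw [hε]
      exact ((continuous_snd.comp continuous_snd).tendsto' (0 : ℂ × ℂ × ℂ) 0 rfl).comp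
        (tendsto_slope hΘ hγ.analyticAt hγ.zero)
    have hε0 : ε 0 = 0 := tendsto_nhds_unique (tendsto_pure_nhds ε 0) (hεa.mono_left (pure_le_nhds 0))
    have hεc : ContinuousAt ε 0 := by rwa [ContinuousAt, hε0]
    have hc1 : ContinuousAt (fun x : ℂ × ℂ => c x.2) 0 := hca.comp_of_eq (by fun_prop) rfl
    have hn1 : ∀ᶠ x in 𝓝 (0 : ℂ × ℂ), 1 - 2 * Complex.I * x.1 * (c x.2).1 ≠ 0 := by
      refine ContinuousAt.eventually_ne ?_ (by simp)
      fun_prop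
    have hn2 : ∀ᶠ t in 𝓝 (0 : ℂ), (c t).2 - ε t * (c t).1 ≠ 0 := by
      refine ContinuousAt.eventually_ne ?_ (by simp [hc0])
      fun_prop
    filter_upwards [hsl, h1.eventually hsl, h2.eventually hτ0, hspec, h2.eventually hcax,
      h2.eventually hcd, h2.eventually hax, hn1, h2.eventually hn2]
      with x h3 h4 h5 h6 h7 h8 h9 h10 h11
    have h3 := h3.2
    have h4 := h4.2
    simp only [h7, h8, h5, h9, zero_smul, add_zero] at h3 h4
    rw [h6.2] at h3
    have e1 : ε x.2 = segreSlope Θ ((conjMap γ x.2).1, γ x.2) := by rw [hε]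
    have e2 : k₁ x.2 = fderiv ℂ (conjMap K) (0, x.2) (1, 0) := by rw [hk₁]
    rw [← e1, ← e2] at h3 h4
    rw [← hc] at h3
    simp only [Prod.fst_add, Prod.snd_add, Prod.smul_fst, Prod.smul_snd, smul_eq_mul] at h3
    rw [h4, div_mul_eq_mul_div, eq_div_iff h10] at h3
    refine mul_right_cancel₀ h11 ?_
    linear_combination h3
  have hg : AnalyticAt ℂ (fun t => (k₁ t).1) 0 := analyticAt_fst.fun_comp_of_eq hk₁a rfl
  have hp : Tendsto (fun x : ℂ × ℂ × ℂ => x.2) (𝓝 0) (𝓝 0) :=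
    Continuous.tendsto' (by fun_prop) _ _ rfl
  obtain ⟨hgs, σ, hσ, hform⟩ := hΘ'.exists_form h0 hg (hp.eventually hτ)
  have hg0 : (fun t => (k₁ t).1) 0 = 1 := by simp [hk₁0]
  have hchain := hpb.chain_iff hΘ hΦ hΦΘ hKa hK0 hKd hg (by simp [hk₁0]) hσ hform
  have hσ1 : ∀ᶠ t in 𝓝 0, deriv (fun z => σ (z, 0, t)) 0 = 0 := by
    have hcurve : (conjMap fun t => K (0, t)) = fun t => conjMap K (0, t) := by
      ext t <;> simp [conjMap, Prod.star_def]
    filter_upwards [hchain, hγ.chain, hcax.eventuallyEq_nhds, hax] with t h1 h2 h3 h4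
    refine h1.1 ?_
    rw [hcurve, h3.deriv.deriv_eq, h3.deriv_eq, h4, h3.eq_of_nhds]
    exact h2
  obtain ⟨a, e, D, E, h1, h2, h3⟩ := hΘ'.exists_isSemiNormal hg hgs hσ hform hσ1
  exact ⟨Θ', _, a, e, D, E, hΘ', hpb, h1, hg0, hgs, h2, h3⟩

end adapted


/-! ### Normal Segre functions and substitutions preserving the axis -/

/-- The Segre function of a hypersurface in normal form:
`w - 2 i z ζ - 2 i z² ζ² (z² D + ζ² E)`. -/
def IsNormalSegreFunction (Θ : ℂ × ℂ × ℂ → ℂ) : Prop :=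
  ∃ D E : ℂ × ℂ × ℂ → ℂ, AnalyticAt ℂ D 0 ∧ AnalyticAt ℂ E 0 ∧
    ∀ᶠ x in 𝓝 (0 : ℂ × ℂ × ℂ), Θ x = x.2.2 - 2 * Complex.I * x.2.1 * x.1 *
      (1 + x.2.1 * x.1 * (x.2.1 ^ 2 * D x + x.1 ^ 2 * E x))

/-- The differential equations for the substitutions which normalize a semi-normal equation. -/
def NormalEquations (g a e s l ν : ℂ → ℂ) (t : ℂ) : Prop :=
  -2 * Complex.I * deriv s t + 2 * Complex.I * l t * ν t * g (s t) = 0 ∧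
  -2 * deriv (deriv s) t + 2 * Complex.I * (-2 * Complex.I * deriv l t * ν t * g (s t)
    + (l t * ν t) ^ 2 * a (s t)) = 0 ∧
  4 * Complex.I / 3 * deriv (deriv (deriv s)) t + 2 * Complex.I *
    (-2 * deriv (deriv l) t * ν t * g (s t)
      - 4 * Complex.I * l t * deriv l t * ν t ^ 2 * a (s t)
      + (l t * ν t) ^ 3 * e (s t)) = 0

/-- Let `Θ'` be obtained from a semi-normal `Θ` by the substitution `(z, w) ↦ (ν (w) z, s (w))`,
`(ζ, ω) ↦ (λ (ω) ζ, s (ω))`. Then `Θ'` is normal if and only if `s`, `l = λ` and `ν` satisfy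
`NormalEquations`. -/
theorem IsSemiNormal.isNormalSegreFunction_iff {Θ Θ' : ℂ × ℂ × ℂ → ℂ} {g a e : ℂ → ℂ}
    {D E : ℂ × ℂ × ℂ → ℂ} (h : IsSemiNormal Θ g a e D E) {s l ν : ℂ → ℂ} (hs : AnalyticAt ℂ s 0)
    (hl : AnalyticAt ℂ l 0) (hν : AnalyticAt ℂ ν 0) (hs0 : s 0 = 0) (hs1 : HasDerivAt s 1 0)
    (hΘ' : AnalyticAt ℂ Θ' 0) (hΘ'0 : Θ' 0 = 0) (hΘ : AnalyticAt ℂ Θ 0)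
    (hrel : ∀ᶠ x in 𝓝 (0 : ℂ × ℂ × ℂ),
      s (Θ' x) = Θ (l (Θ' x) * x.1, ν x.2.2 * x.2.1, s x.2.2)) :
    IsNormalSegreFunction Θ' ↔ ∀ᶠ t in 𝓝 (0 : ℂ), NormalEquations g a e s l ν t := by
  unfold NormalEquations
  have hI2 := Complex.I_sq
  have hI0 := Complex.I_ne_zero
  obtain ⟨ω₀, hω₀⟩ : ∃ f : ℂ × ℂ × ℂ → ℂ, f = fun x => x.2.2 - 2 * Complex.I * (x.1 * x.2.1) :=
    ⟨_, rfl⟩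
  have hω₀a : AnalyticAt ℂ ω₀ 0 := by
    rw [hω₀]
    fun_prop
  have hω₀0 : ω₀ 0 = 0 := by simp [hω₀]
  -- `Θ'` as a perturbation of `ω₀`
  obtain ⟨f, hf⟩ : ∃ f : ℂ × ℂ × ℂ × ℂ → ℂ, f = fun y => s (ω₀ y.2 + y.1)
    - Θ (l (ω₀ y.2 + y.1) * y.2.1, ν y.2.2.2 * y.2.2.1, s y.2.2.2) := ⟨_, rfl⟩
  have hfa : AnalyticAt ℂ f (0, 0) := by
    rw [hf]
    have h1 : AnalyticAt ℂ (fun y : ℂ × ℂ × ℂ × ℂ => ω₀ y.2 + y.1) (0, 0) :=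
      AnalyticAt.fun_add (hω₀a.fun_comp_of_eq analyticAt_snd rfl) analyticAt_fst
    have h2 : AnalyticAt ℂ (fun y : ℂ × ℂ × ℂ × ℂ => s (ω₀ y.2 + y.1)) (0, 0) :=
      hs.fun_comp_of_eq h1 (by simp [hω₀0])
    have h3 : AnalyticAt ℂ (fun y : ℂ × ℂ × ℂ × ℂ => l (ω₀ y.2 + y.1)) (0, 0) :=
      hl.fun_comp_of_eq h1 (by simp [hω₀0])
    have h4 : AnalyticAt ℂ (fun y : ℂ × ℂ × ℂ × ℂ => s y.2.2.2) (0, 0) :=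
      hs.fun_comp_of_eq (by fun_prop) rfl
    have h5 : AnalyticAt ℂ (fun y : ℂ × ℂ × ℂ × ℂ => ν y.2.2.2) (0, 0) :=
      hν.fun_comp_of_eq (by fun_prop) rfl
    refine h2.fun_sub (hΘ.fun_comp_of_eq ?_ (by simp [hs0]))
    exact (h3.fun_mul (by fun_prop)).prod ((h5.fun_mul (by fun_prop)).prod h4)
  -- Division in the perturbation δ: f(δ, x) = f(0, x) + δ U, and f vanishes at δ = Θ' - ω₀. As U is
  -- 1 at the origin, Θ' - ω₀ equals -f(0, x) up to a unit, so normality can be tested on the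
  -- explicit function f(0, x).
  obtain ⟨U, hU, hfU⟩ := hfa.exists_eq_add_smul
  have hU0 : U (0, 0) = 1 := by
    have hin : Tendsto (fun δ : ℂ => (δ, (0 : ℂ × ℂ × ℂ))) (𝓝 0) (𝓝 (0, 0)) :=
      Continuous.tendsto' (by fun_prop) _ _ rfl
    have h1 : HasDerivAt (fun δ : ℂ => s δ - f (0, 0)) 1 0 := hs1.sub_const _
    have h2 : AnalyticAt ℂ (fun δ : ℂ => U (δ, 0)) 0 := hU.fun_comp_of_eq (by fun_prop) rfl
    have h3 := (hasDerivAt_id (0 : ℂ)).mul h2.differentiableAt.hasDerivAt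
    have h4 := h3.unique (h1.congr_of_eventuallyEq ?_)
    · simpa using h4
    · filter_upwards [hin.eventually hfU] with δ hδ
      have e1 : f (δ, 0) = s δ := by
        have e : Θ (0, 0, 0) = 0 := by
          have := h.eq.self_of_nhds
          simp only [Prod.fst_zero, Prod.snd_zero, mul_zero, zero_mul, sub_zero] at this
          exact this
        simp [hf, hω₀0, hs0, e]
      rw [e1] at hδ
      simp only [smul_eq_mul] at hδ
      simp only [Pi.mul_apply, id]
      linear_combination -hδ
  obtain ⟨u, hu⟩ : ∃ u : ℂ × ℂ × ℂ → ℂ, u = fun x => U (Θ' x - ω₀ x, x) := ⟨_, rfl⟩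
  have hδa : AnalyticAt ℂ (fun x : ℂ × ℂ × ℂ => (Θ' x - ω₀ x, x)) 0 :=
    (hΘ'.fun_sub hω₀a).prod analyticAt_id
  have hδ0 : (fun x : ℂ × ℂ × ℂ => (Θ' x - ω₀ x, x)) 0 = (0, 0) := by simp [hΘ'0, hω₀0]
  have hua : AnalyticAt ℂ u 0 := by
    rw [hu]
    exact hU.fun_comp_of_eq hδa hδ0
  have hu0 : u 0 = 1 := by
    rw [hu]
    exact (congrArg U hδ0).trans hU0
  have hune : ∀ᶠ x in 𝓝 (0 : ℂ × ℂ × ℂ), u x ≠ 0 := hua.continuousAt.eventually_ne (by simp [hu0])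
  obtain ⟨v, hv⟩ : ∃ v : ℂ × ℂ × ℂ → ℂ, v = fun x => (u x)⁻¹ := ⟨_, rfl⟩
  have hva : AnalyticAt ℂ v 0 := by
    rw [hv]
    exact hua.fun_inv (by simp [hu0])
  have hfu : ∀ᶠ x in 𝓝 (0 : ℂ × ℂ × ℂ), f (0, x) = -(Θ' x - ω₀ x) * u x := by
    have ht : Tendsto (fun x : ℂ × ℂ × ℂ => (Θ' x - ω₀ x, x)) (𝓝 0) (𝓝 (0, 0)) := hδa.continuousAt.tendsto.trans (le_of_eq (congrArg 𝓝 hδ0))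
    filter_upwards [ht.eventually hfU, hrel] with x h1 h2
    have e1 : f (Θ' x - ω₀ x, x) = 0 := by
      simp only [hf, add_sub_cancel, h2, sub_self]
    rw [e1] at h1
    simp only [hu, smul_eq_mul] at h1 ⊢
    linear_combination -h1
  -- the expansion of `f (0, x)`
  obtain ⟨G, hG⟩ : ∃ G : ℂ → ℂ, G = fun t => g (s t) := ⟨_, rfl⟩
  obtain ⟨A, hA⟩ : ∃ A : ℂ → ℂ, A = fun t => a (s t) := ⟨_, rfl⟩
  obtain ⟨B, hB⟩ : ∃ B : ℂ → ℂ, B = fun t => e (s t) := ⟨_, rfl⟩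
  have hGa : AnalyticAt ℂ G 0 := by
    rw [hG]
    exact h.g_analyticAt.fun_comp_of_eq hs hs0
  have hAa : AnalyticAt ℂ A 0 := by
    rw [hA]
    exact h.a_analyticAt.fun_comp_of_eq hs hs0
  have hBa : AnalyticAt ℂ B 0 := by
    rw [hB]
    exact h.e_analyticAt.fun_comp_of_eq hs hs0
  obtain ⟨s₁, hs₁⟩ : ∃ f, f = deriv s := ⟨_, rfl⟩
  obtain ⟨s₂, hs₂⟩ : ∃ f, f = deriv s₁ := ⟨_, rfl⟩
  obtain ⟨s₃, hs₃⟩ : ∃ f, f = deriv s₂ := ⟨_, rfl⟩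
  obtain ⟨l₁, hl₁⟩ : ∃ f, f = deriv l := ⟨_, rfl⟩
  obtain ⟨l₂, hl₂⟩ : ∃ f, f = deriv l₁ := ⟨_, rfl⟩
  obtain ⟨l₃, hl₃⟩ : ∃ f, f = deriv l₂ := ⟨_, rfl⟩
  have hs₁a : AnalyticAt ℂ s₁ 0 := by
    rw [hs₁]
    exact hs.deriv
  have hs₂a : AnalyticAt ℂ s₂ 0 := by
    rw [hs₂]
    exact hs₁a.deriv
  have hs₃a : AnalyticAt ℂ s₃ 0 := by
    rw [hs₃]
    exact hs₂a.deriv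
  have hl₁a : AnalyticAt ℂ l₁ 0 := by
    rw [hl₁]
    exact hl.deriv
  have hl₂a : AnalyticAt ℂ l₂ 0 := by
    rw [hl₂]
    exact hl₁a.deriv
  have hl₃a : AnalyticAt ℂ l₃ 0 := by
    rw [hl₃]
    exact hl₂a.deriv
  rw [← hs₁, ← hs₂, ← hs₃, ← hl₁, ← hl₂]
  obtain ⟨rs, hrs, hrse⟩ := hs.exists_taylor_shift
  obtain ⟨rl, hrl, hrle⟩ := hl.exists_taylor_shift
  rw [← hs₁, ← hs₂, ← hs₃] at hrse
  rw [← hl₁, ← hl₂, ← hl₃] at hrle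
  have hsh : AnalyticAt ℂ (fun x : ℂ × ℂ × ℂ => (-2 * Complex.I * (x.1 * x.2.1), x.2.2)) 0 := by
    fun_prop
  have hsh0 : (fun x : ℂ × ℂ × ℂ => (-2 * Complex.I * (x.1 * x.2.1), x.2.2)) 0 = 0 := by simp
  have hsht : Tendsto (fun x : ℂ × ℂ × ℂ => (-2 * Complex.I * (x.1 * x.2.1), x.2.2)) (𝓝 0) (𝓝 0) :=
    hsh.continuousAt.tendsto.trans (le_of_eq (congrArg 𝓝 hsh0))
  obtain ⟨qs, hqs⟩ : ∃ q : ℂ × ℂ × ℂ → ℂ, q = fun x => rs (-2 * Complex.I * (x.1 * x.2.1), x.2.2) :=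
    ⟨_, rfl⟩
  obtain ⟨ql, hql⟩ : ∃ q : ℂ × ℂ × ℂ → ℂ, q = fun x => rl (-2 * Complex.I * (x.1 * x.2.1), x.2.2) :=
    ⟨_, rfl⟩
  have hqsa : AnalyticAt ℂ qs 0 := by
    rw [hqs]
    exact hrs.fun_comp_of_eq hsh hsh0
  have hqla : AnalyticAt ℂ ql 0 := by
    rw [hql]
    exact hrl.fun_comp_of_eq hsh hsh0
  obtain ⟨r, hr⟩ : ∃ r : ℂ × ℂ × ℂ → ℂ, r = fun x =>
    8 * Complex.I * (l₃ x.2.2 / 6) + 16 * (x.1 * x.2.1) * ql x := ⟨_, rfl⟩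
  have hra : AnalyticAt ℂ r 0 := by
    rw [hr]
    fun_prop (disch := norm_num)
  obtain ⟨M₂, hM₂⟩ : ∃ M : ℂ × ℂ × ℂ → ℂ, M = fun x => -2 * l₂ x.2.2 + x.1 * x.2.1 * r x := ⟨_, rfl⟩
  have hM₂a : AnalyticAt ℂ M₂ 0 := by
    rw [hM₂]
    fun_prop
  obtain ⟨M₁, hM₁⟩ : ∃ M : ℂ × ℂ × ℂ → ℂ, M = fun x =>
    -2 * Complex.I * l₁ x.2.2 + x.1 * x.2.1 * M₂ x := ⟨_, rfl⟩
  have hM₁a : AnalyticAt ℂ M₁ 0 := by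
    rw [hM₁]
    fun_prop
  have hle : ∀ᶠ x in 𝓝 (0 : ℂ × ℂ × ℂ), l (ω₀ x) = l x.2.2 + x.1 * x.2.1 * M₁ x := by
    filter_upwards [hsht.eventually hrle] with x hx
    have e1 : x.2.2 + -2 * Complex.I * (x.1 * x.2.1) = ω₀ x := by
      rw [hω₀]
      ring
    rw [e1] at hx
    have e3 : Complex.I ^ 3 = -Complex.I := Complex.I_pow_three
    have e4 : Complex.I ^ 4 = 1 := Complex.I_pow_four
    rw [hx, hM₁, hM₂, hr, hql]
    simp only [mul_pow, hI2, e3, e4]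
    ring
  have hse : ∀ᶠ x in 𝓝 (0 : ℂ × ℂ × ℂ), s (ω₀ x) = s x.2.2 - 2 * Complex.I * (x.1 * x.2.1) * s₁ x.2.2
      - 2 * (x.1 * x.2.1) ^ 2 * s₂ x.2.2 + 4 * Complex.I / 3 * (x.1 * x.2.1) ^ 3 * s₃ x.2.2
      + 16 * (x.1 * x.2.1) ^ 4 * qs x := by
    filter_upwards [hsht.eventually hrse] with x hx
    have e1 : x.2.2 + -2 * Complex.I * (x.1 * x.2.1) = ω₀ x := by
      rw [hω₀]
      ring
    rw [e1] at hx
    have e3 : Complex.I ^ 3 = -Complex.I := Complex.I_pow_three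
    have e4 : Complex.I ^ 4 = 1 := Complex.I_pow_four
    rw [hx, hqs]
    simp only [mul_pow, hI2, e3, e4]
    ring
  obtain ⟨p, hp⟩ : ∃ p : ℂ × ℂ × ℂ → ℂ × ℂ × ℂ, p = fun x =>
    (ν x.2.2 * x.2.1, l (ω₀ x) * x.1, s x.2.2) := ⟨_, rfl⟩
  have hlωa : AnalyticAt ℂ (fun x => l (ω₀ x)) 0 := hl.fun_comp_of_eq hω₀a hω₀0
  have hp0 : p 0 = 0 := by simp [hp, hs0]
  have hpa : AnalyticAt ℂ p 0 := by
    rw [hp]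
    have h4 : AnalyticAt ℂ (fun y : ℂ × ℂ × ℂ => s y.2.2) 0 := hs.fun_comp_of_eq (by fun_prop) rfl
    have h5 : AnalyticAt ℂ (fun y : ℂ × ℂ × ℂ => ν y.2.2) 0 := hν.fun_comp_of_eq (by fun_prop) rfl
    exact (h5.fun_mul (by fun_prop)).prod ((hlωa.fun_mul (by fun_prop)).prod h4)
  have hpt : Tendsto (fun x => ((p x).2.1, (p x).1, (p x).2.2)) (𝓝 0) (𝓝 0) := by
    have := hpa.continuousAt
    have : ContinuousAt (fun x => ((p x).2.1, (p x).1, (p x).2.2)) 0 := by fun_prop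
    refine this.tendsto.trans (le_of_eq ?_)
    simp [hp0]
  obtain ⟨Λ, hΛ⟩ : ∃ Λ : ℂ × ℂ × ℂ → ℂ, Λ = fun x => l (ω₀ x) := ⟨_, rfl⟩
  rw [← hΛ] at hlωa
  obtain ⟨D', hD'⟩ : ∃ D' : ℂ × ℂ × ℂ → ℂ, D' = fun x => D (p x) := ⟨_, rfl⟩
  obtain ⟨E', hE'⟩ : ∃ E' : ℂ × ℂ × ℂ → ℂ, E' = fun x => E (p x) := ⟨_, rfl⟩
  have hD'a : AnalyticAt ℂ D' 0 := by
    rw [hD']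
    exact h.D_analyticAt.fun_comp_of_eq hpa hp0
  have hE'a : AnalyticAt ℂ E' 0 := by
    rw [hE']
    exact h.E_analyticAt.fun_comp_of_eq hpa hp0
  obtain ⟨X, hX⟩ : ∃ X : ℂ × ℂ × ℂ → ℂ, X = fun x =>
    2 * Complex.I * (Λ x * ν x.2.2) ^ 2 * ν x.2.2 ^ 2 * D' x := ⟨_, rfl⟩
  obtain ⟨Y, hY⟩ : ∃ Y : ℂ × ℂ × ℂ → ℂ, Y = fun x =>
    2 * Complex.I * (Λ x * ν x.2.2) ^ 2 * Λ x ^ 2 * E' x := ⟨_, rfl⟩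
  have hXa : AnalyticAt ℂ X 0 := by
    rw [hX]
    fun_prop
  have hYa : AnalyticAt ℂ Y 0 := by
    rw [hY]
    fun_prop
  -- R collects everything of order four in zζ. It is harmless, since (zζ)⁴ lies in (zζ)² (z², ζ²).
  obtain ⟨R, hR⟩ : ∃ R : ℂ × ℂ × ℂ → ℂ, R = fun x => 16 * qs x
    + 2 * Complex.I * ν x.2.2 * G x.2.2 * r x
    + 2 * Complex.I * ν x.2.2 ^ 2 * A x.2.2 * (2 * l x.2.2 * M₂ x + M₁ x ^ 2)
    + 2 * Complex.I * ν x.2.2 ^ 3 * B x.2.2 * (3 * l x.2.2 ^ 2 * M₁ x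
      + 3 * l x.2.2 * (x.1 * x.2.1) * M₁ x ^ 2 + (x.1 * x.2.1) ^ 2 * M₁ x ^ 3) := ⟨_, rfl⟩
  have hRa : AnalyticAt ℂ R 0 := by
    rw [hR]
    fun_prop
  obtain ⟨c₁, hc₁⟩ : ∃ c : ℂ → ℂ, c = fun t =>
    -2 * Complex.I * s₁ t + 2 * Complex.I * l t * ν t * G t := ⟨_, rfl⟩
  obtain ⟨c₂, hc₂⟩ : ∃ c : ℂ → ℂ, c = fun t => -2 * s₂ t + 2 * Complex.I *
    (-2 * Complex.I * l₁ t * ν t * G t + (l t * ν t) ^ 2 * A t) := ⟨_, rfl⟩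
  obtain ⟨c₃, hc₃⟩ : ∃ c : ℂ → ℂ, c = fun t => 4 * Complex.I / 3 * s₃ t + 2 * Complex.I *
    (-2 * l₂ t * ν t * G t - 4 * Complex.I * l t * l₁ t * ν t ^ 2 * A t
      + (l t * ν t) ^ 3 * B t) := ⟨_, rfl⟩
  have hfe : ∀ᶠ x in 𝓝 (0 : ℂ × ℂ × ℂ), f (0, x) = x.1 * x.2.1 * c₁ x.2.2
      + (x.1 * x.2.1) ^ 2 * c₂ x.2.2 + (x.1 * x.2.1) ^ 3 * c₃ x.2.2 + (x.1 * x.2.1) ^ 4 * R x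
      + (x.1 * x.2.1) ^ 2 * (x.2.1 ^ 2 * X x + x.1 ^ 2 * Y x) := by
    filter_upwards [hpt.eventually h.eq, hle, hse] with x h1 h2 h3
    simp only [hp] at h1
    have e1 : f (0, x) = s (ω₀ x) - Θ (l (ω₀ x) * x.1, ν x.2.2 * x.2.1, s x.2.2) := by
      simp [hf]
    have e2 : D (ν x.2.2 * x.2.1, l (ω₀ x) * x.1, s x.2.2) = D' x := by simp only [hD', hp]
    have e3 : E (ν x.2.2 * x.2.1, l (ω₀ x) * x.1, s x.2.2) = E' x := by simp only [hE', hp]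
    have e4 : g (s x.2.2) = G x.2.2 := by rw [hG]
    have e5 : a (s x.2.2) = A x.2.2 := by rw [hA]
    have e6 : e (s x.2.2) = B x.2.2 := by rw [hB]
    have e7 : Λ x = l (ω₀ x) := by rw [hΛ]
    have e8 : M₁ x = -2 * Complex.I * l₁ x.2.2 + x.1 * x.2.1 * M₂ x := by rw [hM₁]
    have e9 : M₂ x = -2 * l₂ x.2.2 + x.1 * x.2.1 * r x := by rw [hM₂]
    rw [e1, h1, h3, e2, e3]
    simp only [hX, hY, hc₁, hc₂, hc₃, hR, e4, e5, e6, e7]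
    have T₁ : l (ω₀ x) = l x.2.2 + x.1 * x.2.1 * (-2 * Complex.I * l₁ x.2.2)
        + (x.1 * x.2.1) ^ 2 * (-2 * l₂ x.2.2) + (x.1 * x.2.1) ^ 3 * r x := by
      rw [h2, e8, e9]
      ring
    have T₂ : l (ω₀ x) ^ 2 = l x.2.2 ^ 2 + 2 * l x.2.2 * (x.1 * x.2.1) * (-2 * Complex.I * l₁ x.2.2)
        + (x.1 * x.2.1) ^ 2 * (2 * l x.2.2 * M₂ x + M₁ x ^ 2) := by
      rw [h2]
      linear_combination 2 * l x.2.2 * (x.1 * x.2.1) * e8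
    have T₃ : l (ω₀ x) ^ 3 = l x.2.2 ^ 3 + x.1 * x.2.1 * (3 * l x.2.2 ^ 2 * M₁ x
        + 3 * l x.2.2 * (x.1 * x.2.1) * M₁ x ^ 2 + (x.1 * x.2.1) ^ 2 * M₁ x ^ 3) := by
      rw [h2]
      ring
    linear_combination 2 * Complex.I * (x.1 * x.2.1) * ν x.2.2 * G x.2.2 * T₁
      + 2 * Complex.I * (x.1 * x.2.1) ^ 2 * ν x.2.2 ^ 2 * A x.2.2 * T₂
      + 2 * Complex.I * (x.1 * x.2.1) ^ 3 * ν x.2.2 ^ 3 * B x.2.2 * T₃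
  have hw : Tendsto (fun x : ℂ × ℂ × ℂ => x.2.2) (𝓝 0) (𝓝 0) :=
    Continuous.tendsto' (by fun_prop) _ _ rfl
  suffices hmain : IsNormalSegreFunction Θ' ↔ ∀ᶠ t in 𝓝 (0 : ℂ), c₁ t = 0 ∧ c₂ t = 0 ∧ c₃ t = 0 by
    rw [hmain, hc₁, hc₂, hc₃, hG, hA, hB]
  constructor
  · rintro ⟨D₁, E₁, hD₁, hE₁, h1⟩
    have hq : ∀ᶠ x in 𝓝 (0 : ℂ × ℂ × ℂ), x.1 * x.2.1 * (c₁ x.2.2 + x.1 * x.2.1 * c₂ x.2.2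
        + (x.1 * x.2.1) ^ 2 * c₃ x.2.2 + (x.1 * x.2.1) ^ 3 * R x
        + x.1 * x.2.1 * (x.2.1 ^ 2 * (X x - 2 * Complex.I * u x * D₁ x)
          + x.1 ^ 2 * (Y x - 2 * Complex.I * u x * E₁ x))) = 0 := by
      filter_upwards [h1, hfu, hfe] with x h1 h2 h3
      rw [h3, h1] at h2
      simp only [hω₀] at h2
      linear_combination h2
    have hc₁a : AnalyticAt ℂ c₁ 0 := by
      rw [hc₁]
      fun_prop
    have hc₂a : AnalyticAt ℂ c₂ 0 := by
      rw [hc₂]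
      fun_prop
    have hc₃a : AnalyticAt ℂ c₃ 0 := by
      rw [hc₃]
      fun_prop (disch := norm_num)
    -- After one division by zζ, comparison modulo (z², ζ²) gives c₁ = c₂ = 0; these terms then drop
    -- out, and a second division and comparison give c₃ = 0.
    have hq1 := eventually_eq_zero_of_mul_mul (by fun_prop) hq
    have hq2 := eventually_eq_zero_of_quadratic (α := c₁) (β := c₂)
      (D := fun x => -(x.2.1 ^ 2 * c₃ x.2.2 + x.2.1 ^ 2 * (x.1 * x.2.1) * R x
        + x.1 * x.2.1 * (Y x - 2 * Complex.I * u x * E₁ x)))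
      (E := fun x => -(x.1 * x.2.1 * (X x - 2 * Complex.I * u x * D₁ x)))
      (by fun_prop) (by fun_prop) (by
        filter_upwards [hq1] with x hx
        linear_combination hx)
    have hq3 : ∀ᶠ x in 𝓝 (0 : ℂ × ℂ × ℂ), x.1 * x.2.1 * (x.1 * x.2.1 * c₃ x.2.2
        + (x.1 * x.2.1) ^ 2 * R x
        + (x.2.1 ^ 2 * (X x - 2 * Complex.I * u x * D₁ x)
          + x.1 ^ 2 * (Y x - 2 * Complex.I * u x * E₁ x))) = 0 := by
      filter_upwards [hq1, hw.eventually hq2] with x h2 h3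
      rw [h3.1, h3.2] at h2
      linear_combination h2
    have hq4 := eventually_eq_zero_of_mul_mul (by fun_prop) hq3
    have hq5 := eventually_eq_zero_of_quadratic (α := fun _ => 0) (β := c₃)
      (D := fun x => -(x.2.1 ^ 2 * R x + (Y x - 2 * Complex.I * u x * E₁ x)))
      (E := fun x => -(X x - 2 * Complex.I * u x * D₁ x))
      (by fun_prop) (by fun_prop) (by
        filter_upwards [hq4] with x hx
        linear_combination hx)
    filter_upwards [hq2, hq5] with t h2 h3
    exact ⟨h2.1, h2.2, h3.2⟩
  · intro hc
    -- The factor -i / 2 inverts 2i, up to the sign from f(0, x) = -(Θ' - ω₀) u. The term (zζ)⁴ R is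
    -- filed under z² D, through (zζ)² = z² ζ².
    refine ⟨fun x => -Complex.I / 2 * v x * (x.1 ^ 2 * R x + X x), fun x => -Complex.I / 2 * v x * Y x,
      by fun_prop (disch := norm_num), by fun_prop (disch := norm_num), ?_⟩
    filter_upwards [hw.eventually hc, hfu, hfe, hune] with x h1 h2 h3 h4
    rw [h3, h1.1, h1.2.1, h1.2.2] at h2
    have e1 : u x * v x = 1 := by
      rw [hv]
      exact mul_inv_cancel₀ h4
    have e2 : ω₀ x = x.2.2 - 2 * Complex.I * (x.1 * x.2.1) := by rw [hω₀]
    linear_combination v x * h2 + e2 - (Θ' x - ω₀ x) * e1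
      - (x.1 * x.2.1) ^ 2 * (x.2.1 ^ 2 * v x * (x.1 ^ 2 * R x + X x) + x.1 ^ 2 * v x * Y x) * hI2


/-! ### The normal equations as a real Schwarzian equation -/

/-- The coefficient `a / g²`. -/
noncomputable def normalKappa (g a : ℂ → ℂ) (t : ℂ) : ℂ := a t / g t ^ 2

/-- The coefficient of the projective structure on the chain `z = 0`. -/
noncomputable def normalDelta (g a e : ℂ → ℂ) (t : ℂ) : ℂ :=
  3 * (Complex.I * deriv (normalKappa g a) t - 3 / 2 * normalKappa g a t ^ 2 + e t / g t ^ 3)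

/-- The vector field for `(s, s', s'' / s', l)`. -/
noncomputable def normalField (κ d : ℂ → ℂ) (y : ℂ × ℂ × ℂ × ℂ) : ℂ × ℂ × ℂ × ℂ :=
  (y.2.1, y.2.1 * y.2.2.1, y.2.2.1 ^ 2 / 2 + y.2.1 ^ 2 * d y.1,
    y.2.2.2 * (y.2.2.1 / 2 - Complex.I / 2 * y.2.1 * κ y.1))

section normalEquations

variable {g a e : ℂ → ℂ}

lemma analyticAt_normalKappa (hg : AnalyticAt ℂ g 0) (ha : AnalyticAt ℂ a 0) (hg0 : g 0 = 1) :
    AnalyticAt ℂ (normalKappa g a) 0 :=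
  ha.fun_div (hg.fun_pow 2) (by simp [hg0])

lemma analyticAt_normalDelta (hg : AnalyticAt ℂ g 0) (ha : AnalyticAt ℂ a 0)
    (he : AnalyticAt ℂ e 0) (hg0 : g 0 = 1) : AnalyticAt ℂ (normalDelta g a e) 0 := by
  have h1 := analyticAt_normalKappa hg ha hg0
  have h2 := h1.deriv
  have h3 : AnalyticAt ℂ (fun t => e t / g t ^ 3) 0 := he.fun_div (hg.fun_pow 3) (by simp [hg0])
  exact analyticAt_const.fun_mul (((analyticAt_const.fun_mul h2).fun_sub
    (analyticAt_const.fun_mul (h1.fun_pow 2))).fun_add h3)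

lemma analyticAt_normalField {κ d : ℂ → ℂ} (hκ : AnalyticAt ℂ κ 0) (hd : AnalyticAt ℂ d 0) (n₀ : ℂ) :
    AnalyticAt ℂ (normalField κ d) (0, 1, n₀, 1) := by
  unfold normalField
  have h1 : AnalyticAt ℂ (fun y : ℂ × ℂ × ℂ × ℂ => κ y.1) (0, 1, n₀, 1) :=
    hκ.fun_comp_of_eq (by fun_prop) rfl
  have h2 : AnalyticAt ℂ (fun y : ℂ × ℂ × ℂ × ℂ => d y.1) (0, 1, n₀, 1) :=
    hd.fun_comp_of_eq (by fun_prop) rfl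
  fun_prop (disch := norm_num)

/-- The normal equations in terms of the vector field. -/
lemma normalEquations_iff {s l ν : ℂ → ℂ} {p n m n' m' t : ℂ} (hg : g (s t) ≠ 0) (hp : p ≠ 0)
    (h1 : deriv s t = p) (h2 : deriv (deriv s) t = p * n)
    (h3 : deriv (deriv (deriv s)) t = p * (n' + n ^ 2))
    (hl1 : deriv l t = l t * m) (hl2 : deriv (deriv l) t = l t * (m' + m ^ 2))
    (hm : m = n / 2 - Complex.I / 2 * p * normalKappa g a (s t))
    (hm' : m' = n' / 2 - Complex.I / 2 * (p * n * normalKappa g a (s t)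
      + p ^ 2 * deriv (normalKappa g a) (s t)))
    (hν : l t * ν t * g (s t) = p) :
    NormalEquations g a e s l ν t ↔ n' = n ^ 2 / 2 + p ^ 2 * normalDelta g a e (s t) := by
  have hI2 := Complex.I_sq
  have hI0 := Complex.I_ne_zero
  obtain ⟨K, hK⟩ : ∃ K, K = normalKappa g a (s t) := ⟨_, rfl⟩
  obtain ⟨η, hη⟩ : ∃ η, η = e (s t) / g (s t) ^ 3 := ⟨_, rfl⟩
  -- Written with a / g² and e / g³, the equations contain l, ν and g only through q = l ν g(s),
  -- which equals p.
  have ha : a (s t) = K * g (s t) ^ 2 := by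
    rw [hK, normalKappa]
    field_simp
  have he : e (s t) = η * g (s t) ^ 3 := by
    rw [hη]
    field_simp
  unfold NormalEquations normalDelta
  rw [h1, h2, h3, hl1, hl2, ha, ← hη, he, ← hK]
  rw [← hK] at hm hm'
  generalize deriv (normalKappa g a) (s t) = K' at hm' ⊢
  obtain ⟨q, hq⟩ : ∃ q, q = l t * ν t * g (s t) := ⟨_, rfl⟩
  rw [← hq] at hν
  have e1 : -2 * Complex.I * p + 2 * Complex.I * l t * ν t * g (s t) = 0 := by
    linear_combination 2 * Complex.I * hν - 2 * Complex.I * hq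
  have e2 : -2 * (p * n) + 2 * Complex.I * (-2 * Complex.I * (l t * m) * ν t * g (s t)
      + (l t * ν t) ^ 2 * (K * g (s t) ^ 2)) = 0 := by
    have : -2 * (p * n) + 2 * Complex.I * (-2 * Complex.I * m * q + K * q ^ 2) = 0 := by
      rw [hν, hm]
      linear_combination (-2 * p * n + 2 * Complex.I * p ^ 2 * K) * hI2
    rw [hq] at this
    linear_combination this
  -- After elimination of the logarithmic derivative m of l, the third equation is n' - n² / 2 = p²
  -- δ(s), up to a nonzero factor. The left side is the Schwarzian derivative of s, as n = s'' / s'.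
  have e3 : 4 * Complex.I / 3 * (p * (n' + n ^ 2)) + 2 * Complex.I *
      (-2 * (l t * (m' + m ^ 2)) * ν t * g (s t)
        - 4 * Complex.I * l t * (l t * m) * ν t ^ 2 * (K * g (s t) ^ 2)
        + (l t * ν t) ^ 3 * (η * g (s t) ^ 3)) = 2 * Complex.I * p / 3 *
          (n ^ 2 / 2 + p ^ 2 * (3 * (Complex.I * K' - 3 / 2 * K ^ 2 + η)) - n') := by
    have : 4 * Complex.I / 3 * (p * (n' + n ^ 2)) + 2 * Complex.I *
      (-2 * (m' + m ^ 2) * q - 4 * Complex.I * m * q ^ 2 * K + q ^ 3 * η) = 2 * Complex.I * p / 3 *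
          (n ^ 2 / 2 + p ^ 2 * (3 * (Complex.I * K' - 3 / 2 * K ^ 2 + η)) - n') := by
      rw [hν, hm', hm]
      linear_combination (3 * Complex.I * p ^ 3 * K ^ 2) * hI2
    rw [← this, hq]
    ring
  rw [e3]
  have hne : 2 * Complex.I * p / 3 ≠ 0 := by simp [hp]
  constructor
  · intro h
    have := (mul_eq_zero.1 h.2.2).resolve_left hne
    linear_combination -this
  · intro h
    exact ⟨e1, e2, by rw [h]; ring⟩

/-- The solutions of the normal equations are integral curves of `normalField`. -/
lemma hasDerivAt_of_normalEquations (hg : AnalyticAt ℂ g 0) (ha : AnalyticAt ℂ a 0) (hg0 : g 0 = 1)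
    {s l ν : ℂ → ℂ} (hs : AnalyticAt ℂ s 0) (hl : AnalyticAt ℂ l 0)
    (hs0 : s 0 = 0) (hs1 : deriv s 0 = 1) (hl0 : l 0 = 1)
    (h : ∀ᶠ t in 𝓝 0, NormalEquations g a e s l ν t) :
    ∀ᶠ t in 𝓝 0, HasDerivAt (fun t => (s t, deriv s t, deriv (deriv s) t / deriv s t, l t))
      (normalField (normalKappa g a) (normalDelta g a e)
        (s t, deriv s t, deriv (deriv s) t / deriv s t, l t)) t := by
  have hI2 := Complex.I_sq
  have hκ := analyticAt_normalKappa hg ha hg0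
  have hst : Tendsto s (𝓝 0) (𝓝 0) := by
    have := hs.continuousAt.tendsto
    rwa [hs0] at this
  have hp : ∀ᶠ t in 𝓝 0, deriv s t ≠ 0 := hs.deriv.continuousAt.eventually_ne (by simp [hs1])
  have hln : ∀ᶠ t in 𝓝 0, l t ≠ 0 := hl.continuousAt.eventually_ne (by simp [hl0])
  have hgn : ∀ᶠ t in 𝓝 0, g (s t) ≠ 0 :=
    hst.eventually (hg.continuousAt.eventually_ne (by simp [hg0]))
  obtain ⟨n, hn⟩ : ∃ n : ℂ → ℂ, n = fun t => deriv (deriv s) t / deriv s t := ⟨_, rfl⟩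
  have hna : AnalyticAt ℂ n 0 := by
    rw [hn]
    exact hs.deriv.deriv.fun_div hs.deriv (by simp [hs1])
  -- The logarithmic derivative of l, as forced by the second equation once the first has eliminated
  -- ν.
  obtain ⟨m, hm⟩ : ∃ m : ℂ → ℂ, m = fun t =>
    n t / 2 - Complex.I / 2 * deriv s t * normalKappa g a (s t) := ⟨_, rfl⟩
  have hlm : ∀ᶠ t in 𝓝 0, deriv l t = l t * m t := by
    filter_upwards [h, hp, hgn] with t h1 h2 h3
    obtain ⟨h4, h5, -⟩ := h1
    have e1 : a (s t) = normalKappa g a (s t) * g (s t) ^ 2 := by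
      rw [normalKappa]
      field_simp
    have e2 : n t * deriv s t = deriv (deriv s) t := by
      rw [hn]
      field_simp
    have e3 : l t * ν t * g (s t) = deriv s t := by
      refine mul_left_cancel₀ (mul_ne_zero two_ne_zero Complex.I_ne_zero) ?_
      linear_combination h4
    rw [e1, ← e2] at h5
    have h6 : l t * ν t * g (s t) ≠ 0 := by rwa [e3]
    refine mul_left_cancel₀ (mul_ne_zero (right_ne_zero_of_mul (left_ne_zero_of_mul h6))
      (right_ne_zero_of_mul h6)) ?_
    simp only [hm]
    rw [← e3] at h5 ⊢
    linear_combination h5 / 4 + deriv l t * ν t * g (s t) * hI2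
  have key : ∀ᶠ t in 𝓝 0, HasDerivAt n (n t ^ 2 / 2
      + deriv s t ^ 2 * normalDelta g a e (s t)) t := by
    filter_upwards [h, hp, hgn, hlm.eventually_nhds, hna.eventually_analyticAt,
      hs.eventually_analyticAt, hl.eventually_analyticAt, hst.eventually hκ.eventually_analyticAt]
      with t h1 h2 h3 h4 h5 h6 h7 h8
    have d1 := h5.differentiableAt.hasDerivAt
    have d2 := h6.deriv.differentiableAt.hasDerivAt
    have d3 : HasDerivAt (fun t => normalKappa g a (s t))
        (deriv (normalKappa g a) (s t) * deriv s t) t :=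
      h8.differentiableAt.hasDerivAt.comp t h6.differentiableAt.hasDerivAt
    have d4 : deriv (deriv s) t = deriv s t * n t := by
      rw [hn]
      field_simp
    have d5 : HasDerivAt m (deriv n t / 2 - Complex.I / 2 * (deriv s t * n t * normalKappa g a (s t)
        + deriv s t ^ 2 * deriv (normalKappa g a) (s t))) t := by
      rw [hm]
      refine ((d1.div_const 2).sub ((d2.const_mul (Complex.I / 2)).mul d3)).congr_deriv ?_
      rw [d4]
      ring
    have d6 : deriv (deriv s) =ᶠ[𝓝 t] fun t => deriv s t * n t := by
      filter_upwards [h6.deriv.continuousAt.eventually_ne h2] with t h2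
      rw [hn]
      field_simp
    have d7 : deriv (deriv (deriv s)) t = deriv s t * (deriv n t + n t ^ 2) := by
      rw [d6.deriv_eq, (d2.fun_mul d1).deriv, d4]
      ring
    have d8 : deriv (deriv l) t = l t * (deriv m t + m t ^ 2) := by
      rw [(show deriv l =ᶠ[𝓝 t] fun t => l t * m t from h4).deriv_eq,
        (h7.differentiableAt.hasDerivAt.fun_mul d5.differentiableAt.hasDerivAt).deriv,
        h4.self_of_nhds]
      ring
    have e3 : l t * ν t * g (s t) = deriv s t := by
      refine mul_left_cancel₀ (mul_ne_zero two_ne_zero Complex.I_ne_zero) ?_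
      linear_combination h1.1
    have := (normalEquations_iff h3 h2 rfl d4 d7 h4.self_of_nhds d8 (by rw [hm]) d5.deriv e3).1 h1
    rw [← this]
    exact d1
  filter_upwards [key, hs.eventually_analyticAt, hl.eventually_analyticAt, hlm, hp]
    with t h1 h2 h3 h4 h5
  have d2 := h2.deriv.differentiableAt.hasDerivAt
  have d4 : deriv (deriv s) t = deriv s t * n t := by
    rw [hn]
    field_simp
  have d3 := h3.differentiableAt.hasDerivAt
  rw [h4] at d3
  rw [d4] at d2
  have e1 : ∀ t, deriv (deriv s) t / deriv s t = n t := fun t => by rw [hn]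
  simp only [e1]
  refine (h2.differentiableAt.hasDerivAt.prodMk (d2.prodMk (h1.prodMk d3))).congr_deriv ?_
  simp only [normalField, hm]

lemma tendsto_star_zero : Tendsto (fun t : ℂ => star t) (𝓝 0) (𝓝 0) :=
  Continuous.tendsto' (by fun_prop) _ _ (by simp)

/-- By the reality of the hypersurface, κ differs from its conjugate by 2i g'/g. In the coefficient
of the Schwarzian equation this and the relation for e cancel, so that coefficient is real although
κ and e need not be. This is what allows s to be real. -/
lemma star_normalDelta (hg : AnalyticAt ℂ g 0) (ha : AnalyticAt ℂ a 0)
    (hg0 : g 0 = 1) (hgs : ∀ᶠ t in 𝓝 0, star (g (star t)) = g t)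
    (has : ∀ᶠ t in 𝓝 0, a t = star (a (star t)) - 2 * Complex.I * g t * deriv g t)
    (hes : ∀ᶠ t in 𝓝 0, e t = star (e (star t)) - 2 * Complex.I * g t * deriv (conjMap a) t
        - 2 * Complex.I * deriv g t * a t - 2 * deriv (deriv g) t * g t ^ 2) :
    (∀ᶠ t in 𝓝 0, star (normalKappa g a (star t)) =
      normalKappa g a t + 2 * Complex.I * deriv g t / g t) ∧
    ∀ᶠ t in 𝓝 0, star (normalDelta g a e (star t)) = normalDelta g a e t := by
  have hI2 := Complex.I_sq
  have hκ := analyticAt_normalKappa hg ha hg0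
  have hgn : ∀ᶠ t in 𝓝 0, g t ≠ 0 := hg.continuousAt.eventually_ne (by simp [hg0])
  have hac := ha.analyticAt_conjMap
  have hκc : ∀ᶠ t in 𝓝 0, star (normalKappa g a (star t)) = conjMap a t / g t ^ 2 := by
    filter_upwards [hgs] with t h1
    rw [normalKappa, star_div₀, star_pow, h1]
    rfl
  refine ⟨?_, ?_⟩
  · filter_upwards [hκc, has, hgn] with t h1 h2 h3
    have e1 : conjMap a t = star (a (star t)) := rfl
    rw [h1, normalKappa, h2, e1]
    field_simp
    ring
  · filter_upwards [hκc.eventually_nhds, has.eventually_nhds, hgn, hgs, hes, hg.eventually_analyticAt,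
      hac.eventually_analyticAt, ha.eventually_analyticAt,
      tendsto_star_zero.eventually hκ.eventually_analyticAt] with t h1 h2 h3 h4 h5 h6 h7 h8 h9
    have d1 := h6.differentiableAt.hasDerivAt
    have d2 := h6.deriv.differentiableAt.hasDerivAt
    have d3 := h7.differentiableAt.hasDerivAt
    have d4 : deriv a t = deriv (conjMap a) t
        - 2 * Complex.I * (deriv g t * deriv g t + g t * deriv (deriv g) t) := by
      have := d3.sub ((d1.mul d2).const_mul (2 * Complex.I))
      refine HasDerivAt.deriv (this.congr_of_eventuallyEq ?_)
      filter_upwards [h2] with t h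
      simp only [Pi.sub_apply, Pi.mul_apply]
      rw [h]
      change star (a (star t)) - _ = star (a (star t)) - _
      ring
    have d5 : deriv (normalKappa g a) t = (deriv a t * g t ^ 2 - a t * (2 * g t * deriv g t)) / (g t ^ 2) ^ 2 := by
      have := h8.differentiableAt.hasDerivAt.fun_div (d1.fun_pow 2) (pow_ne_zero 2 h3)
      refine this.deriv.trans ?_
      simp
    have d6 : star (deriv (normalKappa g a) (star t)) =
        (deriv (conjMap a) t * g t ^ 2 - conjMap a t * (2 * g t * deriv g t)) / (g t ^ 2) ^ 2 := by
      have x1 := h9.differentiableAt.hasDerivAt.star_star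
      have x2 := d3.fun_div (d1.fun_pow 2) (pow_ne_zero 2 h3)
      have x3 := x1.unique (x2.congr_of_eventuallyEq h1)
      refine x3.trans ?_
      simp
    have e1 : conjMap a t = a t + 2 * Complex.I * g t * deriv g t := by
      rw [h2.self_of_nhds]
      change star (a (star t)) = _
      ring
    have e2 : star (e (star t)) = e t + 2 * Complex.I * g t * deriv (conjMap a) t
        + 2 * Complex.I * deriv g t * a t + 2 * deriv (deriv g) t * g t ^ 2 := by
      linear_combination -h5
    have e3 : star (2 : ℂ) = 2 := Complex.conj_ofNat 2
    have e4 : star Complex.I = -Complex.I := Complex.conj_I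
    have e5 : star (3 : ℂ) = 3 := Complex.conj_ofNat 3
    have e6 : normalKappa g a t = a t / g t ^ 2 := rfl
    simp only [normalDelta, star_mul', star_add, star_sub, star_div₀, star_pow, e3, e4, e5, h4,
      h1.self_of_nhds, d6, d5, d4, e1, e2, e6]
    field_simp
    ring_nf
    simp only [hI2]
    ring

/-- The normal equations have a real solution. -/
lemma exists_normalEquations (hg : AnalyticAt ℂ g 0) (ha : AnalyticAt ℂ a 0)
    (he : AnalyticAt ℂ e 0) (hg0 : g 0 = 1) (hgs : ∀ᶠ t in 𝓝 0, star (g (star t)) = g t)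
    (has : ∀ᶠ t in 𝓝 0, a t = star (a (star t)) - 2 * Complex.I * g t * deriv g t)
    (hes : ∀ᶠ t in 𝓝 0, e t = star (e (star t)) - 2 * Complex.I * g t * deriv (conjMap a) t
        - 2 * Complex.I * deriv g t * a t - 2 * deriv (deriv g) t * g t ^ 2)
    {n₀ : ℂ} (hn₀ : star n₀ = n₀) :
    ∃ s l : ℂ → ℂ, AnalyticAt ℂ s 0 ∧ AnalyticAt ℂ l 0 ∧ s 0 = 0 ∧ HasDerivAt s 1 0 ∧
      deriv (deriv s) 0 = n₀ ∧ l 0 = 1 ∧ (∀ᶠ t in 𝓝 0, star (s (star t)) = s t) ∧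
      ∀ᶠ t in 𝓝 0, NormalEquations g a e s l (conjMap l) t := by
  have hI2 := Complex.I_sq
  have hκ := analyticAt_normalKappa hg ha hg0
  have hd := analyticAt_normalDelta hg ha he hg0
  obtain ⟨hκs, hds⟩ := star_normalDelta hg ha hg0 hgs has hes
  obtain ⟨κ, hκe⟩ : ∃ κ, κ = normalKappa g a := ⟨_, rfl⟩
  obtain ⟨d, hde⟩ : ∃ d, d = normalDelta g a e := ⟨_, rfl⟩
  rw [← hκe] at hκ hκs
  rw [← hde] at hd hds
  obtain ⟨y, hy, hy0, hyd⟩ := (analyticAt_normalField hκ hd n₀).exists_ode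
  obtain ⟨s, hs⟩ : ∃ s : ℂ → ℂ, s = fun t => (y t).1 := ⟨_, rfl⟩
  obtain ⟨p, hp⟩ : ∃ p : ℂ → ℂ, p = fun t => (y t).2.1 := ⟨_, rfl⟩
  obtain ⟨n, hn⟩ : ∃ n : ℂ → ℂ, n = fun t => (y t).2.2.1 := ⟨_, rfl⟩
  obtain ⟨l, hl⟩ : ∃ l : ℂ → ℂ, l = fun t => (y t).2.2.2 := ⟨_, rfl⟩
  have hsd : ∀ᶠ t in 𝓝 0, HasDerivAt s (p t) t := by
    filter_upwards [hyd] with t h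
    rw [hs, hp]
    exact h.prod_fst
  have hpd : ∀ᶠ t in 𝓝 0, HasDerivAt p (p t * n t) t := by
    filter_upwards [hyd] with t h
    rw [hp, hn]
    exact h.prod_snd.prod_fst
  have hnd : ∀ᶠ t in 𝓝 0, HasDerivAt n (n t ^ 2 / 2 + p t ^ 2 * d (s t)) t := by
    filter_upwards [hyd] with t h
    rw [hp, hn, hs]
    exact h.prod_snd.prod_snd.prod_fst
  have hld : ∀ᶠ t in 𝓝 0, HasDerivAt l (l t * (n t / 2 - Complex.I / 2 * p t * κ (s t))) t := by
    filter_upwards [hyd] with t h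
    rw [hp, hn, hs, hl]
    exact h.prod_snd.prod_snd.prod_snd
  have hs0 : s 0 = 0 := by simp [hs, hy0]
  have hp0 : p 0 = 1 := by simp [hp, hy0]
  have hn0 : n 0 = n₀ := by simp [hn, hy0]
  have hl0 : l 0 = 1 := by simp [hl, hy0]
  have hsa := analyticAt_of_eventually_hasDerivAt hsd
  have hpa := analyticAt_of_eventually_hasDerivAt hpd
  have hna := analyticAt_of_eventually_hasDerivAt hnd
  have hla := analyticAt_of_eventually_hasDerivAt hld
  have hst : Tendsto s (𝓝 0) (𝓝 0) := by
    have := hsa.continuousAt.tendsto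
    rwa [hs0] at this
  -- the solution is real
  have hreal : (fun t => (star (s (star t)), star (p (star t)), star (n (star t)))) =ᶠ[𝓝 0]
      fun t => (s t, p t, n t) := by
    have hV : AnalyticAt ℂ (fun x : ℂ × ℂ × ℂ =>
        (x.2.1, x.2.1 * x.2.2, x.2.2 ^ 2 / 2 + x.2.1 ^ 2 * d x.1)) (0, 1, n₀) := by
      have h2 : AnalyticAt ℂ (fun y : ℂ × ℂ × ℂ => d y.1) (0, 1, n₀) :=
        hd.fun_comp_of_eq (by fun_prop) rfl
      fun_prop (disch := norm_num)
    refine hV.ode_unique (by simp [hs0, hp0, hn0, hn₀]) (by simp [hs0, hp0, hn0]) ?_ ?_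
    · have ht : Tendsto (fun t : ℂ => star (s (star t))) (𝓝 0) (𝓝 0) :=
        tendsto_star_zero.comp (hst.comp tendsto_star_zero)
      filter_upwards [tendsto_star_zero.eventually hsd, tendsto_star_zero.eventually hpd,
        tendsto_star_zero.eventually hnd, ht.eventually hds] with t h1 h2 h3 h4
      rw [_root_.star_star] at h4
      refine (h1.star_star.prodMk (h2.star_star.prodMk h3.star_star)).congr_deriv ?_
      have e3 : star (2 : ℂ) = 2 := Complex.conj_ofNat 2
      simp only [star_mul', star_add, star_div₀, star_pow, e3, h4]
    · filter_upwards [hsd, hpd, hnd] with t h1 h2 h3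
      exact h1.prodMk (h2.prodMk h3)
  -- The conjugate of l solves the conjugate equation: s, p and n are real, and κ changes by 2i
  -- g'/g.
  have hlc : ∀ᶠ t in 𝓝 0, HasDerivAt (conjMap l) (conjMap l t * (n t / 2 + Complex.I / 2 * p t *
      (κ (s t) + 2 * Complex.I * deriv g (s t) / g (s t)))) t := by
    filter_upwards [tendsto_star_zero.eventually hld, hreal, hst.eventually hκs] with t h1 h2 h3
    simp only [Prod.mk.injEq] at h2
    obtain ⟨h4, h5, h6⟩ := h2
    have e2 : star (2 : ℂ) = 2 := Complex.conj_ofNat 2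
    have e4 : star Complex.I = -Complex.I := Complex.conj_I
    refine h1.star_star.congr_deriv ?_
    have e5 : star (κ (s (star t))) = κ (s t) + 2 * Complex.I * deriv g (s t) / g (s t) := by
      rw [← h3, ← h4, _root_.star_star]
    simp only [star_mul', star_sub, star_div₀, e2, e4, e5, h5, h6, conjMap]
    ring
  have hpn : ∀ᶠ t in 𝓝 0, p t ≠ 0 := hpa.continuousAt.eventually_ne (by simp [hp0])
  have hgn : ∀ᶠ t in 𝓝 0, g (s t) ≠ 0 :=
    hst.eventually (hg.continuousAt.eventually_ne (by simp [hg0]))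
  -- The first normal equation with ν the conjugate of l. The logarithmic derivatives of the two
  -- factors add up to n - (g'/g)(s) p, so l ν g(s) / p is constant, and it is 1 at t = 0.
  have hW : (fun t => l t * conjMap l t * g (s t) / p t) =ᶠ[𝓝 0] fun _ => 1 := by
    refine AnalyticAt.ode_unique (V := fun _ => (0 : ℂ)) (y₀ := 1) analyticAt_const
      (by simp [conjMap, hl0, hs0, hg0, hp0]) rfl ?_
      (Eventually.of_forall fun t => hasDerivAt_const t _)
    filter_upwards [hsd, hpd, hld, hlc, hpn, hgn, hst.eventually hg.eventually_analyticAt]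
      with t h1 h2 h3 h4 h5 h6 h7
    have x1 : HasDerivAt (fun t => g (s t)) (deriv g (s t) * p t) t :=
      h7.differentiableAt.hasDerivAt.comp t h1
    refine (((h3.fun_mul h4).fun_mul x1).fun_div h2 h5).congr_deriv ?_
    field_simp
    linear_combination (2 * deriv g (s t) * p t * l t * conjMap l t) * hI2
  have hsd1 : deriv s =ᶠ[𝓝 0] p := hsd.mono fun t h => h.deriv
  have hsd2 : deriv (deriv s) =ᶠ[𝓝 0] fun t => p t * n t := by
    filter_upwards [hsd1.eventuallyEq_nhds, hpd] with t h1 h2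
    rw [h1.deriv_eq]
    exact h2.deriv
  refine ⟨s, l, hsa, hla, hs0, ?_, ?_, hl0, ?_, ?_⟩
  · have := hsd.self_of_nhds
    rwa [hp0] at this
  · rw [hsd2.eq_of_nhds, hp0, hn0, one_mul]
  · filter_upwards [hreal] with t h
    exact congrArg Prod.fst h
  filter_upwards [hsd.eventually_nhds, hsd1.eventuallyEq_nhds, hsd2.eventuallyEq_nhds, hpd, hnd,
    hld.eventually_nhds, hpn, hgn, hW, hst.eventually hκ.eventually_analyticAt]
    with t h1 h2 h3 h4 h5 h6 h7 h8 h9 h10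
  have d3 : HasDerivAt (fun t => κ (s t)) (deriv κ (s t) * p t) t :=
    h10.differentiableAt.hasDerivAt.comp t h1.self_of_nhds
  have d5 : HasDerivAt (fun t => n t / 2 - Complex.I / 2 * p t * κ (s t))
      ((n t ^ 2 / 2 + p t ^ 2 * d (s t)) / 2 - Complex.I / 2 * (p t * n t * κ (s t)
        + p t ^ 2 * deriv κ (s t))) t :=
    ((h5.div_const 2).sub ((h4.const_mul (Complex.I / 2)).mul d3)).congr_deriv (by ring)
  have d6 : deriv l =ᶠ[𝓝 t] fun t => l t * (n t / 2 - Complex.I / 2 * p t * κ (s t)) :=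
    h6.mono fun t h => h.deriv
  refine (normalEquations_iff (p := p t) (n := n t) (n' := n t ^ 2 / 2 + p t ^ 2 * d (s t))
    (m := n t / 2 - Complex.I / 2 * p t * κ (s t))
    (m' := (n t ^ 2 / 2 + p t ^ 2 * d (s t)) / 2 - Complex.I / 2 * (p t * n t * κ (s t)
        + p t ^ 2 * deriv κ (s t))) h8 h7 h2.eq_of_nhds h3.eq_of_nhds ?_ d6.eq_of_nhds ?_ ?_ ?_ ?_).2 ?_
  · rw [h3.deriv_eq, (h4.fun_mul h5).deriv]
    ring
  · rw [d6.deriv_eq, (h6.self_of_nhds.fun_mul d5).deriv]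
    ring
  · rw [hκe]
  · rw [hκe]
  · exact (div_eq_one_iff_eq h7).1 h9
  · rw [hde]

end normalEquations


/-! ### Normal forms and normal Segre functions -/

lemma eventually_coeff_eq_zero {a b c d e k : ℂ → ℂ} {r₁ r₂ r₃ r₄ 𝓡 : ℂ × ℂ × ℂ → ℂ}
    (hr₁ : ContinuousAt r₁ 0) (hr₂ : ContinuousAt r₂ 0) (hr₃ : ContinuousAt r₃ 0)
    (hr₄ : ContinuousAt r₄ 0)
    (h : ∀ᶠ x in 𝓝 (0 : ℂ × ℂ × ℂ), 𝓡 x = a x.2.2 + x.1 * b x.2.2 + x.2.1 * c x.2.2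
        + x.1 ^ 2 * d x.2.2 + x.1 * x.2.1 * e x.2.2 + x.2.1 ^ 2 * k x.2.2
        + (x.1 ^ 3 * r₁ x + x.1 ^ 2 * x.2.1 * r₂ x + x.1 * x.2.1 ^ 2 * r₃ x + x.2.1 ^ 3 * r₄ x))
    (hR : (fun p : ℂ × ℝ => 𝓡 (p.1, conj p.1, p.2)) =O[𝓝 0] fun p => ‖p.1‖ ^ 3) (z : ℂ) :
    ∀ᶠ u : ℝ in 𝓝 0, a u = 0 ∧ z * b u + conj z * c u = 0 ∧
      z ^ 2 * d u + z * conj z * e u + conj z ^ 2 * k u = 0 := by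
  obtain ⟨S, hS⟩ : ∃ S : ℂ × ℂ × ℂ → ℂ, S = fun x =>
    z ^ 3 * r₁ x + z ^ 2 * conj z * r₂ x + z * conj z ^ 2 * r₃ x + conj z ^ 3 * r₄ x := ⟨_, rfl⟩
  have hSc : ContinuousAt S 0 := by
    rw [hS]
    fun_prop
  have ht : Tendsto (fun p : ℝ × ℝ => ((p.1 : ℂ) * z, p.2)) (𝓝 0) (𝓝 0) :=
    Continuous.tendsto' (by fun_prop) _ _ (by simp)
  have h1 : (fun p : ℝ × ℝ => a p.2 + p.1 * (z * b p.2 + conj z * c p.2)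
      + p.1 ^ 2 * (z ^ 2 * d p.2 + z * conj z * e p.2 + conj z ^ 2 * k p.2)) =O[𝓝 0]
      fun p => ‖p.1‖ ^ 3 := by
    have h2 : (fun p : ℝ × ℝ => 𝓡 (p.1 * z, conj (p.1 * z), p.2)) =O[𝓝 0] fun p => ‖p.1‖ ^ 3 := by
      refine (hR.comp_tendsto ht).trans ?_
      refine Asymptotics.IsBigO.of_bound (‖z‖ ^ 3) (Eventually.of_forall fun p => ?_)
      simp [mul_pow, mul_comm]
    have ht' := tendsto_polarized.comp ht
    have h3 : (fun p : ℝ × ℝ => (p.1 : ℂ) ^ 3 * S (p.1 * z, conj (p.1 * z), p.2)) =O[𝓝 0]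
        fun p => ‖p.1‖ ^ 3 := by
      have h4 : (fun p : ℝ × ℝ => S (p.1 * z, conj (p.1 * z), p.2)) =O[𝓝 0] fun _ => (1 : ℝ) :=
        (hSc.isBigO_one ℝ).comp_tendsto ht'
      have h5 : (fun p : ℝ × ℝ => (p.1 : ℂ) ^ 3) =O[𝓝 0] fun p => ‖p.1‖ ^ 3 :=
        Asymptotics.isBigO_of_le _ fun p => by simp
      simpa using h5.mul h4
    refine (h2.sub h3).congr' ?_ EventuallyEq.rfl
    filter_upwards [ht'.eventually h] with p h6
    simp only [Function.comp] at h6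
    rw [h6, hS]
    simp only [map_mul, Complex.conj_ofReal]
    ring
  -- The bound is uniform for u near 0, so currying gives, for each fixed real u, a quadratic
  -- polynomial in the real parameter that is O(3).
  obtain ⟨C, hC⟩ := h1.bound
  have hC' : ∀ᶠ p : ℝ × ℝ in 𝓝 0, ‖a p.1 + p.2 * (z * b p.1 + conj z * c p.1)
      + p.2 ^ 2 * (z ^ 2 * d p.1 + z * conj z * e p.1 + conj z ^ 2 * k p.1)‖ ≤ C * ‖‖p.2‖ ^ 3‖ :=
    (Continuous.tendsto' continuous_swap (0 : ℝ × ℝ) 0 rfl).eventually hC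
  rw [show (0 : ℝ × ℝ) = (0, 0) from rfl, nhds_prod_eq] at hC'
  filter_upwards [hC'.curry] with u hu
  have h2 := coeff_eq_zero_of_isBigO (𝕜 := ℝ) (n := 3) (a := fun j : ℕ => if j = 0 then a u else
    if j = 1 then z * b u + conj z * c u else z ^ 2 * d u + z * conj z * e u + conj z ^ 2 * k u) (by
    refine Asymptotics.IsBigO.of_bound C (nhdsWithin_le_nhds ?_)
    filter_upwards [hu] with s hs
    refine le_trans (le_of_eq ?_) hs
    congr 1
    simp [Finset.sum_range_succ]
    ring)
  exact ⟨by simpa using h2 0 (by norm_num), by simpa using h2 1 (by norm_num),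
    by simpa using h2 2 (by norm_num)⟩

/-- The directions z = 1 and z = i show that the coefficients of 1, z, ζ and zζ vanish. The pure
squares and all cubic terms lie in the ideal (z², ζ²), so nothing need be proved about them. -/
lemma AnalyticAt.exists_of_isBigO {𝓡 : ℂ × ℂ × ℂ → ℂ} (h𝓡 : AnalyticAt ℂ 𝓡 0)
    (hR : (fun p : ℂ × ℝ => 𝓡 (p.1, conj p.1, p.2)) =O[𝓝 0] fun p => ‖p.1‖ ^ 3) :
    ∃ D E : ℂ × ℂ × ℂ → ℂ, AnalyticAt ℂ D 0 ∧ AnalyticAt ℂ E 0 ∧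
      ∀ᶠ x in 𝓝 (0 : ℂ × ℂ × ℂ), 𝓡 x = x.1 ^ 2 * D x + x.2.1 ^ 2 * E x := by
  obtain ⟨a, b, c, d, e, k, r₁, r₂, r₃, r₄, ⟨ha, hb, hc, hd, he, hk⟩, ⟨hr₁, hr₂, hr₃, hr₄⟩, -, hexp⟩ :=
    h𝓡.exists_second_order
  have h0 := eventually_coeff_eq_zero hr₁.continuousAt hr₂.continuousAt hr₃.continuousAt
    hr₄.continuousAt hexp hR 1
  have h1 := eventually_coeff_eq_zero hr₁.continuousAt hr₂.continuousAt hr₃.continuousAt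
    hr₄.continuousAt hexp hR Complex.I
  have hI2 := Complex.I_sq
  have hu : Tendsto (fun p : ℂ × ℝ => p.2) (𝓝 0) (𝓝 0) := Continuous.tendsto' (by fun_prop) _ _ rfl
  have hz : ∀ {f : ℂ → ℂ}, AnalyticAt ℂ f 0 → (∀ᶠ u : ℝ in 𝓝 0, f u = 0) →
      ∀ᶠ x in 𝓝 (0 : ℂ × ℂ × ℂ), f x.2.2 = 0 := by
    intro f hf h
    refine AnalyticAt.eventually_eq_zero_of_polarized (H := fun x => f x.2.2)
      (hf.fun_comp_of_eq (by fun_prop) rfl) (hu.eventually h)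
  have ha0 := hz ha (h0.mono fun u h => h.1)
  have hb0 := hz hb (by
    filter_upwards [h0, h1] with u h2 h3
    have h4 := h2.2.1
    have h5 := h3.2.1
    simp only [map_one, Complex.conj_I] at h4 h5
    linear_combination h4 / 2 - Complex.I / 2 * h5 + (b u - c u) / 2 * hI2)
  have hc0 := hz hc (by
    filter_upwards [h0, h1] with u h2 h3
    have h4 := h2.2.1
    have h5 := h3.2.1
    simp only [map_one, Complex.conj_I] at h4 h5
    linear_combination h4 / 2 + Complex.I / 2 * h5 - (b u - c u) / 2 * hI2)
  have he0 := hz he (by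
    filter_upwards [h0, h1] with u h2 h3
    have h4 := h2.2.2
    have h5 := h3.2.2
    simp only [map_one, Complex.conj_I] at h4 h5
    linear_combination h4 / 2 + h5 / 2 - (d u + k u - e u) / 2 * hI2)
  refine ⟨fun x => d x.2.2 + x.1 * r₁ x + x.2.1 * r₂ x, fun x => k x.2.2 + x.1 * r₃ x + x.2.1 * r₄ x,
    by fun_prop, by fun_prop, ?_⟩
  filter_upwards [hexp, ha0, hb0, hc0, he0] with x h2 h3 h4 h5 h6
  rw [h2, h3, h4, h5, h6]
  ring

/-- Needed for uniqueness, where the target of an arbitrary normalizing map must have a Segre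
function too. All terms other than z z̄ are divisible by z² z̄. -/
lemma IsMoserNormalForm.isLeviModelUpToOrderThree {F : ℂ × ℝ → ℝ} (h : IsMoserNormalForm F) :
    IsLeviModelUpToOrderThree F := by
  obtain ⟨A, B, R, hA, hB, hR, hRO, hF⟩ := h
  have hcz : AnalyticAt ℝ (fun p : ℂ × ℝ => conj p.1) 0 :=
    (Complex.conjCLE.toContinuousLinearMap.analyticAt _).fun_comp_of_eq analyticAt_fst rfl
  have hA' : AnalyticAt ℝ (fun p : ℂ × ℝ => A p.2) 0 := hA.fun_comp_of_eq analyticAt_snd rfl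
  have hB' : AnalyticAt ℝ (fun p : ℂ × ℝ => B p.2) 0 := hB.fun_comp_of_eq analyticAt_snd rfl
  have hG : AnalyticAt ℝ (fun p : ℂ × ℝ => p.1 * conj p.1 + A p.2 * p.1 ^ 4 * conj p.1 ^ 2
        + B p.2 * p.1 ^ 2 * conj p.1 ^ 4 + p.1 ^ 2 * conj p.1 ^ 2 * R p) 0 := by
    have : AnalyticAt ℝ (fun p : ℂ × ℝ => p.1) 0 := analyticAt_fst
    exact (((this.fun_mul hcz).fun_add ((hA'.fun_mul (this.fun_pow 4)).fun_mul (hcz.fun_pow 2))).fun_add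
      ((hB'.fun_mul (this.fun_pow 2)).fun_mul (hcz.fun_pow 4))).fun_add
      (((this.fun_pow 2).fun_mul (hcz.fun_pow 2)).fun_mul hR)
  refine ⟨?_, ?_⟩
  · refine ((Complex.reCLM.analyticAt _).fun_comp_of_eq hG rfl).congr ?_
    filter_upwards [hF] with p hp
    simp only [← hp]
    simp
  · obtain ⟨T, hT⟩ : ∃ T : ℂ × ℝ → ℂ, T = fun p =>
      A p.2 * p.1 ^ 2 * conj p.1 + B p.2 * conj p.1 ^ 3 + conj p.1 * R p := ⟨_, rfl⟩
    have hTc : ContinuousAt T 0 := by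
      rw [hT]
      have h1 := hA'.continuousAt
      have h2 := hB'.continuousAt
      have h3 := hR.continuousAt
      fun_prop
    have h1 : (fun p : ℂ × ℝ => p.1 ^ 2 * conj p.1 * T p) =O[𝓝 0] fun p => ‖p‖ ^ 3 := by
      have h2 : (fun p : ℂ × ℝ => p.1 ^ 2 * conj p.1) =O[𝓝 0] fun p => ‖p‖ ^ 3 := by
        refine Asymptotics.IsBigO.of_bound 1 (Eventually.of_forall fun p => ?_)
        simp only [norm_mul, norm_pow, RCLike.norm_conj, one_mul, norm_norm]
        rw [← pow_succ]
        exact pow_le_pow_left₀ (norm_nonneg _) (norm_fst_le p) 3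
      simpa using h2.mul (hTc.isBigO_one ℝ)
    refine (Asymptotics.isBigO_norm_left.2 h1).norm_left.congr' ?_ EventuallyEq.rfl |>.of_norm_left
    filter_upwards [hF] with p hp
    have e : ((F p - ‖p.1‖ ^ 2 : ℝ) : ℂ) = p.1 ^ 2 * conj p.1 * T p := by
      push_cast
      rw [hp, ← Complex.mul_conj', hT]
      ring
    rw [← e, Complex.norm_real]
    simp

/-- The Segre function of a hypersurface in normal form is normal. -/
lemma IsMoserNormalForm.isNormalSegreFunction {F : ℂ × ℝ → ℝ} (h : IsMoserNormalForm F)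
    {𝓕 Θ : ℂ × ℂ × ℂ → ℂ} (h𝓕 : IsPolarization F 𝓕) (hΘ : IsSegreFunction Θ) (hs : SolvesFor 𝓕 Θ) :
    IsNormalSegreFunction Θ := by
  obtain ⟨A, B, R, hA, hB, hR, hRO, hF⟩ := h
  have hA' : AnalyticAt ℝ (fun p : ℂ × ℝ => A p.2) 0 := hA.fun_comp_of_eq analyticAt_snd rfl
  have hB' : AnalyticAt ℝ (fun p : ℂ × ℝ => B p.2) 0 := hB.fun_comp_of_eq analyticAt_snd rfl
  obtain ⟨𝒜, h𝒜, h𝒜e⟩ := hA'.exists_polarization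
  obtain ⟨ℬ, hℬ, hℬe⟩ := hB'.exists_polarization
  obtain ⟨𝓡, h𝓡, h𝓡e⟩ := hR.exists_polarization
  obtain ⟨D, E, hD, hE, hDE⟩ := h𝓡.exists_of_isBigO (hRO.congr' h𝓡e EventuallyEq.rfl)
  have h1 : ∀ᶠ x in 𝓝 (0 : ℂ × ℂ × ℂ), 𝓕 x - (x.1 * x.2.1 + x.1 ^ 2 * x.2.1 ^ 2 *
      (x.1 ^ 2 * (𝒜 x + D x) + x.2.1 ^ 2 * (ℬ x + E x))) = 0 := by
    refine (h𝓕.analyticAt.fun_sub (by fun_prop)).eventually_eq_zero_of_polarized ?_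
    filter_upwards [hF, h𝒜e, hℬe, h𝓡e, h𝓕.eq, tendsto_polarized.eventually hDE]
      with p h1 h2 h3 h4 h5 h6
    rw [← h5, ← h2, ← h3, h1, h4, h6]
    ring
  have ht : Tendsto (fun x : ℂ × ℂ × ℂ => (x.2.1, x.1, (x.2.2 + Θ x) / 2)) (𝓝 0) (𝓝 0) := by
    have := hΘ.analyticAt.continuousAt
    have : ContinuousAt (fun x : ℂ × ℂ × ℂ => (x.2.1, x.1, (x.2.2 + Θ x) / 2)) 0 := by fun_prop
    refine this.tendsto.trans (le_of_eq ?_)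
    simp [hΘ.zero]
  have hpa : AnalyticAt ℂ (fun x : ℂ × ℂ × ℂ => (x.2.1, x.1, (x.2.2 + Θ x) / 2)) 0 := by
    have := hΘ.analyticAt
    fun_prop (disch := norm_num)
  have hp0 : (fun x : ℂ × ℂ × ℂ => (x.2.1, x.1, (x.2.2 + Θ x) / 2)) 0 = 0 := by simp [hΘ.zero]
  -- The leading term zζ does not involve u, so replacing u by (w + Θ) / 2 affects only the
  -- coefficients inside the ideal.
  refine ⟨fun x => (fun y => 𝒜 y + D y) (x.2.1, x.1, (x.2.2 + Θ x) / 2),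
    fun x => (fun y => ℬ y + E y) (x.2.1, x.1, (x.2.2 + Θ x) / 2),
    AnalyticAt.fun_comp_of_eq (h𝒜.fun_add hD) hpa hp0,
    AnalyticAt.fun_comp_of_eq (hℬ.fun_add hE) hpa hp0, ?_⟩
  filter_upwards [ht.eventually h1, (tendsto_graph hΘ.analyticAt.continuousAt hΘ.zero).eventually hs]
    with x h2 h3
  have h4 := h3.2 rfl
  rw [sub_eq_zero.1 h2, div_eq_iff (mul_ne_zero two_ne_zero Complex.I_ne_zero)] at h4
  linear_combination -h4

/-- A normal Segre function is the Segre function of a hypersurface in normal form. -/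
lemma IsSegreFunction.exists_isMoserNormalForm {Θ : ℂ × ℂ × ℂ → ℂ} (hΘ : IsSegreFunction Θ)
    (h : IsNormalSegreFunction Θ) : ∃ F, IsMoserNormalForm F ∧ IsSegreFunctionOf F Θ := by
  have hI2 := Complex.I_sq
  obtain ⟨D, E, hD, hE, hΘe⟩ := h
  -- solve for the imaginary part
  obtain ⟨f, hf⟩ : ∃ f : (ℂ × ℂ × ℂ) × ℂ → ℂ, f = fun y =>
    Θ (y.1.2.1, y.1.1, y.1.2.2 + Complex.I * y.2) - (y.1.2.2 - Complex.I * y.2) := ⟨_, rfl⟩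
  have hfa : AnalyticAt ℂ f (0, 0) := by
    rw [hf]
    exact (hΘ.analyticAt.fun_comp_of_eq (by fun_prop) (by simp)).fun_sub (by fun_prop)
  have hf0 : f (0, 0) = 0 := by
    have : Θ (0, 0, 0) = 0 := hΘ.zero
    simp [hf, this]
  have hfd : HasFDerivAt (fun v => f (0, v))
      (ContinuousLinearMap.toSpanSingleton ℂ (2 * Complex.I)) 0 := by
    have h1 : HasDerivAt (fun v : ℂ => ((0 : ℂ), (0 : ℂ), Complex.I * v)) (0, 0, Complex.I) 0 :=
      (hasDerivAt_const _ _).prodMk ((hasDerivAt_const _ _).prodMk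
        (((hasDerivAt_id (0 : ℂ)).const_mul Complex.I).congr_deriv (by simp)))
    have h2 := HasFDerivAt.comp_hasDerivAt_of_eq (0 : ℂ) hΘ.hasFDerivAt h1 (by simp; rfl)
    have h3 := h2.add ((hasDerivAt_id (0 : ℂ)).const_mul Complex.I)
    refine HasDerivAt.hasFDerivAt ((h3.congr_deriv ?_).congr_of_eventuallyEq
      (Eventually.of_forall fun v => ?_))
    · simp
      ring
    · simp [hf]
  obtain ⟨𝓥, h𝓥, h𝓥0, h𝓥e⟩ := hfa.exists_implicitFunction hf0 hfd (by
    intro y hy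
    simpa using hy)
  have hiff : ∀ᶠ p in 𝓝 (0 : (ℂ × ℂ × ℂ) × ℂ),
      p.1.2.2 - Complex.I * p.2 = Θ (p.1.2.1, p.1.1, p.1.2.2 + Complex.I * p.2) ↔ 𝓥 p.1 = p.2 := by
    have h𝓥e' : ∀ᶠ p in 𝓝 (0 : (ℂ × ℂ × ℂ) × ℂ), f p = 0 ↔ 𝓥 p.1 = p.2 := h𝓥e
    filter_upwards [h𝓥e'] with p hp
    rw [← hp, hf, sub_eq_zero, eq_comm]
  have h𝓥t : Tendsto (fun x : ℂ × ℂ × ℂ => (x, 𝓥 x)) (𝓝 0) (𝓝 0) := by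
    refine (continuousAt_id.prodMk h𝓥.continuousAt).tendsto.trans (le_of_eq ?_)
    simp [h𝓥0]
  have hgraph : ∀ᶠ x in 𝓝 (0 : ℂ × ℂ × ℂ),
      x.2.2 - Complex.I * 𝓥 x = Θ (x.2.1, x.1, x.2.2 + Complex.I * 𝓥 x) := by
    filter_upwards [h𝓥t.eventually hiff] with x hx using hx.2 rfl
  -- reality
  have hreal : ∀ᶠ x in 𝓝 (0 : ℂ × ℂ × ℂ), 𝓥 (conj x.2.1, conj x.1, conj x.2.2) = conj (𝓥 x) := by
    have ht1 : Tendsto (fun x : ℂ × ℂ × ℂ => (((x.1, x.2.2 + Complex.I * 𝓥 x),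
        (x.2.1, x.2.2 - Complex.I * 𝓥 x)) : (ℂ × ℂ) × ℂ × ℂ)) (𝓝 0) (𝓝 0) := by
      have := h𝓥.continuousAt
      have : ContinuousAt (fun x : ℂ × ℂ × ℂ => (((x.1, x.2.2 + Complex.I * 𝓥 x),
        (x.2.1, x.2.2 - Complex.I * 𝓥 x)) : (ℂ × ℂ) × ℂ × ℂ)) 0 := by fun_prop
      refine this.tendsto.trans (le_of_eq ?_)
      simp [h𝓥0]
    have ht2 : Tendsto (fun x : ℂ × ℂ × ℂ => (((conj x.2.1, conj x.1, conj x.2.2), conj (𝓥 x)) :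
        (ℂ × ℂ × ℂ) × ℂ)) (𝓝 0) (𝓝 0) := by
      have := h𝓥.continuousAt
      have h1 := Complex.continuous_conj
      have : ContinuousAt (fun x : ℂ × ℂ × ℂ => (((conj x.2.1, conj x.1, conj x.2.2), conj (𝓥 x)) :
        (ℂ × ℂ × ℂ) × ℂ)) 0 := by fun_prop
      refine this.tendsto.trans (le_of_eq ?_)
      simp [h𝓥0]
    filter_upwards [hgraph, ht1.eventually hΘ.symm, ht2.eventually hiff] with x h1 h2 h3
    refine h3.1 ?_
    have h4 := h2.1 h1
    simp only [Prod.star_def, Complex.star_def, map_add, map_sub, map_mul, Complex.conj_I] at h4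
    convert h4 using 3
    · ring
    · simp
  obtain ⟨F, hFd⟩ : ∃ F : ℂ × ℝ → ℝ, F = fun p => (𝓥 (p.1, conj p.1, p.2)).re := ⟨_, rfl⟩
  have hFe : ∀ᶠ p in 𝓝 (0 : ℂ × ℝ), (F p : ℂ) = 𝓥 (p.1, conj p.1, p.2) := by
    filter_upwards [tendsto_polarized.eventually hreal] with p hp
    simp only [Complex.conj_conj, Complex.conj_ofReal] at hp
    rw [hFd]
    exact Complex.conj_eq_iff_re.1 hp.symm
  -- the normal form of `𝓥`
  have hpa : AnalyticAt ℂ (fun x : ℂ × ℂ × ℂ => (x.2.1, x.1, x.2.2 + Complex.I * 𝓥 x)) 0 := by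
    fun_prop
  have hp0 : (fun x : ℂ × ℂ × ℂ => (x.2.1, x.1, x.2.2 + Complex.I * 𝓥 x)) 0 = 0 := by simp [h𝓥0]
  have hpt : Tendsto (fun x : ℂ × ℂ × ℂ => (x.2.1, x.1, x.2.2 + Complex.I * 𝓥 x)) (𝓝 0) (𝓝 0) :=
    hpa.continuousAt.tendsto.trans (le_of_eq (congrArg 𝓝 hp0))
  obtain ⟨D', hD'⟩ : ∃ D' : ℂ × ℂ × ℂ → ℂ, D' = fun x => D (x.2.1, x.1, x.2.2 + Complex.I * 𝓥 x) :=
    ⟨_, rfl⟩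
  obtain ⟨E', hE'⟩ : ∃ E' : ℂ × ℂ × ℂ → ℂ, E' = fun x => E (x.2.1, x.1, x.2.2 + Complex.I * 𝓥 x) :=
    ⟨_, rfl⟩
  have hD'a : AnalyticAt ℂ D' 0 := by
    rw [hD']
    exact hD.fun_comp_of_eq hpa hp0
  have hE'a : AnalyticAt ℂ E' 0 := by
    rw [hE']
    exact hE.fun_comp_of_eq hpa hp0
  have h𝓥n : ∀ᶠ x in 𝓝 (0 : ℂ × ℂ × ℂ), 𝓥 x = x.1 * x.2.1
      + x.1 ^ 2 * x.2.1 ^ 2 * (x.1 ^ 2 * D' x + x.2.1 ^ 2 * E' x) := by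
    filter_upwards [hgraph, hpt.eventually hΘe] with x h1 h2
    rw [h2] at h1
    simp only [hD', hE']
    linear_combination Complex.I / 2 * h1 + (𝓥 x - x.1 * x.2.1 - x.1 ^ 2 * x.2.1 ^ 2 *
      (x.1 ^ 2 * D (x.2.1, x.1, x.2.2 + Complex.I * 𝓥 x)
        + x.2.1 ^ 2 * E (x.2.1, x.1, x.2.2 + Complex.I * 𝓥 x))) * hI2
  -- The values of D' and E' on the axis become the coefficients of z⁴ z̄² and z² z̄⁴; the remaining
  -- parts are of order one in (z, z̄) and, multiplied by z² or z̄², give the remainder of order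
  -- three.
  obtain ⟨P, Q, hP, hQ, hPQ⟩ := hD'a.exists_hadamard_two
  obtain ⟨P', Q', hP', hQ', hPQ'⟩ := hE'a.exists_hadamard_two
  have hpol : AnalyticAt ℝ (fun p : ℂ × ℝ => (p.1, conj p.1, (p.2 : ℂ))) 0 := by
    refine analyticAt_fst.prod (AnalyticAt.prod ?_ ?_)
    · exact (Complex.conjCLE.toContinuousLinearMap.analyticAt _).fun_comp_of_eq analyticAt_fst rfl
    · exact (Complex.ofRealCLM.analyticAt _).fun_comp_of_eq analyticAt_snd rfl
  have hpol0 : (fun p : ℂ × ℝ => (p.1, conj p.1, (p.2 : ℂ))) 0 = 0 := by simp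
  have hax : AnalyticAt ℝ (fun u : ℝ => ((0 : ℂ), (0 : ℂ), (u : ℂ))) 0 :=
    analyticAt_const.prod (analyticAt_const.prod (Complex.ofRealCLM.analyticAt _))
  have hax0 : (fun u : ℝ => ((0 : ℂ), (0 : ℂ), (u : ℂ))) 0 = 0 := by simp
  obtain ⟨S, hS⟩ : ∃ S : ℂ × ℂ × ℂ → ℂ, S = fun x =>
    x.1 ^ 2 * (x.1 * P x + x.2.1 * Q x) + x.2.1 ^ 2 * (x.1 * P' x + x.2.1 * Q' x) := ⟨_, rfl⟩
  have hSa : AnalyticAt ℂ S 0 := by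
    rw [hS]
    fun_prop
  refine ⟨F, ⟨fun u => D' (0, 0, u), fun u => E' (0, 0, u), fun p => S (p.1, conj p.1, p.2),
    hD'a.restrictScalars.fun_comp_of_eq hax hax0, hE'a.restrictScalars.fun_comp_of_eq hax hax0,
    hSa.restrictScalars.fun_comp_of_eq hpol hpol0, ?_, ?_⟩, ?_⟩
  · have h3 : ∀ {T : ℂ × ℂ × ℂ → ℂ} {m : ℂ × ℝ → ℂ}, AnalyticAt ℂ T 0 → (∀ p, ‖m p‖ = ‖p.1‖ ^ 3) →
        (fun p : ℂ × ℝ => m p * T (p.1, conj p.1, p.2)) =O[𝓝 0] fun p => ‖p.1‖ ^ 3 := by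
      intro T m hT hm
      have h4 : (fun p : ℂ × ℝ => T (p.1, conj p.1, p.2)) =O[𝓝 0] fun _ => (1 : ℝ) :=
        (hT.continuousAt.isBigO_one ℝ).comp_tendsto tendsto_polarized
      have h5 : m =O[𝓝 0] fun p => ‖p.1‖ ^ 3 :=
        Asymptotics.isBigO_of_le _ fun p => by simp [hm]
      simpa using h5.mul h4
    have h4 := (((h3 (m := fun p => p.1 ^ 3) hP (by simp)).add
      (h3 (m := fun p => p.1 ^ 2 * conj p.1) hQ (by intro p; simp [pow_succ]))).add
      (h3 (m := fun p => conj p.1 ^ 2 * p.1) hP' (by intro p; simp [pow_succ]))).add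
      (h3 (m := fun p => conj p.1 ^ 3) hQ' (by simp))
    refine h4.congr_left fun p => ?_
    rw [hS]
    ring
  · filter_upwards [hFe, tendsto_polarized.eventually h𝓥n, tendsto_polarized.eventually hPQ,
      tendsto_polarized.eventually hPQ'] with p h1 h2 h3 h4
    rw [h1, h2, h3, h4, hS]
    ring
  · have ht1 : Tendsto (fun p : ℂ × ℂ => (p.1, p.2.re)) (𝓝 0) (𝓝 0) :=
      Continuous.tendsto' (by fun_prop) _ _ rfl
    have ht2 : Tendsto (fun p : ℂ × ℂ => (((p.1, conj p.1, (p.2.re : ℂ)), (p.2.im : ℂ)) :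
        (ℂ × ℂ × ℂ) × ℂ)) (𝓝 0) (𝓝 0) := by
      have h1 := Complex.continuous_conj
      exact Continuous.tendsto' (by fun_prop) _ _ (by simp)
    filter_upwards [ht1.eventually hFe, ht2.eventually hiff] with p h1 h2
    have e1 : (p.2.re : ℂ) + Complex.I * p.2.im = p.2 := by
      rw [mul_comm]
      exact Complex.re_add_im _
    have e2 : (p.2.re : ℂ) - Complex.I * p.2.im = conj p.2 := by
      conv_rhs => rw [← e1]
      simp [sub_eq_add_neg]
    rw [e1, e2, ← h1, Complex.ofReal_inj] at h2
    rw [graphHypersurface, Set.mem_ofPred_eq, eq_comm, ← h2]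
    rfl


/-! ### Maps to normal form -/

lemma IsNormalSegreFunction.segreSlope_eq {Θ : ℂ × ℂ × ℂ → ℂ} (h : IsNormalSegreFunction Θ)
    (hΘ : IsSegreFunction Θ) :
    ∀ᶠ x in 𝓝 (0 : ℂ × ℂ), segreSlope Θ (0, x) = -2 * Complex.I * x.1 := by
  obtain ⟨D, E, hD, hE, he⟩ := h
  have hin : Tendsto (fun x : ℂ × ℂ => ((0 : ℂ), x)) (𝓝 0) (𝓝 0) :=
    Continuous.tendsto' (by fun_prop) _ _ rfl
  filter_upwards [hin.eventually hΘ.analyticAt.eventually_analyticAt,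
    hin.eventually hD.eventually_analyticAt, hin.eventually hE.eventually_analyticAt,
    hin.eventually he.eventually_nhds] with x h1 h2 h3 h4
  have hl : AnalyticAt ℂ (fun ζ : ℂ => (ζ, x)) 0 := by fun_prop
  obtain ⟨S, hS⟩ : ∃ S : ℂ → ℂ, S = fun ζ => 1 + x.1 * ζ * (x.1 ^ 2 * D (ζ, x) + ζ ^ 2 * E (ζ, x)) :=
    ⟨_, rfl⟩
  have hSa : AnalyticAt ℂ S 0 := by
    have h5 : AnalyticAt ℂ (fun ζ : ℂ => D (ζ, x)) 0 := h2.fun_comp_of_eq hl rfl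
    have h6 : AnalyticAt ℂ (fun ζ : ℂ => E (ζ, x)) 0 := h3.fun_comp_of_eq hl rfl
    rw [hS]
    fun_prop
  have h5 := (((hasDerivAt_id (0 : ℂ)).const_mul (2 * Complex.I * x.1)).fun_mul
    hSa.differentiableAt.hasDerivAt).const_sub x.2
  refine (h1.hasDerivAt_segreSlope.unique (h5.congr_of_eventuallyEq ?_)).trans ?_
  · filter_upwards [hl.continuousAt.eventually h4] with ζ h6
    rw [h6, hS]
    rfl
  · simp [hS]

section

variable {Θ Φ : ℂ × ℂ × ℂ → ℂ} {ξ : ℂ × ℂ × ℂ → ℂ × ℂ} {γ : ℂ → ℂ × ℂ}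

/-- A map to normal form sends the axis `z = 0` to a chain. -/
lemma IsPullback.isSegreChain {Θ' : ℂ × ℂ × ℂ → ℂ} {H : ℂ × ℂ → ℂ × ℂ} (hΘ : IsSegreFunction Θ)
    (hΦ : AnalyticAt ℂ Φ 0)
    (hΦΘ : ∀ᶠ x in 𝓝 0, segreSlope (segreSlope Θ) x = Φ (x.1, Θ x, segreSlope Θ x))
    (hH : AnalyticAt ℂ H 0) (hH0 : H 0 = 0)
    (hHd : HasFDerivAt H (ContinuousLinearMap.id ℂ (ℂ × ℂ)) 0)
    (hΘ' : IsSegreFunction Θ') (hn : IsNormalSegreFunction Θ') (hpb : IsPullback Θ H Θ') :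
    IsSegreChain Θ Φ (fun t => H (0, t)) := by
  have hcurve : (conjMap fun t => H (0, t)) = fun t => conjMap H (0, t) := by
    ext t <;> simp [conjMap, Prod.star_def]
  have hax : Tendsto (fun t : ℂ => ((0 : ℂ), t)) (𝓝 0) (𝓝 0) :=
    Continuous.tendsto' (by fun_prop) _ _ rfl
  have h0 : ∀ᶠ x in 𝓝 (0 : ℂ × ℂ × ℂ), Θ' (0, x.2) = x.2.2 := by
    obtain ⟨D, E, hD, hE, he⟩ := hn
    have hp : Tendsto (fun x : ℂ × ℂ × ℂ => ((0 : ℂ), x.2)) (𝓝 0) (𝓝 0) :=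
      Continuous.tendsto' (by fun_prop) _ _ rfl
    filter_upwards [hp.eventually he] with x hx
    rw [hx]
    simp
  refine ⟨hH.fun_comp_of_eq (by fun_prop) rfl, hH0, ?_, ?_, ?_⟩
  · have h1 : HasDerivAt (fun t : ℂ => ((0 : ℂ), t)) (0, 1) 0 :=
      (hasDerivAt_const _ _).prodMk (hasDerivAt_id (0 : ℂ))
    exact (HasFDerivAt.comp_hasDerivAt_of_eq (0 : ℂ) hHd h1 rfl).congr_deriv (by simp)
  · filter_upwards [hax.eventually (hpb.slope_eq hΘ hΘ' hH hH0 h0)] with t ht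
    rw [hcurve]
    exact ht.1
  · obtain ⟨D, E, hD, hE, he⟩ := hn
    have hsw : AnalyticAt ℂ (fun y : ℂ × ℂ × ℂ => (y.2.1, y.1, y.2.2)) 0 := by fun_prop
    have hD' : AnalyticAt ℂ (fun y : ℂ × ℂ × ℂ => D (y.2.1, y.1, y.2.2)) 0 :=
      hD.fun_comp_of_eq hsw rfl
    have hE' : AnalyticAt ℂ (fun y : ℂ × ℂ × ℂ => E (y.2.1, y.1, y.2.2)) 0 :=
      hE.fun_comp_of_eq hsw rfl
    -- A normal Segre function has g = 1 and σ = z² D + ζ² E, so σ_z vanishes on the axis and the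
    -- criterion applies.
    have h1 := hpb.chain_iff hΘ hΦ hΦΘ hH hH0 hHd (g := fun _ => 1)
      (σ := fun y => y.1 ^ 2 * D (y.2.1, y.1, y.2.2) + y.2.1 ^ 2 * E (y.2.1, y.1, y.2.2))
      analyticAt_const one_ne_zero (by fun_prop) he
    have hin : Tendsto (fun t : ℂ => ((0 : ℂ), (0 : ℂ), t)) (𝓝 0) (𝓝 0) :=
      Continuous.tendsto' (by fun_prop) _ _ rfl
    filter_upwards [h1, hin.eventually hD.eventually_analyticAt] with t h2 h3
    have h4 : deriv (fun z : ℂ => z ^ 2 * D (0, z, t) + 0 ^ 2 * E (0, z, t)) 0 = 0 := by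
      have h5 : AnalyticAt ℂ (fun z : ℂ => D (0, z, t)) 0 := h3.fun_comp_of_eq (by fun_prop) rfl
      have h6 := ((hasDerivAt_id (0 : ℂ)).pow 2).mul h5.differentiableAt.hasDerivAt
      refine (HasDerivAt.congr_of_eventuallyEq h6 (Eventually.of_forall fun z => ?_)).deriv.trans ?_
      · simp
      · simp
    have h7 := h2.2 h4
    rw [hcurve] at h7 ⊢
    exact h7

/-- A map to normal form along a reparametrization of the chain `γ` factors through the adapted
map. -/
lemma IsPullback.exists_eq_adaptedMap {Θ' : ℂ × ℂ × ℂ → ℂ} {H : ℂ × ℂ → ℂ × ℂ}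
    (hΘ : IsSegreFunction Θ) (hγ : IsSegreChain Θ Φ γ)
    (hξe : ∀ᶠ p in 𝓝 (0 : (ℂ × ℂ × ℂ) × ℂ × ℂ),
      (Θ (p.1.1, p.2) = p.1.2.1 ∧ segreSlope Θ (p.1.1, p.2) = p.1.2.2) ↔ ξ p.1 = p.2)
    (hH : AnalyticAt ℂ H 0) (hH0 : H 0 = 0)
    (hHd : HasFDerivAt H (ContinuousLinearMap.id ℂ (ℂ × ℂ)) 0)
    (hΘ' : IsSegreFunction Θ') (hn : IsNormalSegreFunction Θ') (hpb : IsPullback Θ H Θ')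
    {s : ℂ → ℂ} (hs : AnalyticAt ℂ s 0) (hs0 : s 0 = 0) (hs1 : HasDerivAt s 1 0)
    (hss : ∀ᶠ t in 𝓝 0, star (s (star t)) = s t) (hHγ : ∀ᶠ t in 𝓝 0, H (0, t) = γ (s t)) :
    ∃ l : ℂ → ℂ, AnalyticAt ℂ l 0 ∧ l 0 = 1 ∧
      ∀ᶠ x in 𝓝 (0 : ℂ × ℂ), H x = adaptedMap Θ ξ γ (conjMap l x.2 * x.1, s x.2) := by
  have hcH := hH.analyticAt_conjMap
  have hcγ := hγ.analyticAt.analyticAt_conjMap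
  have hp2 : Tendsto (fun x : ℂ × ℂ => x.2) (𝓝 0) (𝓝 0) := Continuous.tendsto' (by fun_prop) _ _ rfl
  have hax2 : Tendsto (fun x : ℂ × ℂ => ((0 : ℂ), x.2)) (𝓝 0) (𝓝 0) :=
    Continuous.tendsto' (by fun_prop) _ _ rfl
  have hst : Tendsto s (𝓝 0) (𝓝 0) := by
    have := hs.continuousAt.tendsto
    rwa [hs0] at this
  have h0 : ∀ᶠ x in 𝓝 (0 : ℂ × ℂ × ℂ), Θ' (0, x.2) = x.2.2 := by
    obtain ⟨D, E, hD, hE, he⟩ := hn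
    have hp : Tendsto (fun x : ℂ × ℂ × ℂ => ((0 : ℂ), x.2)) (𝓝 0) (𝓝 0) :=
      Continuous.tendsto' (by fun_prop) _ _ rfl
    filter_upwards [hp.eventually he] with x hx
    rw [hx]
    simp
  have hcax : ∀ᶠ t in 𝓝 (0 : ℂ), conjMap H (0, t) = conjMap γ (s t) := by
    filter_upwards [tendsto_star_zero.eventually hHγ, hss] with t h1 h2
    change star (H (star (0 : ℂ), star t)) = star (γ (star (s t)))
    rw [star_zero, h1, ← h2, star_star]
  have hcd : ∀ᶠ t in 𝓝 (0 : ℂ), fderiv ℂ (conjMap H) (0, t) (0, 1)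
      = deriv s t • deriv (conjMap γ) (s t) := by
    have h1 : Tendsto (fun t : ℂ => ((0 : ℂ), t)) (𝓝 0) (𝓝 0) :=
      Continuous.tendsto' (by fun_prop) _ _ rfl
    filter_upwards [h1.eventually hcH.eventually_analyticAt, hcax.eventually_nhds,
      hs.eventually_analyticAt, hst.eventually hcγ.eventually_analyticAt] with t h2 h3 h4 h5
    have h6 := HasFDerivAt.comp_hasDerivAt t h2.differentiableAt.hasFDerivAt
        ((hasDerivAt_const t (0 : ℂ)).prodMk (hasDerivAt_id t))
    have h7 : HasDerivAt (fun t => conjMap γ (s t)) (deriv s t • deriv (conjMap γ) (s t)) t :=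
      HasDerivAt.scomp t h5.differentiableAt.hasDerivAt h4.differentiableAt.hasDerivAt
    exact h6.unique (h7.congr_of_eventuallyEq h3)
  obtain ⟨k, hk⟩ : ∃ k : ℂ → ℂ × ℂ, k = fun t => fderiv ℂ (conjMap H) (0, t) (1, 0) := ⟨_, rfl⟩
  have hka : AnalyticAt ℂ k 0 := by
    rw [hk]
    exact (hcH.fderiv_apply (1, 0)).fun_comp_of_eq (by fun_prop) rfl
  have hk0 : (k 0).1 = 1 := by
    have : fderiv ℂ (conjMap H) (0, 0) = ContinuousLinearMap.id ℂ (ℂ × ℂ) :=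
      (hasFDerivAt_conjMap_id hHd).fderiv
    simp [hk, this]
  have hk1a : AnalyticAt ℂ (fun t => (k t).1) 0 := analyticAt_fst.fun_comp_of_eq hka rfl
  have hkn : ∀ᶠ t in 𝓝 0, (k t).1 ≠ 0 := hk1a.continuousAt.eventually_ne (by simp [hk0])
  -- In normal coordinates the Segre slope on ζ = 0 is -2iz, so the transported direction is k - 2iz
  -- s' γ̄'(s) with k = k.1 (1, ε). Divided by k.1 it is the direction that `adaptedMap` prescribes
  -- for the first coordinate (s' / k.1) z.
  obtain ⟨ν, hν⟩ : ∃ ν : ℂ → ℂ, ν = fun t => deriv s t / (k t).1 := ⟨_, rfl⟩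
  have hνa : AnalyticAt ℂ ν 0 := by
    rw [hν]
    exact hs.deriv.fun_div hk1a (by simp [hk0])
  have hν0 : ν 0 = 1 := by simp [hν, hs1.deriv, hk0]
  refine ⟨conjMap ν, hνa.analyticAt_conjMap, by simp [conjMap, hν0], ?_⟩
  have hcc : conjMap (conjMap ν) = ν := by
    ext t
    simp [conjMap]
  rw [hcc]
  have hsl := hpb.slope_eq hΘ hΘ' hH hH0 h0
  have hslope : Tendsto (fun x : ℂ × ℂ => (((conjMap H (0, x.2)).1, (conjMap H (0, x.2)).2,
      segreSlope Θ ((conjMap H (0, x.2)).1, H x)), H x)) (𝓝 0) (𝓝 0) := by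
    have h1 : ContinuousAt (fun x : ℂ × ℂ => conjMap H (0, x.2)) 0 :=
      hcH.continuousAt.comp_of_eq (by fun_prop) rfl
    have e : conjMap H (0, 0) = 0 := conjMap_zero hH0
    have e' : segreSlope Θ (0, 0) = 0 := hΘ.segreSlope_zero
    have h2 : ContinuousAt (fun x : ℂ × ℂ => segreSlope Θ ((conjMap H (0, x.2)).1, H x)) 0 :=
      hΘ.analyticAt.analyticAt_segreSlope.continuousAt.comp_of_eq
        ((continuous_fst.continuousAt.comp h1).prodMk hH.continuousAt) (by simp [e, hH0])
    refine (((continuous_fst.continuousAt.comp h1).prodMk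
      ((continuous_snd.continuousAt.comp h1).prodMk h2)).prodMk hH.continuousAt).tendsto.trans
        (le_of_eq ?_)
    simp [e, hH0, e']
  have hden : ∀ᶠ x in 𝓝 (0 : ℂ × ℂ),
      1 - 2 * Complex.I * (ν x.2 * x.1) * (deriv (conjMap γ) (s x.2)).1 ≠ 0 := by
    have h1 : ContinuousAt (fun x : ℂ × ℂ => deriv (conjMap γ) (s x.2)) 0 :=
      hcγ.deriv.continuousAt.comp_of_eq (hs.continuousAt.comp_of_eq (by fun_prop) rfl) (by simp [hs0])
    have h2 : ContinuousAt (fun x : ℂ × ℂ => ν x.2) 0 :=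
      hνa.continuousAt.comp_of_eq (by fun_prop) rfl
    refine ContinuousAt.eventually_ne ?_ (by simp)
    fun_prop
  filter_upwards [hsl, hax2.eventually hsl, hn.segreSlope_eq hΘ',
    hax2.eventually (hn.segreSlope_eq hΘ'), hslope.eventually hξe, hp2.eventually hcax,
    hp2.eventually hcd, hp2.eventually hkn, hp2.eventually hHγ, hden]
    with x h1 h2 h3 h4 h5 h6 h7 h8 h9 h10
  have h11 : ξ ((conjMap H (0, x.2)).1, (conjMap H (0, x.2)).2,
      segreSlope Θ ((conjMap H (0, x.2)).1, H x)) = H x := h5.1 ⟨h1.1.symm, rfl⟩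
  rw [← h11, adaptedMap]
  have h12 := h1.2
  have h13 := h2.2
  simp only [h3, h4, h7, h9, h6, mul_zero, zero_smul, add_zero] at h12 h13
  have e2 : k x.2 = fderiv ℂ (conjMap H) (0, x.2) (1, 0) := by rw [hk]
  rw [← e2] at h12 h13
  simp only [Prod.fst_add, Prod.snd_add, Prod.smul_fst, Prod.smul_snd, smul_eq_mul, h13] at h12
  have e3 : deriv s x.2 = ν x.2 * (k x.2).1 := by
    rw [hν]
    field_simp
  rw [e3] at h12
  simp only [h6]
  congr 3
  rw [eq_div_iff h10]
  refine mul_right_cancel₀ h8 ?_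
  linear_combination -h12

end


/-! ### Correspondences of hypersurfaces and second-order jets -/

lemma IsPullback.congr {Θ Θ₁ Θ₂ : ℂ × ℂ × ℂ → ℂ} {K₁ K₂ : ℂ × ℂ → ℂ × ℂ} (h : IsPullback Θ K₁ Θ₁)
    (hK : K₁ =ᶠ[𝓝 0] K₂) (hΘ : Θ₁ =ᶠ[𝓝 0] Θ₂) : IsPullback Θ K₂ Θ₂ := by
  have h1 : Tendsto (fun q : (ℂ × ℂ) × ℂ × ℂ => (q.2.1, q.1)) (𝓝 0) (𝓝 0) :=
    Continuous.tendsto' (by fun_prop) _ _ rfl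
  have h2 : Tendsto (fun q : (ℂ × ℂ) × ℂ × ℂ => q.1) (𝓝 0) (𝓝 0) :=
    Continuous.tendsto' (by fun_prop) _ _ rfl
  have h3 : Tendsto (fun q : (ℂ × ℂ) × ℂ × ℂ => star q.2) (𝓝 0) (𝓝 0) :=
    Continuous.tendsto' (by fun_prop) _ _ (by simp)
  filter_upwards [h, h1.eventually hΘ, h2.eventually hK, h3.eventually hK] with q h4 h5 h6 h7
  rw [← h5, ← h6]
  simp only [conjMap, ← h7]
  exact h4

lemma IsNormalSegreFunction.congr {Θ₁ Θ₂ : ℂ × ℂ × ℂ → ℂ} (h : IsNormalSegreFunction Θ₁)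
    (hΘ : Θ₁ =ᶠ[𝓝 0] Θ₂) : IsNormalSegreFunction Θ₂ := by
  obtain ⟨D, E, hD, hE, he⟩ := h
  refine ⟨D, E, hD, hE, ?_⟩
  filter_upwards [he, hΘ] with x h1 h2
  rw [← h2, h1]

/-- A pullback of Segre functions restricts to a correspondence of hypersurfaces. -/
lemma IsPullback.mem_graphHypersurface_iff {F F' : ℂ × ℝ → ℝ} {Θ Θ' : ℂ × ℂ × ℂ → ℂ}
    {H : ℂ × ℂ → ℂ × ℂ} (h : IsPullback Θ H Θ') (hF : IsSegreFunctionOf F Θ)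
    (hF' : IsSegreFunctionOf F' Θ') (hH : ContinuousAt H 0) (hH0 : H 0 = 0) :
    ∀ᶠ x in 𝓝 (0 : ℂ × ℂ), H x ∈ graphHypersurface F ↔ x ∈ graphHypersurface F' := by
  have h1 : Tendsto (fun x : ℂ × ℂ => (x, star x)) (𝓝 0) (𝓝 0) :=
    Continuous.tendsto' (by fun_prop) _ _ (by simp)
  have h2 : Tendsto H (𝓝 0) (𝓝 0) := by rwa [ContinuousAt, hH0] at hH
  filter_upwards [h1.eventually h, h2.eventually hF, hF'] with x h3 h4 h5
  rw [h4, h5]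
  simp only [conjMap, star_star] at h3
  exact h3

/-- A correspondence of hypersurfaces extends to a pullback of Segre functions. -/
lemma IsSegreFunction.isPullback_of_mem_graphHypersurface_iff {F F' : ℂ × ℝ → ℝ}
    {Θ Θ' 𝓕' : ℂ × ℂ × ℂ → ℂ} {H : ℂ × ℂ → ℂ × ℂ} (hΘ : IsSegreFunction Θ)
    (hF : IsSegreFunctionOf F Θ) (h𝓕' : IsPolarization F' 𝓕') (h𝓕'0 : 𝓕' 0 = 0)
    (hΘ' : IsSegreFunction Θ') (hs : SolvesFor 𝓕' Θ') (hH : AnalyticAt ℂ H 0) (hH0 : H 0 = 0)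
    (hHd : HasFDerivAt H (ContinuousLinearMap.id ℂ (ℂ × ℂ)) 0)
    (h : ∀ᶠ x in 𝓝 (0 : ℂ × ℂ), H x ∈ graphHypersurface F ↔ x ∈ graphHypersurface F') :
    IsPullback Θ H Θ' := by
  have hI2 := Complex.I_sq
  obtain ⟨Θ'', hΘ'', hpb⟩ := hΘ.exists_pullback hH hH0 hHd
  refine hpb.congr EventuallyEq.rfl ?_
  have h𝓕a := h𝓕'.analyticAt
  have hpa : AnalyticAt ℂ (fun y : ℂ × ℂ × ℂ => (y.2.1, y.1, y.2.2 + Complex.I * 𝓕' y)) 0 := by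
    fun_prop
  -- At real points z, w = u + i F', w̄ = u - i F' the correspondence of hypersurfaces puts the
  -- graph of F' on the Segre family of Θ''. This is an identity on ζ = z̄, u real, and hence holds
  -- for independent variables.
  have h1 : ∀ᶠ y in 𝓝 (0 : ℂ × ℂ × ℂ),
      Θ'' (y.2.1, y.1, y.2.2 + Complex.I * 𝓕' y) - (y.2.2 - Complex.I * 𝓕' y) = 0 := by
    refine AnalyticAt.eventually_eq_zero_of_polarized ((hΘ''.analyticAt.fun_comp_of_eq hpa
      (by simp [h𝓕'0])).fun_sub (by fun_prop)) ?_
    have ht : Tendsto (fun p : ℂ × ℝ => (p.1, p.2 + Complex.I * 𝓕' (p.1, conj p.1, p.2)))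
        (𝓝 0) (𝓝 0) := by
      have hc : ContinuousAt (fun y : ℂ × ℂ × ℂ => (y.1, y.2.2 + Complex.I * 𝓕' y)) 0 := by
        have := h𝓕a.continuousAt
        fun_prop
      have hc' : Tendsto (fun y : ℂ × ℂ × ℂ => (y.1, y.2.2 + Complex.I * 𝓕' y)) (𝓝 0) (𝓝 0) := by
        refine hc.tendsto.trans (le_of_eq ?_)
        simp [h𝓕'0]
      exact hc'.comp tendsto_polarized
    have hst : Tendsto (fun x : ℂ × ℂ => (x, star x)) (𝓝 0) (𝓝 0) :=
      Continuous.tendsto' (by fun_prop) _ _ (by simp)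
    have hHt : Tendsto H (𝓝 0) (𝓝 0) := by
      have := hH.continuousAt
      rwa [ContinuousAt, hH0] at this
    filter_upwards [h𝓕'.eq, ht.eventually h, ht.eventually (hHt.eventually hF),
      ht.eventually (hst.eventually hpb)] with p h2 h3 h4 h5
    rw [← h2] at h3 h4 h5 ⊢
    have h6 : ((p.1, (p.2 : ℂ) + Complex.I * (F' p : ℂ)) : ℂ × ℂ) ∈ graphHypersurface F' := by
      simp [graphHypersurface]
    simp only [conjMap, star_star] at h5
    have h7 := h5.1 (h4.1 (h3.2 h6))
    rw [sub_eq_zero]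
    refine Eq.trans ?_ (h7.symm.trans ?_)
    · rfl
    · simp [sub_eq_add_neg]
  have ht : Tendsto (fun x : ℂ × ℂ × ℂ => (x.2.1, x.1, (x.2.2 + Θ' x) / 2)) (𝓝 0) (𝓝 0) := by
    have := hΘ'.analyticAt.continuousAt
    have : ContinuousAt (fun x : ℂ × ℂ × ℂ => (x.2.1, x.1, (x.2.2 + Θ' x) / 2)) 0 := by fun_prop
    refine this.tendsto.trans (le_of_eq ?_)
    simp [hΘ'.zero]
  filter_upwards [ht.eventually h1, (tendsto_graph hΘ'.analyticAt.continuousAt hΘ'.zero).eventually hs]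
    with x h2 h3
  have h4 := h3.2 rfl
  -- Specialized to u = (w + Θ') / 2, the points u ± i 𝓕' are w and Θ', so the identity becomes Θ''
  -- = Θ'.
  have e1 : (x.2.2 + Θ' x) / 2 + Complex.I * 𝓕' (x.2.1, x.1, (x.2.2 + Θ' x) / 2) = x.2.2 := by
    rw [← h4]
    field_simp
    ring
  have e2 : (x.2.2 + Θ' x) / 2 - Complex.I * 𝓕' (x.2.1, x.1, (x.2.2 + Θ' x) / 2) = Θ' x := by
    linear_combination -e1
  rw [e1, e2, sub_eq_zero] at h2
  exact h2

section scaling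

variable {s l : ℂ → ℂ}

lemma analyticAt_scaling (hs : AnalyticAt ℂ s 0) (hl : AnalyticAt ℂ l 0) :
    AnalyticAt ℂ (fun x : ℂ × ℂ => (conjMap l x.2 * x.1, s x.2)) 0 := by
  have h1 : AnalyticAt ℂ (fun x : ℂ × ℂ => conjMap l x.2) 0 :=
    hl.analyticAt_conjMap.fun_comp_of_eq analyticAt_snd rfl
  have h2 : AnalyticAt ℂ (fun x : ℂ × ℂ => s x.2) 0 := hs.fun_comp_of_eq analyticAt_snd rfl
  exact (h1.fun_mul analyticAt_fst).prod h2

lemma hasFDerivAt_scaling (hl : AnalyticAt ℂ l 0) (hs1 : HasDerivAt s 1 0) (hl0 : l 0 = 1) :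
    HasFDerivAt (fun x : ℂ × ℂ => (conjMap l x.2 * x.1, s x.2))
      (ContinuousLinearMap.id ℂ (ℂ × ℂ)) 0 := by
  have h1 : AnalyticAt ℂ (fun x : ℂ × ℂ => conjMap l x.2) 0 :=
    hl.analyticAt_conjMap.fun_comp_of_eq analyticAt_snd rfl
  have h2 := h1.differentiableAt.hasFDerivAt.mul
    (hasFDerivAt_fst (𝕜 := ℂ) (E := ℂ) (F := ℂ) (p := 0))
  have h3 := HasFDerivAt.comp_of_eq hs1.hasFDerivAt (0 : ℂ × ℂ)
    (hasFDerivAt_snd (𝕜 := ℂ) (E := ℂ) (F := ℂ) (p := 0)) rfl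
  refine (h2.prodMk h3).congr_fderiv ?_
  have e : conjMap l 0 = 1 := by simp [conjMap, hl0]
  ext <;> simp [e]

/-- Since s is real, the conjugate substitution on (ζ, ω) is (l(ω) ζ, s(ω)). -/
lemma IsPullback.scaling {Θ Θ' : ℂ × ℂ × ℂ → ℂ} (hss : ∀ᶠ t in 𝓝 0, star (s (star t)) = s t)
    (hΘ' : IsSegreFunction Θ')
    (h : IsPullback Θ (fun x : ℂ × ℂ => (conjMap l x.2 * x.1, s x.2)) Θ') :
    ∀ᶠ x in 𝓝 (0 : ℂ × ℂ × ℂ),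
      s (Θ' x) = Θ (l (Θ' x) * x.1, conjMap l x.2.2 * x.2.1, s x.2.2) := by
  have hg := tendsto_graph hΘ'.analyticAt.continuousAt hΘ'.zero
  have ht : Tendsto Θ' (𝓝 0) (𝓝 0) := by
    have := hΘ'.analyticAt.continuousAt
    rwa [ContinuousAt, hΘ'.zero] at this
  filter_upwards [hg.eventually h, ht.eventually hss] with x h1 h2
  have h3 := h1.2 rfl
  have e : conjMap (fun x : ℂ × ℂ => (conjMap l x.2 * x.1, s x.2)) (x.1, Θ' x)
      = (l (Θ' x) * x.1, s (Θ' x)) := by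
    rw [← h2]
    simp [conjMap, Prod.star_def]
  rw [e] at h3
  exact h3

end scaling

/-- Second derivatives add under composition because both maps have derivative 1 at the fixed point.
-/
lemma deriv_deriv_comp {s φ : ℂ → ℂ} (hs : AnalyticAt ℂ s 0) (hφ : AnalyticAt ℂ φ 0) (hφ0 : φ 0 = 0)
    (hs1 : HasDerivAt s 1 0) (hφ1 : HasDerivAt φ 1 0) :
    deriv (deriv fun w => s (φ w)) 0 = deriv (deriv s) 0 + deriv (deriv φ) 0 := by
  have hφt : Tendsto φ (𝓝 0) (𝓝 0) := by
    have := hφ.continuousAt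
    rwa [ContinuousAt, hφ0] at this
  have h1 : deriv (fun w => s (φ w)) =ᶠ[𝓝 0] fun w => deriv s (φ w) * deriv φ w := by
    filter_upwards [hφ.eventually_analyticAt, hφt.eventually hs.eventually_analyticAt] with w h2 h3
    exact (h3.differentiableAt.hasDerivAt.comp w h2.differentiableAt.hasDerivAt).deriv
  have h2 : HasDerivAt (fun w => deriv s (φ w)) (deriv (deriv s) 0 * 1) 0 :=
    HasDerivAt.comp_of_eq (0 : ℂ) hs.deriv.differentiableAt.hasDerivAt hφ1 hφ0.symm
  rw [h1.deriv_eq, (h2.fun_mul hφ.deriv.differentiableAt.hasDerivAt).deriv, hφ1.deriv, hφ0, hs1.deriv]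
  ring

lemma star_deriv_deriv {s : ℂ → ℂ} (h : ∀ᶠ t in 𝓝 0, star (s (star t)) = s t) :
    star (deriv (deriv s) 0) = deriv (deriv s) 0 := by
  have e : ∀ f : ℂ → ℂ, deriv (conjMap f) = conjMap (deriv f) := fun f => by
    ext t
    exact congrFun (deriv_conj_conj (f := f)) t
  have h1 : conjMap s =ᶠ[𝓝 0] s := h
  have h2 := h1.deriv.deriv_eq
  rw [e, e] at h2
  simpa [conjMap] using h2

/-- The second order jet of the inverse of `K ∘ L` along `z = 0`, where `L` acts on `w` by `s`. -/
lemma deriv_deriv_inverse {K k h : ℂ × ℂ → ℂ × ℂ} {ν s : ℂ → ℂ} (hs : AnalyticAt ℂ s 0)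
    (hs0 : s 0 = 0) (hs1 : HasDerivAt s 1 0)
    (hν : ContinuousAt ν 0)
    (hkK : ∀ᶠ x in 𝓝 (0 : ℂ × ℂ), k (K x) = x) (hh : AnalyticAt ℂ h 0) (hh0 : h 0 = 0)
    (hhd : HasFDerivAt h (ContinuousLinearMap.id ℂ (ℂ × ℂ)) 0)
    (hKh : ∀ᶠ p in 𝓝 (0 : ℂ × ℂ), K (ν (h p).2 * (h p).1, s (h p).2) = p) :
    deriv (deriv fun w => (k (0, w)).2) 0 =
      deriv (deriv s) 0 + deriv (deriv fun w => (h (0, w)).2) 0 := by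
  have hax : Tendsto (fun w : ℂ => ((0 : ℂ), w)) (𝓝 0) (𝓝 0) :=
    Continuous.tendsto' (by fun_prop) _ _ rfl
  have hφ : AnalyticAt ℂ (fun w : ℂ => (h (0, w)).2) 0 := by
    have : AnalyticAt ℂ (fun w : ℂ => h (0, w)) 0 := hh.fun_comp_of_eq (by fun_prop) rfl
    exact analyticAt_snd.fun_comp_of_eq this rfl
  have hφ0 : (fun w : ℂ => (h (0, w)).2) 0 = 0 := by
    have : h (0, 0) = 0 := hh0
    simp [this]
  have hφ1 : HasDerivAt (fun w : ℂ => (h (0, w)).2) 1 0 := by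
    have h1 : HasDerivAt (fun t : ℂ => ((0 : ℂ), t)) (0, 1) 0 :=
      (hasDerivAt_const _ _).prodMk (hasDerivAt_id (0 : ℂ))
    exact (HasFDerivAt.comp_hasDerivAt_of_eq (0 : ℂ) hhd h1 rfl).prod_snd.congr_deriv (by simp)
  rw [← deriv_deriv_comp hs hφ hφ0 hs1 hφ1]
  -- The substitution followed by K inverts h near 0, so applying k shows that k is the substitution
  -- after h, and its second component is s of the second component of h.
  have ht : Tendsto (fun p : ℂ × ℂ => (ν (h p).2 * (h p).1, s (h p).2)) (𝓝 0) (𝓝 0) := by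
    have h1 := hh.continuousAt
    have h2 : ContinuousAt (fun p : ℂ × ℂ => (h p).2) 0 := by fun_prop
    have h3 : ContinuousAt (fun p : ℂ × ℂ => ν (h p).2) 0 := hν.comp_of_eq h2 (by simp [hh0])
    have h4 : ContinuousAt (fun p : ℂ × ℂ => s (h p).2) 0 :=
      hs.continuousAt.comp_of_eq h2 (by simp [hh0])
    have h5 : ContinuousAt (fun p : ℂ × ℂ => (ν (h p).2 * (h p).1, s (h p).2)) 0 :=
      (h3.mul (continuous_fst.continuousAt.comp h1)).prodMk h4
    refine h5.tendsto.trans (le_of_eq ?_)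
    simp [hh0, hs0]
  refine EventuallyEq.deriv_eq (EventuallyEq.deriv ?_)
  filter_upwards [hax.eventually hKh, hax.eventually (ht.eventually hkK)] with w h1 h2
  rw [h1] at h2
  rw [h2]


/-! ### The normalized map and its uniqueness -/

lemma IsBiholomorphismFixingZero.analyticAt {h : ℂ × ℂ → ℂ × ℂ} (hh : IsBiholomorphismFixingZero h) :
    AnalyticAt ℂ h 0 := by
  obtain ⟨-, e, he0, heq, he, -⟩ := hh
  exact (he 0 he0).congr (EventuallyEq.symm (heq.eventuallyEq_of_mem (e.open_source.mem_nhds he0)))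

/-- A normalized map is tangent to the identity. -/
lemma HasNormalizedJet.hasFDerivAt {f g : ℂ × ℂ → ℂ} (hj : HasNormalizedJet f g)
    (hh : AnalyticAt ℂ (identityPlus f g) 0) :
    HasFDerivAt (identityPlus f g) (ContinuousLinearMap.id ℂ (ℂ × ℂ)) 0 := by
  obtain ⟨h1, h2, h3, h4, -⟩ := hj
  have hd := hh.differentiableAt.hasFDerivAt
  have hf : AnalyticAt ℂ f 0 := by
    have : AnalyticAt ℂ (fun p => (identityPlus f g p).1 - p.1) 0 :=
      (analyticAt_fst.fun_comp_of_eq hh rfl).fun_sub analyticAt_fst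
    exact this.congr (Eventually.of_forall fun p => by simp [identityPlus])
  have hg : AnalyticAt ℂ g 0 := by
    have : AnalyticAt ℂ (fun p => (identityPlus f g p).2 - p.2) 0 :=
      (analyticAt_snd.fun_comp_of_eq hh rfl).fun_sub analyticAt_snd
    exact this.congr (Eventually.of_forall fun p => by simp [identityPlus])
  have key : ∀ {f : ℂ × ℂ → ℂ}, AnalyticAt ℂ f 0 → deriv (fun z => f (z, 0)) 0 = 0 →
      deriv (fun w => f (0, w)) 0 = 0 → HasFDerivAt f (0 : ℂ × ℂ →L[ℂ] ℂ) 0 := by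
    intro f hf h1 h2
    have hz : HasDerivAt (fun z : ℂ => (z, (0 : ℂ))) (1, 0) 0 :=
      (hasDerivAt_id (0 : ℂ)).prodMk (hasDerivAt_const _ _)
    have hw : HasDerivAt (fun w : ℂ => ((0 : ℂ), w)) (0, 1) 0 :=
      (hasDerivAt_const _ _).prodMk (hasDerivAt_id (0 : ℂ))
    have h3 := (HasFDerivAt.comp_hasDerivAt_of_eq (0 : ℂ) hf.differentiableAt.hasFDerivAt hz rfl).deriv
    have h4 := (HasFDerivAt.comp_hasDerivAt_of_eq (0 : ℂ) hf.differentiableAt.hasFDerivAt hw rfl).deriv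
    have h5 : fderiv ℂ f 0 (1, 0) = 0 := h3.symm.trans h1
    have h6 : fderiv ℂ f 0 (0, 1) = 0 := h4.symm.trans h2
    refine hf.differentiableAt.hasFDerivAt.congr_fderiv ?_
    ext
    · simpa using h5
    · simpa using h6
  have h5 := (hasFDerivAt_fst (𝕜 := ℂ) (E := ℂ) (F := ℂ) (p := 0)).add (key hf h1 h2)
  have h6 := (hasFDerivAt_snd (𝕜 := ℂ) (E := ℂ) (F := ℂ) (p := 0)).add (key hg h3 h4)
  refine (h5.prodMk h6).congr_fderiv ?_
  ext <;> simp

lemma iteratedDeriv_two_identityPlus {f g : ℂ × ℂ → ℂ} (hh : AnalyticAt ℂ (identityPlus f g) 0) :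
    iteratedDeriv 2 (fun w => g (0, w)) 0 = deriv (deriv fun w => (identityPlus f g (0, w)).2) 0 := by
  have h1 : AnalyticAt ℂ (fun w : ℂ => (identityPlus f g (0, w)).2) 0 := by
    have : AnalyticAt ℂ (fun w : ℂ => identityPlus f g (0, w)) 0 := hh.fun_comp_of_eq (by fun_prop) rfl
    exact analyticAt_snd.fun_comp_of_eq this rfl
  have h2 : (fun w => g (0, w)) = fun w => (identityPlus f g (0, w)).2 - w := by
    ext w
    simp [identityPlus]
  rw [iteratedDeriv_succ, iteratedDeriv_one, h2]
  have h3 : deriv (fun w => (identityPlus f g (0, w)).2 - w) =ᶠ[𝓝 0]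
      fun w => deriv (fun w => (identityPlus f g (0, w)).2) w - 1 := by
    filter_upwards [h1.eventually_analyticAt] with w h4
    exact (h4.differentiableAt.hasDerivAt.sub (hasDerivAt_id w)).deriv
  rw [h3.deriv_eq, deriv_sub_const]

lemma tendsto_of_analyticAt {h : ℂ × ℂ → ℂ × ℂ} (hh : AnalyticAt ℂ h 0) (hh0 : h 0 = 0) :
    Tendsto h (𝓝 0) (𝓝 0) := by
  have := hh.continuousAt
  rwa [ContinuousAt, hh0] at this

/-- A substitution `(z, w) ↦ (star l (w) z, s (w))` between a semi-normal and a normal equation is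
determined by `s'' (0)`. -/
lemma IsSemiNormal.scaling_unique {Θ : ℂ × ℂ × ℂ → ℂ} {g a e : ℂ → ℂ}
    {D E : ℂ × ℂ × ℂ → ℂ} (h : IsSemiNormal Θ g a e D E) (hg0 : g 0 = 1)
    {s₁ l₁ s₂ l₂ : ℂ → ℂ} (hs₁ : AnalyticAt ℂ s₁ 0) (hl₁ : AnalyticAt ℂ l₁ 0) (hs₁0 : s₁ 0 = 0)
    (hs₁1 : HasDerivAt s₁ 1 0) (hl₁0 : l₁ 0 = 1) (hs₂ : AnalyticAt ℂ s₂ 0) (hl₂ : AnalyticAt ℂ l₂ 0)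
    (hs₂0 : s₂ 0 = 0) (hs₂1 : HasDerivAt s₂ 1 0) (hl₂0 : l₂ 0 = 1)
    (h2 : deriv (deriv s₁) 0 = deriv (deriv s₂) 0)
    (h₁ : ∀ᶠ t in 𝓝 0, NormalEquations g a e s₁ l₁ (conjMap l₁) t)
    (h₂ : ∀ᶠ t in 𝓝 0, NormalEquations g a e s₂ l₂ (conjMap l₂) t) :
    s₁ =ᶠ[𝓝 0] s₂ ∧ l₁ =ᶠ[𝓝 0] l₂ := by
  have hg := h.g_analyticAt
  have ha := h.a_analyticAt
  have d₁ := hasDerivAt_of_normalEquations hg ha hg0 hs₁ hl₁ hs₁0 hs₁1.deriv hl₁0 h₁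
  have d₂ := hasDerivAt_of_normalEquations hg ha hg0 hs₂ hl₂ hs₂0 hs₂1.deriv hl₂0 h₂
  have hV := analyticAt_normalField (analyticAt_normalKappa hg ha hg0)
    (analyticAt_normalDelta hg ha h.e_analyticAt hg0) (deriv (deriv s₂) 0)
  have := hV.ode_unique (by simp [hs₁0, hs₁1.deriv, hl₁0, h2]) (by simp [hs₂0, hs₂1.deriv, hl₂0]) d₁ d₂
  constructor
  · filter_upwards [this] with t ht
    exact congrArg (fun y => y.1) ht
  · filter_upwards [this] with t ht
    exact congrArg (fun y => y.2.2.2) ht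

theorem theorem13p1 (F : ℂ × ℝ → ℝ) (hF : IsLeviModelUpToOrderThree F) :
    (∃ h : ℂ × ℂ → ℂ × ℂ, MapsToMoserNormalForm h F) ∧
    ∃ f g : ℂ × ℂ → ℂ,
      (HasNormalizedJet f g ∧ MapsToMoserNormalForm (identityPlus f g) F) ∧
      ∀ f₁ g₁ : ℂ × ℂ → ℂ,
        HasNormalizedJet f₁ g₁ → MapsToMoserNormalForm (identityPlus f₁ g₁) F →
        f₁ =ᶠ[𝓝 0] f ∧ g₁ =ᶠ[𝓝 0] g := by
  suffices hmain : ∃ f g : ℂ × ℂ → ℂ,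
      (HasNormalizedJet f g ∧ MapsToMoserNormalForm (identityPlus f g) F) ∧
      ∀ f₁ g₁ : ℂ × ℂ → ℂ,
        HasNormalizedJet f₁ g₁ → MapsToMoserNormalForm (identityPlus f₁ g₁) F →
        f₁ =ᶠ[𝓝 0] f ∧ g₁ =ᶠ[𝓝 0] g by
    obtain ⟨f, g, h1, h2⟩ := hmain
    exact ⟨⟨_, h1.2⟩, f, g, h1, h2⟩
  obtain ⟨𝓕, Θ, h𝓕, hΘ, hFΘ, hsol, h𝓕1, hL⟩ := exists_isSegreFunction hF
  obtain ⟨ξ, hξ, hξ0, hξe⟩ := hΘ.exists_of_slope hL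
  obtain ⟨Φ, hΦd⟩ : ∃ Φ : ℂ × ℂ × ℂ → ℂ,
    Φ = fun y => segreSlope (segreSlope Θ) (y.1, ξ y) := ⟨_, rfl⟩
  have hΦ : AnalyticAt ℂ Φ 0 := by
    rw [hΦd]
    exact hΘ.analyticAt.analyticAt_segreSlope.analyticAt_segreSlope.fun_comp_of_eq
      (analyticAt_fst.prod hξ) (by simp [hξ0])
  have hΦΘ := hΘ.segreSlope_segreSlope hξe
  rw [← hΦd] at hΦΘ
  obtain ⟨γ, hγ, hγu⟩ := exists_isSegreChain h𝓕.analyticAt (h𝓕.jet hF).1 h𝓕1 h𝓕.symm hΘ hsol hΦ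
  obtain ⟨Θ', g, a, e, D, E, hΘ', hpb, hsn, hg0, hgs, has, hes⟩ :=
    hγ.exists_isSemiNormal hΘ hL hξ hξ0 hξe hΦ hΦΘ
  have hK := analyticAt_adaptedMap hΘ hγ hξ
  have hK0 := adaptedMap_zero hΘ hγ hξ0
  have hKd := hasFDerivAt_adaptedMap hΘ hL hγ hξ hξ0 hξe
  -- The inverse of every normalized map to normal form factors through one fixed adapted map; only
  -- the substitution (s, l) varies. The particular form of that map plays no role afterwards.
  have hHK : ∀ (H : ℂ × ℂ → ℂ × ℂ) (Θ₁ : ℂ × ℂ × ℂ → ℂ), AnalyticAt ℂ H 0 → H 0 = 0 →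
      HasFDerivAt H (ContinuousLinearMap.id ℂ (ℂ × ℂ)) 0 → IsSegreFunction Θ₁ →
      IsNormalSegreFunction Θ₁ → IsPullback Θ H Θ₁ →
      ∃ s l : ℂ → ℂ, AnalyticAt ℂ s 0 ∧ AnalyticAt ℂ l 0 ∧ s 0 = 0 ∧ HasDerivAt s 1 0 ∧ l 0 = 1 ∧
        (∀ᶠ t in 𝓝 0, star (s (star t)) = s t) ∧
        ∀ᶠ x in 𝓝 (0 : ℂ × ℂ), H x = adaptedMap Θ ξ γ (conjMap l x.2 * x.1, s x.2) := by
    intro H Θ₁ hH hH0 hHd hΘ₁ hn hpb₁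
    obtain ⟨s, hs, hs0, hs1, hss, hse⟩ :=
      hγu _ (hpb₁.isSegreChain hΘ hΦ hΦΘ hH hH0 hHd hΘ₁ hn)
    obtain ⟨l, hl, hl0, hle⟩ :=
      hpb₁.exists_eq_adaptedMap hΘ hγ hξe hH hH0 hHd hΘ₁ hn hs hs0 hs1 hss hse
    exact ⟨s, l, hs, hl, hs0, hs1, hl0, hss, hle⟩
  generalize adaptedMap Θ ξ γ = K at *
  obtain ⟨k, hk, hk0, hkd, hkK, hKk⟩ := hK.exists_germInverse hK0 hKd
  -- existence
  obtain ⟨n₀, hn₀⟩ : ∃ n₀ : ℂ, n₀ = ((deriv (deriv fun w => (k (0, w)).2) 0).re : ℂ) := ⟨_, rfl⟩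
  obtain ⟨s, l, hs, hl, hs0, hs1, hs2, hl0, hss, hne⟩ := exists_normalEquations hsn.g_analyticAt
    hsn.a_analyticAt hsn.e_analyticAt hg0 hgs has hes (n₀ := n₀) (by simp [hn₀])
  have hLa := analyticAt_scaling hs hl
  have hLd := hasFDerivAt_scaling hl hs1 hl0
  have hL0 : (fun x : ℂ × ℂ => (conjMap l x.2 * x.1, s x.2)) 0 = 0 := by simp [hs0]
  obtain ⟨Θ₀, hΘ₀, hpb₀⟩ := hΘ'.exists_pullback hLa hL0 hLd
  have hn₀' : IsNormalSegreFunction Θ₀ :=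
    (hsn.isNormalSegreFunction_iff hs hl hl.analyticAt_conjMap hs0 hs1 hΘ₀.analyticAt hΘ₀.zero
      hΘ'.analyticAt (hpb₀.scaling hss hΘ₀)).2 hne
  obtain ⟨F₀, hF₀, hFΘ₀⟩ := hΘ₀.exists_isMoserNormalForm hn₀'
  obtain ⟨H, hHe⟩ : ∃ H : ℂ × ℂ → ℂ × ℂ, H = fun x => K (conjMap l x.2 * x.1, s x.2) := ⟨_, rfl⟩
  have hHa : AnalyticAt ℂ H 0 := by
    rw [hHe]
    exact hK.fun_comp_of_eq hLa hL0
  have hH0 : H 0 = 0 := by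
    rw [hHe]
    exact (congrArg K hL0).trans hK0
  have hHd : HasFDerivAt H (ContinuousLinearMap.id ℂ (ℂ × ℂ)) 0 := by
    rw [hHe]
    exact HasFDerivAt.comp_of_eq hKd (0 : ℂ × ℂ) hLd hL0
  have hHpb : IsPullback Θ H Θ₀ := by
    rw [hHe]
    exact hpb.comp hLa.continuousAt hL0 hpb₀
  obtain ⟨h, hh, hh0, hhd, hhH, hHh⟩ := hHa.exists_germInverse hH0 hHd
  have hht := tendsto_of_analyticAt hh hh0
  have hid : identityPlus (fun p => (h p).1 - p.1) (fun p => (h p).2 - p.2) = h := by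
    ext p <;> simp [identityPlus]
  have hjet := deriv_deriv_inverse hs hs0 hs1 hl.analyticAt_conjMap.continuousAt hkK hh hh0 hhd (by
    filter_upwards [hHh] with p hp
    rw [hHe] at hp
    exact hp)
  refine ⟨fun p => (h p).1 - p.1, fun p => (h p).2 - p.2, ⟨⟨?_, ?_, ?_, ?_, ?_⟩, ?_, F₀, hF₀, ?_⟩, ?_⟩
  · have hz : HasDerivAt (fun z : ℂ => (z, (0 : ℂ))) (1, 0) 0 :=
      (hasDerivAt_id (0 : ℂ)).prodMk (hasDerivAt_const _ _)
    refine ((HasFDerivAt.comp_hasDerivAt_of_eq (0 : ℂ) hhd hz rfl).prod_fst.sub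
      (hasDerivAt_id (0 : ℂ))).deriv.trans (by simp)
  · have hw : HasDerivAt (fun w : ℂ => ((0 : ℂ), w)) (0, 1) 0 :=
      (hasDerivAt_const _ _).prodMk (hasDerivAt_id (0 : ℂ))
    refine ((HasFDerivAt.comp_hasDerivAt_of_eq (0 : ℂ) hhd hw rfl).prod_fst.sub
      (hasDerivAt_const (0 : ℂ) (0 : ℂ))).deriv.trans (by simp)
  · have hz : HasDerivAt (fun z : ℂ => (z, (0 : ℂ))) (1, 0) 0 :=
      (hasDerivAt_id (0 : ℂ)).prodMk (hasDerivAt_const _ _)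
    refine ((HasFDerivAt.comp_hasDerivAt_of_eq (0 : ℂ) hhd hz rfl).prod_snd.sub
      (hasDerivAt_const (0 : ℂ) (0 : ℂ))).deriv.trans (by simp)
  · have hw : HasDerivAt (fun w : ℂ => ((0 : ℂ), w)) (0, 1) 0 :=
      (hasDerivAt_const _ _).prodMk (hasDerivAt_id (0 : ℂ))
    refine ((HasFDerivAt.comp_hasDerivAt_of_eq (0 : ℂ) hhd hw rfl).prod_snd.sub
      (hasDerivAt_id (0 : ℂ))).deriv.trans (by simp)
  · have := iteratedDeriv_two_identityPlus (f := fun p => (h p).1 - p.1) (g := fun p => (h p).2 - p.2)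
      (by rwa [hid])
    rw [hid] at this
    rw [this, ← add_sub_cancel_left (deriv (deriv s) 0) (deriv (deriv fun w => (h (0, w)).2) 0),
      ← hjet, hs2, hn₀]
    simp
  · rw [hid]
    obtain ⟨φ, hφ0, hφ, hφ1, hφ2⟩ := hh.exists_localInverse hh0 hhd
    exact ⟨hh0, φ, hφ0, fun x _ => by rw [hφ], hφ1, hφ2⟩
  · rw [hid]
    filter_upwards [hHh, hht.eventually (hHpb.mem_graphHypersurface_iff hFΘ hFΘ₀ hHa.continuousAt hH0)]
      with p h1 h2
    rw [← h2, h1]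
  -- uniqueness
  intro f₁ g₁ hj hm
  obtain ⟨hb, F₁, hF₁, hgr⟩ := hm
  have hh₁ := hb.analyticAt
  have hh₁0 := hb.1
  have hh₁d := hj.hasFDerivAt hh₁
  have hre : (deriv (deriv fun w => (identityPlus f₁ g₁ (0, w)).2) 0).re = 0 := by
    rw [← iteratedDeriv_two_identityPlus hh₁]
    exact hj.2.2.2.2
  obtain ⟨h₁, hh₁e⟩ : ∃ h₁, h₁ = identityPlus f₁ g₁ := ⟨_, rfl⟩
  rw [← hh₁e] at hh₁ hh₁0 hh₁d hre hgr
  obtain ⟨H₁, hH₁, hH₁0, hH₁d, hHh₁, hhH₁⟩ := hh₁.exists_germInverse hh₁0 hh₁d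
  have hLevi := hF₁.isLeviModelUpToOrderThree
  obtain ⟨𝓕₁, Θ₁, h𝓕₁, hΘ₁, -, hsol₁, -, -⟩ := exists_isSegreFunction hLevi
  have hn₁ := hF₁.isNormalSegreFunction h𝓕₁ hΘ₁ hsol₁
  -- The equivalence at real points becomes a pullback of Segre functions along the inverse H₁, to
  -- which the rigidity of chains applies.
  have hpb₁ : IsPullback Θ H₁ Θ₁ := by
    refine hΘ.isPullback_of_mem_graphHypersurface_iff hFΘ h𝓕₁ (h𝓕₁.jet hLevi).1 hΘ₁ hsol₁ hH₁ hH₁0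
      hH₁d ?_
    filter_upwards [(tendsto_of_analyticAt hH₁ hH₁0).eventually hgr, hhH₁] with x h1 h2
    rw [h1, h2]
  obtain ⟨s₁, l₁, hs₁, hl₁, hs₁0, hs₁1, hl₁0, hss₁, hH₁e⟩ := hHK H₁ Θ₁ hH₁ hH₁0 hH₁d hΘ₁ hn₁ hpb₁
  have hLa₁ := analyticAt_scaling hs₁ hl₁
  have hLd₁ := hasFDerivAt_scaling hl₁ hs₁1 hl₁0
  have hL₁0 : (fun x : ℂ × ℂ => (conjMap l₁ x.2 * x.1, s₁ x.2)) 0 = 0 := by simp [hs₁0]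
  obtain ⟨Θ₂, hΘ₂, hpb₂⟩ := hΘ'.exists_pullback hLa₁ hL₁0 hLd₁
  -- Pulling back along H₁ directly or through K and the substitution gives the same Segre function,
  -- so the substitution normalizes the semi-normal equation and satisfies the normal equations.
  have h12 : Θ₁ =ᶠ[𝓝 0] Θ₂ :=
    (hpb₁.congr hH₁e EventuallyEq.rfl).eventuallyEq (hpb.comp hLa₁.continuousAt hL₁0 hpb₂)
      hΘ₁.analyticAt.continuousAt hΘ₁.zero
  have hne₁ := (hsn.isNormalSegreFunction_iff hs₁ hl₁ hl₁.analyticAt_conjMap hs₁0 hs₁1 hΘ₂.analyticAt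
    hΘ₂.zero hΘ'.analyticAt (hpb₂.scaling hss₁ hΘ₂)).1 (hn₁.congr h12)
  have hjet₁ := deriv_deriv_inverse hs₁ hs₁0 hs₁1 hl₁.analyticAt_conjMap.continuousAt hkK hh₁ hh₁0
    hh₁d (by
      filter_upwards [hHh₁, (tendsto_of_analyticAt hh₁ hh₁0).eventually hH₁e] with p h1 h2
      rw [← h2, h1])
  -- s₁ is real, so its second derivative equals its real part, which the normalization of h₁ forces
  -- to be the value used for existence.
  have hs₁2 : deriv (deriv s₁) 0 = n₀ := by
    rw [hn₀, hjet₁, Complex.add_re, hre, add_zero]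
    exact (Complex.conj_eq_iff_re.1 (star_deriv_deriv hss₁)).symm
  obtain ⟨hs12, hl12⟩ := hsn.scaling_unique hg0 hs₁ hl₁ hs₁0 hs₁1 hl₁0 hs hl hs0 hs1 hl0
    (hs₁2.trans hs2.symm) hne₁ hne
  have hw : Tendsto (fun x : ℂ × ℂ => x.2) (𝓝 0) (𝓝 0) := Continuous.tendsto' (by fun_prop) _ _ rfl
  have hws : Tendsto (fun x : ℂ × ℂ => star x.2) (𝓝 0) (𝓝 0) :=
    Continuous.tendsto' (by fun_prop) _ _ (by simp)
  have hHH : ∀ᶠ x in 𝓝 (0 : ℂ × ℂ), H₁ x = H x := by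
    filter_upwards [hH₁e, hw.eventually hs12, hws.eventually hl12] with x h1 h2 h3
    rw [h1, hHe]
    simp only [conjMap, h2, h3]
  have hfin : ∀ᶠ p in 𝓝 (0 : ℂ × ℂ), h p = identityPlus f₁ g₁ p := by
    have ht₁ := tendsto_of_analyticAt hh₁ hh₁0
    filter_upwards [ht₁.eventually hhH, hHh₁, ht₁.eventually hHH] with p h1 h2 h3
    rw [← h3, h2] at h1
    rw [h1, hh₁e]
  constructor
  · filter_upwards [hfin] with p hp
    rw [hp]
    simp [identityPlus]
  · filter_upwards [hfin] with p hp
    rw [hp]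
    simp [identityPlus]
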